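/- Let $d\ge 1$ and let $b_j,f_j,g_j,c_j:\mathbb R\to\mathbb R$ ($1\le j\le d$), with $c_j\in C^1$ and $b_j,f_j,g_j$ of class $C^1$ or, more generally, piecewise continuous. Consider on $\mathbb R^d$ the Cauchy problem $i\partial_t\psi=H(t)\psi$ with $$H(t)\psi=-\tfrac12\Delta\psi+\sum_{j=1}^d\Big(b_j(t)x_j^2\psi-f_j(t)x_j\psi+ig_j(t)\partial_{x_j}\psi-\tfrac{i}{2}c_j(t)\big(2x_j\partial_{x_j}\psi+\psi\big)\Big).$$ Suppose that, for every $j$, $$\sigma_j(t):=\frac{b_j(t)}2-\frac{c_j(t)^2}4-\frac{c_j'(t)}4$$ is constant, $\sigma_j=\delta_j\omega_j^2/4$ with $\delta_j\in\{-1,0,1\}$ and $\omega_j>0$ (for $\omega_j=1$ this is $\sigma_j\in\{-\frac14,0,\frac14\}$). Then: 1. The characteristic function $\mu_j$, that is, the solution of $\mu_j''+4\sigma_j\mu_j=0$, $\mu_j(0)=0$, $\mu_j'(0)=1$, is $$\mu_j(t)=\frac{\sinh(\omega_jt)}{\omega_j}\ (\delta_j=-1),\qquad \mu_j(t)=t\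 (\delta_j=0),\qquad \mu_j(t)=\frac{\sin(\omega_jt)}{\omega_j}\ (\delta_j=1).$$ 2. The Cauchy problem has exactly one evolution operator $U_H(t,s)$, $t,s\in\mathbb R$, i.e. one jointly strongly continuous family of isometries of $L^2(\mathbb R^d)$ with $U_H(t,t)=\mathrm{Id}$ and $U_H(t,\tau)U_H(\tau,s)=U_H(t,s)$ that maps Schwartz functions $\varphi$ to Schwartz functions $\psi(t)=U_H(t,s)\varphi$ which satisfy $\psi'(t)=-iH(t)\psi(t)$ in $L^2$ at all times $t$ at which the coefficients are continuous. Put $U_H(t)=U_H(t,0)$. For every $t$ such that $\mu_j(t)\ne0$ and $\mu_j'$ has no zero between $0$ and $t$ (for all $j$), and every $\varphi\in L^1\cap L^2$, $$U_H(t)\varphi(x)=\prod_{j=1}^d\frac1{\sqrt{2\pi i\mu_j(t)}}\int_{\mathbb R^d}e^{i\sum_j(\alpha_jx_j^2+\beta_jx_jy_j+\gamma_jy_j^2+\delta^*_jx_j+\varepsilon_jy_j+\kappa_j)}\varphi(y)\,dy\quad\text{for a.e. }x,$$ where the root is the principal one, and, with $h_j=f_j-c_jg_j$, $$\alpha_j=\frac{\mu_j'}{2\mu_j}-\frac{c_j}2,\qquad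 \beta_j=-\frac1{\mu_j},\qquad \gamma_j=\frac1{2\mu_j\mu_j'}-2\int_0^t\frac{\sigma_j}{(\mu_j')^2}\,d\tau+\frac{c_j(0)}2,$$ $$\delta^*_j=\frac1{\mu_j}\int_0^t(h_j\mu_j+g_j\mu_j')\,d\tau,\qquad \varepsilon_j=-\frac{\delta^*_j}{\mu_j'}+4\int_0^t\frac{\mu_j\delta^*_j\sigma_j}{(\mu_j')^2}\,d\tau+\int_0^t\frac{h_j}{\mu_j'}\,d\tau,$$ $$\kappa_j=\frac{\mu_j(\delta^*_j)^2}{2\mu_j'}-2\int_0^t\frac{\sigma_j(\mu_j\delta^*_j)^2}{(\mu_j')^2}\,d\tau-\int_0^t\frac{\mu_j\delta^*_j}{\mu_j'}h_j\,d\tau.$$ The same formula holds at every $t$ with $\mu_j(t)\neq0$ for all $j$, if $\gamma_j,\varepsilon_j,\kappa_j$ are replaced by $$\frac{\mu_j'}{2\mu_j}+\frac{c_j(0)}2,\qquad \frac1{\mu_j(t)}\int_0^t\big(\mu_j(t-\tau)h_j(\tau)-\mu_j'(t-\tau)g_j(\tau)\big)d\tau,\qquad \frac{\mu_j\mu_j'(\delta_j^*)^2}2+\int_0^t\mu_j\delta_j^*\big(4\sigma_j\mu_jg_j-\mu_j'h_j\big)d\tau,$$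 and $1/\sqrt{2\pi i\mu_j(t)}$ is read as $e^{-\frac{i\pi}4(1+2n_j)}/\sqrt{2\pi|\mu_j(t)|}$, where $n_j=\lfloor\omega_jt/\pi\rfloor$ if $\delta_j=1$ and otherwise $n_j=0$ for $t\ge0$, $n_j=-1$ for $t<0$. 3. For all $t,s$ with $\mu_j(t-s)\ne0$ for every $j$, and all $\varphi\in L^2$ (the right side may be infinite), $$\|U_H(t,s)\varphi\|_{L^\infty}\le\Big(\prod_{j=1}^d\frac1{2\pi|\mu_j(t-s)|}\Big)^{1/2}\|\varphi\|_{L^1}.$$ 4. If $\delta_j=-1$ for some $j$, global in time Strichartz estimates hold. Call $(q,r)\in[2,\infty]^2$ admissible if $\frac1q+\frac d{2r}=\frac d4$ and $(q,r,d)\ne(2,\infty,2)$. For all admissible $(q,r)$ and $(\tilde q,\tilde r)$ there is a constant $C$, which depends only on $d,(\delta_j),(\omega_j)$ and these exponents, such that $$\|U_H(t)\varphi\|_{L^q_t(\mathbb R;L^r_x)}\le C\|\varphi\|_{L^2},\qquad \Big\|\int_{\mathbb R}U_H(s)^*F(s)\,ds\Big\|_{L^2}\le C\|F\|_{L^{q'}_tL^{r'}_x},$$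 $$\Big\|\int_{s<t}U_H(t)U_H(s)^*F(s)\,ds\Big\|_{L^q_t(\mathbb R;L^r_x)}\le C\|F\|_{L^{\tilde q'}_tL^{\tilde r'}_x}$$ for all $\varphi\in L^2$ and all $F\in L^1(\mathbb R;L^2(\mathbb R^d))$ (a class whose members with finite right side are dense in the space on the right side). -/

import Mathlib

open MeasureTheory Set Filter Topology
open scoped ENNReal NNReal Laplacian

noncomputable section

namespace QuadSchrodinger

/-- Configuration space `ℝ^d`. -/
abbrev Space (d : ℕ) : Type := EuclideanSpace ℝ (Fin d)

/-- The complex Hilbert space `L²(ℝ^d)`. -/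
abbrev L2 (d : ℕ) : Type := Lp ℂ 2 (volume : Measure (Space d))

/-- Piecewise continuity on `ℝ`: finitely many discontinuities in each bounded interval, and
one-sided limits everywhere. -/
def PiecewiseContinuous (h : ℝ → ℝ) : Prop :=
  (∀ a b : ℝ, {t ∈ Icc a b | ¬ ContinuousAt h t}.Finite) ∧
    ∀ t : ℝ, (∃ l : ℝ, Tendsto h (𝓝[<] t) (𝓝 l)) ∧ ∃ l : ℝ, Tendsto h (𝓝[>] t) (𝓝 l)

/-- The real, time-dependent coefficients of a quadratic Hamiltonian on `ℝ^d`. -/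
structure Coefficients (d : ℕ) where
  b : Fin d → ℝ → ℝ
  f : Fin d → ℝ → ℝ
  g : Fin d → ℝ → ℝ
  c : Fin d → ℝ → ℝ

namespace Coefficients

variable {d : ℕ}

/-- `c_j` is `C¹`; `b_j, f_j, g_j` are piecewise continuous (in particular, `C¹` is allowed). -/
def Regular (P : Coefficients d) : Prop :=
  ∀ j, ContDiff ℝ 1 (P.c j) ∧ PiecewiseContinuous (P.b j) ∧ PiecewiseContinuous (P.f j) ∧
    PiecewiseContinuous (P.g j)

/-- `σ_j = b_j / 2 - c_j² / 4 - c_j' / 4`. -/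
def sigma (P : Coefficients d) (j : Fin d) (t : ℝ) : ℝ :=
  P.b j t / 2 - P.c j t ^ 2 / 4 - deriv (P.c j) t / 4

end Coefficients

/-- The partial derivative `∂ψ/∂x_j`. -/
def partialDeriv {d : ℕ} (j : Fin d) (ψ : Space d → ℂ) (x : Space d) : ℂ :=
  fderiv ℝ ψ x (EuclideanSpace.single j 1)

/-- The Hamiltonian
`H(t)ψ = -½ Δψ + ∑_j (b_j x_j² ψ - f_j x_j ψ + i g_j ∂_jψ - i (c_j/2) (2 x_j ∂_jψ + ψ))`. -/
def hamiltonian {d : ℕ} (P : Coefficients d) (t : ℝ) (ψ : Space d → ℂ) (x : Space d) : ℂ :=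
  -(1 / 2 : ℂ) * Laplacian.laplacian ψ x
    + ∑ j, ((P.b j t : ℂ) * (x j : ℂ) ^ 2 * ψ x
        - (P.f j t : ℂ) * (x j : ℂ) * ψ x
        + Complex.I * (P.g j t : ℂ) * partialDeriv j ψ x
        - Complex.I * ((P.c j t : ℂ) / 2) * (2 * (x j : ℂ) * partialDeriv j ψ x + ψ x))

/-- `U(t,s)` is the (unitary) evolution operator on `L²(ℝ^d)` of the Cauchy problem
`i ∂_t ψ = H(t) ψ`. Schwartz data `φ` given at time `s` evolve into Schwartz functions
`ψ(t) = U(t,s)φ`, and `t ↦ ψ(t)` is differentiable in `L²(ℝ^d)` with `ψ'(t) = -i H(t) ψ(t)` at every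
time at which the coefficients are continuous. -/
structure IsEvolutionOperator {d : ℕ} (P : Coefficients d) (U : ℝ → ℝ → (L2 d →L[ℂ] L2 d)) :
    Prop where
  norm_eq : ∀ t s φ, ‖U t s φ‖ = ‖φ‖
  diag : ∀ t, U t t = ContinuousLinearMap.id ℂ (L2 d)
  comp : ∀ t r s, (U t r).comp (U r s) = U t s
  strongly_continuous : ∀ φ, Continuous fun p : ℝ × ℝ => U p.1 p.2 φ
  solves : ∀ (s : ℝ) (φ : SchwartzMap (Space d) ℂ), ∃ ψ : ℝ → SchwartzMap (Space d) ℂ,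
    (∀ t, U t s (φ.toLp 2) = (ψ t).toLp 2) ∧
    ∀ t, (∀ j, ContinuousAt (P.b j) t ∧ ContinuousAt (P.f j) t ∧ ContinuousAt (P.g j) t) →
      ∃ η : L2 d, (η : Space d → ℂ) =ᵐ[volume] hamiltonian P t (ψ t) ∧
        HasDerivAt (fun τ => (ψ τ).toLp 2) (-Complex.I • η) t

/-- `m` is the characteristic function: `m'' + 4 σ m = 0`, `m(0) = 0`, `m'(0) = 1`. -/
def IsCharacteristicFunction (σ m : ℝ → ℝ) : Prop :=
  Differentiable ℝ m ∧ (∀ t, HasDerivAt (deriv m) (-(4 * σ t * m t)) t) ∧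
    m 0 = 0 ∧ deriv m 0 = 1

/-- `sinh(ω t)/ω`, `t`, `sin(ω t)/ω` in the cases `δ = -1, 0, 1`. -/
def mu (δ : SignType) (ω t : ℝ) : ℝ :=
  match δ with
  | SignType.neg => Real.sinh (ω * t) / ω
  | SignType.zero => t
  | SignType.pos => Real.sin (ω * t) / ω

/-! The coefficients of the phase for one coordinate, with characteristic function `m`. -/

def alphaC (m c : ℝ → ℝ) (t : ℝ) : ℝ := deriv m t / (2 * m t) - c t / 2

def betaC (m : ℝ → ℝ) (t : ℝ) : ℝ := -1 / m t

def gammaC (σ m c : ℝ → ℝ) (t : ℝ) : ℝ :=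
  1 / (2 * m t * deriv m t) - 2 * (∫ τ in (0 : ℝ)..t, σ τ / deriv m τ ^ 2) + c 0 / 2

def deltaC (m f g c : ℝ → ℝ) (t : ℝ) : ℝ :=
  (1 / m t) * ∫ τ in (0 : ℝ)..t, ((f τ - c τ * g τ) * m τ + g τ * deriv m τ)

def epsilonC (σ m f g c : ℝ → ℝ) (t : ℝ) : ℝ :=
  -(deltaC m f g c t / deriv m t)
    + 4 * (∫ τ in (0 : ℝ)..t, m τ * deltaC m f g c τ * σ τ / deriv m τ ^ 2)
    + ∫ τ in (0 : ℝ)..t, (1 / deriv m τ) * (f τ - c τ * g τ)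

def kappaC (σ m f g c : ℝ → ℝ) (t : ℝ) : ℝ :=
  m t / (2 * deriv m t) * deltaC m f g c t ^ 2
    - 2 * (∫ τ in (0 : ℝ)..t, σ τ / deriv m τ ^ 2 * (m τ * deltaC m f g c τ) ^ 2)
    - ∫ τ in (0 : ℝ)..t, m τ * deltaC m f g c τ / deriv m τ * (f τ - c τ * g τ)

/-! For constant `σ`, integration by parts removes the division by `m'` from `γ, ε, κ`: these forms
make sense at all times with `m t ≠ 0`. -/

def gammaExt (m c : ℝ → ℝ) (t : ℝ) : ℝ := deriv m t / (2 * m t) + c 0 / 2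

def epsilonExt (m f g c : ℝ → ℝ) (t : ℝ) : ℝ :=
  (1 / m t) * ∫ τ in (0 : ℝ)..t, (m (t - τ) * (f τ - c τ * g τ) - deriv m (t - τ) * g τ)

def kappaExt (σ m f g c : ℝ → ℝ) (t : ℝ) : ℝ :=
  m t * deriv m t * deltaC m f g c t ^ 2 / 2
    + ∫ τ in (0 : ℝ)..t, m τ * deltaC m f g c τ *
        (4 * σ τ * m τ * g τ - deriv m τ * (f τ - c τ * g τ))

/-- The quadratic polynomial `α x² + β x y + γ y² + δ x + ε y + κ`. -/
def quadPhase (α β γ δ ε κ x y : ℝ) : ℝ :=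
  α * x ^ 2 + β * x * y + γ * y ^ 2 + δ * x + ε * y + κ

/-- The phase of coordinate `j` at time `t`. -/
def phase {d : ℕ} (P : Coefficients d) (j : Fin d) (m : ℝ → ℝ) (t x y : ℝ) : ℝ :=
  quadPhase (alphaC m (P.c j) t) (betaC m t) (gammaC (P.sigma j) m (P.c j) t)
    (deltaC m (P.f j) (P.g j) (P.c j) t)
    (epsilonC (P.sigma j) m (P.f j) (P.g j) (P.c j) t)
    (kappaC (P.sigma j) m (P.f j) (P.g j) (P.c j) t) x y

/-- The phase of coordinate `j` at time `t`, in the form valid at all times with `m t ≠ 0`. -/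
def phaseExt {d : ℕ} (P : Coefficients d) (j : Fin d) (m : ℝ → ℝ) (t x y : ℝ) : ℝ :=
  quadPhase (alphaC m (P.c j) t) (betaC m t) (gammaExt m (P.c j) t)
    (deltaC m (P.f j) (P.g j) (P.c j) t)
    (epsilonExt m (P.f j) (P.g j) (P.c j) t)
    (kappaExt (P.sigma j) m (P.f j) (P.g j) (P.c j) t) x y

/-- `1 / √(2π i m)` with the principal branch of the root. -/
def amplitude (m : ℝ) : ℂ := ((2 * (Real.pi : ℂ) * Complex.I * (m : ℂ)) ^ (1 / 2 : ℂ))⁻¹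

/-- The value of `1 / √(2π i μ(t))` on the branch that is followed through the zeros of `μ`: every
time a zero is crossed forward in time the argument drops by `π/2`. -/
def amplitudeExt (δ : SignType) (ω t : ℝ) : ℂ :=
  let n : ℤ := if δ = SignType.pos then ⌊ω * t / Real.pi⌋ else if 0 ≤ t then 0 else -1
  Complex.exp (-(Complex.I * (Real.pi : ℂ) / 4) * (1 + 2 * (n : ℂ))) /
    (Real.sqrt (2 * Real.pi * |mu δ ω t|) : ℂ)

/-- The integral operator with kernel `∏_j A_j · exp(i ∑_j S_j(x_j, y_j))`. -/
def oscillatoryOperator {d : ℕ} (A : Fin d → ℂ) (S : Fin d → ℝ → ℝ → ℝ) (φ : Space d → ℂ)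
    (x : Space d) : ℂ :=
  (∏ j, A j) * ∫ y : Space d, Complex.exp (Complex.I * ((∑ j, S j (x j) (y j) : ℝ) : ℂ)) * φ y

/-- The mixed norm `‖F‖_{L^q_t L^r_x}` over all times `t ∈ ℝ`. -/
def mixedNorm {d : ℕ} (q r : ℝ≥0∞) (F : ℝ → Space d → ℂ) : ℝ≥0∞ :=
  eLpNorm (fun t => eLpNorm (F t) r volume) q volume

/-- `(q, r)` is sharp `σ`-admissible. -/
def SharpAdmissible (σ q r : ℝ≥0∞) : Prop :=
  2 ≤ q ∧ 2 ≤ r ∧ (q, r, σ) ≠ (2, ∞, 1) ∧ 1 / q + σ / r = σ / 2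

/-- The Strichartz estimates, global in time, for `U(t) = U(t,0)` with constant `C`: homogeneous,
dual, and retarded. The last two are stated for `F` in the subspace `L¹_t L²_x` of functions for
which the time integrals are Bochner integrals in `L²`; within `L^{q'}_t L^{r'}_x` (norm possibly
infinite) this subspace is dense. -/
def StrichartzEstimates {d : ℕ} (U : ℝ → ℝ → (L2 d →L[ℂ] L2 d)) (q r q₁ r₁ : ℝ≥0∞) (C : ℝ≥0) :
    Prop :=
  (∀ φ : L2 d, mixedNorm q r (fun t => (U t 0 φ : Space d → ℂ)) ≤ C * ‖φ‖ₑ) ∧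
  (∀ F : ℝ → L2 d, Integrable F volume →
    ‖∫ s, ContinuousLinearMap.adjoint (U s 0) (F s)‖ₑ ≤
      C * mixedNorm (ENNReal.conjExponent q) (ENNReal.conjExponent r)
        (fun t => (F t : Space d → ℂ))) ∧
  (∀ F : ℝ → L2 d, Integrable F volume →
    mixedNorm q r (fun t =>
        ((∫ s in Iio t, U t 0 (ContinuousLinearMap.adjoint (U s 0) (F s)) : L2 d) :
          Space d → ℂ)) ≤
      C * mixedNorm (ENNReal.conjExponent q₁) (ENNReal.conjExponent r₁)
        (fun t => (F t : Space d → ℂ)))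

end QuadSchrodinger

end

noncomputable section

namespace QuadSchrodinger

/-! ### The characteristic functions -/

/-! The gauge factor e^{-icx²/2} turns the Hamiltonian of one coordinate into p²/2 + 2σx² - hx - gp
with p = -i∂ and constant σ: a free particle, an oscillator or an inverted oscillator, driven by the
sources. Its propagator is metaplectic. Apart from the displacement along the classical trajectory
that starts at rest at the origin, it is a product e^{iax²/2} e^{-isp²/2} e^{iax²/2}, with s = εμ
and a = -4σεμ/(1 + εμ') for a sign ε = (-1)^n; for ε = -1 it is preceded by the reflection x ↦ -x,
and it carries the phase e^{-iπn/2}.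

The factors are bijections of Schwartz space that preserve the L² norm (`SchwartzIsometry`). Hence
products can be differentiated in L² by the product rule (`hasDerivAt_apply`), and the Schrödinger
equation becomes the system `ChirpODE`, which `chirpODE_branch` verifies. The number a has no
singularity where μ = 0, only where εμ' = -1, and there a branch of the other parity is regular. Two
branches have the same integral kernel off a countable set of times and are strongly continuous, so
they agree wherever both are regular (`branch_congr`); gluing them gives a propagator for all times,
which passes through the zeros of μ.

The kernel comes from `fourierChirp_eq_integral`, by a Gaussian regularisation of the multiplier
e^{-isp²/2}, and reaches L¹ ∩ L² by duality. It has the phase coefficients free of division by μ';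
the other form follows by parts from (μ/μ')' = 1/μ'². Uniqueness: an evolution by isometries forces
H(t) to be symmetric on Schwartz functions, so the norm of the difference of two solutions is
constant. The kernel has constant modulus, which is the dispersive bound from time 0; a translation
in time gives it from any time s, because σ is constant.

The Strichartz estimates use only unitarity and this bound. The decisive point is
`exists_weakType_dispersion`: K(τ) = ∏ (2π|μ_j(τ)|)^{-1/2} is globally of weak type 2/d as soon as
one μ_j is a sinh. The exponential growth of that factor can be shared among the other coordinates,
and it makes the neighbourhoods of the zeros of the sines summable in length.

All three estimates follow from one bound at a single admissible pair (q₀, r₀), for the form with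
integrand ⟨V(t)*G(t), V(s)*F(s)⟩ restricted to t - s ∈ W for an arbitrary measurable window W
(`BaseEstimate`). The window ℝ gives the homogeneous and dual estimates by the TT* argument, the
half-line gives the retarded one, and the other pairs with q ≥ q₀ follow by interpolation with the
energy bound and by duality. For q₀ > 2 the bilinear bound is interpolation between L¹ and L²
followed by the Hardy–Littlewood–Sobolev inequality. For q₀ = 2 it is the argument of Keel and Tao,
with dyadic shells in the size of K instead of the size of t - s. Interpolation,
Hardy–Littlewood–Sobolev and the endpoint are all done by hand with dyadic level sets;
`exists_min_forms_le` is the reason why the triple sums converge. -/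

/-- The derivative of the characteristic function `mu`. -/
def dmu (δ : SignType) (ω t : ℝ) : ℝ :=
  match δ with
  | SignType.neg => Real.cosh (ω * t)
  | SignType.zero => 1
  | SignType.pos => Real.cos (ω * t)

/-- The constant `4 σ = δ ω²`. -/
def freqSq (δ : SignType) (ω : ℝ) : ℝ := (δ : ℝ) * ω ^ 2

lemma hasDerivAt_mu (δ : SignType) {ω : ℝ} (hω : 0 < ω) (t : ℝ) :
    HasDerivAt (mu δ ω) (dmu δ ω t) t := by
  have hl : HasDerivAt (fun t : ℝ => ω * t) ω t := by
    simpa using (hasDerivAt_id t).const_mul ω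
  cases δ with
  | zero => exact hasDerivAt_id t
  | neg =>
    have := (hl.sinh).div_const ω
    rwa [mul_div_cancel_right₀ _ hω.ne'] at this
  | pos =>
    have := (hl.sin).div_const ω
    rwa [mul_div_cancel_right₀ _ hω.ne'] at this

lemma deriv_mu (δ : SignType) {ω : ℝ} (hω : 0 < ω) : deriv (mu δ ω) = dmu δ ω :=
  funext fun t => (hasDerivAt_mu δ hω t).deriv

lemma hasDerivAt_dmu (δ : SignType) {ω : ℝ} (hω : 0 < ω) (t : ℝ) :
    HasDerivAt (dmu δ ω) (-(freqSq δ ω * mu δ ω t)) t := by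
  have hl : HasDerivAt (fun t : ℝ => ω * t) ω t := by
    simpa using (hasDerivAt_id t).const_mul ω
  have := hω.ne'
  cases δ with
  | zero => exact (hasDerivAt_const t (1 : ℝ)).congr_deriv (by simp [freqSq])
  | neg => exact hl.cosh.congr_deriv (by simp [freqSq, mu]; field_simp)
  | pos => exact hl.cos.congr_deriv (by simp [freqSq, mu]; field_simp)

/-- Conservation of energy for m'' + 4σm = 0; equivalently, the flow matrix with rows (μ', μ) and
(-4σμ, μ') has determinant 1. Most of the algebra below reduces to multiples of this identity. -/
lemma dmu_sq_add (δ : SignType) {ω : ℝ} (hω : 0 < ω) (t : ℝ) :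
    dmu δ ω t ^ 2 + freqSq δ ω * mu δ ω t ^ 2 = 1 := by
  have := hω.ne'
  cases δ with
  | zero => simp [freqSq, dmu]
  | neg =>
    simp [freqSq, dmu, mu]
    field_simp
    linarith [Real.cosh_sq (ω * t)]
  | pos =>
    simp [freqSq, dmu, mu]
    field_simp
    linarith [Real.sin_sq_add_cos_sq (ω * t)]

/-- The flow matrix at time t - s is the one at t times the inverse of the one at s. With `dmu_sub`
this separates the variables in the integrand of `epsilonExt`. -/
lemma mu_sub (δ : SignType) {ω : ℝ} (hω : 0 < ω) (t s : ℝ) :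
    mu δ ω (t - s) = mu δ ω t * dmu δ ω s - dmu δ ω t * mu δ ω s := by
  have := hω.ne'
  cases δ with
  | zero => simp [dmu, mu]
  | neg =>
    simp only [dmu, mu, mul_sub, Real.sinh_sub]
    field_simp
  | pos =>
    simp only [dmu, mu, mul_sub, Real.sin_sub]
    field_simp

lemma dmu_sub (δ : SignType) {ω : ℝ} (hω : 0 < ω) (t s : ℝ) :
    dmu δ ω (t - s) = dmu δ ω t * dmu δ ω s + freqSq δ ω * (mu δ ω t * mu δ ω s) := by
  have := hω.ne'
  cases δ with
  | zero => simp [dmu, freqSq]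
  | neg =>
    simp only [dmu, mu, mul_sub, Real.cosh_sub, freqSq]
    simp
    field_simp
    ring
  | pos =>
    simp only [dmu, mu, mul_sub, Real.cos_sub, freqSq]
    simp
    field_simp

@[simp] lemma mu_zero_time (δ : SignType) (ω : ℝ) : mu δ ω 0 = 0 := by
  cases δ <;> simp [mu]

@[simp] lemma dmu_zero_time (δ : SignType) (ω : ℝ) : dmu δ ω 0 = 1 := by
  cases δ <;> simp [dmu]

lemma continuous_mu (δ : SignType) {ω : ℝ} (hω : 0 < ω) : Continuous (mu δ ω) :=
  continuous_iff_continuousAt.2 fun t => (hasDerivAt_mu δ hω t).continuousAt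

lemma continuous_dmu (δ : SignType) {ω : ℝ} (hω : 0 < ω) : Continuous (dmu δ ω) :=
  continuous_iff_continuousAt.2 fun t => (hasDerivAt_dmu δ hω t).continuousAt

/-- Uniqueness of the characteristic function, through the two Wronskians with `mu`. -/
theorem isCharacteristicFunction_iff (δ : SignType) {ω : ℝ} (hω : 0 < ω) {σ : ℝ → ℝ}
    (hσ : ∀ t, σ t = (δ : ℝ) * ω ^ 2 / 4) (m : ℝ → ℝ) :
    IsCharacteristicFunction σ m ↔ m = mu δ ω := by
  have h4 : ∀ t, 4 * σ t = freqSq δ ω := fun t => by rw [hσ, freqSq]; ring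
  constructor
  · rintro ⟨hd, hdd, h0, h1⟩
    have hm : ∀ t, HasDerivAt m (deriv m t) t := fun t => (hd t).hasDerivAt
    have const : ∀ F : ℝ → ℝ, (∀ t, HasDerivAt F 0 t) → ∀ t, F t = F 0 := fun F hF t =>
      is_const_of_deriv_eq_zero (fun t => (hF t).differentiableAt) (fun t => (hF t).deriv) t 0
    -- Two constants of motion, bilinear in m and μ; their values at time 0 are 0 and 1.
    have hX := const (fun t => dmu δ ω t * m t - mu δ ω t * deriv m t) fun t =>
      (((hasDerivAt_dmu δ hω t).mul (hm t)).sub ((hasDerivAt_mu δ hω t).mul (hdd t))).congr_deriv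
        (by rw [h4]; ring)
    have hY := const (fun t => dmu δ ω t * deriv m t + freqSq δ ω * (mu δ ω t * m t)) fun t =>
      (((hasDerivAt_dmu δ hω t).mul (hdd t)).add
        (((hasDerivAt_mu δ hω t).mul (hm t)).const_mul (freqSq δ ω))).congr_deriv
        (by rw [h4]; ring)
    funext t
    have hX := hX t
    have hY := hY t
    simp only [h0, h1, mu_zero_time, dmu_zero_time] at hX hY
    -- The constants of motion form a linear system for (m, m') of determinant 1, and Cramer's rule
    -- returns m = μ.
    linear_combination dmu δ ω t * hX + mu δ ω t * hY - m t * dmu_sq_add δ hω t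
  · rintro rfl
    refine ⟨fun t => (hasDerivAt_mu δ hω t).differentiableAt, fun t => ?_, mu_zero_time _ _, ?_⟩
    · rw [deriv_mu δ hω, h4]; exact hasDerivAt_dmu δ hω t
    · rw [deriv_mu δ hω, dmu_zero_time]

/-! ### Piecewise continuous functions -/

namespace PiecewiseContinuous

variable {h : ℝ → ℝ}

lemma countable_discontinuities (hh : PiecewiseContinuous h) :
    {t | ¬ ContinuousAt h t}.Countable := by
  refine Set.Countable.mono (s₂ := ⋃ n : ℕ, {t ∈ Icc (-(n : ℝ)) n | ¬ ContinuousAt h t})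
    (fun t ht => ?_) (countable_iUnion fun n => (hh.1 _ _).countable)
  obtain ⟨n, hn⟩ := exists_nat_ge |t|
  exact mem_iUnion.2 ⟨n, ⟨(abs_le.1 hn).1, (abs_le.1 hn).2⟩, ht⟩

/-- Off the countable set of discontinuities the function is continuous, and on a countable set
every function is measurable. -/
lemma measurable (hh : PiecewiseContinuous h) : Measurable h := by
  have hc := hh.countable_discontinuities
  have hs : MeasurableSet {t | ¬ ContinuousAt h t} := hc.measurableSet
  refine measurable_of_restrict_of_restrict_compl hs ?_ ?_
  · have : Countable {t | ¬ ContinuousAt h t} := hc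
    exact measurable_of_countable _
  · refine ContinuousOn.domRestrict (fun t ht => ?_) |>.measurable
    simp only [mem_compl_iff, mem_ofPred_eq, not_not] at ht
    exact ht.continuousWithinAt

lemma isBounded_near (hh : PiecewiseContinuous h) (t : ℝ) : ∃ C, ∀ᶠ s in 𝓝 t, |h s| ≤ C := by
  obtain ⟨⟨l, hl⟩, r, hr⟩ := hh.2 t
  refine ⟨max (max (|l| + 1) (|r| + 1)) |h t|, ?_⟩
  have h1 : ∀ᶠ s in 𝓝[<] t, |h s| ≤ |l| + 1 :=
    (hl.abs.eventually (ge_mem_nhds (lt_add_one _)))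
  have h2 : ∀ᶠ s in 𝓝[>] t, |h s| ≤ |r| + 1 :=
    (hr.abs.eventually (ge_mem_nhds (lt_add_one _)))
  filter_upwards [eventually_nhdsWithin_iff.1 h1, eventually_nhdsWithin_iff.1 h2] with s hs1 hs2
  rcases lt_trichotomy s t with hs | rfl | hs
  · exact (hs1 hs).trans ((le_max_left _ _).trans (le_max_left _ _))
  · exact le_max_right _ _
  · exact (hs2 hs).trans ((le_max_right _ _).trans (le_max_left _ _))

end PiecewiseContinuous

/-- Measurable and locally bounded. -/
def MeasLocBounded (h : ℝ → ℝ) : Prop :=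
  Measurable h ∧ ∀ t, ∃ C, ∀ᶠ s in 𝓝 t, |h s| ≤ C

lemma PiecewiseContinuous.measLocBounded {h : ℝ → ℝ} (hh : PiecewiseContinuous h) :
    MeasLocBounded h := ⟨hh.measurable, hh.isBounded_near⟩

lemma _root_.Continuous.measLocBounded {h : ℝ → ℝ} (hh : Continuous h) : MeasLocBounded h :=
  ⟨hh.measurable, fun t => ⟨|h t| + 1, hh.abs.continuousAt.eventually (ge_mem_nhds (lt_add_one _))⟩⟩

namespace MeasLocBounded

variable {u v : ℝ → ℝ}

lemma add (hu : MeasLocBounded u) (hv : MeasLocBounded v) :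
    MeasLocBounded (fun t => u t + v t) := by
  refine ⟨hu.1.add hv.1, fun t => ?_⟩
  obtain ⟨C, hC⟩ := hu.2 t
  obtain ⟨C', hC'⟩ := hv.2 t
  exact ⟨C + C', by filter_upwards [hC, hC'] with s h h' using (abs_add_le _ _).trans (add_le_add h h')⟩

lemma mul (hu : MeasLocBounded u) (hv : MeasLocBounded v) :
    MeasLocBounded (fun t => u t * v t) := by
  refine ⟨hu.1.mul hv.1, fun t => ?_⟩
  obtain ⟨C, hC⟩ := hu.2 t
  obtain ⟨C', hC'⟩ := hv.2 t
  refine ⟨C * C', ?_⟩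
  filter_upwards [hC, hC'] with s h h'
  rw [abs_mul]
  exact mul_le_mul h h' (abs_nonneg _) ((abs_nonneg _).trans h)

lemma sub (hu : MeasLocBounded u) (hv : MeasLocBounded v) :
    MeasLocBounded (fun t => u t - v t) := by
  simpa [sub_eq_add_neg] using hu.add ((continuous_const (y := (-1 : ℝ))).measLocBounded.mul hv)

lemma intervalIntegrable (hu : MeasLocBounded u) (a b : ℝ) : IntervalIntegrable u volume a b := by
  refine LocallyIntegrable.integrableOn_isCompact (k := uIcc a b) (fun t => ?_) isCompact_uIcc
    |>.intervalIntegrable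
  obtain ⟨C, hC⟩ := hu.2 t
  exact Measure.FiniteAtFilter.integrableAtFilter
    ⟨univ, univ_mem, hu.1.aestronglyMeasurable⟩ (volume.finiteAt_nhds t) ⟨C, by simpa using hC⟩

lemma continuous_integral (hu : MeasLocBounded u) :
    Continuous fun t => ∫ τ in (0 : ℝ)..t, u τ :=
  intervalIntegral.continuous_primitive (fun a b => hu.intervalIntegrable a b) 0

lemma hasDerivAt_integral (hu : MeasLocBounded u) {t : ℝ} (ht : ContinuousAt u t) :
    HasDerivAt (fun t => ∫ τ in (0 : ℝ)..t, u τ) (u t) t :=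
  intervalIntegral.integral_hasDerivAt_right (hu.intervalIntegrable 0 t)
    ⟨univ, univ_mem, hu.1.aestronglyMeasurable⟩ ht

end MeasLocBounded

/-! ### Classical trajectories -/

/-- The regularity assumptions on the sources `f, g` and on `c`. -/
structure RegularSources (f g c : ℝ → ℝ) : Prop where
  f : PiecewiseContinuous f
  g : PiecewiseContinuous g
  c : Continuous c

section Trajectory

variable (δ : SignType) (ω : ℝ) (f g c : ℝ → ℝ)

/-- Integrand of `momentumInt`. -/
def driftRate (τ : ℝ) : ℝ := (f τ - c τ * g τ) * mu δ ω τ + g τ * dmu δ ω τ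

/-- Integrand of `kick`. -/
def kickRate (τ : ℝ) : ℝ := dmu δ ω τ * (f τ - c τ * g τ) - freqSq δ ω * mu δ ω τ * g τ

/-- The drift `∫₀ᵗ (h μ + g μ')`. -/
def drift (t : ℝ) : ℝ := ∫ τ in (0 : ℝ)..t, driftRate δ ω f g c τ

/-- The kick `∫₀ᵗ (h μ' - 4σ g μ)`. -/
def kick (t : ℝ) : ℝ := ∫ τ in (0 : ℝ)..t, kickRate δ ω f g c τ

/-- The integral of `drift` against the derivative of `kick`. -/
def driftKick (t : ℝ) : ℝ := ∫ τ in (0 : ℝ)..t, drift δ ω f g c τ * kickRate δ ω f g c τ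

/-- Position of the classical trajectory that starts at rest at the origin. -/
def position (t : ℝ) : ℝ :=
  mu δ ω t * kick δ ω f g c t - dmu δ ω t * drift δ ω f g c t

/-- Momentum of the classical trajectory that starts at rest at the origin. -/
def momentum (t : ℝ) : ℝ :=
  dmu δ ω t * kick δ ω f g c t + freqSq δ ω * mu δ ω t * drift δ ω f g c t

/-- The phase gathered along the classical trajectory. -/
def action (t : ℝ) : ℝ :=
  freqSq δ ω * mu δ ω t * dmu δ ω t * drift δ ω f g c t ^ 2 / 2
    - mu δ ω t * dmu δ ω t * kick δ ω f g c t ^ 2 / 2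
    + dmu δ ω t ^ 2 * (kick δ ω f g c t * drift δ ω f g c t) - driftKick δ ω f g c t

variable {δ ω f g c}

lemma RegularSources.measLocBounded_driftRate (h : RegularSources f g c) (hω : 0 < ω) :
    MeasLocBounded (driftRate δ ω f g c) :=
  ((h.f.measLocBounded.sub (h.c.measLocBounded.mul h.g.measLocBounded)).mul
    (continuous_mu δ hω).measLocBounded).add
    (h.g.measLocBounded.mul (continuous_dmu δ hω).measLocBounded)

lemma RegularSources.measLocBounded_kickRate (h : RegularSources f g c) (hω : 0 < ω) :
    MeasLocBounded (kickRate δ ω f g c) :=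
  ((continuous_dmu δ hω).measLocBounded.mul
    (h.f.measLocBounded.sub (h.c.measLocBounded.mul h.g.measLocBounded))).sub
    ((continuous_const.mul (continuous_mu δ hω)).measLocBounded.mul h.g.measLocBounded)

lemma RegularSources.continuous_drift (h : RegularSources f g c) (hω : 0 < ω) :
    Continuous (drift δ ω f g c) := (h.measLocBounded_driftRate hω).continuous_integral

lemma RegularSources.continuous_kick (h : RegularSources f g c) (hω : 0 < ω) :
    Continuous (kick δ ω f g c) := (h.measLocBounded_kickRate hω).continuous_integral

lemma RegularSources.measLocBounded_driftKick (h : RegularSources f g c) (hω : 0 < ω) :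
    MeasLocBounded fun τ => drift δ ω f g c τ * kickRate δ ω f g c τ :=
  (h.continuous_drift hω).measLocBounded.mul (h.measLocBounded_kickRate hω)

lemma RegularSources.continuous_driftKick (h : RegularSources f g c) (hω : 0 < ω) :
    Continuous (driftKick δ ω f g c) := (h.measLocBounded_driftKick hω).continuous_integral

lemma RegularSources.continuous_position (h : RegularSources f g c) (hω : 0 < ω) :
    Continuous (position δ ω f g c) :=
  ((continuous_mu δ hω).mul (h.continuous_kick hω)).sub
    ((continuous_dmu δ hω).mul (h.continuous_drift hω))

lemma RegularSources.continuous_momentum (h : RegularSources f g c) (hω : 0 < ω) :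
    Continuous (momentum δ ω f g c) :=
  ((continuous_dmu δ hω).mul (h.continuous_kick hω)).add
    ((continuous_const.mul (continuous_mu δ hω)).mul (h.continuous_drift hω))

lemma RegularSources.continuous_action (h : RegularSources f g c) (hω : 0 < ω) :
    Continuous (action δ ω f g c) := by
  have h1 := h.continuous_kick (δ := δ) hω
  have h2 := h.continuous_drift (δ := δ) hω
  have h3 := h.continuous_driftKick (δ := δ) hω
  have h4 := continuous_mu δ hω
  have h5 := continuous_dmu δ hω
  unfold action
  fun_prop

section Derivatives

variable {t : ℝ}

lemma RegularSources.hasDerivAt_drift (h : RegularSources f g c) (hω : 0 < ω)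
    (hf : ContinuousAt f t) (hg : ContinuousAt g t) :
    HasDerivAt (drift δ ω f g c) (driftRate δ ω f g c t) t :=
  (h.measLocBounded_driftRate hω).hasDerivAt_integral
    (((hf.sub (h.c.continuousAt.mul hg)).mul (continuous_mu δ hω).continuousAt).add
      (hg.mul (continuous_dmu δ hω).continuousAt))

lemma RegularSources.continuousAt_kickRate (h : RegularSources f g c) (hω : 0 < ω)
    (hf : ContinuousAt f t) (hg : ContinuousAt g t) : ContinuousAt (kickRate δ ω f g c) t :=
  ((continuous_dmu δ hω).continuousAt.mul (hf.sub (h.c.continuousAt.mul hg))).sub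
    ((continuous_const.mul (continuous_mu δ hω)).continuousAt.mul hg)

lemma RegularSources.hasDerivAt_kick (h : RegularSources f g c) (hω : 0 < ω)
    (hf : ContinuousAt f t) (hg : ContinuousAt g t) :
    HasDerivAt (kick δ ω f g c) (kickRate δ ω f g c t) t :=
  (h.measLocBounded_kickRate hω).hasDerivAt_integral (h.continuousAt_kickRate hω hf hg)

lemma RegularSources.hasDerivAt_driftKick (h : RegularSources f g c) (hω : 0 < ω)
    (hf : ContinuousAt f t) (hg : ContinuousAt g t) :
    HasDerivAt (driftKick δ ω f g c) (drift δ ω f g c t * kickRate δ ω f g c t) t :=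
  (h.measLocBounded_driftKick hω).hasDerivAt_integral
    ((h.continuous_drift hω).continuousAt.mul (h.continuousAt_kickRate hω hf hg))

/-- The classical Hamiltonian is p²/2 + bx² - fx - gp + cxp. For the gauge-changed momentum P = p +
cx its equations are X' = P - g and P' = h - 4σX, since 4σ = 2b - c² - c'. `position` and `momentum`
solve them by variation of constants, the coefficients being `kick` and `drift`. -/
lemma RegularSources.hasDerivAt_position (h : RegularSources f g c) (hω : 0 < ω)
    (hf : ContinuousAt f t) (hg : ContinuousAt g t) :
    HasDerivAt (position δ ω f g c) (momentum δ ω f g c t - g t) t := by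
  refine (((hasDerivAt_mu δ hω t).mul (h.hasDerivAt_kick hω hf hg)).sub
    ((hasDerivAt_dmu δ hω t).mul (h.hasDerivAt_drift hω hf hg))).congr_deriv ?_
  simp only [momentum, driftRate, kickRate]
  linear_combination (-g t) * dmu_sq_add δ hω t

lemma RegularSources.hasDerivAt_momentum (h : RegularSources f g c) (hω : 0 < ω)
    (hf : ContinuousAt f t) (hg : ContinuousAt g t) :
    HasDerivAt (momentum δ ω f g c)
      (f t - c t * g t - freqSq δ ω * position δ ω f g c t) t := by
  refine (((hasDerivAt_dmu δ hω t).mul (h.hasDerivAt_kick hω hf hg)).add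
    (((hasDerivAt_mu δ hω t).const_mul (freqSq δ ω)).mul
      (h.hasDerivAt_drift hω hf hg))).congr_deriv ?_
  simp only [position, driftRate, kickRate]
  linear_combination (f t - c t * g t) * dmu_sq_add δ hω t

/-- The rate is PX' - H - (PX)' for H = P²/2 + 2σX² - hX - gP: the phase of a wave packet written as
e^{i(Px + θ)} around the trajectory. -/
lemma RegularSources.hasDerivAt_action (h : RegularSources f g c) (hω : 0 < ω)
    (hf : ContinuousAt f t) (hg : ContinuousAt g t) :
    HasDerivAt (action δ ω f g c)
      (-(momentum δ ω f g c t ^ 2) / 2 + g t * momentum δ ω f g c t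
        + freqSq δ ω * position δ ω f g c t ^ 2 / 2) t := by
  have hm := hasDerivAt_mu δ hω t
  have hd := hasDerivAt_dmu δ hω t
  have hD := h.hasDerivAt_drift (δ := δ) hω hf hg
  have hE := h.hasDerivAt_kick (δ := δ) hω hf hg
  have hI := h.hasDerivAt_driftKick (δ := δ) hω hf hg
  refine (((((((hm.const_mul (freqSq δ ω)).mul hd).mul (hD.pow 2)).div_const 2).sub
    (((hm.mul hd).mul (hE.pow 2)).div_const 2)).add
    ((hd.pow 2).mul (hE.mul hD))).sub hI).congr_deriv ?_
  simp only [momentum, position, driftRate, kickRate, Pi.mul_apply, Pi.pow_apply, Nat.cast_ofNat, Nat.add_one_sub_one, pow_one]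
  linear_combination dmu δ ω t * (g t * kick δ ω f g c t
    + (f t - c t * g t) * drift δ ω f g c t) * dmu_sq_add δ hω t

end Derivatives

end Trajectory

end QuadSchrodinger

end

noncomputable section

namespace QuadSchrodinger

open scoped FourierTransform LineDeriv SchwartzMap

variable {d : ℕ}

/-! ### Isometries of Schwartz space for the `L²` norm -/

/-- A linear bijection of Schwartz space that preserves the `L²` norm. -/
structure SchwartzIsometry (d : ℕ) where
  toEquiv : 𝓢(Space d, ℂ) ≃ₗ[ℂ] 𝓢(Space d, ℂ)
  norm_toLp : ∀ f, ‖(toEquiv f).toLp 2 volume‖ = ‖f.toLp 2 volume‖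

lemma denseRange_toLp : DenseRange (SchwartzMap.toLpCLM ℂ (E := Space d) ℂ 2 volume) :=
  SchwartzMap.denseRange_toLpCLM ENNReal.ofNat_ne_top

namespace SchwartzIsometry

instance : CoeFun (SchwartzIsometry d) (fun _ => 𝓢(Space d, ℂ) → 𝓢(Space d, ℂ)) :=
  ⟨fun e => e.toEquiv⟩

/-- Composition, the first argument acting first. -/
def trans (e e' : SchwartzIsometry d) : SchwartzIsometry d where
  toEquiv := e.toEquiv.trans e'.toEquiv
  norm_toLp f := by simp [e.norm_toLp, e'.norm_toLp]

/-- The inverse. -/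
def symm (e : SchwartzIsometry d) : SchwartzIsometry d where
  toEquiv := e.toEquiv.symm
  norm_toLp f := by simpa using (e.norm_toLp (e.toEquiv.symm f)).symm

@[simp] lemma trans_apply (e e' : SchwartzIsometry d) (f : 𝓢(Space d, ℂ)) :
    (e.trans e') f = e' (e f) := rfl

/-- The extension to `L²`. -/
def toL2 (e : SchwartzIsometry d) : L2 d ≃ₗᵢ[ℂ] L2 d :=
  e.toEquiv.extendOfIsometry (SchwartzMap.toLpCLM ℂ (E := Space d) ℂ 2 volume).toLinearMap
    (SchwartzMap.toLpCLM ℂ (E := Space d) ℂ 2 volume).toLinearMap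
    denseRange_toLp denseRange_toLp e.norm_toLp

lemma toL2_toLp (e : SchwartzIsometry d) (f : 𝓢(Space d, ℂ)) :
    e.toL2 (f.toLp 2) = (e f).toLp 2 :=
  LinearEquiv.extendOfIsometry_eq _ _ _ _ _ _ f

lemma toL2_symm_toLp (e : SchwartzIsometry d) (f : 𝓢(Space d, ℂ)) :
    e.toL2.symm (f.toLp 2) = (e.symm f).toLp 2 :=
  LinearEquiv.extendOfIsometry_symm_eq _ _ _ _ _ _ f

end SchwartzIsometry

lemma toLp_add (f g : 𝓢(Space d, ℂ)) :
    (f + g).toLp 2 volume = f.toLp 2 volume + g.toLp 2 volume :=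
  map_add (SchwartzMap.toLpCLM ℂ (E := Space d) ℂ 2 volume) f g

lemma toLp_sub (f g : 𝓢(Space d, ℂ)) :
    (f - g).toLp 2 volume = f.toLp 2 volume - g.toLp 2 volume :=
  map_sub (SchwartzMap.toLpCLM ℂ (E := Space d) ℂ 2 volume) f g

lemma toLp_smul (c : ℂ) (f : 𝓢(Space d, ℂ)) :
    (c • f).toLp 2 volume = c • f.toLp 2 volume :=
  map_smul (SchwartzMap.toLpCLM ℂ (E := Space d) ℂ 2 volume) c f

lemma real_smul_L2 (r : ℝ) (φ : L2 d) : r • φ = (r : ℂ) • φ :=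
  RCLike.real_smul_eq_coe_smul (K := ℂ) r φ

/-- `L²`-continuity on Schwartz functions, at a point. -/
def StrongContAt {T : Type*} [TopologicalSpace T] (e : T → SchwartzIsometry d) (t : T) : Prop :=
  ∀ f, ContinuousAt (fun τ => (e τ f).toLp 2 volume) t

section StrongCont

variable {T : Type*} [TopologicalSpace T] {e e' : T → SchwartzIsometry d} {t : T}

/-- An ε/3 argument: Schwartz functions are dense and the isometries are equicontinuous. -/
lemma StrongContAt.toL2 (h : StrongContAt e t) (φ : L2 d) :
    ContinuousAt (fun τ => (e τ).toL2 φ) t := by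
  rw [Metric.continuousAt_iff']
  intro ε hε
  obtain ⟨f, hf⟩ := denseRange_toLp.exists_dist_lt φ (show 0 < ε / 3 by positivity)
  have hf' : dist φ (f.toLp 2) < ε / 3 := hf
  filter_upwards [Metric.continuousAt_iff'.1 (h f) (ε / 3) (by positivity)] with τ hτ
  have h1 : dist ((e τ).toL2 φ) ((e τ).toL2 (f.toLp 2)) < ε / 3 := by
    rwa [(e τ).toL2.isometry.dist_eq]
  have h2 : dist ((e t).toL2 (f.toLp 2)) ((e t).toL2 φ) < ε / 3 := by
    rw [(e t).toL2.isometry.dist_eq, dist_comm]; exact hf'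
  rw [← SchwartzIsometry.toL2_toLp, ← SchwartzIsometry.toL2_toLp] at hτ
  have := dist_triangle4 ((e τ).toL2 φ) ((e τ).toL2 (f.toLp 2)) ((e t).toL2 (f.toLp 2))
    ((e t).toL2 φ)
  linarith

/-- No continuity of the second family on Schwartz space is needed: the change of its argument
passes through an isometry at unchanged size, and the rest concerns a fixed argument. -/
lemma StrongContAt.trans (h : StrongContAt e t) (h' : StrongContAt e' t) :
    StrongContAt (fun τ => (e τ).trans (e' τ)) t := by
  intro f
  have h1 := h f
  have h2 := h' (e t f)
  simp only [ContinuousAt, SchwartzIsometry.trans_apply] at h1 h2 ⊢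
  rw [tendsto_iff_norm_sub_tendsto_zero] at h1 h2 ⊢
  refine squeeze_zero (fun _ => norm_nonneg _) (fun τ => ?_) (by simpa using h1.add h2)
  have : ‖(e' τ (e τ f)).toLp 2 volume - (e' τ (e t f)).toLp 2 volume‖ =
      ‖(e τ f).toLp 2 volume - (e t f).toLp 2 volume‖ := by
    rw [← toLp_sub, ← toLp_sub, ← map_sub, (e' τ).norm_toLp]
  rw [← this]
  exact norm_sub_le_norm_sub_add_norm_sub _ _ _

lemma strongContAt_const (e : SchwartzIsometry d) : StrongContAt (fun _ : T => e) t :=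
  fun _ => continuousAt_const

end StrongCont

/-- The product rule for `τ ↦ e τ (ψ τ)` in `L²`. -/
lemma hasDerivAt_apply {e : ℝ → SchwartzIsometry d} {t : ℝ} (he : StrongContAt e t)
    {ψ : ℝ → 𝓢(Space d, ℂ)} {ψ' D : 𝓢(Space d, ℂ)}
    (hψ : HasDerivAt (fun τ => (ψ τ).toLp 2 volume) (ψ'.toLp 2 volume) t)
    (hD : HasDerivAt (fun τ => (e τ (ψ t)).toLp 2 volume) (D.toLp 2 volume) t) :
    HasDerivAt (fun τ => (e τ (ψ τ)).toLp 2 volume) ((D + e t ψ').toLp 2 volume) t := by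
  rw [hasDerivAt_iff_tendsto_slope] at *
  rw [toLp_add]
  -- The difference quotient of e τ (ψ τ) is that of e τ at the fixed vector ψ t plus e τ applied to
  -- the difference quotient of ψ. The second part converges by strong continuity and isometry.
  have key : Tendsto (fun τ => (e τ).toL2 (slope (fun τ => (ψ τ).toLp 2 volume) t τ)) (𝓝[≠] t)
      (𝓝 ((e t ψ').toLp 2 volume)) := by
    have h1 := (he.toL2 (ψ'.toLp 2 volume)).tendsto.mono_left (nhdsWithin_le_nhds (s := {t}ᶜ))
    rw [SchwartzIsometry.toL2_toLp] at h1
    rw [tendsto_iff_norm_sub_tendsto_zero] at h1 hψ ⊢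
    refine squeeze_zero (fun _ => norm_nonneg _) (fun τ => ?_) (by simpa using hψ.add h1)
    rw [← (e τ).toL2.norm_map (slope _ _ _ - _), map_sub]
    exact norm_sub_le_norm_sub_add_norm_sub _ _ _
  refine (hD.add key).congr fun τ => ?_
  simp only [slope, vsub_eq_sub, real_smul_L2]
  rw [map_smul, map_sub, SchwartzIsometry.toL2_toLp, SchwartzIsometry.toL2_toLp, ← smul_add]
  congr 1
  abel

lemma norm_toLp_le_mul {f g : 𝓢(Space d, ℂ)} {C : ℝ} (h : ∀ x, ‖f x‖ ≤ C * ‖g x‖) :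
    ‖f.toLp 2 volume‖ ≤ C * ‖g.toLp 2 volume‖ := by
  refine Lp.norm_le_mul_norm_of_ae_le_mul ?_
  filter_upwards [f.coeFn_toLp 2 volume, g.coeFn_toLp 2 volume] with x hf hg
  rw [hf, hg]; exact h x

lemma norm_toLp_eq_of_norm_eq {f g : 𝓢(Space d, ℂ)} (h : ∀ x, ‖f x‖ = ‖g x‖) :
    ‖f.toLp 2 volume‖ = ‖g.toLp 2 volume‖ := by
  apply le_antisymm
  · simpa using norm_toLp_le_mul (f := f) (g := g) (C := 1) fun x => by simp [h]
  · simpa using norm_toLp_le_mul (f := g) (g := f) (C := 1) fun x => by simp [h]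

/-! ### Chirps -/

/-- `x ↦ e^{i q(x)}`. -/
def expI (q : Space d → ℝ) (x : Space d) : ℂ := Complex.exp (Complex.I * (q x : ℂ))

/-- All derivatives have modulus 1. Composition with a real polynomial then shows that chirps are
multipliers of Schwartz space. -/
lemma hasTemperateGrowth_cexp_I_mul :
    Function.HasTemperateGrowth (fun t : ℝ => Complex.exp (Complex.I * (t : ℂ))) := by
  have hd : ∀ t : ℝ, HasDerivAt (fun t : ℝ => Complex.exp (Complex.I * (t : ℂ)))
      (Complex.I * Complex.exp (Complex.I * (t : ℂ))) t := fun t => by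
    have := ((Complex.ofRealCLM.hasDerivAt (x := t)).const_mul Complex.I).cexp
    simpa [mul_comm] using this
  have hn : ∀ n : ℕ, iteratedDeriv n (fun t : ℝ => Complex.exp (Complex.I * (t : ℂ))) =
      fun t : ℝ => Complex.I ^ n * Complex.exp (Complex.I * (t : ℂ)) := by
    intro n
    induction n with
    | zero => simp
    | succ n ih =>
      rw [iteratedDeriv_succ, ih]
      funext t
      rw [((hd t).const_mul (Complex.I ^ n)).deriv]
      ring
  refine ⟨(contDiff_const.mul Complex.ofRealCLM.contDiff).cexp, fun n => ⟨0, 1, fun t => ?_⟩⟩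
  rw [norm_iteratedFDeriv_eq_norm_iteratedDeriv, hn]
  simp [Complex.norm_exp]

lemma hasTemperateGrowth_expI {q : Space d → ℝ} (hq : Function.HasTemperateGrowth q) :
    Function.HasTemperateGrowth (expI q) :=
  hasTemperateGrowth_cexp_I_mul.comp hq

lemma norm_expI (q : Space d → ℝ) (x : Space d) : ‖expI q x‖ = 1 := by
  simp [expI, Complex.norm_exp]

lemma expI_neg_mul (q : Space d → ℝ) (x : Space d) : expI (fun x => -q x) x * expI q x = 1 := by
  simp [expI, ← Complex.exp_add]

/-- Multiplication by `e^{i q}`. -/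
def mulExpI (q : Space d → ℝ) (hq : Function.HasTemperateGrowth q) : SchwartzIsometry d where
  toEquiv := LinearEquiv.ofLinearMap
    (SchwartzMap.smulLeftCLM ℂ (expI q)).toLinearMap
    (SchwartzMap.smulLeftCLM ℂ (expI fun x => -q x)).toLinearMap
    (by
      have h1 := hasTemperateGrowth_expI hq
      have h2 : Function.HasTemperateGrowth (expI fun x => -q x) := hasTemperateGrowth_expI hq.neg
      refine LinearMap.ext fun f => SchwartzMap.ext fun x => ?_
      change SchwartzMap.smulLeftCLM ℂ _ (SchwartzMap.smulLeftCLM ℂ _ f) x = f x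
      rw [SchwartzMap.smulLeftCLM_apply_apply h1, SchwartzMap.smulLeftCLM_apply_apply h2,
        smul_smul, mul_comm, expI_neg_mul, one_smul])
    (by
      have h1 := hasTemperateGrowth_expI hq
      have h2 : Function.HasTemperateGrowth (expI fun x => -q x) := hasTemperateGrowth_expI hq.neg
      refine LinearMap.ext fun f => SchwartzMap.ext fun x => ?_
      change SchwartzMap.smulLeftCLM ℂ _ (SchwartzMap.smulLeftCLM ℂ _ f) x = f x
      rw [SchwartzMap.smulLeftCLM_apply_apply h2, SchwartzMap.smulLeftCLM_apply_apply h1,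
        smul_smul, expI_neg_mul, one_smul])
  norm_toLp f := by
    refine norm_toLp_eq_of_norm_eq fun x => ?_
    change ‖SchwartzMap.smulLeftCLM ℂ _ f x‖ = _
    rw [SchwartzMap.smulLeftCLM_apply_apply (hasTemperateGrowth_expI hq), norm_smul, norm_expI,
      one_mul]

lemma mulExpI_apply {q : Space d → ℝ} (hq : Function.HasTemperateGrowth q)
    (f : 𝓢(Space d, ℂ)) (x : Space d) : mulExpI q hq f x = expI q x * f x :=
  SchwartzMap.smulLeftCLM_apply_apply (hasTemperateGrowth_expI hq) f x

/-- Coefficients `(A, B, C)` of the quadratic polynomial `∑_j (A_j x_j² + B_j x_j) + C`. -/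
abbrev QuadCoeff (d : ℕ) : Type := (Fin d → ℝ) × (Fin d → ℝ) × ℝ

/-- The quadratic polynomial `∑_j (A_j x_j² + B_j x_j) + C`. -/
def quadForm (v : QuadCoeff d) (x : Space d) : ℝ :=
  ∑ j, (v.1 j * x j ^ 2 + v.2.1 j * x j) + v.2.2

lemma quadForm_add (v w : QuadCoeff d) (x : Space d) :
    quadForm (v + w) x = quadForm v x + quadForm w x := by
  simp only [quadForm, Prod.fst_add, Prod.snd_add, Pi.add_apply, add_mul]
  rw [add_add_add_comm, ← Finset.sum_add_distrib]
  congr 1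
  exact Finset.sum_congr rfl fun j _ => by ring

lemma quadForm_smul (c : ℝ) (v : QuadCoeff d) (x : Space d) :
    quadForm (c • v) x = c * quadForm v x := by
  simp only [quadForm, Prod.smul_fst, Prod.smul_snd, Pi.smul_apply, smul_eq_mul, mul_add,
    Finset.mul_sum]
  congr 1
  exact Finset.sum_congr rfl fun j _ => by ring

lemma quadForm_sub (v w : QuadCoeff d) (x : Space d) :
    quadForm (v - w) x = quadForm v x - quadForm w x := by
  rw [sub_eq_add_neg, quadForm_add, ← neg_one_smul ℝ w, quadForm_smul]; ring

lemma abs_quadForm_le (v : QuadCoeff d) (x : Space d) :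
    |quadForm v x| ≤ (2 * d + 1) * ‖v‖ * (1 + ‖x‖ ^ 2) := by
  have hx : ∀ j, |x j| ≤ ‖x‖ := fun j => by simpa using PiLp.norm_apply_le x j
  have h1 : ∀ j, |v.1 j| ≤ ‖v‖ := fun j => (norm_le_pi_norm v.1 j).trans (norm_fst_le v)
  have h2 : ∀ j, |v.2.1 j| ≤ ‖v‖ := fun j =>
    (norm_le_pi_norm v.2.1 j).trans ((norm_fst_le v.2).trans (norm_snd_le v))
  have h3 : |v.2.2| ≤ ‖v‖ := (norm_snd_le v.2).trans (norm_snd_le v)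
  have hterm : ∀ j, |v.1 j * x j ^ 2 + v.2.1 j * x j| ≤ 2 * ‖v‖ * (1 + ‖x‖ ^ 2) := fun j => by
    refine (abs_add_le _ _).trans ?_
    rw [abs_mul, abs_mul, abs_pow]
    have e1 : |v.1 j| * |x j| ^ 2 ≤ ‖v‖ * ‖x‖ ^ 2 := by
      gcongr
      · exact h1 j
      · exact hx j
    have e2 : |v.2.1 j| * |x j| ≤ ‖v‖ * ‖x‖ := by
      gcongr
      · exact h2 j
      · exact hx j
    nlinarith [norm_nonneg v, norm_nonneg x, mul_nonneg (norm_nonneg v) (sq_nonneg (‖x‖ - 1)),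
      mul_nonneg (norm_nonneg v) (sq_nonneg ‖x‖)]
  refine (abs_add_le _ _).trans ?_
  have := (Finset.abs_sum_le_sum_abs (fun j => v.1 j * x j ^ 2 + v.2.1 j * x j)
    Finset.univ).trans (Finset.sum_le_sum fun j _ => hterm j)
  simp only [Finset.sum_const, Finset.card_univ, Fintype.card_fin, nsmul_eq_mul] at this
  nlinarith [norm_nonneg v, mul_nonneg (norm_nonneg v) (sq_nonneg ‖x‖)]

lemma hasTemperateGrowth_coord (j : Fin d) :
    Function.HasTemperateGrowth (fun x : Space d => x j) :=
  (EuclideanSpace.proj (𝕜 := ℝ) j : Space d →L[ℝ] ℝ).hasTemperateGrowth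

@[fun_prop]
lemma hasTemperateGrowth_quadForm (v : QuadCoeff d) :
    Function.HasTemperateGrowth (quadForm v) := by
  have := fun j : Fin d => hasTemperateGrowth_coord j
  unfold quadForm
  fun_prop

/-- Multiplication by `e^{i q}`, `q` a quadratic polynomial. -/
def chirp (v : QuadCoeff d) : SchwartzIsometry d :=
  mulExpI (quadForm v) (hasTemperateGrowth_quadForm v)

lemma chirp_apply (v : QuadCoeff d) (f : 𝓢(Space d, ℂ)) (x : Space d) :
    chirp v f x = Complex.exp (Complex.I * (quadForm v x : ℂ)) * f x :=
  mulExpI_apply _ f x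

/-- Multiplication of a Schwartz function by a quadratic polynomial. -/
def mulQuad (v : QuadCoeff d) (f : 𝓢(Space d, ℂ)) : 𝓢(Space d, ℂ) :=
  SchwartzMap.smulLeftCLM ℂ (quadForm v) f

lemma mulQuad_apply (v : QuadCoeff d) (f : 𝓢(Space d, ℂ)) (x : Space d) :
    mulQuad v f x = (quadForm v x : ℂ) * f x := by
  simp [mulQuad, hasTemperateGrowth_quadForm v]

/-- Multiplication by `1 + ‖x‖²`. -/
def mulWeight (f : 𝓢(Space d, ℂ)) : 𝓢(Space d, ℂ) :=
  SchwartzMap.smulLeftCLM ℂ (fun x : Space d => 1 + ‖x‖ ^ 2) f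

lemma mulWeight_apply (f : 𝓢(Space d, ℂ)) (x : Space d) :
    mulWeight f x = ((1 + ‖x‖ ^ 2 : ℝ) : ℂ) * f x := by
  have := Function.hasTemperateGrowth_norm_sq (Space d)
  have h : Function.HasTemperateGrowth (fun x : Space d => 1 + ‖x‖ ^ 2) := by fun_prop
  simp [mulWeight, h]

lemma norm_mulWeight_apply (f : 𝓢(Space d, ℂ)) (x : Space d) :
    ‖mulWeight f x‖ = (1 + ‖x‖ ^ 2) * ‖f x‖ := by
  rw [mulWeight_apply, norm_mul, Complex.norm_real, Real.norm_of_nonneg (by positivity)]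

/-- The exponential on the imaginary axis is 1-Lipschitz, and the difference of the two polynomials
is at most a multiple of ‖v - w‖(1 + ‖x‖²); the Schwartz function absorbs the weight. -/
lemma norm_chirp_sub_le (v w : QuadCoeff d) (f : 𝓢(Space d, ℂ)) :
    ‖(chirp v f).toLp 2 volume - (chirp w f).toLp 2 volume‖ ≤
      (2 * d + 1) * ‖v - w‖ * ‖(mulWeight f).toLp 2 volume‖ := by
  rw [← toLp_sub]
  refine norm_toLp_le_mul fun x => ?_
  rw [norm_mulWeight_apply, sub_apply, chirp_apply, chirp_apply, ← sub_mul, norm_mul,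
    ← mul_assoc]
  gcongr
  have : Complex.exp (Complex.I * (quadForm v x : ℂ)) - Complex.exp (Complex.I * (quadForm w x : ℂ))
      = Complex.exp (Complex.I * (quadForm w x : ℂ)) *
        (Complex.exp (Complex.I * (quadForm (v - w) x : ℂ)) - 1) := by
    rw [mul_sub, ← Complex.exp_add, quadForm_sub]
    push_cast
    ring_nf
  rw [this, norm_mul, show ‖Complex.exp (Complex.I * (quadForm w x : ℂ))‖ = 1 from norm_expI _ x,
    one_mul]
  exact (Real.norm_exp_I_mul_ofReal_sub_one_le).trans (abs_quadForm_le _ _)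

lemma strongContAt_chirp {T : Type*} [TopologicalSpace T] {v : T → QuadCoeff d} {t : T}
    (hv : ContinuousAt v t) : StrongContAt (fun τ => chirp (v τ)) t := by
  intro f
  rw [ContinuousAt, tendsto_iff_norm_sub_tendsto_zero] at hv ⊢
  refine squeeze_zero (fun _ => norm_nonneg _) (fun τ => norm_chirp_sub_le _ _ f) ?_
  simpa using (hv.const_mul (2 * (d : ℝ) + 1)).mul_const ‖(mulWeight f).toLp 2 volume‖

/-- Taylor's bound for |s| ≤ 1; beyond that the trivial bound 2|s| is below 2s², which makes the
estimate global in s. -/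
lemma norm_exp_I_mul_sub_one_sub_le (s : ℝ) :
    ‖Complex.exp (Complex.I * (s : ℂ)) - 1 - Complex.I * (s : ℂ)‖ ≤ 2 * s ^ 2 := by
  by_cases hs : |s| ≤ 1
  · have := Complex.norm_exp_sub_one_sub_id_le (x := Complex.I * (s : ℂ)) (by simpa using hs)
    simp only [norm_mul, Complex.norm_I, Complex.norm_real, one_mul, Real.norm_eq_abs, sq_abs]
      at this
    nlinarith [sq_nonneg s]
  · push Not at hs
    have h1 := Real.norm_exp_I_mul_ofReal_sub_one_le (x := s)
    have h2 : ‖Complex.I * (s : ℂ)‖ = |s| := by simp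
    have h3 := norm_sub_le (Complex.exp (Complex.I * (s : ℂ)) - 1) (Complex.I * (s : ℂ))
    rw [Real.norm_eq_abs] at h1
    nlinarith [sq_abs s]

/-- A second-order expansion of the exponential. The error of linearising the coefficients costs one
weight 1 + ‖x‖², the quadratic remainder costs two, hence the doubled `mulWeight`. -/
lemma hasDerivAt_chirp {v : ℝ → QuadCoeff d} {v' : QuadCoeff d} {t : ℝ} (hv : HasDerivAt v v' t)
    (f : 𝓢(Space d, ℂ)) :
    HasDerivAt (fun τ => (chirp (v τ) f).toLp 2 volume)
      ((Complex.I • mulQuad v' (chirp (v t) f)).toLp 2 volume) t := by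
  set K : ℝ := 2 * d + 1
  have hK : 0 ≤ K := by positivity
  have bound : ∀ τ : ℝ, ‖(chirp (v τ) f).toLp 2 volume - (chirp (v t) f).toLp 2 volume -
      (τ - t) • (Complex.I • mulQuad v' (chirp (v t) f)).toLp 2 volume‖ ≤
      (K * ‖v τ - v t - (τ - t) • v'‖ + 2 * (K * ‖v τ - v t‖) ^ 2) *
        ‖(mulWeight (mulWeight f)).toLp 2 volume‖ := by
    intro τ
    rw [← toLp_sub, real_smul_L2, ← toLp_smul, ← toLp_sub]
    refine norm_toLp_le_mul fun x => ?_
    rw [norm_mulWeight_apply, norm_mulWeight_apply]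
    simp only [sub_apply, smul_apply, mulQuad_apply, chirp_apply,
      smul_eq_mul]
    set W := 1 + ‖x‖ ^ 2
    have hW : 1 ≤ W := by simp only [W]; nlinarith [sq_nonneg ‖x‖]
    set s := quadForm (v τ - v t) x
    have hs : |s| ≤ K * ‖v τ - v t‖ * W := abs_quadForm_le _ _
    have hr : |quadForm (v τ - v t - (τ - t) • v') x| ≤ K * ‖v τ - v t - (τ - t) • v'‖ * W :=
      abs_quadForm_le _ _
    rw [quadForm_sub, quadForm_smul] at hr
    have e1 : Complex.exp (Complex.I * (quadForm (v τ) x : ℂ)) =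
        Complex.exp (Complex.I * (quadForm (v t) x : ℂ)) * Complex.exp (Complex.I * (s : ℂ)) := by
      rw [← Complex.exp_add]
      simp only [s, quadForm_sub]
      push_cast
      ring_nf
    have e2 : Complex.exp (Complex.I * (quadForm (v τ) x : ℂ)) * f x -
        Complex.exp (Complex.I * (quadForm (v t) x : ℂ)) * f x - ((τ - t : ℝ) : ℂ) *
          (Complex.I * ((quadForm v' x : ℂ) *
            (Complex.exp (Complex.I * (quadForm (v t) x : ℂ)) * f x))) =
        Complex.exp (Complex.I * (quadForm (v t) x : ℂ)) *
          ((Complex.exp (Complex.I * (s : ℂ)) - 1 - Complex.I * (s : ℂ)) +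
            Complex.I * ((s - (τ - t) * quadForm v' x : ℝ) : ℂ)) * f x := by
      rw [e1]; push_cast; ring
    rw [e2, norm_mul, norm_mul,
      show ‖Complex.exp (Complex.I * (quadForm (v t) x : ℂ))‖ = 1 from norm_expI _ x, one_mul,
      ← mul_assoc W, ← mul_assoc]
    gcongr
    refine (norm_add_le _ _).trans ?_
    have e3 := norm_exp_I_mul_sub_one_sub_le s
    have e4 : ‖Complex.I * ((s - (τ - t) * quadForm v' x : ℝ) : ℂ)‖ =
        |s - (τ - t) * quadForm v' x| := by
      rw [norm_mul, Complex.norm_I, one_mul, Complex.norm_real, Real.norm_eq_abs]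
    rw [e4]
    have e5 : s ^ 2 ≤ (K * ‖v τ - v t‖ * W) ^ 2 := sq_le_sq' (abs_le.1 hs).1 (abs_le.1 hs).2
    have e6 : K * ‖v τ - v t - (τ - t) • v'‖ * W ≤ K * ‖v τ - v t - (τ - t) • v'‖ * (W * W) := by
      gcongr
      nlinarith
    nlinarith
  rw [hasDerivAt_iff_isLittleO]
  refine Asymptotics.IsBigO.trans_isLittleO (g := fun τ =>
    K * ‖v τ - v t - (τ - t) • v'‖ + 2 * (K * ‖v τ - v t‖) ^ 2)
    (Asymptotics.IsBigO.of_bound ‖(mulWeight (mulWeight f)).toLp 2 volume‖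
      (Eventually.of_forall fun τ => ?_)) ?_
  · refine (bound τ).trans ?_
    rw [mul_comm]
    gcongr
    exact le_abs_self _
  · refine Asymptotics.IsLittleO.add ?_ ?_
    · exact ((hasDerivAt_iff_isLittleO.1 hv).norm_left).const_mul_left K
    · have h1 : (fun τ => v τ - v t) =O[𝓝 t] fun τ => τ - t := hv.differentiableAt.isBigO_sub
      have h2 : (fun τ => (K * ‖v τ - v t‖) ^ 2) =O[𝓝 t] fun τ => (τ - t) ^ 2 :=
        (h1.norm_left.const_mul_left K).pow 2
      refine (h2.trans_isLittleO ?_).const_mul_left 2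
      have h3 : (fun τ : ℝ => τ - t) =o[𝓝 t] fun _ => (1 : ℝ) := by
        rw [Asymptotics.isLittleO_one_iff]
        have : ContinuousAt (fun τ : ℝ => τ - t) t := by fun_prop
        simpa [ContinuousAt] using this
      simpa [sq] using (Asymptotics.isBigO_refl (fun τ : ℝ => τ - t) (𝓝 t)).mul_isLittleO h3

end QuadSchrodinger

end

noncomputable section

namespace QuadSchrodinger

open scoped FourierTransform LineDeriv SchwartzMap

variable {d : ℕ}

/-! ### Fourier multipliers and reflections -/

/-- The Fourier transform. -/
def fourierIsometry (d : ℕ) : SchwartzIsometry d where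
  toEquiv := FourierTransform.fourierEquiv ℂ 𝓢(Space d, ℂ)
  norm_toLp f := SchwartzMap.norm_fourier_toL2_eq f

/-- The Fourier multiplier `e^{i q(ξ)}`. -/
def fourierChirp (v : QuadCoeff d) : SchwartzIsometry d :=
  ((fourierIsometry d).trans (chirp v)).trans (fourierIsometry d).symm

lemma fourierChirp_apply (v : QuadCoeff d) (f : 𝓢(Space d, ℂ)) :
    fourierChirp v f = 𝓕⁻ (chirp v (𝓕 f)) := rfl

lemma fourier_fourierChirp (v : QuadCoeff d) (f : 𝓢(Space d, ℂ)) :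
    𝓕 (fourierChirp v f) = chirp v (𝓕 f) := by
  rw [fourierChirp_apply, FourierTransform.fourier_fourierInv_eq]

lemma strongContAt_fourierChirp {T : Type*} [TopologicalSpace T] {v : T → QuadCoeff d} {t : T}
    (hv : ContinuousAt v t) : StrongContAt (fun τ => fourierChirp (v τ)) t :=
  ((strongContAt_const _).trans (strongContAt_chirp hv)).trans (strongContAt_const _)

lemma hasDerivAt_fourierChirp {v : ℝ → QuadCoeff d} {v' : QuadCoeff d} {t : ℝ}
    (hv : HasDerivAt v v' t) (f : 𝓢(Space d, ℂ)) :
    HasDerivAt (fun τ => (fourierChirp (v τ) f).toLp 2 volume)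
      ((Complex.I • 𝓕⁻ (mulQuad v' (𝓕 (fourierChirp (v t) f)))).toLp 2 volume) t := by
  have h := hasDerivAt_chirp hv (𝓕 f)
  have h2 := ((fourierIsometry d).symm.toL2.toContinuousLinearEquiv.toContinuousLinearMap.restrictScalars
    ℝ).hasFDerivAt.comp_hasDerivAt t h
  rw [fourier_fourierChirp, ← FourierTransform.fourierInv_smul]
  refine (h2.congr_deriv ?_).congr_of_eventuallyEq (Eventually.of_forall fun τ => ?_)
  · exact (fourierIsometry d).symm.toL2_toLp _
  · exact ((fourierIsometry d).symm.toL2_toLp _).symm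

/-- Multiplication by a sign, as an isometry of `ℝ`. -/
def signIsometry (u : ℤˣ) : ℝ ≃ₗᵢ[ℝ] ℝ :=
  if u = 1 then LinearIsometryEquiv.refl ℝ ℝ else LinearIsometryEquiv.neg ℝ

lemma signIsometry_apply (u : ℤˣ) (x : ℝ) : signIsometry u x = ((u : ℤ) : ℝ) * x := by
  rcases Int.units_eq_one_or u with rfl | rfl <;> simp [signIsometry]

/-- The reflection `x ↦ (ε_j x_j)`. -/
def reflectIsometry (ε : Fin d → ℤˣ) : Space d ≃ₗᵢ[ℝ] Space d :=
  LinearIsometryEquiv.piLpCongrRight 2 fun j => signIsometry (ε j)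

lemma reflectIsometry_apply (ε : Fin d → ℤˣ) (x : Space d) (j : Fin d) :
    reflectIsometry ε x j = ((ε j : ℤ) : ℝ) * x j := by
  simp [reflectIsometry, signIsometry_apply]

lemma reflectIsometry_reflectIsometry (ε : Fin d → ℤˣ) (x : Space d) :
    reflectIsometry ε (reflectIsometry ε x) = x := by
  ext j
  rw [reflectIsometry_apply, reflectIsometry_apply, ← mul_assoc, ← Int.cast_mul, ← Units.val_mul,
    Int.units_mul_self]
  simp

/-- Composition with a reflection on Schwartz space. -/
def reflectCLM (ε : Fin d → ℤˣ) : 𝓢(Space d, ℂ) →L[ℂ] 𝓢(Space d, ℂ) :=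
  SchwartzMap.compCLMOfContinuousLinearEquiv ℂ (reflectIsometry ε).toContinuousLinearEquiv

lemma reflectCLM_apply (ε : Fin d → ℤˣ) (f : 𝓢(Space d, ℂ)) (x : Space d) :
    reflectCLM ε f x = f (reflectIsometry ε x) := rfl

lemma reflectCLM_reflectCLM (ε : Fin d → ℤˣ) (f : 𝓢(Space d, ℂ)) :
    reflectCLM ε (reflectCLM ε f) = f := by
  ext x
  rw [reflectCLM_apply, reflectCLM_apply, reflectIsometry_reflectIsometry]

/-- Composition with a reflection. -/
def reflect (ε : Fin d → ℤˣ) : SchwartzIsometry d where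
  toEquiv := LinearEquiv.ofLinearMap (reflectCLM ε).toLinearMap (reflectCLM ε).toLinearMap
    (LinearMap.ext fun f => reflectCLM_reflectCLM ε f)
    (LinearMap.ext fun f => reflectCLM_reflectCLM ε f)
  norm_toLp f := by
    rw [SchwartzMap.norm_toLp, SchwartzMap.norm_toLp]
    congr 1
    exact eLpNorm_comp_measurePreserving (f := (reflectIsometry ε)) (g := f)
      f.continuous.aestronglyMeasurable (reflectIsometry ε).measurePreserving

lemma reflect_apply (ε : Fin d → ℤˣ) (f : 𝓢(Space d, ℂ)) (x : Space d) :
    reflect ε f x = f (reflectIsometry ε x) := rfl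

/-! ### Coordinates and derivatives on Schwartz space -/

/-- The `j`-th unit vector. -/
abbrev basisVec (j : Fin d) : Space d := EuclideanSpace.single j 1

/-- Multiplication by the coordinate `x_j`. -/
def coordMul (j : Fin d) (f : 𝓢(Space d, ℂ)) : 𝓢(Space d, ℂ) :=
  SchwartzMap.smulLeftCLM ℂ (fun x : Space d => inner ℝ x (basisVec j)) f

/-- The partial derivative `∂_j`. -/
def partialD (j : Fin d) (f : 𝓢(Space d, ℂ)) : 𝓢(Space d, ℂ) := ∂_{basisVec j} f

lemma inner_basisVec (x : Space d) (j : Fin d) : inner ℝ x (basisVec j) = x j := by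
  simp [basisVec, EuclideanSpace.inner_single_right]

lemma coordMul_apply (j : Fin d) (f : 𝓢(Space d, ℂ)) (x : Space d) :
    coordMul j f x = (x j : ℂ) * f x := by
  have h : Function.HasTemperateGrowth (fun x : Space d => inner ℝ x (basisVec j)) := by fun_prop
  rw [coordMul, SchwartzMap.smulLeftCLM_apply_apply h, inner_basisVec]
  simp

lemma partialD_apply (j : Fin d) (f : 𝓢(Space d, ℂ)) (x : Space d) :
    partialD j f x = partialDeriv j f x :=
  SchwartzMap.lineDerivOp_apply_eq_fderiv _ _ _

lemma laplacian_apply_eq_sum (f : 𝓢(Space d, ℂ)) (x : Space d) :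
    Laplacian.laplacian (f : Space d → ℂ) x = ∑ j, partialD j (partialD j f) x := by
  rw [← SchwartzMap.laplacian_apply,
    SchwartzMap.laplacian_eq_sum (EuclideanSpace.basisFun (Fin d) ℝ)]
  simp [partialD, sum_apply]

lemma fourierInv_coordMul (j : Fin d) (f : 𝓢(Space d, ℂ)) :
    𝓕⁻ (coordMul j (𝓕 f)) = (2 * Real.pi * Complex.I)⁻¹ • partialD j f := by
  have h := SchwartzMap.lineDerivOp_fourierInv_eq (𝓕 f) (basisVec j)
  rw [FourierTransform.fourierInv_fourier_eq, FourierTransform.fourierInv_smul] at h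
  rw [partialD, h, smul_smul, inv_mul_cancel₀ Complex.two_pi_I_ne_zero, one_smul]
  rfl

lemma fourierInv_partialD (j : Fin d) (f : 𝓢(Space d, ℂ)) :
    𝓕⁻ (partialD j f) = -(2 * Real.pi * Complex.I) • coordMul j (𝓕⁻ f) :=
  SchwartzMap.fourierInv_lineDerivOp_eq f (basisVec j)

lemma fourier_coordMul (j : Fin d) (f : 𝓢(Space d, ℂ)) :
    𝓕 (coordMul j f) = -(2 * Real.pi * Complex.I)⁻¹ • partialD j (𝓕 f) := by
  have h := SchwartzMap.lineDerivOp_fourier_eq f (basisVec j)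
  rw [FourierTransform.fourier_smul] at h
  rw [partialD, h, smul_smul, neg_mul_neg, inv_mul_cancel₀ Complex.two_pi_I_ne_zero, one_smul]
  rfl

lemma hasFDerivAt_quadForm (v : QuadCoeff d) (x : Space d) :
    HasFDerivAt (quadForm v) (∑ j, (2 * v.1 j * x j + v.2.1 j) •
      (EuclideanSpace.proj (𝕜 := ℝ) j : Space d →L[ℝ] ℝ)) x := by
  have hc : ∀ j, HasFDerivAt (fun x : Space d => x j)
      (EuclideanSpace.proj (𝕜 := ℝ) j : Space d →L[ℝ] ℝ) x := fun j =>
    (EuclideanSpace.proj (𝕜 := ℝ) j : Space d →L[ℝ] ℝ).hasFDerivAt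
  have := (HasFDerivAt.fun_sum (u := Finset.univ) fun j _ =>
    (((hc j).pow 2).const_mul (v.1 j)).add ((hc j).const_mul (v.2.1 j))).add_const v.2.2
  refine this.congr_fderiv ?_
  refine Finset.sum_congr rfl fun j _ => ?_
  ext y
  simp
  ring

lemma partialD_chirp (v : QuadCoeff d) (j : Fin d) (f : 𝓢(Space d, ℂ)) (x : Space d) :
    partialD j (chirp v f) x = Complex.exp (Complex.I * (quadForm v x : ℂ)) *
      (partialD j f x + Complex.I * ((2 * v.1 j * x j + v.2.1 j : ℝ) : ℂ) * f x) := by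
  rw [partialD_apply, partialD_apply, partialDeriv, partialDeriv]
  have h1 : (chirp v f : Space d → ℂ) = fun x =>
      Complex.exp (Complex.I * (quadForm v x : ℂ)) * f x := funext (chirp_apply v f)
  have h0 : HasFDerivAt (fun x => (quadForm v x : ℂ)) _ x :=
    Complex.ofRealCLM.hasFDerivAt.comp x (hasFDerivAt_quadForm v x)
  have h2 := (h0.const_mul Complex.I).cexp.mul (f.hasFDerivAt x)
  rw [h1]
  refine (congrArg (fun L => L (basisVec j)) h2.fderiv).trans ?_
  simp
  ring

lemma coordMul_smul (j : Fin d) (c : ℂ) (f : 𝓢(Space d, ℂ)) :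
    coordMul j (c • f) = c • coordMul j f := by
  ext x
  simp only [coordMul_apply, smul_apply, smul_eq_mul]
  ring

lemma mulQuad_eq_sum (v : QuadCoeff d) (f : 𝓢(Space d, ℂ)) :
    mulQuad v f = ∑ j, (((v.1 j : ℝ) : ℂ) • coordMul j (coordMul j f)
      + ((v.2.1 j : ℝ) : ℂ) • coordMul j f) + ((v.2.2 : ℝ) : ℂ) • f := by
  ext x
  simp only [mulQuad_apply, quadForm, add_apply, sum_apply, smul_apply, smul_eq_mul, coordMul_apply]
  push_cast
  rw [add_mul, Finset.sum_mul]
  congr 1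
  exact Finset.sum_congr rfl fun j _ => by ring

lemma fourierInv_sum {ι : Type*} (s : Finset ι) (f : ι → 𝓢(Space d, ℂ)) :
    𝓕⁻ (∑ i ∈ s, f i) = ∑ i ∈ s, 𝓕⁻ (f i) :=
  map_sum (fourierIsometry d).symm.toEquiv f s

lemma fourierInv_sub (f g : 𝓢(Space d, ℂ)) : 𝓕⁻ (f - g) = 𝓕⁻ f - 𝓕⁻ g :=
  map_sub (fourierIsometry d).symm.toEquiv f g

/-- The position operator after the Fourier multiplier. -/
lemma fourierChirp_coordMul (v : QuadCoeff d) (j : Fin d) (f : 𝓢(Space d, ℂ)) (x : Space d) :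
    fourierChirp v (coordMul j f) x =
      ((x j + (2 * Real.pi)⁻¹ * v.2.1 j : ℝ) : ℂ) * fourierChirp v f x
        - Complex.I * ((v.1 j / (2 * Real.pi ^ 2) : ℝ) : ℂ) *
          partialD j (fourierChirp v f) x := by
  set g := fourierChirp v f with hg
  -- On the Fourier side the coordinate is a derivative, and the derivative of the chirp contributes
  -- the gradient of its phase: conjugation moves x by a first-order operator.
  have h1 : chirp v (partialD j (𝓕 f)) = partialD j (𝓕 g)
      - Complex.I • ((((2 * v.1 j : ℝ) : ℂ)) • coordMul j (𝓕 g) + ((v.2.1 j : ℝ) : ℂ) • 𝓕 g) := by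
    ext x
    rw [hg, fourier_fourierChirp]
    simp only [sub_apply, add_apply, smul_apply, smul_eq_mul, partialD_chirp, coordMul_apply]
    rw [chirp_apply, chirp_apply]
    push_cast
    ring
  rw [fourierChirp_apply, fourier_coordMul, map_smul, h1, FourierTransform.fourierInv_smul,
    fourierInv_sub, FourierTransform.fourierInv_smul,
    FourierTransform.fourierInv_add, FourierTransform.fourierInv_smul,
    FourierTransform.fourierInv_smul, fourierInv_partialD, fourierInv_coordMul,
    FourierTransform.fourierInv_fourier_eq]
  simp only [sub_apply, add_apply, smul_apply, smul_eq_mul, coordMul_apply]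
  have hpi : (Real.pi : ℂ) ≠ 0 := Complex.ofReal_ne_zero.2 Real.pi_ne_zero
  have hI : (2 * Real.pi * Complex.I)⁻¹ = -Complex.I / (2 * Real.pi) := by
    rw [mul_inv, Complex.inv_I]; field_simp
  rw [hI]
  push_cast
  ring_nf
  simp only [Complex.I_sq]
  field_simp
  rw [Complex.I_pow_three]
  ring

/-- The generator of the Fourier multipliers. -/
lemma fourierInv_mulQuad (v : QuadCoeff d) (f : 𝓢(Space d, ℂ)) (x : Space d) :
    𝓕⁻ (mulQuad v (𝓕 f)) x =
      ∑ j, (-((v.1 j / (4 * Real.pi ^ 2) : ℝ) : ℂ) * partialD j (partialD j f) x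
        - Complex.I * ((v.2.1 j / (2 * Real.pi) : ℝ) : ℂ) * partialD j f x) + (v.2.2 : ℂ) * f x := by
  have h1 : ∀ (j : Fin d) (f : 𝓢(Space d, ℂ)),
      coordMul j (𝓕 f) = (2 * Real.pi * Complex.I)⁻¹ • 𝓕 (partialD j f) := fun j f => by
    rw [← FourierTransform.fourier_smul, ← fourierInv_coordMul,
      FourierTransform.fourier_fourierInv_eq]
  rw [mulQuad_eq_sum]
  simp only [FourierTransform.fourierInv_add, fourierInv_sum, FourierTransform.fourierInv_smul,
    FourierTransform.fourierInv_fourier_eq, h1, coordMul_smul]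
  simp only [add_apply, sum_apply, smul_apply, smul_eq_mul]
  congr 1
  refine Finset.sum_congr rfl fun j _ => ?_
  have hpi : (Real.pi : ℂ) ≠ 0 := Complex.ofReal_ne_zero.2 Real.pi_ne_zero
  have hI : (2 * Real.pi * Complex.I)⁻¹ = -Complex.I / (2 * Real.pi) := by
    rw [mul_inv, Complex.inv_I]; field_simp
  rw [hI]
  push_cast
  ring_nf
  simp only [Complex.I_sq]
  field_simp

end QuadSchrodinger

end

noncomputable section

namespace QuadSchrodinger

open scoped FourierTransform LineDeriv SchwartzMap

variable {d : ℕ}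

/-! ### The Schrödinger equation for products of chirps -/

lemma partialD_add (j : Fin d) (f g : 𝓢(Space d, ℂ)) :
    partialD j (f + g) = partialD j f + partialD j g := LineDeriv.lineDerivOp_add _ _ _

lemma partialD_smul (j : Fin d) (c : ℂ) (f : 𝓢(Space d, ℂ)) :
    partialD j (c • f) = c • partialD j f := LineDeriv.lineDerivOp_smul _ _ _

lemma partialD_coordMul (j : Fin d) (f : 𝓢(Space d, ℂ)) (x : Space d) :
    partialD j (coordMul j f) x = f x + (x j : ℂ) * partialD j f x := by
  rw [partialD_apply, partialD_apply, partialDeriv, partialDeriv]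
  have h1 : (coordMul j f : Space d → ℂ) = fun x => (x j : ℂ) * f x := funext (coordMul_apply j f)
  have h0 : HasFDerivAt (fun x : Space d => ((x j : ℝ) : ℂ)) _ x :=
    Complex.ofRealCLM.hasFDerivAt.comp x
      (EuclideanSpace.proj (𝕜 := ℝ) j : Space d →L[ℝ] ℝ).hasFDerivAt
  rw [h1]
  refine (congrArg (fun L => L (basisVec j)) (h0.mul (f.hasFDerivAt x)).fderiv).trans ?_
  simp
  ring

lemma partialD_partialD_chirp (v : QuadCoeff d) (j : Fin d) (f : 𝓢(Space d, ℂ)) (x : Space d) :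
    partialD j (partialD j (chirp v f)) x = Complex.exp (Complex.I * (quadForm v x : ℂ)) *
      (partialD j (partialD j f) x
        + 2 * Complex.I * ((2 * v.1 j * x j + v.2.1 j : ℝ) : ℂ) * partialD j f x
        + (2 * Complex.I * ((v.1 j : ℝ) : ℂ) - ((2 * v.1 j * x j + v.2.1 j : ℝ) : ℂ) ^ 2) * f x) := by
  have h : partialD j (chirp v f) = chirp v (partialD j f + ((2 * Complex.I * ((v.1 j : ℝ) : ℂ)) •
      coordMul j f + (Complex.I * ((v.2.1 j : ℝ) : ℂ)) • f)) := by
    ext x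
    rw [partialD_chirp, chirp_apply]
    simp only [add_apply, smul_apply, smul_eq_mul, coordMul_apply]
    push_cast
    ring
  rw [h, partialD_chirp]
  simp only [partialD_add, partialD_smul, add_apply, smul_apply, smul_eq_mul, coordMul_apply,
    partialD_coordMul]
  push_cast
  linear_combination (Complex.exp (Complex.I * (quadForm v x : ℂ)) *
    (2 * v.1 j * x j + v.2.1 j) ^ 2 * f x) * Complex.I_sq

/-- Conjugation by e^{-i(sp²/2 + Xp)} replaces x by x - X - sp; the right side is the square of this
operator, the term without x and ∂ being its commutator part. It moves the time derivative of the
inner chirp to the left of the multiplier. -/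
lemma fourierChirp_coordMul_coordMul (v : QuadCoeff d) (j : Fin d) {s X : ℝ}
    (hs : v.1 j = -(2 * Real.pi ^ 2) * s) (hX : v.2.1 j = -(2 * Real.pi) * X)
    (f : 𝓢(Space d, ℂ)) (x : Space d) :
    fourierChirp v (coordMul j (coordMul j f)) x =
      ((x j - X : ℝ) : ℂ) ^ 2 * fourierChirp v f x
        + 2 * Complex.I * (s : ℂ) * ((x j - X : ℝ) : ℂ) * partialD j (fourierChirp v f) x
        + Complex.I * (s : ℂ) * fourierChirp v f x
        - (s : ℂ) ^ 2 * partialD j (partialD j (fourierChirp v f)) x := by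
  have hpi : Real.pi ≠ 0 := Real.pi_ne_zero
  have hs' : v.1 j / (2 * Real.pi ^ 2) = -s := by rw [hs]; field_simp
  have hX' : (2 * Real.pi)⁻¹ * v.2.1 j = -X := by rw [hX]; field_simp
  set g := fourierChirp v f
  have h1 : fourierChirp v (coordMul j f) = coordMul j g +
      ((Complex.I * (s : ℂ)) • partialD j g + (-(X : ℂ)) • g) := by
    ext x
    rw [fourierChirp_coordMul, hs', hX']
    simp only [add_apply, smul_apply, smul_eq_mul, coordMul_apply]
    push_cast
    ring
  rw [fourierChirp_coordMul, hs', hX', h1]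
  simp only [partialD_add, partialD_smul, add_apply, smul_apply, smul_eq_mul, coordMul_apply,
    partialD_coordMul]
  push_cast
  linear_combination ((s : ℂ) ^ 2 * partialD j (partialD j g) x) * Complex.I_sq

/-- The instantaneous conditions on the parameters of a product of chirps which make it solve the
Schrödinger equation; `b, f, g, c` are the values of the coefficients. -/
structure ChirpODE (b f g c s s' X X' a a' A A' B B' C' : ℝ) : Prop where
  -- In order, the fields compare the coefficients of ∂², x∂ + 1/2, ∂, x², x and 1.
  s_eq : s' - a' * s ^ 2 = 1
  mix : a' * s = 2 * A + c
  X_eq : X' - a' * s * X = B - g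
  A_eq : A' + a' / 2 = -2 * A ^ 2 - b - 2 * c * A
  B_eq : B' - a' * X = -2 * A * B + f + 2 * g * A - c * B
  C_eq : C' + a' * X ^ 2 / 2 = -B ^ 2 / 2 + g * B

/-- The coefficients `(A, B, ∑ C + κ)`. -/
def outerCoeff (A B C : Fin d → ℝ) (κ : ℝ) : QuadCoeff d := (A, B, ∑ j, C j + κ)

/-- The coefficients of the Fourier multiplier `e^{-i (s p²/2 + X p)}`. -/
def multiplierCoeff (s X : Fin d → ℝ) : QuadCoeff d :=
  -- The Fourier transform has the character e^{-2πi x·ξ}, so p = 2πξ and sp²/2 = 2π²sξ².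
  (fun j => -(2 * Real.pi ^ 2) * s j, fun j => -(2 * Real.pi) * X j, 0)

/-- The coefficients of `∑ a_j x_j² / 2`. -/
def innerCoeff (a : Fin d → ℝ) : QuadCoeff d := (fun j => a j / 2, 0, 0)

lemma quadForm_innerCoeff (a : Fin d → ℝ) (x : Space d) :
    quadForm (innerCoeff a) x = ∑ j, a j / 2 * x j ^ 2 := by
  simp [quadForm, innerCoeff]

/-- The product of chirps `e^{i(Ax²+Bx+C)} e^{-i(s p²/2+Xp)} e^{i a x²/2}`. -/
def chirps (A B C s X a : Fin d → ℝ) (κ : ℝ) : SchwartzIsometry d :=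
  ((chirp (innerCoeff a)).trans (fourierChirp (multiplierCoeff s X))).trans
    (chirp (outerCoeff A B C κ))

/-- Gauge covariance: conjugation by the chirp replaces ∂_j by ∂_j + i(2A_jx_j + B_j). -/
lemma hamiltonian_chirp (P : Coefficients d) (t : ℝ) (v : QuadCoeff d) (w : 𝓢(Space d, ℂ))
    (x : Space d) :
    hamiltonian P t (chirp v w) x = Complex.exp (Complex.I * (quadForm v x : ℂ)) *
      ∑ j, (-(1 / 2 : ℂ) * (partialD j (partialD j w) x
          + 2 * Complex.I * ((2 * v.1 j * x j + v.2.1 j : ℝ) : ℂ) * partialD j w x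
          + (2 * Complex.I * ((v.1 j : ℝ) : ℂ) - ((2 * v.1 j * x j + v.2.1 j : ℝ) : ℂ) ^ 2) * w x)
        + ((P.b j t : ℂ) * (x j : ℂ) ^ 2 * w x - (P.f j t : ℂ) * (x j : ℂ) * w x
        + Complex.I * (P.g j t : ℂ) * (partialD j w x
          + Complex.I * ((2 * v.1 j * x j + v.2.1 j : ℝ) : ℂ) * w x)
        - Complex.I * ((P.c j t : ℂ) / 2) * (2 * (x j : ℂ) * (partialD j w x
          + Complex.I * ((2 * v.1 j * x j + v.2.1 j : ℝ) : ℂ) * w x) + w x))) := by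
  rw [hamiltonian, laplacian_apply_eq_sum, Finset.mul_sum, ← Finset.sum_add_distrib,
    Finset.mul_sum]
  refine Finset.sum_congr rfl fun j _ => ?_
  rw [partialD_partialD_chirp, ← partialD_apply, partialD_chirp, chirp_apply]
  ring

/-- The product rule gives one term per factor. Each is the outer exponential times a differential
operator of order at most two with polynomial coefficients, applied to the function w in front of
which the outer chirp stands. The system `ChirpODE` says that these operators add up to the
gauge-transformed -iH. -/
theorem hasDerivAt_chirps (P : Coefficients d) {t : ℝ}
    {A B C s X a : Fin d → ℝ → ℝ} {A' B' C' s' X' a' : Fin d → ℝ} {κ : ℝ}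
    (hA : ∀ j, HasDerivAt (A j) (A' j) t) (hB : ∀ j, HasDerivAt (B j) (B' j) t)
    (hC : ∀ j, HasDerivAt (C j) (C' j) t) (hs : ∀ j, HasDerivAt (s j) (s' j) t)
    (hX : ∀ j, HasDerivAt (X j) (X' j) t) (ha : ∀ j, HasDerivAt (a j) (a' j) t)
    (hode : ∀ j, ChirpODE (P.b j t) (P.f j t) (P.g j t) (P.c j t) (s j t) (s' j) (X j t) (X' j)
      (a j t) (a' j) (A j t) (A' j) (B j t) (B' j) (C' j)) (φ : 𝓢(Space d, ℂ)) :
    ∃ D : 𝓢(Space d, ℂ),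
      (∀ x, -Complex.I * hamiltonian P t (chirps (fun j => A j t) (fun j => B j t)
        (fun j => C j t) (fun j => s j t) (fun j => X j t) (fun j => a j t) κ φ) x = D x) ∧
      HasDerivAt (fun τ => (chirps (fun j => A j τ) (fun j => B j τ) (fun j => C j τ)
        (fun j => s j τ) (fun j => X j τ) (fun j => a j τ) κ φ).toLp 2 volume)
        (D.toLp 2 volume) t := by
  have hv1 : HasDerivAt (fun τ => outerCoeff (fun j => A j τ) (fun j => B j τ) (fun j => C j τ) κ)
      (outerCoeff A' B' C' 0) t :=
    (hasDerivAt_pi.2 hA).prodMk ((hasDerivAt_pi.2 hB).prodMk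
      ((HasDerivAt.fun_sum fun j _ => hC j).add_const κ |>.congr_deriv (by simp)))
  have hv2 : HasDerivAt (fun τ => multiplierCoeff (fun j => s j τ) (fun j => X j τ))
      (multiplierCoeff s' X') t :=
    (hasDerivAt_pi.2 fun j => (hs j).const_mul _).prodMk
      ((hasDerivAt_pi.2 fun j => (hX j).const_mul _).prodMk (hasDerivAt_const _ _))
  have hv3 : HasDerivAt (fun τ => innerCoeff (fun j => a j τ)) (innerCoeff a') t :=
    (hasDerivAt_pi.2 fun j => (ha j).div_const 2).prodMk
      ((hasDerivAt_const _ _).prodMk (hasDerivAt_const _ _))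
  have h3 := hasDerivAt_chirp hv3 φ
  have h2 := hasDerivAt_apply (strongContAt_fourierChirp hv2.continuousAt) h3
    (hasDerivAt_fourierChirp hv2 _)
  have h1 := hasDerivAt_apply (strongContAt_chirp hv1.continuousAt) h2 (hasDerivAt_chirp hv1 _)
  refine ⟨_, fun x => ?_, h1⟩
  set v1 := outerCoeff (fun j => A j t) (fun j => B j t) (fun j => C j t) κ with hv1def
  set v2 := multiplierCoeff (fun j => s j t) (fun j => X j t) with hv2def
  set v3 := innerCoeff (fun j => a j t) with hv3def
  set u := chirp v3 φ with hu
  set w := fourierChirp v2 u with hw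
  have hψ : chirps (fun j => A j t) (fun j => B j t)
        (fun j => C j t) (fun j => s j t) (fun j => X j t) (fun j => a j t) κ φ = chirp v1 w := rfl
  -- The derivative of the inner chirp stands to the right of the multiplier; e3 and e3' rewrite it
  -- through the conjugated position operators.
  have e3 : fourierChirp v2 (Complex.I • mulQuad (innerCoeff a') u) x =
      ∑ j, Complex.I * ((a' j / 2 : ℝ) : ℂ) * fourierChirp v2 (coordMul j (coordMul j u)) x := by
    rw [mulQuad_eq_sum]
    simp only [innerCoeff, map_smul, map_add, map_sum, add_apply, smul_apply, sum_apply,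
      smul_eq_mul]
    simp [Finset.mul_sum, mul_assoc]
  have e3' : ∀ j, fourierChirp v2 (coordMul j (coordMul j u)) x = _ := fun j =>
    fourierChirp_coordMul_coordMul v2 j (s := s j t) (X := X j t) rfl rfl u x
  have e2 : 𝓕⁻ (mulQuad (multiplierCoeff s' X') (𝓕 w)) x = ∑ j,
      (((s' j / 2 : ℝ) : ℂ) * partialD j (partialD j w) x
        + Complex.I * (X' j : ℂ) * partialD j w x) := by
    rw [fourierInv_mulQuad]
    have hpi : (Real.pi : ℂ) ≠ 0 := Complex.ofReal_ne_zero.2 Real.pi_ne_zero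
    simp only [multiplierCoeff, Complex.ofReal_zero, zero_mul, add_zero]
    refine Finset.sum_congr rfl fun j _ => ?_
    push_cast
    field_simp
    ring
  rw [hψ, hamiltonian_chirp]
  simp only [add_apply, smul_apply, smul_eq_mul, mulQuad_apply, chirp_apply]
  rw [e2, e3]
  simp only [e3', ← hw]
  have hq : ((quadForm (outerCoeff A' B' C' 0) x : ℝ) : ℂ) = ∑ j, (((A' j : ℝ) : ℂ) * (x j : ℂ) ^ 2
      + (B' j : ℂ) * (x j : ℂ) + (C' j : ℂ)) := by
    simp [quadForm, outerCoeff, Finset.sum_add_distrib]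
  rw [hq, mul_left_comm, mul_left_comm Complex.I, mul_left_comm _ (Complex.exp _),
    mul_left_comm _ (Complex.exp _), ← mul_add]
  congr 1
  rw [Finset.mul_sum, Finset.sum_mul, Finset.mul_sum, ← Finset.sum_add_distrib,
    ← Finset.sum_add_distrib]
  refine Finset.sum_congr rfl fun j _ => ?_
  have hA1 : v1.1 j = A j t := rfl
  have hB1 : v1.2.1 j = B j t := rfl
  rw [hA1, hB1]
  obtain ⟨o1, o2, o3, o4, o5, o6⟩ := hode j
  have o1 := congrArg (fun r : ℝ => (r : ℂ)) o1
  have o2 := congrArg (fun r : ℝ => (r : ℂ)) o2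
  have o3 := congrArg (fun r : ℝ => (r : ℂ)) o3
  have o4 := congrArg (fun r : ℝ => (r : ℂ)) o4
  have o5 := congrArg (fun r : ℝ => (r : ℂ)) o5
  have o6 := congrArg (fun r : ℝ => (r : ℂ)) o6
  push_cast at o1 o2 o3 o4 o5 o6 ⊢
  linear_combination (-(Complex.I / 2) * partialD j (partialD j w) x) * o1
    + partialD j w x * o3 + ((x j : ℂ) * partialD j w x + w x / 2) * o2
    - Complex.I * w x * ((x j : ℂ) ^ 2 * o4 + (x j : ℂ) * o5 + o6)
    + (partialD j w x * ((2 * A j t * x j + B j t) - P.g j t + P.c j t * x j)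
      + w x * (A j t + P.c j t / 2)
      + Complex.I * w x * (-(P.g j t) * (2 * A j t * x j + B j t)
        + P.c j t * x j * (2 * A j t * x j + B j t))
      - X' j * partialD j w x - a' j * s j t * (x j - X j t) * partialD j w x
      - a' j * s j t / 2 * w x) * Complex.I_sq

end QuadSchrodinger

end

noncomputable section

namespace QuadSchrodinger

open scoped FourierTransform LineDeriv SchwartzMap

variable {d : ℕ}

/-! ### The kernel of the Fourier multipliers -/

/-- The complex Gaussian whose Fourier transform gives the regularised kernel. -/
def regGaussian (b : Fin d → ℂ) (c : Fin d → ℂ) (ξ : Space d) : ℂ :=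
  Complex.exp (-∑ j, b j * (ξ j : ℂ) ^ 2 + ∑ j, c j * (ξ j : ℂ))

lemma integrable_regGaussian {b : Fin d → ℂ} (hb : ∀ j, 0 < (b j).re) (c : Fin d → ℂ) :
    Integrable (regGaussian b c) := by
  have := GaussianFourier.integrable_cexp_neg_sum_mul_add hb c
  exact (PiLp.volume_preserving_ofLp (Fin d)).integrable_comp_emb
    (MeasurableEquiv.toLp 2 (Fin d → ℝ)).symm.measurableEmbedding |>.2 this

lemma integral_regGaussian {b : Fin d → ℂ} (hb : ∀ j, 0 < (b j).re) (c : Fin d → ℂ) :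
    ∫ ξ, regGaussian b c ξ =
      ∏ j, (Real.pi / b j) ^ (1 / 2 : ℂ) * Complex.exp (c j ^ 2 / (4 * b j)) := by
  rw [← GaussianFourier.integral_cexp_neg_sum_mul_add hb c]
  exact (PiLp.volume_preserving_ofLp (Fin d)).integral_comp
    (MeasurableEquiv.toLp 2 (Fin d → ℝ)).symm.measurableEmbedding
    (fun v : Fin d → ℝ => Complex.exp (-∑ j, b j * (v j : ℂ) ^ 2 + ∑ j, c j * (v j : ℂ)))

/-- The quadratic coefficient of the regularised multiplier. -/
def regCoeff (s ε : ℝ) : ℂ := (ε : ℂ) + 2 * (Real.pi : ℂ) ^ 2 * Complex.I * (s : ℂ)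

lemma regCoeff_re (s ε : ℝ) : (regCoeff s ε).re = ε := by
  have : regCoeff s ε = (ε : ℂ) + ((2 * Real.pi ^ 2 * s : ℝ) : ℂ) * Complex.I := by
    rw [regCoeff]; push_cast; ring
  rw [this]; simp [-Complex.ofReal_mul, -Complex.ofReal_pow]

lemma regCoeff_im (s ε : ℝ) : (regCoeff s ε).im = 2 * Real.pi ^ 2 * s := by
  have : regCoeff s ε = (ε : ℂ) + ((2 * Real.pi ^ 2 * s : ℝ) : ℂ) * Complex.I := by
    rw [regCoeff]; push_cast; ring
  rw [this]; simp [-Complex.ofReal_mul, -Complex.ofReal_pow]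

lemma regCoeff_ne_zero {s : ℝ} (hs : s ≠ 0) (ε : ℝ) : regCoeff s ε ≠ 0 := by
  intro h
  have := congrArg Complex.im h
  rw [regCoeff_im] at this
  have hpi := Real.pi_ne_zero
  simp_all

/-- One factor of the regularised kernel. -/
def regKernel (s ε z : ℝ) : ℂ :=
  (Real.pi / regCoeff s ε) ^ (1 / 2 : ℂ) *
    Complex.exp ((2 * Real.pi * Complex.I * (z : ℂ)) ^ 2 / (4 * regCoeff s ε))

/-- The bound is uniform in ε ≥ 0: the modulus of `regCoeff` is at least its imaginary part 2π²|s|,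
and the exponent has non-positive real part. -/
lemma norm_regKernel_le {s : ℝ} (hs : s ≠ 0) {ε : ℝ} (hε : 0 ≤ ε) (z : ℝ) :
    ‖regKernel s ε z‖ ≤ (2 * Real.pi * |s|) ^ (-(1 / 2) : ℝ) := by
  have hpi := Real.pi_pos
  have hs' : 0 < |s| := abs_pos.2 hs
  have hne := regCoeff_ne_zero hs ε
  have h1 : ‖((Real.pi : ℂ) / regCoeff s ε) ^ (1 / 2 : ℂ)‖ ≤ (2 * Real.pi * |s|) ^ (-(1 / 2) : ℝ) := by
    have : (1 / 2 : ℂ) = ((1 / 2 : ℝ) : ℂ) := by push_cast; rfl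
    rw [this, Complex.norm_cpow_real, norm_div, Complex.norm_real, Real.norm_of_nonneg hpi.le]
    rw [Real.rpow_neg (by positivity), ← Real.inv_rpow (by positivity)]
    refine Real.rpow_le_rpow (by positivity) ?_ (by norm_num)
    have h2 : 2 * Real.pi ^ 2 * |s| ≤ ‖regCoeff s ε‖ := by
      have := Complex.abs_im_le_norm (regCoeff s ε)
      rwa [regCoeff_im, abs_mul, abs_of_nonneg (by positivity)] at this
    rw [div_le_iff₀ (norm_pos_iff.2 hne)]
    calc Real.pi = (2 * Real.pi * |s|)⁻¹ * (2 * Real.pi ^ 2 * |s|) := by field_simp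
      _ ≤ _ := by gcongr
  have h2 : ‖Complex.exp ((2 * Real.pi * Complex.I * (z : ℂ)) ^ 2 / (4 * regCoeff s ε))‖ ≤ 1 := by
    rw [Complex.norm_exp, Real.exp_le_one_iff]
    have : (2 * Real.pi * Complex.I * (z : ℂ)) ^ 2 / (4 * regCoeff s ε) =
        ((-(Real.pi * z) ^ 2 : ℝ) : ℂ) * (regCoeff s ε)⁻¹ := by
      push_cast
      field_simp
      rw [Complex.I_sq]; ring
    rw [this, Complex.re_ofReal_mul, Complex.inv_re, regCoeff_re]
    have : 0 ≤ ε / Complex.normSq (regCoeff s ε) := div_nonneg hε (Complex.normSq_nonneg _)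
    nlinarith [sq_nonneg (Real.pi * z)]
  rw [regKernel, norm_mul]
  calc _ ≤ (2 * Real.pi * |s|) ^ (-(1 / 2) : ℝ) * 1 :=
        mul_le_mul h1 h2 (norm_nonneg _) (by positivity)
    _ = _ := mul_one _

lemma regKernel_zero {s : ℝ} (hs : s ≠ 0) (z : ℝ) :
    regKernel s 0 z = amplitude s * Complex.exp (Complex.I * ((z ^ 2 / (2 * s) : ℝ) : ℂ)) := by
  have hpi : (Real.pi : ℂ) ≠ 0 := Complex.ofReal_ne_zero.2 Real.pi_ne_zero
  have hs' : (s : ℂ) ≠ 0 := Complex.ofReal_ne_zero.2 hs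
  rw [regKernel, amplitude]
  congr 1
  · rw [← Complex.inv_cpow]
    · congr 1
      rw [regCoeff]
      field_simp
      simp
    · intro h
      rw [Complex.arg_eq_pi_iff] at h
      have : 2 * (Real.pi : ℂ) * Complex.I * (s : ℂ) = ((2 * Real.pi * s : ℝ) : ℂ) * Complex.I := by
        push_cast; ring
      rw [this] at h
      simp at h
  · congr 1
    rw [regCoeff]
    push_cast
    rw [zero_add]
    field_simp
    ring

/-- For s ≠ 0 the limit π / `regCoeff s 0` is a nonzero imaginary number, off the cut of the power
function. The root in the Gaussian integrals therefore stays on the principal branch, and this fixes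
the phase of the amplitude. -/
lemma tendsto_regKernel {s : ℝ} (hs : s ≠ 0) (z : ℝ) :
    Tendsto (fun ε => regKernel s ε z) (𝓝 0) (𝓝 (regKernel s 0 z)) := by
  have hne := regCoeff_ne_zero hs 0
  have hc : ContinuousAt (fun ε => regCoeff s ε) 0 := by unfold regCoeff; fun_prop
  have h1 : ContinuousAt (fun ε => (Real.pi : ℂ) / regCoeff s ε) 0 :=
    continuousAt_const.div hc hne
  have hsl : (Real.pi : ℂ) / regCoeff s 0 ∈ Complex.slitPlane := by
    right
    rw [div_eq_mul_inv, Complex.im_ofReal_mul, Complex.inv_im, regCoeff_im]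
    have hpi := Real.pi_ne_zero
    have := Complex.normSq_pos.2 hne
    simp [hs, this.ne']
  have h2 : ContinuousAt (fun ε => ((Real.pi : ℂ) / regCoeff s ε) ^ (1 / 2 : ℂ)) 0 :=
    h1.cpow continuousAt_const hsl
  have h3 : ContinuousAt (fun ε => Complex.exp ((2 * Real.pi * Complex.I * (z : ℂ)) ^ 2 /
      (4 * regCoeff s ε))) 0 :=
    (continuousAt_const.div (continuousAt_const.mul hc)
      (mul_ne_zero (by norm_num) hne)).cexp
  exact h2.mul h3

lemma fourier_regGaussian (s X : Fin d → ℝ) {ε : ℝ} (hε : 0 < ε) (x y : Space d) :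
    𝓕 (regGaussian (fun j => regCoeff (s j) ε)
      (fun j => 2 * Real.pi * Complex.I * ((x j - X j : ℝ) : ℂ))) y =
      ∏ j, regKernel (s j) ε (x j - X j - y j) := by
  rw [Real.fourier_eq']
  have : ∀ ξ : Space d, Complex.exp (((-2 * Real.pi * inner ℝ ξ y : ℝ) : ℂ) * Complex.I) •
      regGaussian (fun j => regCoeff (s j) ε)
      (fun j => 2 * Real.pi * Complex.I * ((x j - X j : ℝ) : ℂ)) ξ =
      regGaussian (fun j => regCoeff (s j) ε)
      (fun j => 2 * Real.pi * Complex.I * ((x j - X j - y j : ℝ) : ℂ)) ξ := by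
    intro ξ
    rw [regGaussian, regGaussian, smul_eq_mul, ← Complex.exp_add]
    congr 1
    rw [← add_assoc, add_comm (_ * Complex.I), add_assoc]
    congr 1
    rw [PiLp.inner_apply, Finset.mul_sum]
    push_cast
    rw [Finset.sum_mul, ← Finset.sum_add_distrib]
    refine Finset.sum_congr rfl fun j _ => ?_
    simp only [RCLike.inner_apply, conj_trivial, Complex.ofReal_mul]
    ring
  simp_rw [this]
  rw [integral_regGaussian (fun j => by rw [regCoeff_re]; exact hε)]
  rfl

/-- The kernel representation of the Fourier multipliers on Schwartz functions. -/
theorem fourierChirp_eq_integral {s X : Fin d → ℝ} (hs : ∀ j, s j ≠ 0) (f : 𝓢(Space d, ℂ))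
    (x : Space d) :
    fourierChirp (multiplierCoeff s X) f x = (∏ j, amplitude (s j)) * ∫ y : Space d,
      Complex.exp (Complex.I * ((∑ j, (x j - X j - y j) ^ 2 / (2 * s j) : ℝ) : ℂ)) * f y := by
  set G : ℝ → Space d → ℂ := fun ε => regGaussian (fun j => regCoeff (s j) ε)
      (fun j => 2 * Real.pi * Complex.I * ((x j - X j : ℝ) : ℂ)) with hG
  have hcont : ∀ ε, Continuous (G ε) := fun ε => by
    have : G ε = fun ξ => regGaussian _ _ ξ := rfl
    rw [this]
    unfold regGaussian
    fun_prop
  have hGnorm : ∀ ε, 0 ≤ ε → ∀ ξ, ‖G ε ξ‖ ≤ 1 := fun ε hε ξ => by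
    simp only [hG, regGaussian, Complex.norm_exp, Complex.add_re, Complex.neg_re, Complex.re_sum]
    rw [Real.exp_le_one_iff]
    have h1 : ∀ j, (regCoeff (s j) ε * (ξ j : ℂ) ^ 2).re = ε * ξ j ^ 2 := fun j => by
      rw [← Complex.ofReal_pow, Complex.re_mul_ofReal, regCoeff_re]
    have h2 : ∀ j, (2 * Real.pi * Complex.I * ((x j - X j : ℝ) : ℂ) * (ξ j : ℂ)).re = 0 := fun j => by
      have : 2 * Real.pi * Complex.I * ((x j - X j : ℝ) : ℂ) * (ξ j : ℂ) =
        ((2 * Real.pi * (x j - X j) * ξ j : ℝ) : ℂ) * Complex.I := by push_cast; ring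
      rw [this]; simp
    simp only [h1, h2, Finset.sum_const_zero, add_zero, Left.neg_nonpos_iff]
    exact Finset.sum_nonneg fun j _ => by positivity
  have h0 : fourierChirp (multiplierCoeff s X) f x = ∫ ξ, 𝓕 f ξ * G 0 ξ := by
    rw [fourierChirp_apply, SchwartzMap.fourierInv_coe, Real.fourierInv_eq']
    refine integral_congr_ae (Eventually.of_forall fun ξ => ?_)
    simp only [smul_eq_mul, chirp_apply, hG, regGaussian]
    rw [← mul_assoc, ← Complex.exp_add, mul_comm]
    congr 2
    rw [PiLp.inner_apply, quadForm, multiplierCoeff]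
    push_cast
    rw [Finset.mul_sum, Finset.sum_mul, add_zero, Finset.mul_sum, ← Finset.sum_neg_distrib,
      ← Finset.sum_add_distrib, ← Finset.sum_add_distrib]
    refine Finset.sum_congr rfl fun j _ => ?_
    simp only [RCLike.inner_apply, conj_trivial, Complex.ofReal_mul, regCoeff, Complex.ofReal_zero]
    ring
  -- The regularised multiplier has modulus at most 1, so |𝓕 f| dominates.
  have hl : Tendsto (fun ε => ∫ ξ, 𝓕 f ξ * G ε ξ) (𝓝[>] 0) (𝓝 (∫ ξ, 𝓕 f ξ * G 0 ξ)) := by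
    refine tendsto_integral_filter_of_dominated_convergence (fun ξ => ‖𝓕 f ξ‖)
      (Eventually.of_forall fun ε => ((𝓕 f).continuous.mul (hcont ε)).aestronglyMeasurable)
      ?_ (𝓕 f).integrable.norm (Eventually.of_forall fun ξ => ?_)
    · filter_upwards [self_mem_nhdsWithin] with ε hε
      refine Eventually.of_forall fun ξ => ?_
      rw [norm_mul]
      exact mul_le_of_le_one_right (norm_nonneg _) (hGnorm ε (le_of_lt hε) ξ)
    · refine Tendsto.mul tendsto_const_nhds ?_
      have : Continuous fun ε => G ε ξ := by
        simp only [hG, regGaussian, regCoeff]; fun_prop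
      exact (this.tendsto 0).mono_left nhdsWithin_le_nhds
  have hr : Tendsto (fun ε => ∫ y, f y * ∏ j, regKernel (s j) ε (x j - X j - y j)) (𝓝[>] 0)
      (𝓝 (∫ y, f y * ∏ j, regKernel (s j) 0 (x j - X j - y j))) := by
    refine tendsto_integral_filter_of_dominated_convergence
      (fun y => ‖f y‖ * ∏ j, (2 * Real.pi * |s j|) ^ (-(1 / 2) : ℝ))
      (Eventually.of_forall fun ε => (f.continuous.mul ?_).aestronglyMeasurable)
      ?_ (f.integrable.norm.mul_const _) (Eventually.of_forall fun y => ?_)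
    · simp only [regKernel]
      fun_prop
    · filter_upwards [self_mem_nhdsWithin] with ε hε
      refine Eventually.of_forall fun y => ?_
      rw [norm_mul, norm_prod]
      refine mul_le_mul_of_nonneg_left ?_ (norm_nonneg _)
      exact Finset.prod_le_prod (fun _ _ => norm_nonneg _)
        fun j _ => norm_regKernel_le (hs j) (le_of_lt hε) _
    · refine Tendsto.mul tendsto_const_nhds (tendsto_finsetProd _ fun j _ => ?_)
      exact (tendsto_regKernel (hs j) _).mono_left nhdsWithin_le_nhds
  -- For ε > 0 the multiplier is an integrable Gaussian, and the multiplication formula moves the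
  -- transform from f to it.
  have heq : ∀ ε, 0 < ε → ∫ ξ, 𝓕 f ξ * G ε ξ =
      ∫ y, f y * ∏ j, regKernel (s j) ε (x j - X j - y j) := fun ε hε => by
    have := VectorFourier.integral_fourierIntegral_smul_eq_flip (μ := volume) (ν := volume)
      (f := (f : Space d → ℂ)) (g := G ε) (L := innerₗ (Space d)) Real.continuous_fourierChar
      continuous_inner f.integrable
      (integrable_regGaussian (fun j => by rw [regCoeff_re]; exact hε) _)
    simp only [smul_eq_mul, flip_innerₗ] at this
    refine Eq.trans ?_ (this.trans ?_)
    · rfl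
    · refine integral_congr_ae (Eventually.of_forall fun y => ?_)
      exact congrArg (f y * ·) (fourier_regGaussian s X hε x y)
  have hfin := tendsto_nhds_unique (hl.congr' ?_) hr
  · rw [h0, hfin, ← integral_const_mul]
    refine integral_congr_ae (Eventually.of_forall fun y => ?_)
    simp only [regKernel_zero (hs _), Finset.prod_mul_distrib, ← Complex.exp_sum, ← Finset.mul_sum,
      ← Complex.ofReal_sum]
    ring
  · filter_upwards [self_mem_nhdsWithin] with ε hε using heq ε hε

end QuadSchrodinger

end

noncomputable section

namespace QuadSchrodinger

/-! ### The phase coefficients in terms of the classical trajectory -/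

lemma countable_mu_eq_zero (δ : SignType) {ω : ℝ} (hω : 0 < ω) :
    {t | mu δ ω t = 0}.Countable := by
  cases δ with
  | zero => exact (countable_singleton (0 : ℝ)).mono fun t ht => ht
  | neg =>
    refine (countable_singleton (0 : ℝ)).mono fun t ht => ?_
    simpa [mu, hω.ne'] using ht
  | pos =>
    refine (countable_range fun n : ℤ => n * Real.pi / ω).mono fun t ht => ?_
    have : Real.sin (ω * t) = 0 := by simpa [mu, hω.ne'] using ht
    obtain ⟨n, hn⟩ := Real.sin_eq_zero_iff.1 this
    exact ⟨n, by field_simp; linarith⟩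

section Phase

variable {δ : SignType} {ω : ℝ} {f g c : ℝ → ℝ}

lemma deltaC_eq (hω : 0 < ω) (t : ℝ) :
    deltaC (mu δ ω) f g c t = drift δ ω f g c t / mu δ ω t := by
  rw [deltaC, deriv_mu δ hω, drift, one_div, div_eq_inv_mul]
  rfl

lemma mu_mul_deltaC (hω : 0 < ω) {t : ℝ} (ht : mu δ ω t ≠ 0) :
    mu δ ω t * deltaC (mu δ ω) f g c t = drift δ ω f g c t := by
  rw [deltaC_eq hω, mul_div_cancel₀ _ ht]

lemma ae_mu_ne_zero (δ : SignType) {ω : ℝ} (hω : 0 < ω) : ∀ᵐ t, mu δ ω t ≠ 0 :=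
  (countable_mu_eq_zero δ hω).ae_notMem volume

/-- δ* is a quotient by μ and has a default value at the zeros of μ, such as τ = 0. The zeros form a
null set, so μδ* may be replaced by `drift` under the integral. -/
lemma integral_congr_of_mu_ne_zero (δ : SignType) {ω : ℝ} (hω : 0 < ω) {u v : ℝ → ℝ} {a b : ℝ}
    (h : ∀ τ ∈ uIcc a b, mu δ ω τ ≠ 0 → u τ = v τ) : ∫ τ in a..b, u τ = ∫ τ in a..b, v τ := by
  refine intervalIntegral.integral_congr_ae ?_
  filter_upwards [ae_mu_ne_zero δ hω] with τ hτ hm using h τ (uIoc_subset_uIcc hm) hτ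

/-- The addition formulas split μ(t - τ) and μ'(t - τ); the coefficients of μ(t) and of -μ'(t) are
the rates of `kick` and `drift`. -/
lemma epsilonExt_eq (h : RegularSources f g c) (hω : 0 < ω) (t : ℝ) :
    epsilonExt (mu δ ω) f g c t = position δ ω f g c t / mu δ ω t := by
  rw [epsilonExt, deriv_mu δ hω, one_div, div_eq_inv_mul]
  congr 1
  rw [position, kick, drift, ← intervalIntegral.integral_const_mul,
    ← intervalIntegral.integral_const_mul, ← intervalIntegral.integral_sub]
  · refine intervalIntegral.integral_congr fun τ _ => ?_
    simp only [mu_sub δ hω, dmu_sub δ hω, kickRate, driftRate]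
    ring
  · exact ((h.measLocBounded_kickRate hω).intervalIntegrable _ _).const_mul _
  · exact ((h.measLocBounded_driftRate hω).intervalIntegrable _ _).const_mul _

/-- The integral in κ is minus `driftKick`, because μδ* is `drift` almost everywhere and the bracket
is minus the rate of `kick`. The rest is the energy identity. -/
lemma kappaExt_eq {σ : ℝ → ℝ} (hσ : ∀ t, σ t = (δ : ℝ) * ω ^ 2 / 4) (hω : 0 < ω) {t : ℝ}
    (ht : mu δ ω t ≠ 0) :
    kappaExt σ (mu δ ω) f g c t =
      action δ ω f g c t + dmu δ ω t * position δ ω f g c t ^ 2 / (2 * mu δ ω t) := by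
  have h1 : ∫ τ in (0 : ℝ)..t, mu δ ω τ * deltaC (mu δ ω) f g c τ *
      (4 * σ τ * mu δ ω τ * g τ - deriv (mu δ ω) τ * (f τ - c τ * g τ)) =
      -driftKick δ ω f g c t := by
    rw [driftKick, ← intervalIntegral.integral_neg]
    refine integral_congr_of_mu_ne_zero δ hω fun τ _ hτ => ?_
    rw [mu_mul_deltaC hω hτ, deriv_mu δ hω, hσ, kickRate, freqSq]
    ring
  rw [kappaExt, h1, deltaC_eq hω, deriv_mu δ hω, action, position]
  field_simp
  linear_combination (-(dmu δ ω t * drift δ ω f g c t ^ 2)) * dmu_sq_add δ hω t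

end Phase

/-! ### The two forms of γ, ε and κ agree while μ' has no zero. -/

section ByParts

variable {δ : SignType} {ω : ℝ} {f g c : ℝ → ℝ} {t : ℝ}

lemma hasDerivAt_mu_div_dmu (hω : 0 < ω) {τ : ℝ} (hτ : dmu δ ω τ ≠ 0) :
    HasDerivAt (fun τ => mu δ ω τ / dmu δ ω τ) (1 / dmu δ ω τ ^ 2) τ := by
  refine ((hasDerivAt_mu δ hω τ).div (hasDerivAt_dmu δ hω τ) hτ).congr_deriv ?_
  congr 1
  linear_combination dmu_sq_add δ hω τ

lemma continuousOn_inv_dmu_sq (hω : 0 < ω) (hd : ∀ τ ∈ uIcc 0 t, dmu δ ω τ ≠ 0) :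
    ContinuousOn (fun τ => 1 / dmu δ ω τ ^ 2) (uIcc 0 t) :=
  continuousOn_const.div ((continuous_dmu δ hω).continuousOn.pow 2) fun τ hτ => pow_ne_zero 2 (hd τ hτ)

/-- Integration by parts against `1 / μ'^2 = (μ / μ')'`. -/
lemma integral_div_dmu_sq (hω : 0 < ω) (hd : ∀ τ ∈ uIcc 0 t, dmu δ ω τ ≠ 0) {u u' : ℝ → ℝ}
    (hu : Continuous u) {s : Set ℝ} (hs : s.Countable) (hu' : ∀ τ ∉ s, HasDerivAt u (u' τ) τ)
    (hi : MeasLocBounded u') :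
    ∫ τ in (0 : ℝ)..t, u τ / dmu δ ω τ ^ 2 =
      u t * (mu δ ω t / dmu δ ω t) - ∫ τ in (0 : ℝ)..t, u' τ * (mu δ ω τ / dmu δ ω τ) := by
  have hq : ContinuousOn (fun τ => mu δ ω τ / dmu δ ω τ) (uIcc 0 t) :=
    (continuous_mu δ hω).continuousOn.div (continuous_dmu δ hω).continuousOn hd
  have i1 : IntervalIntegrable (fun τ => u τ / dmu δ ω τ ^ 2) volume 0 t := by
    exact ((hu.continuousOn.mul (continuousOn_inv_dmu_sq hω hd)).congr
      fun τ _ => by simp [div_eq_mul_inv]).intervalIntegrable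
  have i2 : IntervalIntegrable (fun τ => u' τ * (mu δ ω τ / dmu δ ω τ)) volume 0 t :=
    (hi.intervalIntegrable 0 t).mul_continuousOn hq
  -- Jumps of the sources leave u continuous and differentiable off a countable set, which the
  -- fundamental theorem allows. The boundary term at 0 vanishes with μ(0).
  have key := MeasureTheory.integral_eq_of_hasDerivAt_off_countable
    (fun τ => u τ * (mu δ ω τ / dmu δ ω τ))
    (fun τ => u' τ * (mu δ ω τ / dmu δ ω τ) + u τ / dmu δ ω τ ^ 2) hs
    (a := 0) (b := t) (hu.continuousOn.mul hq)
    (fun τ hτ => by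
      have h1 := hd τ (Ioo_subset_Icc_self hτ.1)
      refine ((hu' τ hτ.2).mul (hasDerivAt_mu_div_dmu hω h1)).congr_deriv ?_
      ring) (i2.add i1)
  rw [intervalIntegral.integral_add i2 i1] at key
  simp only [mu_zero_time, zero_div, mul_zero, sub_zero] at key
  linarith

lemma RegularSources.countable_discontinuities (h : RegularSources f g c) :
    {τ | ¬ (ContinuousAt f τ ∧ ContinuousAt g τ)}.Countable := by
  refine (h.f.countable_discontinuities.union h.g.countable_discontinuities).mono fun τ hτ => ?_
  by_contra hc
  exact hτ ⟨by by_contra h1; exact hc (Or.inl h1), by by_contra h1; exact hc (Or.inr h1)⟩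

lemma integral_inv_dmu_sq (hω : 0 < ω) (hd : ∀ τ ∈ uIcc 0 t, dmu δ ω τ ≠ 0) :
    ∫ τ in (0 : ℝ)..t, 1 / dmu δ ω τ ^ 2 = mu δ ω t / dmu δ ω t := by
  have := integral_div_dmu_sq hω hd (u := fun _ => 1) (u' := fun _ => 0) continuous_const
    countable_empty (fun τ _ => hasDerivAt_const _ _) continuous_const.measLocBounded
  simpa using this

variable {σ : ℝ → ℝ}

/-- With σ constant the integral is σμ/μ'; what remains is 1 - 4σμ² = μ'². -/
lemma gammaC_eq (hω : 0 < ω) (hσ : ∀ t, σ t = (δ : ℝ) * ω ^ 2 / 4) (ht : mu δ ω t ≠ 0)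
    (hd : ∀ τ ∈ uIcc 0 t, dmu δ ω τ ≠ 0) :
    gammaC σ (mu δ ω) c t = gammaExt (mu δ ω) c t := by
  have h1 : ∫ τ in (0 : ℝ)..t, σ τ / dmu δ ω τ ^ 2 =
      freqSq δ ω / 4 * (mu δ ω t / dmu δ ω t) := by
    rw [← integral_inv_dmu_sq hω hd, ← intervalIntegral.integral_const_mul]
    refine intervalIntegral.integral_congr fun τ _ => ?_
    simp only [hσ, freqSq]; ring
  have hdt := hd t right_mem_uIcc
  rw [gammaC, gammaExt, deriv_mu δ hω, h1]
  field_simp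
  linear_combination (-4 : ℝ) * dmu_sq_add δ hω t

/-- Integration by parts with u = `drift` removes the square of μ' from the first integral. By the
energy identity the remaining integrals combine to `kick`. -/
lemma epsilonC_eq (h : RegularSources f g c) (hω : 0 < ω)
    (hσ : ∀ t, σ t = (δ : ℝ) * ω ^ 2 / 4) (ht : mu δ ω t ≠ 0)
    (hd : ∀ τ ∈ uIcc 0 t, dmu δ ω τ ≠ 0) :
    epsilonC σ (mu δ ω) f g c t = epsilonExt (mu δ ω) f g c t := by
  have hdt := hd t right_mem_uIcc
  have hq : ContinuousOn (fun τ => mu δ ω τ / dmu δ ω τ) (uIcc 0 t) :=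
    (continuous_mu δ hω).continuousOn.div (continuous_dmu δ hω).continuousOn hd
  have h1 : 4 * ∫ τ in (0 : ℝ)..t, mu δ ω τ * deltaC (mu δ ω) f g c τ * σ τ / dmu δ ω τ ^ 2 =
      freqSq δ ω * (drift δ ω f g c t * (mu δ ω t / dmu δ ω t) -
        ∫ τ in (0 : ℝ)..t, driftRate δ ω f g c τ * (mu δ ω τ / dmu δ ω τ)) := by
    rw [← integral_div_dmu_sq hω hd (h.continuous_drift hω) h.countable_discontinuities
      (fun τ hτ => by
        simp only [mem_ofPred_eq, not_not] at hτ
        exact h.hasDerivAt_drift hω hτ.1 hτ.2) (h.measLocBounded_driftRate hω),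
      ← intervalIntegral.integral_const_mul, ← intervalIntegral.integral_const_mul]
    refine integral_congr_of_mu_ne_zero δ hω fun τ _ hτ => ?_
    rw [mu_mul_deltaC hω hτ, hσ, freqSq]
    ring
  have i1 : IntervalIntegrable (fun τ => freqSq δ ω * (driftRate δ ω f g c τ *
      (mu δ ω τ / dmu δ ω τ))) volume 0 t :=
    (((h.measLocBounded_driftRate hω).intervalIntegrable 0 t).mul_continuousOn hq).const_mul _
  have hkick : kick δ ω f g c t = (∫ τ in (0 : ℝ)..t, (1 / dmu δ ω τ) * (f τ - c τ * g τ)) -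
      freqSq δ ω * ∫ τ in (0 : ℝ)..t, driftRate δ ω f g c τ * (mu δ ω τ / dmu δ ω τ) := by
    rw [kick, ← intervalIntegral.integral_const_mul, ← intervalIntegral.integral_sub _ i1]
    · refine intervalIntegral.integral_congr fun τ hτ => ?_
      have := hd τ hτ
      simp only [kickRate, driftRate]
      field_simp
      linear_combination (f τ - c τ * g τ) * dmu_sq_add δ hω τ
    · refine ((h.f.measLocBounded.sub (h.c.measLocBounded.mul
        h.g.measLocBounded)).intervalIntegrable 0 t).continuousOn_mul ?_
      exact continuousOn_const.div (continuous_dmu δ hω).continuousOn hd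
  rw [epsilonC, deriv_mu δ hω, h1, epsilonExt_eq h hω, position, deltaC_eq hω, hkick]
  field_simp
  linear_combination (drift δ ω f g c t) * dmu_sq_add δ hω t

/-- The same argument with u = `drift`², whose derivative is twice `drift` times its rate; the
integrals combine to `driftKick`. -/
lemma kappaC_eq (h : RegularSources f g c) (hω : 0 < ω)
    (hσ : ∀ t, σ t = (δ : ℝ) * ω ^ 2 / 4) (ht : mu δ ω t ≠ 0)
    (hd : ∀ τ ∈ uIcc 0 t, dmu δ ω τ ≠ 0) :
    kappaC σ (mu δ ω) f g c t = kappaExt σ (mu δ ω) f g c t := by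
  have hdt := hd t right_mem_uIcc
  have hq : ContinuousOn (fun τ => mu δ ω τ / dmu δ ω τ) (uIcc 0 t) :=
    (continuous_mu δ hω).continuousOn.div (continuous_dmu δ hω).continuousOn hd
  have hDc := h.continuous_drift (δ := δ) hω
  have h1 : 2 * ∫ τ in (0 : ℝ)..t, σ τ / dmu δ ω τ ^ 2 *
        (mu δ ω τ * deltaC (mu δ ω) f g c τ) ^ 2 =
      freqSq δ ω / 2 * (drift δ ω f g c t ^ 2 * (mu δ ω t / dmu δ ω t) -
        ∫ τ in (0 : ℝ)..t, (2 * (drift δ ω f g c τ * driftRate δ ω f g c τ)) *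
          (mu δ ω τ / dmu δ ω τ)) := by
    rw [← integral_div_dmu_sq (u := fun τ => drift δ ω f g c τ ^ 2) hω hd (hDc.pow 2)
      h.countable_discontinuities
      (fun τ hτ => by
        simp only [mem_ofPred_eq, not_not] at hτ
        refine ((h.hasDerivAt_drift hω hτ.1 hτ.2).pow 2).congr_deriv ?_
        simp; ring)
      (continuous_const.measLocBounded.mul
        (hDc.measLocBounded.mul (h.measLocBounded_driftRate hω))),
      ← intervalIntegral.integral_const_mul, ← intervalIntegral.integral_const_mul]
    refine integral_congr_of_mu_ne_zero δ hω fun τ _ hτ => ?_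
    rw [mu_mul_deltaC hω hτ, hσ, freqSq]
    ring
  have h2 : ∫ τ in (0 : ℝ)..t, mu δ ω τ * deltaC (mu δ ω) f g c τ / dmu δ ω τ *
      (f τ - c τ * g τ) = ∫ τ in (0 : ℝ)..t, drift δ ω f g c τ / dmu δ ω τ * (f τ - c τ * g τ) :=
    integral_congr_of_mu_ne_zero δ hω fun τ _ hτ => by rw [mu_mul_deltaC hω hτ]
  have h3 : ∫ τ in (0 : ℝ)..t, mu δ ω τ * deltaC (mu δ ω) f g c τ *
      (4 * σ τ * mu δ ω τ * g τ - dmu δ ω τ * (f τ - c τ * g τ)) =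
      -driftKick δ ω f g c t := by
    rw [driftKick, ← intervalIntegral.integral_neg]
    refine integral_congr_of_mu_ne_zero δ hω fun τ _ hτ => ?_
    rw [mu_mul_deltaC hω hτ, hσ, kickRate, freqSq]
    ring
  have i1 : IntervalIntegrable (fun τ => freqSq δ ω / 2 * ((2 * (drift δ ω f g c τ *
      driftRate δ ω f g c τ)) * (mu δ ω τ / dmu δ ω τ))) volume 0 t :=
    (((continuous_const.measLocBounded.mul
        (hDc.measLocBounded.mul (h.measLocBounded_driftRate hω))).intervalIntegrable
          0 t).mul_continuousOn hq).const_mul _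
  have h4 : driftKick δ ω f g c t =
      (∫ τ in (0 : ℝ)..t, drift δ ω f g c τ / dmu δ ω τ * (f τ - c τ * g τ)) -
      freqSq δ ω / 2 * ∫ τ in (0 : ℝ)..t, (2 * (drift δ ω f g c τ * driftRate δ ω f g c τ)) *
          (mu δ ω τ / dmu δ ω τ) := by
    rw [driftKick, ← intervalIntegral.integral_const_mul, ← intervalIntegral.integral_sub _ i1]
    · refine intervalIntegral.integral_congr fun τ hτ => ?_
      have := hd τ hτ
      simp only [kickRate, driftRate]
      field_simp
      linear_combination (drift δ ω f g c τ * (f τ - c τ * g τ)) * dmu_sq_add δ hω τ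
    · refine ((h.f.measLocBounded.sub (h.c.measLocBounded.mul
        h.g.measLocBounded)).intervalIntegrable 0 t).continuousOn_mul ?_
      exact hDc.continuousOn.div (continuous_dmu δ hω).continuousOn hd
  rw [kappaC, kappaExt, deriv_mu δ hω, h1, h2, h3, h4, deltaC_eq hω]
  field_simp
  linear_combination (-(drift δ ω f g c t ^ 2)) * dmu_sq_add δ hω t

end ByParts

end QuadSchrodinger

end

noncomputable section

namespace QuadSchrodinger

open scoped FourierTransform LineDeriv SchwartzMap ComplexConjugate

variable {d : ℕ}

/-! ### Integral kernels -/

/-- A continuous bounded kernel. -/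
structure BoundedKernel (k : Space d → Space d → ℂ) : Prop where
  continuous : Continuous (Function.uncurry k)
  bounded : ∃ M, ∀ x y, ‖k x y‖ ≤ M

namespace BoundedKernel

variable {k : Space d → Space d → ℂ} {u v : Space d → ℂ}

lemma conj_swap (hk : BoundedKernel k) : BoundedKernel fun x y => conj (k y x) := by
  refine ⟨Complex.continuous_conj.comp (hk.continuous.comp continuous_swap), ?_⟩
  obtain ⟨M, hM⟩ := hk.bounded
  exact ⟨M, fun x y => by simpa using hM y x⟩

lemma locallyIntegrable_integral (hk : BoundedKernel k) (hv : Integrable v) :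
    LocallyIntegrable fun x => ∫ y, k x y * v y := by
  obtain ⟨M, hM⟩ := hk.bounded
  refine MemLp.locallyIntegrable (p := ∞) (memLp_top_of_bound ?_ (M * ∫ y, ‖v y‖)
    (Eventually.of_forall fun x => ?_)) le_top
  · exact (hk.continuous.aestronglyMeasurable.mul hv.1.comp_snd).integral_prod_right'
  · rw [← integral_const_mul]
    refine norm_integral_le_of_norm_le (hv.norm.const_mul M) (Eventually.of_forall fun y => ?_)
    rw [norm_mul]
    exact mul_le_mul_of_nonneg_right (hM x y) (norm_nonneg _)

/-- Fubini's theorem; the kernel is only bounded, so the integrability comes from u ⊗ v. -/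
lemma integral_swap (hk : BoundedKernel k) (hu : Integrable u) (hv : Integrable v) :
    ∫ x, conj (u x) * ∫ y, k x y * v y = ∫ y, conj (∫ x, conj (k x y) * u x) * v y := by
  obtain ⟨M, hM⟩ := hk.bounded
  have hi : Integrable (fun p : Space d × Space d => k p.1 p.2 * (conj (u p.1) * v p.2))
      (volume.prod volume) := by
    refine Integrable.bdd_mul (c := M) ?_ hk.continuous.aestronglyMeasurable
      (Eventually.of_forall fun p => hM _ _)
    exact (Complex.conjLIE.toContinuousLinearEquiv.toContinuousLinearMap.integrable_comp hu).mul_prod hv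
  have h1 := integral_integral_swap (f := fun x y => k x y * (conj (u x) * v y)) hi
  calc _ = ∫ x, ∫ y, k x y * (conj (u x) * v y) := by
        refine integral_congr_ae (Eventually.of_forall fun x => ?_)
        simp only [← integral_const_mul]
        exact integral_congr_ae (Eventually.of_forall fun y => by ring)
    _ = _ := h1
    _ = _ := by
        refine integral_congr_ae (Eventually.of_forall fun y => ?_)
        simp only [← integral_conj, ← integral_mul_const]
        exact integral_congr_ae (Eventually.of_forall fun x => by simp; ring)

end BoundedKernel

/-- Smooth functions with compact support are Schwartz functions and already separate locally
integrable functions. -/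
lemma ae_eq_of_integral_conj_mul_eq {u v : Space d → ℂ} (hu : LocallyIntegrable u)
    (hv : LocallyIntegrable v)
    (h : ∀ g : 𝓢(Space d, ℂ), ∫ x, conj (g x) * u x = ∫ x, conj (g x) * v x) : u =ᵐ[volume] v := by
  refine ae_eq_of_integral_contDiff_smul_eq hu hv fun g hg hgs => ?_
  have h1 : HasCompactSupport fun x => (g x : ℂ) := hgs.comp_left (g := fun r : ℝ => (r : ℂ)) (by simp)
  have h2 : ContDiff ℝ ((⊤ : ℕ∞) : WithTop ℕ∞) fun x => (g x : ℂ) := Complex.ofRealCLM.contDiff.comp hg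
  have := h (h1.toSchwartzMap h2)
  simpa [Complex.real_smul] using this

lemma inner_toLp_left (g : 𝓢(Space d, ℂ)) (φ : L2 d) :
    inner ℂ (g.toLp 2 volume) φ = ∫ x, conj (g x) * φ x := by
  rw [L2.inner_def]
  refine integral_congr_ae ?_
  filter_upwards [g.coeFn_toLp 2 volume] with x hx
  rw [hx, RCLike.inner_apply, mul_comm]

lemma inner_toLp_right (g : 𝓢(Space d, ℂ)) (φ : L2 d) :
    inner ℂ φ (g.toLp 2 volume) = ∫ x, conj (φ x) * g x := by
  rw [L2.inner_def]
  refine integral_congr_ae ?_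
  filter_upwards [g.coeFn_toLp 2 volume] with x hx
  rw [hx, RCLike.inner_apply, mul_comm]

lemma locallyIntegrable_L2 (φ : L2 d) : LocallyIntegrable φ :=
  (Lp.memLp φ).locallyIntegrable (by norm_num)

/-- The kernel of the inverse. -/
lemma SchwartzIsometry.symm_ae_eq_integral (e : SchwartzIsometry d) {k : Space d → Space d → ℂ}
    (hk : BoundedKernel k) (h : ∀ (f : 𝓢(Space d, ℂ)) x, e f x = ∫ y, k x y * f y)
    (g : 𝓢(Space d, ℂ)) :
    (e.symm g : Space d → ℂ) =ᵐ[volume] fun y => ∫ x, conj (k x y) * g x := by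
  refine ae_eq_of_integral_conj_mul_eq
    ((e.symm g).integrable.locallyIntegrable)
    (hk.conj_swap.locallyIntegrable_integral g.integrable) fun f => ?_
  have h1 : inner ℂ (f.toLp 2 volume) ((e.symm g).toLp 2 volume) =
      inner ℂ ((e f).toLp 2 volume) (g.toLp 2 volume) := by
    rw [← toL2_symm_toLp, ← toL2_toLp, ← LinearIsometryEquiv.inner_map_map e.toL2,
      LinearIsometryEquiv.apply_symm_apply]
  have e1 : inner ℂ (f.toLp 2 volume) ((e.symm g).toLp 2 volume) =
      ∫ x, conj (f x) * e.symm g x := by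
    rw [inner_toLp_left]
    refine integral_congr_ae ?_
    filter_upwards [(e.symm g).coeFn_toLp 2 volume] with x hx
    rw [hx]
  have e2 : inner ℂ ((e f).toLp 2 volume) (g.toLp 2 volume) = ∫ x, conj (e f x) * g x := by
    rw [inner_toLp_right]
    refine integral_congr_ae ?_
    filter_upwards [(e f).coeFn_toLp 2 volume] with x hx
    rw [hx]
  rw [← e1, h1, e2, hk.conj_swap.integral_swap f.integrable g.integrable]
  refine integral_congr_ae (Eventually.of_forall fun x => ?_)
  simp only [h, Complex.conj_conj]

/-- An integral kernel on Schwartz functions is an integral kernel on `L¹ ∩ L²`. -/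
theorem SchwartzIsometry.toL2_ae_eq_integral (e : SchwartzIsometry d) {k : Space d → Space d → ℂ}
    (hk : BoundedKernel k) (h : ∀ (f : 𝓢(Space d, ℂ)) x, e f x = ∫ y, k x y * f y)
    (φ : L2 d) (hφ : Integrable φ) :
    (e.toL2 φ : Space d → ℂ) =ᵐ[volume] fun x => ∫ y, k x y * φ y := by
  refine ae_eq_of_integral_conj_mul_eq (locallyIntegrable_L2 _)
    (hk.locallyIntegrable_integral hφ) fun g => ?_
  -- Duality avoids an approximation of φ in L¹ and L² at once: the operator passes to the test
  -- function, where the inverse has the conjugate transposed kernel.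
  rw [hk.integral_swap g.integrable hφ, ← inner_toLp_left]
  have h1 : inner ℂ (g.toLp 2 volume) (e.toL2 φ) = inner ℂ ((e.symm g).toLp 2 volume) φ := by
    rw [← toL2_symm_toLp, ← LinearIsometryEquiv.inner_map_map e.toL2 (e.toL2.symm _),
      LinearIsometryEquiv.apply_symm_apply]
  rw [h1, inner_toLp_left]
  refine integral_congr_ae ?_
  filter_upwards [e.symm_ae_eq_integral hk h g] with y hy
  rw [hy]

end QuadSchrodinger

end

noncomputable section

namespace QuadSchrodinger

open scoped FourierTransform LineDeriv SchwartzMap ComplexConjugate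

variable {d : ℕ}

/-! ### Branches of the propagator -/

/-- The standing assumptions. -/
structure ConstantSigma (P : Coefficients d) (δ : Fin d → SignType) (ω : Fin d → ℝ) : Prop where
  regular : P.Regular
  pos : ∀ j, 0 < ω j
  sigma_eq : ∀ j t, P.sigma j t = (δ j : ℝ) * ω j ^ 2 / 4

namespace ConstantSigma

variable {P : Coefficients d} {δ : Fin d → SignType} {ω : Fin d → ℝ}

lemma sources (h : ConstantSigma P δ ω) (j : Fin d) : RegularSources (P.f j) (P.g j) (P.c j) :=
  ⟨(h.regular j).2.2.1, (h.regular j).2.2.2, (h.regular j).1.continuous⟩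

lemma hasDerivAt_c (h : ConstantSigma P δ ω) (j : Fin d) (t : ℝ) :
    HasDerivAt (P.c j) (deriv (P.c j) t) t :=
  ((h.regular j).1.differentiable one_ne_zero t).hasDerivAt

lemma b_eq (h : ConstantSigma P δ ω) (j : Fin d) (t : ℝ) :
    P.b j t = (freqSq (δ j) (ω j) + P.c j t ^ 2 + deriv (P.c j) t) / 2 := by
  have := h.sigma_eq j t
  rw [Coefficients.sigma] at this
  rw [freqSq]
  linarith

end ConstantSigma

/-- The sign `(-1)^n`. -/
def branchSign (n : ℤ) : ℝ := ((n.negOnePow : ℤ) : ℝ)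

lemma branchSign_mul_self (n : ℤ) : branchSign n * branchSign n = 1 := by
  rw [branchSign, ← Int.cast_mul, ← Units.val_mul, Int.units_mul_self]; simp

lemma branchSign_sq (n : ℤ) : branchSign n ^ 2 = 1 := by rw [sq, branchSign_mul_self]

lemma branchSign_ne_zero (n : ℤ) : branchSign n ≠ 0 := fun h => by
  simpa [h] using branchSign_mul_self n

@[simp] lemma branchSign_zero : branchSign 0 = 1 := by simp [branchSign]

lemma branchSign_eq (n : ℤ) : branchSign n = (-1 : ℝ) ^ n := by
  rcases Int.even_or_odd n with h | h
  · rw [branchSign, Int.negOnePow_even n h, h.neg_one_zpow]; simp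
  · rw [branchSign, Int.negOnePow_odd n h, h.neg_one_zpow]; simp

/-- The branch of index `n` is regular at time `t`. -/
def Admissible (δ : SignType) (ω : ℝ) (n : ℤ) (t : ℝ) : Prop :=
  (δ = SignType.pos → |ω * t - n * Real.pi| < Real.pi) ∧ (δ ≠ SignType.pos → n = 0)

section Scalar

variable {δ : SignType} {ω : ℝ} {n : ℤ} {t : ℝ}

/-- The curvature of the inner chirp. -/
def curvature (δ : SignType) (ω : ℝ) (n : ℤ) (t : ℝ) : ℝ :=
  -(freqSq δ ω * (branchSign n * mu δ ω t)) / (1 + branchSign n * dmu δ ω t)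

/-- The denominator of `curvature` is 1 + cos(ωt - nπ) in the oscillatory case, with argument inside
(-π, π). In the other cases n = 0 and μ' is positive. -/
lemma Admissible.one_add_pos (h : Admissible δ ω n t) : 0 < 1 + branchSign n * dmu δ ω t := by
  cases δ with
  | zero => simp [h.2 (by decide), dmu]
  | neg =>
    have := Real.cosh_pos (ω * t)
    simp [h.2 (by decide), dmu]; linarith
  | pos =>
    have h1 := h.1 rfl
    have h2 : branchSign n * dmu SignType.pos ω t = Real.cos |ω * t - n * Real.pi| := by
      rw [Real.cos_abs, Real.cos_sub_int_mul_pi, branchSign_eq]; rfl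
    have h3 := Real.cos_lt_cos_of_nonneg_of_le_pi (abs_nonneg _) le_rfl h1
    rw [Real.cos_pi] at h3
    have h2' : branchSign n * dmu SignType.pos ω t = Real.cos |ω * t - n * Real.pi| := h2
    rw [h2']; linarith

lemma Admissible.eventually (h : Admissible δ ω n t) : ∀ᶠ τ in 𝓝 t, Admissible δ ω n τ := by
  by_cases hδ : δ = SignType.pos
  · have hc : ContinuousAt (fun τ => |ω * τ - n * Real.pi|) t := by fun_prop
    filter_upwards [hc.eventually (gt_mem_nhds (h.1 hδ))] with τ hτ
    exact ⟨fun _ => hτ, h.2⟩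
  · exact Eventually.of_forall fun τ => ⟨fun h' => absurd h' hδ, h.2⟩

/-- The index of a branch that is regular at time `t`. -/
def branchIndex (δ : SignType) (ω t : ℝ) : ℤ :=
  if δ = SignType.pos then round (ω * t / Real.pi) else 0

lemma admissible_branchIndex (δ : SignType) (ω t : ℝ) : Admissible δ ω (branchIndex δ ω t) t := by
  refine ⟨fun h => ?_, fun h => if_neg h⟩
  have hpi := Real.pi_pos
  have h1 := abs_sub_round (ω * t / Real.pi)
  rw [branchIndex, if_pos h]
  have h2 : ω * t - (round (ω * t / Real.pi) : ℝ) * Real.pi =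
      (ω * t / Real.pi - round (ω * t / Real.pi)) * Real.pi := by field_simp
  rw [h2, abs_mul, abs_of_pos hpi]
  nlinarith

lemma hasDerivAt_curvature (hω : 0 < ω) (h : Admissible δ ω n t) :
    HasDerivAt (curvature δ ω n) (-freqSq δ ω / (1 + branchSign n * dmu δ ω t)) t := by
  have h0 := h.one_add_pos.ne'
  refine ((((((hasDerivAt_mu δ hω t).const_mul (branchSign n)).const_mul (freqSq δ ω)).neg).div
    (((hasDerivAt_dmu δ hω t).const_mul (branchSign n)).const_add 1) h0)).congr_deriv ?_
  simp only [Pi.neg_apply]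
  field_simp
  linear_combination (freqSq δ ω) * ((-branchSign n ^ 2) * dmu_sq_add δ hω t - branchSign_sq n)

/-- The coefficients come from e^{-icx²/2} e^{ia(x - X)²/2} e^{i(px + θ)}, a chirp centred at the
classical trajectory in the gauge of c. Everything follows from a's = a, from the Riccati equation
2a' = -(a² + 4σ) and from s' - a's² = 1, where s = εμ. -/
lemma chirpODE_branch {b f g c c' p X : ℝ} (hω : 0 < ω) (h : Admissible δ ω n t)
    (hb : b = (freqSq δ ω + c ^ 2 + c') / 2) :
    ChirpODE b f g c (branchSign n * mu δ ω t) (branchSign n * dmu δ ω t) X (p - g)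
      (curvature δ ω n t) (-freqSq δ ω / (1 + branchSign n * dmu δ ω t))
      ((curvature δ ω n t - c) / 2) ((-freqSq δ ω / (1 + branchSign n * dmu δ ω t) - c') / 2)
      (p - curvature δ ω n t * X)
      (f - c * g - freqSq δ ω * X - (-freqSq δ ω / (1 + branchSign n * dmu δ ω t) * X
        + curvature δ ω n t * (p - g)))
      (-(p ^ 2) / 2 + g * p + freqSq δ ω * X ^ 2 / 2
        + ((-freqSq δ ω / (1 + branchSign n * dmu δ ω t)) * X ^ 2
          + curvature δ ω n t * (2 * X * (p - g))) / 2) := by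
  have h0 := h.one_add_pos.ne'
  have hm := dmu_sq_add δ hω t
  have hs := branchSign_sq n
  set a := curvature δ ω n t with ha
  set a' := -freqSq δ ω / (1 + branchSign n * dmu δ ω t) with ha'
  have e1 : a' * (branchSign n * mu δ ω t) = a := by
    rw [ha, ha', curvature]; field_simp
  have e2 : 2 * a' = -(a ^ 2 + freqSq δ ω) := by
    rw [ha, ha', curvature]; field_simp
    linear_combination (freqSq δ ω) * (branchSign n ^ 2 * hm + hs)
  have e3 : branchSign n * dmu δ ω t - a' * (branchSign n * mu δ ω t) ^ 2 = 1 := by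
    rw [ha']; field_simp
    linear_combination (branchSign n ^ 2) * hm + hs
  refine ⟨e3, by rw [e1]; ring, by rw [e1]; ring, ?_, ?_, ?_⟩
  · rw [hb]; linear_combination e2 / 2
  · linear_combination (-X) * e2
  · linear_combination (X ^ 2 / 2) * e2

/-! ### The amplitude along the branches -/

/-- The principal logarithm of ±i is ±iπ/2, so the root contributes e^{∓iπ/4} according to the sign
e of m. -/
lemma amplitude_eq {e m : ℝ} (he : e = 1 ∨ e = -1) (hm : 0 < e * m) :
    amplitude m = Complex.exp (-(Complex.I * (Real.pi : ℂ) / 4) * (e : ℂ)) /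
      (Real.sqrt (2 * Real.pi * |m|) : ℂ) := by
  have hpi := Real.pi_pos
  have habs : |m| = e * m := by
    rcases he with rfl | rfl
    · rw [one_mul] at hm ⊢; exact abs_of_pos hm
    · rw [neg_one_mul] at hm ⊢; exact abs_of_neg (by linarith)
  have hR : 0 < 2 * Real.pi * |m| := by rw [habs]; positivity
  have hlog : Complex.log ((e : ℂ) * Complex.I) = (e : ℂ) * (Real.pi / 2 * Complex.I) := by
    rcases he with rfl | rfl
    · simp [Complex.log_I]
    · simp [Complex.log_neg_I]
  have h1 : 2 * (Real.pi : ℂ) * Complex.I * (m : ℂ) =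
      ((2 * Real.pi * |m| : ℝ) : ℂ) * ((e : ℂ) * Complex.I) := by
    rw [habs]
    have he2 : (e : ℂ) ^ 2 = 1 := by rcases he with rfl | rfl <;> simp
    push_cast
    linear_combination (-(2 * (Real.pi : ℂ) * Complex.I * (m : ℂ))) * he2
  have hne : (e : ℂ) * Complex.I ≠ 0 := by
    rcases he with rfl | rfl <;> simp
  rw [amplitude, h1, Complex.cpow_def_of_ne_zero
    (mul_ne_zero (Complex.ofReal_ne_zero.2 hR.ne') hne), Complex.log_ofReal_mul hR hne, hlog,
    Real.sqrt_eq_rpow, Real.rpow_def_of_pos hR, Complex.ofReal_exp,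
    ← Complex.exp_neg, ← Complex.exp_sub]
  congr 1
  push_cast
  ring

/-- On branch n the argument x = ωt - nπ lies in (-π, π). If x > 0 the floor is n and the principal
root gives e^{-iπ/4}; if x < 0 the floor is n - 1 and the root gives e^{iπ/4}. Both cases are 1 + 2N
= 2n + e, with N the floor and e the sign. For δ ≠ 1 the sign of t plays this role, with n = 0. -/
lemma amplitudeExt_eq (hω : 0 < ω) (h : Admissible δ ω n t) (ht : mu δ ω t ≠ 0) :
    amplitudeExt δ ω t = Complex.exp (-(Complex.I * (Real.pi * (n : ℂ) / 2))) *
      amplitude (branchSign n * mu δ ω t) := by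
  have hpi := Real.pi_pos
  have habs : |branchSign n * mu δ ω t| = |mu δ ω t| := by
    have : |branchSign n| = 1 := by
      rcases Int.units_eq_one_or n.negOnePow with h | h <;> simp [branchSign, h]
    rw [abs_mul, this, one_mul]
  have key : ∀ (e : ℝ) (N : ℤ), (e = 1 ∨ e = -1) → 0 < e * (branchSign n * mu δ ω t) →
      (1 + 2 * (N : ℝ) = 2 * n + e) →
      (if δ = SignType.pos then ⌊ω * t / Real.pi⌋ else if 0 ≤ t then 0 else -1) = N →
      amplitudeExt δ ω t = Complex.exp (-(Complex.I * (Real.pi * (n : ℂ) / 2))) *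
        amplitude (branchSign n * mu δ ω t) := by
    intro e N he hm hN hif
    rw [amplitude_eq he hm, habs, amplitudeExt, hif, ← mul_div_assoc, ← Complex.exp_add]
    congr 2
    have hN' : 1 + 2 * (N : ℂ) = 2 * n + (e : ℂ) := by exact_mod_cast hN
    rw [hN']
    ring
  by_cases hδ : δ = SignType.pos
  · subst hδ
    have h1 := abs_lt.1 (h.1 rfl)
    have h2 : branchSign n * mu SignType.pos ω t = Real.sin (ω * t - n * Real.pi) / ω := by
      rw [Real.sin_sub_int_mul_pi, branchSign_eq, mul_div_assoc]; rfl
    have h3 : ω * t - n * Real.pi ≠ 0 := fun h0 => by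
      rw [h0, Real.sin_zero, zero_div] at h2
      exact mul_ne_zero (branchSign_ne_zero n) ht h2
    rcases lt_or_gt_of_ne h3 with h4 | h4
    · refine key (-1) (n - 1) (Or.inr rfl) ?_ (by push_cast; ring) ?_
      · rw [h2, neg_one_mul, ← neg_div, ← Real.sin_neg]
        exact div_pos (Real.sin_pos_of_pos_of_lt_pi (by linarith) (by linarith)) hω
      · rw [if_pos rfl, Int.floor_eq_iff]
        push_cast
        exact ⟨by rw [le_div_iff₀ hpi]; linarith, by rw [div_lt_iff₀ hpi]; linarith⟩
    · refine key 1 n (Or.inl rfl) ?_ (by ring) ?_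
      · rw [h2, one_mul]
        exact div_pos (Real.sin_pos_of_pos_of_lt_pi h4 (by linarith)) hω
      · rw [if_pos rfl, Int.floor_eq_iff]
        exact ⟨by rw [le_div_iff₀ hpi]; linarith, by rw [div_lt_iff₀ hpi]; linarith⟩
  · have hn := h.2 hδ
    subst hn
    have hsign : ∀ e : ℝ, (e = 1 ∨ e = -1) → 0 < e * t → 0 < e * mu δ ω t := by
      intro e he het
      cases δ with
      | pos => exact absurd rfl hδ
      | zero => exact het
      | neg =>
        change 0 < e * (Real.sinh (ω * t) / ω)
        rw [← mul_div_assoc]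
        refine div_pos ?_ hω
        rcases he with rfl | rfl
        · rw [one_mul] at het ⊢; exact Real.sinh_pos_iff.2 (by positivity)
        · have : 0 < -t := by linarith
          rw [neg_one_mul, ← Real.sinh_neg]; exact Real.sinh_pos_iff.2 (by nlinarith)
    have ht0 : t ≠ 0 := fun h0 => ht (by rw [h0, mu_zero_time])
    rcases lt_or_gt_of_ne ht0 with h4 | h4
    · refine key (-1) (-1) (Or.inr rfl) ?_ (by norm_num) (by rw [if_neg hδ, if_neg h4.not_ge])
      rw [branchSign_zero, one_mul]
      exact hsign _ (Or.inr rfl) (by linarith)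
    · refine key 1 0 (Or.inl rfl) ?_ (by norm_num) (by rw [if_neg hδ, if_pos h4.le])
      rw [branchSign_zero, one_mul]
      exact hsign _ (Or.inl rfl) (by linarith)

/-- While `μ'` has no zero, the branch of index `0` is regular. -/
lemma admissible_zero (hω : 0 < ω) (h : ∀ τ ∈ uIcc 0 t, dmu δ ω τ ≠ 0) :
    Admissible δ ω 0 t := by
  refine ⟨fun hδ => ?_, fun _ => rfl⟩
  subst hδ
  have hpi := Real.pi_pos
  simp only [Int.cast_zero, zero_mul, sub_zero]
  by_contra! hc
  have hq : Real.pi / 2 / ω ≤ |t| := by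
    rw [abs_mul, abs_of_pos hω] at hc
    rw [div_le_iff₀ hω]; nlinarith [abs_nonneg t]
  rcases le_total 0 t with h0 | h0
  · rw [abs_of_nonneg h0] at hq
    refine h (Real.pi / 2 / ω) (by rw [uIcc_of_le h0]; exact ⟨by positivity, hq⟩) ?_
    change Real.cos (ω * (Real.pi / 2 / ω)) = 0
    rw [mul_div_cancel₀ _ hω.ne', Real.cos_pi_div_two]
  · rw [abs_of_nonpos h0] at hq
    refine h (-(Real.pi / 2 / ω)) (by
      rw [uIcc_of_ge h0]; exact ⟨by linarith, by rw [neg_nonpos]; positivity⟩) ?_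
    change Real.cos (ω * -(Real.pi / 2 / ω)) = 0
    rw [mul_neg, Real.cos_neg, mul_div_cancel₀ _ hω.ne', Real.cos_pi_div_two]

end Scalar

end QuadSchrodinger

end

noncomputable section

namespace QuadSchrodinger

open scoped FourierTransform LineDeriv SchwartzMap ComplexConjugate

variable {d : ℕ}

/-! ### The propagator -/

/-- The propagator from time `0` to time `t`, written with the branch of index `n`. -/
def branch (P : Coefficients d) (δ : Fin d → SignType) (ω : Fin d → ℝ) (n : Fin d → ℤ) (t : ℝ) :
    SchwartzIsometry d :=
  -- The first chirp enters the gauge of c at time 0; the reflection compensates the sign that the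
  -- branch puts in front of μ.
  ((chirp (innerCoeff fun j => P.c j 0)).trans (reflect fun j => (n j).negOnePow)).trans
    (chirps (fun j => (curvature (δ j) (ω j) (n j) t - P.c j t) / 2)
      (fun j => momentum (δ j) (ω j) (P.f j) (P.g j) (P.c j) t
        - curvature (δ j) (ω j) (n j) t * position (δ j) (ω j) (P.f j) (P.g j) (P.c j) t)
      (fun j => action (δ j) (ω j) (P.f j) (P.g j) (P.c j) t
        + curvature (δ j) (ω j) (n j) t * position (δ j) (ω j) (P.f j) (P.g j) (P.c j) t ^ 2 / 2)
      (fun j => branchSign (n j) * mu (δ j) (ω j) t)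
      (fun j => position (δ j) (ω j) (P.f j) (P.g j) (P.c j) t)
      (fun j => curvature (δ j) (ω j) (n j) t)
      -- The Maslov phase: e^{-iπ/2} for each half period.
      (-∑ j, Real.pi * (n j : ℝ) / 2))

lemma strongContAt_chirps {A B C s X a : Fin d → ℝ → ℝ} {κ t : ℝ}
    (hA : ∀ j, ContinuousAt (A j) t) (hB : ∀ j, ContinuousAt (B j) t)
    (hC : ∀ j, ContinuousAt (C j) t) (hs : ∀ j, ContinuousAt (s j) t)
    (hX : ∀ j, ContinuousAt (X j) t) (ha : ∀ j, ContinuousAt (a j) t) :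
    StrongContAt (fun τ => chirps (fun j => A j τ) (fun j => B j τ) (fun j => C j τ)
      (fun j => s j τ) (fun j => X j τ) (fun j => a j τ) κ) t := by
  refine ((strongContAt_chirp ?_).trans (strongContAt_fourierChirp ?_)).trans
    (strongContAt_chirp ?_)
  · exact (continuousAt_pi.2 fun j => (ha j).div_const 2).prodMk
      (continuousAt_const.prodMk continuousAt_const)
  · exact (continuousAt_pi.2 fun j => continuousAt_const.mul (hs j)).prodMk
      ((continuousAt_pi.2 fun j => continuousAt_const.mul (hX j)).prodMk continuousAt_const)
  · exact (continuousAt_pi.2 hA).prodMk ((continuousAt_pi.2 hB).prodMk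
      ((tendsto_finsetSum _ fun j _ => hC j).add tendsto_const_nhds))

lemma branchSign_eq_one_or (m : ℤ) : branchSign m = 1 ∨ branchSign m = -1 := by
  rcases Int.units_eq_one_or m.negOnePow with h | h <;> simp [branchSign, h]

namespace ConstantSigma

variable {P : Coefficients d} {δ : Fin d → SignType} {ω : Fin d → ℝ} {n n' : Fin d → ℤ} {t : ℝ}

lemma strongContAt_branch (h : ConstantSigma P δ ω) (hn : ∀ j, Admissible (δ j) (ω j) (n j) t) :
    StrongContAt (branch P δ ω n) t := by
  have ha := fun j => (hasDerivAt_curvature (h.pos j) (hn j)).continuousAt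
  have hX := fun j => ((h.sources j).continuous_position (δ := δ j) (h.pos j)).continuousAt (x := t)
  have hp := fun j => ((h.sources j).continuous_momentum (δ := δ j) (h.pos j)).continuousAt (x := t)
  have hθ := fun j => ((h.sources j).continuous_action (δ := δ j) (h.pos j)).continuousAt (x := t)
  have hc := fun j => (h.sources j).c.continuousAt (x := t)
  exact (strongContAt_const _).trans (strongContAt_chirps
    (fun j => ((ha j).sub (hc j)).div_const 2)
    (fun j => (hp j).sub ((ha j).mul (hX j)))
    (fun j => (hθ j).add (((ha j).mul ((hX j).pow 2)).div_const 2))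
    (fun j => continuousAt_const.mul (continuous_mu (δ j) (h.pos j)).continuousAt) hX ha)

/-- Only the continuity of f and g matters here: constancy of σ expresses b through c and c'. -/
lemma hasDerivAt_branch (h : ConstantSigma P δ ω) (hn : ∀ j, Admissible (δ j) (ω j) (n j) t)
    (hfg : ∀ j, ContinuousAt (P.f j) t ∧ ContinuousAt (P.g j) t) (φ : 𝓢(Space d, ℂ)) :
    ∃ D : 𝓢(Space d, ℂ), (∀ x, -Complex.I * hamiltonian P t (branch P δ ω n t φ) x = D x) ∧
      HasDerivAt (fun τ => (branch P δ ω n τ φ).toLp 2 volume) (D.toLp 2 volume) t := by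
  have ha := fun j => hasDerivAt_curvature (h.pos j) (hn j)
  have hX := fun j => (h.sources j).hasDerivAt_position (δ := δ j) (h.pos j) (hfg j).1 (hfg j).2
  have hp := fun j => (h.sources j).hasDerivAt_momentum (δ := δ j) (h.pos j) (hfg j).1 (hfg j).2
  have hθ := fun j => (h.sources j).hasDerivAt_action (δ := δ j) (h.pos j) (hfg j).1 (hfg j).2
  have hc := fun j => h.hasDerivAt_c j t
  exact hasDerivAt_chirps P (fun j => ((ha j).sub (hc j)).div_const 2)
    (fun j => (hp j).sub ((ha j).mul (hX j)))
    (fun j => ((hθ j).add (((ha j).mul ((hX j).pow 2)).div_const 2)).congr_deriv (by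
      simp only [Pi.pow_apply, Nat.cast_ofNat, Nat.add_one_sub_one, pow_one]))
    (fun j => (hasDerivAt_mu (δ j) (h.pos j) t).const_mul _) hX ha
    (fun j => chirpODE_branch (h.pos j) (hn j) (h.b_eq j t)) _

/-- Away from the zeros of μ the curvature is (μ' - ε)/μ. Expanding the kernel's square cancels the
ε/μ parts in the pure squares, and the dependence on the branch disappears. -/
lemma phaseExt_eq (h : ConstantSigma P δ ω) {j : Fin d} {m : ℤ} (hn : Admissible (δ j) (ω j) m t)
    (ht : mu (δ j) (ω j) t ≠ 0) (x y : ℝ) :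
    phaseExt P j (mu (δ j) (ω j)) t x y =
      (curvature (δ j) (ω j) m t - P.c j t) / 2 * x ^ 2
      + (momentum (δ j) (ω j) (P.f j) (P.g j) (P.c j) t
        - curvature (δ j) (ω j) m t * position (δ j) (ω j) (P.f j) (P.g j) (P.c j) t) * x
      + (action (δ j) (ω j) (P.f j) (P.g j) (P.c j) t
        + curvature (δ j) (ω j) m t * position (δ j) (ω j) (P.f j) (P.g j) (P.c j) t ^ 2 / 2)
      + (x - position (δ j) (ω j) (P.f j) (P.g j) (P.c j) t - branchSign m * y) ^ 2 /
        (2 * (branchSign m * mu (δ j) (ω j) t))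
      + curvature (δ j) (ω j) m t / 2 * (branchSign m * y) ^ 2 + P.c j 0 / 2 * y ^ 2 := by
  have hω := h.pos j
  have h0 := hn.one_add_pos.ne'
  have hm := dmu_sq_add (δ j) hω t
  have hs := branchSign_sq m
  have hs0 := branchSign_ne_zero m
  have ha : curvature (δ j) (ω j) m t = dmu (δ j) (ω j) t / mu (δ j) (ω j) t -
      branchSign m / mu (δ j) (ω j) t := by
    rw [curvature]
    field_simp
    linear_combination (-branchSign m) * hm + dmu (δ j) (ω j) t * hs
  have hD : drift (δ j) (ω j) (P.f j) (P.g j) (P.c j) t =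
      momentum (δ j) (ω j) (P.f j) (P.g j) (P.c j) t * mu (δ j) (ω j) t
      - dmu (δ j) (ω j) t * position (δ j) (ω j) (P.f j) (P.g j) (P.c j) t := by
    rw [momentum, position]
    linear_combination (-drift (δ j) (ω j) (P.f j) (P.g j) (P.c j) t) * hm
  have hi : ∀ z : ℝ, z ^ 2 / (2 * (branchSign m * mu (δ j) (ω j) t)) =
      branchSign m * z ^ 2 / (2 * mu (δ j) (ω j) t) := fun z => by
    field_simp; linear_combination (-z ^ 2) * hs
  rw [phaseExt, quadPhase, alphaC, betaC, gammaExt, deltaC_eq hω, epsilonExt_eq (h.sources j) hω,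
    kappaExt_eq (h.sigma_eq j) hω ht, deriv_mu _ hω, hD, ha, hi]
  -- The identity needs the square of the sign to be 1; inserting both values makes it rational.
  rcases branchSign_eq_one_or m with h1 | h1
  all_goals
    rw [h1]
    field_simp
    ring

/-- The substitution y ↦ Ry removes the reflection from the data and puts the sign into the phase;
the Maslov phase completes the amplitude. The right side does not involve n. -/
lemma branch_apply (h : ConstantSigma P δ ω) (hn : ∀ j, Admissible (δ j) (ω j) (n j) t)
    (ht : ∀ j, mu (δ j) (ω j) t ≠ 0) (φ : 𝓢(Space d, ℂ)) (x : Space d) :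
    branch P δ ω n t φ x = oscillatoryOperator (fun j => amplitudeExt (δ j) (ω j) t)
      (fun j => phaseExt P j (mu (δ j) (ω j)) t) φ x := by
  have hs : ∀ j, branchSign (n j) * mu (δ j) (ω j) t ≠ 0 := fun j =>
    mul_ne_zero (branchSign_ne_zero _) (ht j)
  set R := reflectIsometry fun j => (n j).negOnePow with hR
  have hRx : ∀ (y : Space d) j, R y j = branchSign (n j) * y j := fun y j =>
    reflectIsometry_apply _ y j
  rw [branch, SchwartzIsometry.trans_apply, chirps, SchwartzIsometry.trans_apply, chirp_apply,
    SchwartzIsometry.trans_apply, fourierChirp_eq_integral hs]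
  rw [← R.measurePreserving.integral_comp R.toHomeomorph.measurableEmbedding, oscillatoryOperator]
  simp only [SchwartzIsometry.trans_apply, chirp_apply, reflect_apply, ← hR,
    hR ▸ reflectIsometry_reflectIsometry (fun j => (n j).negOnePow) _]
  have hamp : ∏ j, amplitudeExt (δ j) (ω j) t =
      Complex.exp (-(Complex.I * ∑ j, (Real.pi * (n j : ℂ) / 2))) *
        ∏ j, amplitude (branchSign (n j) * mu (δ j) (ω j) t) := by
    rw [Finset.mul_sum, ← Finset.sum_neg_distrib, Complex.exp_sum, ← Finset.prod_mul_distrib]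
    exact Finset.prod_congr rfl fun j _ => amplitudeExt_eq (h.pos j) (hn j) (ht j)
  rw [hamp, mul_left_comm, mul_right_comm, mul_comm (∏ j, amplitude _)]
  congr 1
  rw [← integral_const_mul, ← integral_const_mul]
  refine integral_congr_ae (Eventually.of_forall fun y => ?_)
  simp only [← mul_assoc, ← Complex.exp_add]
  congr 2
  simp only [quadForm_innerCoeff]
  simp only [phaseExt_eq h (hn _) (ht _), quadForm, outerCoeff, hRx, Finset.sum_add_distrib]
  push_cast
  ring_nf

/-- The branches agree where they are regular. -/
lemma branch_congr (h : ConstantSigma P δ ω) (hn : ∀ j, Admissible (δ j) (ω j) (n j) t)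
    (hn' : ∀ j, Admissible (δ j) (ω j) (n' j) t) (φ : 𝓢(Space d, ℂ)) :
    branch P δ ω n t φ = branch P δ ω n' t φ := by
  apply SchwartzMap.injective_toLp 2 volume
  -- The zeros of all μ_j are countable, hence t is a limit of times at which the kernel formula
  -- holds for both branches.
  have hS : Dense {τ : ℝ | ∀ j, mu (δ j) (ω j) τ ≠ 0} := by
    have : {τ : ℝ | ∀ j, mu (δ j) (ω j) τ ≠ 0} = (⋃ j, {τ | mu (δ j) (ω j) τ = 0})ᶜ := by
      ext τ; simp
    rw [this]
    exact (countable_iUnion fun j => countable_mu_eq_zero (δ j) (h.pos j)).dense_compl ℝ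
  have hne : (𝓝[{τ : ℝ | ∀ j, mu (δ j) (ω j) τ ≠ 0}] t).NeBot :=
    mem_closure_iff_nhdsWithin_neBot.1 (hS t)
  have h1 := (h.strongContAt_branch hn φ).tendsto.mono_left
    (nhdsWithin_le_nhds (s := {τ : ℝ | ∀ j, mu (δ j) (ω j) τ ≠ 0}))
  have h2 := (h.strongContAt_branch hn' φ).tendsto.mono_left
    (nhdsWithin_le_nhds (s := {τ : ℝ | ∀ j, mu (δ j) (ω j) τ ≠ 0}))
  refine tendsto_nhds_unique (h1.congr' ?_) h2
  have e1 := nhdsWithin_le_nhds (s := {τ : ℝ | ∀ j, mu (δ j) (ω j) τ ≠ 0})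
    (eventually_all.2 fun j => (hn j).eventually)
  have e2 := nhdsWithin_le_nhds (s := {τ : ℝ | ∀ j, mu (δ j) (ω j) τ ≠ 0})
    (eventually_all.2 fun j => (hn' j).eventually)
  filter_upwards [e1, e2, self_mem_nhdsWithin] with τ a1 a2 a3
  congr 1
  ext x
  rw [h.branch_apply a1 a3, h.branch_apply a2 a3]

end ConstantSigma

/-- The propagator from time `0` to time `t`. -/
def propagator (P : Coefficients d) (δ : Fin d → SignType) (ω : Fin d → ℝ) (t : ℝ) :
    SchwartzIsometry d :=
  branch P δ ω (fun j => branchIndex (δ j) (ω j) t) t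

/-- The two-parameter family of propagators. -/
def evolution (P : Coefficients d) (δ : Fin d → SignType) (ω : Fin d → ℝ) (t s : ℝ) :
    L2 d →L[ℂ] L2 d :=
  ((propagator P δ ω s).toL2.symm.trans (propagator P δ ω t).toL2).toContinuousLinearEquiv

lemma evolution_apply (P : Coefficients d) (δ : Fin d → SignType) (ω : Fin d → ℝ) (t s : ℝ)
    (φ : L2 d) : evolution P δ ω t s φ =
      (propagator P δ ω t).toL2 ((propagator P δ ω s).toL2.symm φ) := rfl

namespace ConstantSigma

variable {P : Coefficients d} {δ : Fin d → SignType} {ω : Fin d → ℝ} {n : Fin d → ℤ} {t : ℝ}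

lemma propagator_eq (h : ConstantSigma P δ ω) (hn : ∀ j, Admissible (δ j) (ω j) (n j) t)
    (φ : 𝓢(Space d, ℂ)) : propagator P δ ω t φ = branch P δ ω n t φ :=
  h.branch_congr (fun j => admissible_branchIndex (δ j) (ω j) t) hn φ

/-- The index obtained by rounding jumps in time. Near t it may be frozen at its value at t, since
that branch stays regular, so the propagator inherits the regularity of one branch. -/
lemma propagator_eventuallyEq (h : ConstantSigma P δ ω) (t : ℝ) (φ : 𝓢(Space d, ℂ)) :
    ∀ᶠ τ in 𝓝 t, propagator P δ ω τ φ =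
      branch P δ ω (fun j => branchIndex (δ j) (ω j) t) τ φ := by
  filter_upwards [eventually_all.2 fun j => (admissible_branchIndex (δ j) (ω j) t).eventually]
    with τ hτ using h.propagator_eq hτ φ

lemma strongContAt_propagator (h : ConstantSigma P δ ω) (t : ℝ) :
    StrongContAt (propagator P δ ω) t := fun φ =>
  (h.strongContAt_branch (fun j => admissible_branchIndex (δ j) (ω j) t) φ).congr_of_eventuallyEq
    ((h.propagator_eventuallyEq t φ).mono fun _ hτ => congrArg (fun f => f.toLp 2 volume) hτ)

lemma hasDerivAt_propagator (h : ConstantSigma P δ ω)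
    (hfg : ∀ j, ContinuousAt (P.f j) t ∧ ContinuousAt (P.g j) t) (φ : 𝓢(Space d, ℂ)) :
    ∃ D : 𝓢(Space d, ℂ), (∀ x, -Complex.I * hamiltonian P t (propagator P δ ω t φ) x = D x) ∧
      HasDerivAt (fun τ => (propagator P δ ω τ φ).toLp 2 volume) (D.toLp 2 volume) t := by
  obtain ⟨D, h1, h2⟩ := h.hasDerivAt_branch
    (fun j => admissible_branchIndex (δ j) (ω j) t) hfg φ
  exact ⟨D, h1, h2.congr_of_eventuallyEq
    ((h.propagator_eventuallyEq t φ).mono fun _ hτ => congrArg (fun f => f.toLp 2 volume) hτ)⟩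

lemma propagator_apply (h : ConstantSigma P δ ω) (ht : ∀ j, mu (δ j) (ω j) t ≠ 0)
    (φ : 𝓢(Space d, ℂ)) (x : Space d) :
    propagator P δ ω t φ x = oscillatoryOperator (fun j => amplitudeExt (δ j) (ω j) t)
      (fun j => phaseExt P j (mu (δ j) (ω j)) t) φ x :=
  h.branch_apply (fun j => admissible_branchIndex (δ j) (ω j) t) ht φ x

end ConstantSigma

end QuadSchrodinger

end

noncomputable section

namespace QuadSchrodinger

open scoped FourierTransform LineDeriv SchwartzMap ComplexConjugate

variable {d : ℕ}

/-! ### The evolution operator -/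

lemma chirp_apply_of_quadForm_eq_zero {v : QuadCoeff d} (hv : ∀ x, quadForm v x = 0)
    (f : 𝓢(Space d, ℂ)) : chirp v f = f := by
  ext x
  simp [chirp_apply, hv]

lemma fourierChirp_apply_of_quadForm_eq_zero {v : QuadCoeff d} (hv : ∀ x, quadForm v x = 0)
    (f : 𝓢(Space d, ℂ)) : fourierChirp v f = f := by
  rw [fourierChirp_apply, chirp_apply_of_quadForm_eq_zero hv, FourierTransform.fourierInv_fourier_eq]

/-- The times at which the coefficients are continuous. -/
def Coefficients.ContAt (P : Coefficients d) (t : ℝ) : Prop :=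
  ∀ j, ContinuousAt (P.b j) t ∧ ContinuousAt (P.f j) t ∧ ContinuousAt (P.g j) t

lemma Coefficients.Regular.countable_not_contAt {P : Coefficients d} (h : P.Regular) :
    {t | ¬ P.ContAt t}.Countable := by
  have : {t | ¬ P.ContAt t} ⊆ ⋃ j, ({t | ¬ ContinuousAt (P.b j) t} ∪
      ({t | ¬ ContinuousAt (P.f j) t} ∪ {t | ¬ ContinuousAt (P.g j) t})) := by
    intro t ht
    simp only [Coefficients.ContAt, mem_ofPred_eq, not_forall] at ht
    obtain ⟨j, hj⟩ := ht
    refine mem_iUnion.2 ⟨j, ?_⟩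
    by_contra hc
    simp only [mem_union, mem_ofPred_eq, not_or, not_not] at hc
    exact hj hc
  exact (countable_iUnion fun j => (h j).2.1.countable_discontinuities.union
    ((h j).2.2.1.countable_discontinuities.union (h j).2.2.2.countable_discontinuities)).mono this

namespace ConstantSigma

variable {P : Coefficients d} {δ : Fin d → SignType} {ω : Fin d → ℝ} {t : ℝ}

/-- At time 0 trajectory, action and curvature vanish and the multiplier is trivial; the gauge
chirps at the two ends cancel. -/
lemma propagator_zero (h : ConstantSigma P δ ω) (φ : 𝓢(Space d, ℂ)) :
    propagator P δ ω 0 φ = φ := by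
  have h0 : ∀ j, Admissible (δ j) (ω j) 0 0 := fun j =>
    admissible_zero (h.pos j) (by simp)
  have hr : ∀ f : 𝓢(Space d, ℂ), reflect (fun _ : Fin d => Int.negOnePow 0) f = f := fun f => by
    ext x
    rw [reflect_apply]
    congr 1
  have hp : ∀ j, position (δ j) (ω j) (P.f j) (P.g j) (P.c j) 0 = 0 := fun j => by
    simp [position, drift, kick]
  have hq : ∀ j, momentum (δ j) (ω j) (P.f j) (P.g j) (P.c j) 0 = 0 := fun j => by
    simp [momentum, drift, kick]
  have ha : ∀ j, action (δ j) (ω j) (P.f j) (P.g j) (P.c j) 0 = 0 := fun j => by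
    simp [action, drift, kick, driftKick]
  have hc : ∀ j, curvature (δ j) (ω j) 0 0 = 0 := fun j => by simp [curvature]
  rw [h.propagator_eq h0, branch]
  simp only [SchwartzIsometry.trans_apply, chirps, hp, hq, ha, hc, hr]
  rw [chirp_apply_of_quadForm_eq_zero (v := innerCoeff fun _ => 0) (by simp [quadForm_innerCoeff]),
    fourierChirp_apply_of_quadForm_eq_zero (by simp [quadForm, multiplierCoeff])]
  ext x
  rw [chirp_apply, chirp_apply, ← mul_assoc, ← Complex.exp_add, quadForm_innerCoeff]
  have : quadForm (outerCoeff (fun j => (0 - P.c j 0) / 2) (fun _ => 0 - 0 * 0)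
      (fun _ : Fin d => (0 : ℝ) + 0 * 0 ^ 2 / 2) (-∑ j : Fin d, Real.pi * ((0 : ℤ) : ℝ) / 2)) x =
      -∑ j, P.c j 0 / 2 * x j ^ 2 := by
    simp only [quadForm, outerCoeff]
    simp [neg_div]
  rw [this]
  simp

lemma toL2_propagator_zero (h : ConstantSigma P δ ω) (φ : L2 d) :
    (propagator P δ ω 0).toL2 φ = φ := by
  refine congrFun (denseRange_toLp.equalizer (propagator P δ ω 0).toL2.continuous continuous_id
    (funext fun f => ?_)) φ
  exact ((propagator P δ ω 0).toL2_toLp f).trans (by rw [h.propagator_zero]; rfl)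

lemma evolution_zero_apply (h : ConstantSigma P δ ω) (φ : L2 d) :
    evolution P δ ω t 0 φ = (propagator P δ ω t).toL2 φ := by
  rw [evolution_apply]
  congr 1
  rw [LinearIsometryEquiv.symm_apply_eq, h.toL2_propagator_zero]

theorem isEvolutionOperator (h : ConstantSigma P δ ω) :
    IsEvolutionOperator P (evolution P δ ω) where
  norm_eq t s φ := by simp [evolution_apply]
  diag t := by ext1 φ; simp [evolution_apply]
  comp t r s := by ext1 φ; simp [evolution_apply]
  strongly_continuous φ := by
    -- For the inverse, apply the isometry at τ to the difference: its norm is that of φ minus the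
    -- propagator at τ applied to a fixed vector.
    have hsymm : Continuous fun s => (propagator P δ ω s).toL2.symm φ := by
      refine continuous_iff_continuousAt.2 fun s => ?_
      have h1 := (h.strongContAt_propagator s).toL2 ((propagator P δ ω s).toL2.symm φ)
      rw [ContinuousAt, tendsto_iff_norm_sub_tendsto_zero] at h1 ⊢
      refine h1.congr fun τ => ?_
      rw [LinearIsometryEquiv.apply_symm_apply, ← (propagator P δ ω τ).toL2.norm_map
        ((propagator P δ ω τ).toL2.symm φ - _), map_sub, LinearIsometryEquiv.apply_symm_apply,
        norm_sub_rev]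
    refine continuous_iff_continuousAt.2 fun p => ?_
    have h1 := ((h.strongContAt_propagator p.1).toL2
      ((propagator P δ ω p.2).toL2.symm φ)).comp (f := Prod.fst) continuousAt_fst
    have h2 := (hsymm.continuousAt (x := p.2)).comp (f := Prod.snd) continuousAt_snd
    rw [ContinuousAt, tendsto_iff_norm_sub_tendsto_zero] at h1 h2 ⊢
    refine squeeze_zero (fun _ => norm_nonneg _) (fun q => ?_) (by simpa using h2.add h1)
    have := norm_sub_le_norm_sub_add_norm_sub
      ((propagator P δ ω q.1).toL2 ((propagator P δ ω q.2).toL2.symm φ))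
      ((propagator P δ ω q.1).toL2 ((propagator P δ ω p.2).toL2.symm φ))
      ((propagator P δ ω p.1).toL2 ((propagator P δ ω p.2).toL2.symm φ))
    rw [← map_sub, LinearIsometryEquiv.norm_map] at this
    exact this
  solves s φ := by
    refine ⟨fun t => propagator P δ ω t ((propagator P δ ω s).symm φ), fun t => ?_, fun t ht => ?_⟩
    · rw [evolution_apply, SchwartzIsometry.toL2_symm_toLp, SchwartzIsometry.toL2_toLp]
    · obtain ⟨D, h1, h2⟩ := h.hasDerivAt_propagator (fun j => (ht j).2)
        ((propagator P δ ω s).symm φ)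
      refine ⟨(Complex.I • D).toLp 2, ?_, h2.congr_deriv ?_⟩
      · filter_upwards [(Complex.I • D).coeFn_toLp 2 volume] with x hx
        rw [hx, smul_apply, smul_eq_mul, ← h1]
        linear_combination (-hamiltonian P t
          (propagator P δ ω t ((propagator P δ ω s).symm φ)) x) * Complex.I_mul_I
      · rw [toLp_smul, smul_smul, neg_mul, Complex.I_mul_I, neg_neg, one_smul]

end ConstantSigma

/-! ### Uniqueness -/

lemma hamiltonian_sub (P : Coefficients d) (t : ℝ) (f g : 𝓢(Space d, ℂ)) (x : Space d) :
    hamiltonian P t (f - g : 𝓢(Space d, ℂ)) x = hamiltonian P t f x - hamiltonian P t g x := by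
  have hs : ∀ j (f g : 𝓢(Space d, ℂ)), partialD j (f - g) = partialD j f - partialD j g :=
    fun j f g => by
      rw [sub_eq_add_neg, ← neg_one_smul ℂ g, partialD_add, partialD_smul, neg_one_smul,
        ← sub_eq_add_neg]
  simp only [hamiltonian, laplacian_apply_eq_sum, ← partialD_apply, hs, sub_apply,
    Finset.mul_sum, ← Finset.sum_add_distrib, ← Finset.sum_sub_distrib]
  exact Finset.sum_congr rfl fun j _ => by ring

namespace IsEvolutionOperator

variable {P : Coefficients d} {U V : ℝ → ℝ → (L2 d →L[ℂ] L2 d)}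

/-- Symmetry of H(t) on Schwartz functions, obtained without integration by parts: the norm of U(τ,
t)f does not depend on τ, and its derivative at τ = t is this inner product. -/
lemma inner_generator_eq_zero (hU : IsEvolutionOperator P U) {t : ℝ} (ht : P.ContAt t)
    (f : 𝓢(Space d, ℂ)) {η : L2 d} (hη : (η : Space d → ℂ) =ᵐ[volume] hamiltonian P t f) :
    inner ℝ (f.toLp 2 volume) (-Complex.I • η) = 0 := by
  obtain ⟨ψ, h1, h2⟩ := hU.solves t f
  have h3 : ψ t = f := by
    apply SchwartzMap.injective_toLp 2 volume
    exact (h1 t).symm.trans (by rw [hU.diag]; rfl)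
  obtain ⟨η', h4, h5⟩ := h2 t ht
  have h6 : η' = η := by
    apply Lp.ext
    rw [h3] at h4
    exact h4.trans hη.symm
  rw [h6] at h5
  have h7 := h5.norm_sq
  have h8 : (fun τ => ‖(ψ τ).toLp 2 volume‖ ^ 2) = fun _ => ‖f.toLp 2 volume‖ ^ 2 := by
    funext τ
    rw [← h1, hU.norm_eq]
  rw [h8, h3] at h7
  have := h7.unique (hasDerivAt_const _ _)
  linarith

/-- The difference of two solutions with the same Schwartz data is Schwartz at each time and solves
the equation, so by the symmetry of H its squared norm has derivative zero. Density extends the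
equality to L². -/
theorem unique (hP : P.Regular) (hU : IsEvolutionOperator P U) (hV : IsEvolutionOperator P V) :
    U = V := by
  funext t s
  refine ContinuousLinearMap.ext fun φ => ?_
  refine congrFun (denseRange_toLp.equalizer (U t s).continuous (V t s).continuous
    (funext fun f => ?_)) φ
  change U t s (f.toLp 2 volume) = V t s (f.toLp 2 volume)
  obtain ⟨ψ, u1, u2⟩ := hU.solves s f
  obtain ⟨χ, v1, v2⟩ := hV.solves s f
  have hc : Continuous fun τ => ‖U τ s (f.toLp 2 volume) - V τ s (f.toLp 2 volume)‖ ^ 2 := by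
    have a := (hU.strongly_continuous (f.toLp 2 volume)).comp
      (continuous_id.prodMk (continuous_const (y := s)))
    have b := (hV.strongly_continuous (f.toLp 2 volume)).comp
      (continuous_id.prodMk (continuous_const (y := s)))
    exact (a.sub b).norm.pow 2
  have hd : ∀ τ, P.ContAt τ →
      HasDerivAt (fun τ => ‖U τ s (f.toLp 2 volume) - V τ s (f.toLp 2 volume)‖ ^ 2) 0 τ := by
    intro τ hτ
    obtain ⟨η, a1, a2⟩ := u2 τ hτ
    obtain ⟨ξ, b1, b2⟩ := v2 τ hτ
    have h1 : ((η - ξ : L2 d) : Space d → ℂ) =ᵐ[volume]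
        hamiltonian P τ (ψ τ - χ τ : 𝓢(Space d, ℂ)) := by
      filter_upwards [Lp.coeFn_sub η ξ, a1, b1] with x hx ha hb
      rw [hx, Pi.sub_apply, ha, hb, hamiltonian_sub]
    have h2 := hU.inner_generator_eq_zero hτ (ψ τ - χ τ) h1
    have h3 := (a2.sub b2).norm_sq
    rw [Pi.sub_apply, ← toLp_sub, ← smul_sub, h2, mul_zero] at h3
    refine h3.congr_of_eventuallyEq (Eventually.of_forall fun τ => ?_)
    simp only [u1, v1, Pi.sub_apply]
  -- The times of discontinuity are countable, and strong continuity carries the squared norm across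
  -- them.
  have h0 := MeasureTheory.integral_eq_of_hasDerivAt_off_countable _ (fun _ => (0 : ℝ))
    hP.countable_not_contAt (a := s) (b := t) hc.continuousOn
    (fun τ hτ => hd τ (by simpa using hτ.2)) (by simp)
  simp only [intervalIntegral.integral_zero, hU.diag, hV.diag, sub_self, norm_zero] at h0
  have : ‖U t s (f.toLp 2 volume) - V t s (f.toLp 2 volume)‖ = 0 := by
    nlinarith [norm_nonneg (U t s (f.toLp 2 volume) - V t s (f.toLp 2 volume))]
  exact sub_eq_zero.1 (norm_eq_zero.1 this)

end IsEvolutionOperator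

end QuadSchrodinger

end

noncomputable section

namespace QuadSchrodinger

open scoped FourierTransform LineDeriv SchwartzMap ComplexConjugate

variable {d : ℕ}

/-! ### Explicit formulas and the dispersive bound -/

/-- The kernel of `oscillatoryOperator`. -/
def oscillatoryKernel (A : Fin d → ℂ) (S : Fin d → ℝ → ℝ → ℝ) (x y : Space d) : ℂ :=
  (∏ j, A j) * Complex.exp (Complex.I * ((∑ j, S j (x j) (y j) : ℝ) : ℂ))

lemma oscillatoryOperator_eq (A : Fin d → ℂ) (S : Fin d → ℝ → ℝ → ℝ) (φ : Space d → ℂ)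
    (x : Space d) : oscillatoryOperator A S φ x = ∫ y, oscillatoryKernel A S x y * φ y := by
  rw [oscillatoryOperator, ← integral_const_mul]
  exact integral_congr_ae (Eventually.of_forall fun y => by simp only [oscillatoryKernel, mul_assoc])

lemma norm_oscillatoryKernel (A : Fin d → ℂ) (S : Fin d → ℝ → ℝ → ℝ) (x y : Space d) :
    ‖oscillatoryKernel A S x y‖ = ∏ j, ‖A j‖ := by
  rw [oscillatoryKernel, norm_mul, norm_prod, mul_comm Complex.I, Complex.norm_exp_ofReal_mul_I,
    mul_one]

lemma boundedKernel_oscillatoryKernel (A : Fin d → ℂ) {S : Fin d → ℝ → ℝ → ℝ}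
    (hS : ∀ j, Continuous (Function.uncurry (S j))) : BoundedKernel (oscillatoryKernel A S) := by
  refine ⟨?_, _, fun x y => (norm_oscillatoryKernel A S x y).le⟩
  have h : ∀ j, Continuous fun p : Space d × Space d => S j (p.1 j) (p.2 j) := fun j =>
    (hS j).comp (by fun_prop : Continuous fun p : Space d × Space d => (p.1 j, p.2 j))
  have : Function.uncurry (oscillatoryKernel A S) = fun p : Space d × Space d =>
    (∏ j, A j) * Complex.exp (Complex.I * ((∑ j, S j (p.1 j) (p.2 j) : ℝ) : ℂ)) := rfl
  rw [this]
  fun_prop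

lemma continuous_phaseExt (P : Coefficients d) (j : Fin d) (m : ℝ → ℝ) (t : ℝ) :
    Continuous (Function.uncurry (phaseExt P j m t)) := by
  have : Function.uncurry (phaseExt P j m t) = fun p : ℝ × ℝ => phaseExt P j m t p.1 p.2 := rfl
  rw [this]
  unfold phaseExt quadPhase
  fun_prop

lemma norm_amplitudeExt (δ : SignType) (ω t : ℝ) :
    ‖amplitudeExt δ ω t‖ = (2 * Real.pi * |mu δ ω t|) ^ (-(1 / 2) : ℝ) := by
  have hpi := Real.pi_pos
  have h0 : 0 ≤ 2 * Real.pi * |mu δ ω t| := by positivity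
  rw [amplitudeExt]
  generalize (if δ = SignType.pos then ⌊ω * t / Real.pi⌋ else if 0 ≤ t then 0 else -1) = N
  have h1 : -(Complex.I * (Real.pi : ℂ) / 4) * (1 + 2 * (N : ℂ)) =
      ((-(Real.pi / 4) * (1 + 2 * (N : ℝ)) : ℝ) : ℂ) * Complex.I := by
    push_cast; ring
  rw [h1, norm_div, Complex.norm_exp_ofReal_mul_I, Complex.norm_real,
    Real.norm_of_nonneg (Real.sqrt_nonneg _), Real.rpow_neg h0, Real.sqrt_eq_rpow, one_div]

lemma eLpNorm_oscillatoryOperator_le (A : Fin d → ℂ) (S : Fin d → ℝ → ℝ → ℝ) (φ : Space d → ℂ) :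
    eLpNorm (oscillatoryOperator A S φ) ∞ volume ≤
      ENNReal.ofReal (∏ j, ‖A j‖) * eLpNorm φ 1 volume := by
  rw [eLpNorm_exponent_top]
  refine eLpNormEssSup_le_of_ae_enorm_bound (Eventually.of_forall fun x => ?_)
  rw [oscillatoryOperator_eq, eLpNorm_one_eq_lintegral_enorm,
    ← lintegral_const_mul' _ _ ENNReal.ofReal_ne_top]
  refine (enorm_integral_le_lintegral_enorm _).trans (le_of_eq ?_)
  refine lintegral_congr fun y => ?_
  rw [enorm_mul, ← norm_oscillatoryKernel A S x y, ofReal_norm]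

namespace ConstantSigma

variable {P : Coefficients d} {δ : Fin d → SignType} {ω : Fin d → ℝ} {t : ℝ}
  {U : ℝ → ℝ → (L2 d →L[ℂ] L2 d)}

lemma eq_evolution (h : ConstantSigma P δ ω) (hU : IsEvolutionOperator P U) :
    U = evolution P δ ω := hU.unique h.regular h.isEvolutionOperator

theorem ae_eq_oscillatoryOperator_ext (h : ConstantSigma P δ ω) (hU : IsEvolutionOperator P U)
    (ht : ∀ j, mu (δ j) (ω j) t ≠ 0) (φ : L2 d) (hφ : Integrable φ) :
    (U t 0 φ : Space d → ℂ) =ᵐ[volume] oscillatoryOperator (fun j => amplitudeExt (δ j) (ω j) t)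
      (fun j => phaseExt P j (mu (δ j) (ω j)) t) φ := by
  rw [h.eq_evolution hU, h.evolution_zero_apply]
  have := (propagator P δ ω t).toL2_ae_eq_integral
    (boundedKernel_oscillatoryKernel (fun j => amplitudeExt (δ j) (ω j) t)
      fun j => continuous_phaseExt P j (mu (δ j) (ω j)) t)
    (fun f x => by rw [h.propagator_apply ht, oscillatoryOperator_eq]) φ hφ
  filter_upwards [this] with x hx
  rw [hx, oscillatoryOperator_eq]

/-- While μ' has no zero, branch 0 is regular up to t. Its amplitude is the principal root, and the
two forms of the phase coincide. -/
theorem ae_eq_oscillatoryOperator (h : ConstantSigma P δ ω) (hU : IsEvolutionOperator P U)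
    (ht : ∀ j, mu (δ j) (ω j) t ≠ 0 ∧ ∀ τ ∈ uIcc 0 t, deriv (mu (δ j) (ω j)) τ ≠ 0)
    (φ : L2 d) (hφ : Integrable φ) :
    (U t 0 φ : Space d → ℂ) =ᵐ[volume]
      oscillatoryOperator (fun j => amplitude (mu (δ j) (ω j) t))
        (fun j => phase P j (mu (δ j) (ω j)) t) φ := by
  have hd : ∀ j, ∀ τ ∈ uIcc 0 t, dmu (δ j) (ω j) τ ≠ 0 := fun j => by
    rw [← deriv_mu _ (h.pos j)]; exact (ht j).2
  have h1 : (fun j => amplitude (mu (δ j) (ω j) t)) = fun j => amplitudeExt (δ j) (ω j) t := by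
    funext j
    rw [amplitudeExt_eq (h.pos j) (admissible_zero (h.pos j) (hd j)) (ht j).1]
    simp
  have h2 : (fun j => phase P j (mu (δ j) (ω j)) t) =
      fun j => phaseExt P j (mu (δ j) (ω j)) t := by
    funext j x y
    rw [phase, phaseExt, gammaC_eq (h.pos j) (h.sigma_eq j) (ht j).1 (hd j),
      epsilonC_eq (h.sources j) (h.pos j) (h.sigma_eq j) (ht j).1 (hd j),
      kappaC_eq (h.sources j) (h.pos j) (h.sigma_eq j) (ht j).1 (hd j)]
  rw [h1, h2]
  exact h.ae_eq_oscillatoryOperator_ext hU (fun j => (ht j).1) φ hφ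

end ConstantSigma

/-! ### Translation in time -/

lemma PiecewiseContinuous.comp_add_const {u : ℝ → ℝ} (hu : PiecewiseContinuous u) (s : ℝ) :
    PiecewiseContinuous fun t => u (t + s) := by
  have hc : ∀ t, ContinuousAt u (t + s) → ContinuousAt (fun t => u (t + s)) t := fun t ht =>
    ContinuousAt.comp (f := fun t => t + s) ht (by fun_prop)
  refine ⟨fun a b => ?_, fun t => ?_⟩
  · refine ((hu.1 (a + s) (b + s)).image fun t => t - s).subset fun t ht => ?_
    exact ⟨t + s, ⟨⟨by linarith [ht.1.1], by linarith [ht.1.2]⟩, fun h => ht.2 (hc t h)⟩, by simp⟩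
  · obtain ⟨⟨l, hl⟩, r, hr⟩ := hu.2 (t + s)
    have hcont : ContinuousAt (fun t => t + s) t := by fun_prop
    exact ⟨⟨l, hl.comp (tendsto_nhdsWithin_of_tendsto_nhds_of_eventually_within _
        (hcont.tendsto.mono_left nhdsWithin_le_nhds)
        (by filter_upwards [self_mem_nhdsWithin] with τ hτ; simpa using hτ))⟩,
      r, hr.comp (tendsto_nhdsWithin_of_tendsto_nhds_of_eventually_within _
        (hcont.tendsto.mono_left nhdsWithin_le_nhds)
        (by filter_upwards [self_mem_nhdsWithin] with τ hτ; simpa using hτ))⟩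

/-- The coefficients translated in time. -/
def Coefficients.shift (P : Coefficients d) (s : ℝ) : Coefficients d where
  b j t := P.b j (t + s)
  f j t := P.f j (t + s)
  g j t := P.g j (t + s)
  c j t := P.c j (t + s)

lemma IsEvolutionOperator.shift {P : Coefficients d} {U : ℝ → ℝ → (L2 d →L[ℂ] L2 d)}
    (hU : IsEvolutionOperator P U) (s : ℝ) :
    IsEvolutionOperator (P.shift s) fun t r => U (t + s) (r + s) where
  norm_eq t r φ := hU.norm_eq _ _ φ
  diag t := hU.diag _
  comp t r q := hU.comp _ _ _
  strongly_continuous φ := (hU.strongly_continuous φ).comp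
    (by fun_prop : Continuous fun p : ℝ × ℝ => (p.1 + s, p.2 + s))
  solves r φ := by
    obtain ⟨ψ, h1, h2⟩ := hU.solves (r + s) φ
    refine ⟨fun t => ψ (t + s), fun t => h1 _, fun t ht => ?_⟩
    have hc : ∀ u : ℝ → ℝ, ContinuousAt (fun t => u (t + s)) t → ContinuousAt u (t + s) := by
      intro u hu
      have h3 : ContinuousAt (fun t => u (t + s)) (t + s - s) := by rwa [add_sub_cancel_right]
      have := ContinuousAt.comp (f := fun t => t - s) h3
        (by fun_prop : ContinuousAt (fun t => t - s) (t + s))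
      simpa [Function.comp_def] using this
    obtain ⟨η, h3, h4⟩ := h2 (t + s) fun j => ⟨hc _ (ht j).1, hc _ (ht j).2.1, hc _ (ht j).2.2⟩
    exact ⟨η, h3, h4.comp_add_const t s⟩

namespace ConstantSigma

variable {P : Coefficients d} {δ : Fin d → SignType} {ω : Fin d → ℝ}
  {U : ℝ → ℝ → (L2 d →L[ℂ] L2 d)}

lemma shift (h : ConstantSigma P δ ω) (s : ℝ) : ConstantSigma (P.shift s) δ ω where
  regular j := ⟨(h.regular j).1.comp (contDiff_id.add contDiff_const),
    (h.regular j).2.1.comp_add_const s, (h.regular j).2.2.1.comp_add_const s,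
    (h.regular j).2.2.2.comp_add_const s⟩
  pos := h.pos
  sigma_eq j t := by
    rw [← h.sigma_eq j (t + s), Coefficients.sigma, Coefficients.sigma, ← deriv_comp_add_const]
    rfl

/-- Translating the coefficients by s keeps σ and turns U(t, s) into an evolution from time 0, whose
kernel has constant modulus. If φ is not integrable, the right side is a positive constant times ∞.
-/
theorem eLpNorm_top_le (h : ConstantSigma P δ ω) (hU : IsEvolutionOperator P U) (t s : ℝ)
    (hts : ∀ j, mu (δ j) (ω j) (t - s) ≠ 0) (φ : L2 d) :
    eLpNorm (U t s φ) ∞ volume ≤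
      ENNReal.ofReal (∏ j, (2 * Real.pi * |mu (δ j) (ω j) (t - s)|) ^ (-(1 / 2) : ℝ)) *
        eLpNorm φ 1 volume := by
  by_cases hφ : Integrable φ
  · have h1 := (h.shift s).ae_eq_oscillatoryOperator_ext (hU.shift s) hts φ hφ
    simp only [sub_add_cancel, zero_add] at h1
    rw [eLpNorm_congr_ae h1]
    refine (eLpNorm_oscillatoryOperator_le _ _ _).trans (le_of_eq ?_)
    simp only [norm_amplitudeExt]
  · have h1 : eLpNorm φ 1 volume = ∞ := by
      by_contra hc
      exact hφ (memLp_one_iff_integrable.1 ⟨(Lp.memLp φ).1, lt_top_iff_ne_top.2 hc⟩)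
    have hpos : 0 < ∏ j, (2 * Real.pi * |mu (δ j) (ω j) (t - s)|) ^ (-(1 / 2) : ℝ) :=
      Finset.prod_pos fun j _ => Real.rpow_pos_of_pos
        (mul_pos (by positivity) (abs_pos.2 (hts j))) _
    rw [h1, ENNReal.mul_top (by simpa using hpos)]
    exact le_top

end ConstantSigma

end QuadSchrodinger

end

noncomputable section

namespace QuadSchrodinger

/-! ### Dyadic sums -/

/-- `2^x` in `[0, ∞]`. -/
def pow2 (x : ℝ) : ℝ≥0∞ := (2 : ℝ≥0∞) ^ x

lemma pow2_add (x y : ℝ) : pow2 (x + y) = pow2 x * pow2 y :=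
  ENNReal.rpow_add x y two_ne_zero ENNReal.ofNat_ne_top

lemma pow2_ne_zero (x : ℝ) : pow2 x ≠ 0 :=
  (ENNReal.rpow_pos (by norm_num) ENNReal.ofNat_ne_top).ne'

lemma pow2_ne_top (x : ℝ) : pow2 x ≠ ∞ :=
  ENNReal.rpow_ne_top_of_ne_zero two_ne_zero ENNReal.ofNat_ne_top

lemma pow2_lt_top (x : ℝ) : pow2 x < ∞ := lt_top_iff_ne_top.2 (pow2_ne_top x)

@[simp] lemma pow2_zero : pow2 0 = 1 := ENNReal.rpow_zero

@[simp] lemma pow2_one : pow2 1 = 2 := ENNReal.rpow_one 2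

lemma pow2_mono {x y : ℝ} (h : x ≤ y) : pow2 x ≤ pow2 y :=
  ENNReal.rpow_le_rpow_of_exponent_le (by norm_num) h

lemma pow2_le_iff {x y : ℝ} : pow2 x ≤ pow2 y ↔ x ≤ y :=
  ⟨fun h => by
    by_contra! hc
    exact absurd h (not_le.2 (ENNReal.rpow_lt_rpow_of_exponent_lt (by norm_num)
      ENNReal.ofNat_ne_top hc)), pow2_mono⟩

lemma pow2_rpow (x y : ℝ) : pow2 x ^ y = pow2 (x * y) := (ENNReal.rpow_mul 2 x y).symm

lemma pow2_eq_ofReal (x : ℝ) : pow2 x = ENNReal.ofReal ((2 : ℝ) ^ x) := by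
  rw [pow2, ← ENNReal.ofReal_rpow_of_pos two_pos, ENNReal.ofReal_ofNat]

lemma exists_pow2_lt_le {y : ℝ≥0∞} (h0 : y ≠ 0) (ht : y ≠ ∞) :
    ∃ m : ℤ, pow2 m < y ∧ y ≤ pow2 (m + 1) := by
  obtain ⟨x, hx⟩ : ∃ x : ℝ, y = pow2 x := by
    refine ⟨Real.logb 2 y.toReal, ?_⟩
    rw [pow2_eq_ofReal, Real.rpow_logb two_pos (by norm_num) (ENNReal.toReal_pos h0 ht),
      ENNReal.ofReal_toReal ht]
  refine ⟨⌈x⌉ - 1, ?_, ?_⟩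
  · rw [hx, ← not_le, pow2_le_iff, not_le]
    have := Int.ceil_lt_add_one x
    push_cast; linarith
  · rw [hx, pow2_le_iff]
    have := Int.le_ceil x
    push_cast; linarith

lemma tsum_pow2_neg_abs_ne_top {c : ℝ} (hc : 0 < c) : ∑' k : ℤ, pow2 (-(c * |(k : ℝ)|)) ≠ ∞ := by
  have h1 : Summable fun n : ℕ => (2 : ℝ) ^ (-(c * |((n : ℤ) : ℝ)|)) := by
    have : ∀ n : ℕ, (2 : ℝ) ^ (-(c * |((n : ℤ) : ℝ)|)) = ((2 : ℝ) ^ (-c)) ^ n := fun n => by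
      rw [← Real.rpow_natCast, ← Real.rpow_mul two_pos.le]
      simp
    simp_rw [this]
    exact summable_geometric_of_lt_one (by positivity)
      (Real.rpow_lt_one_of_one_lt_of_neg one_lt_two (by linarith))
  have h2 : Summable fun k : ℤ => (2 : ℝ) ^ (-(c * |(k : ℝ)|)) :=
    Summable.of_nat_of_neg h1 (by simpa using h1)
  simp_rw [pow2_eq_ofReal]
  rw [← ENNReal.ofReal_tsum_of_nonneg (fun k => by positivity) h2]
  exact ENNReal.ofReal_ne_top

/-- The sum of `2^{-c|pk+x|}` over `k ∈ ℤ` is bounded uniformly in `x`. -/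
lemma exists_tsum_pow2_le {c p : ℝ} (hc : 0 < c) (hp : 0 < p) :
    ∃ C : ℝ≥0, ∀ x : ℝ, ∑' k : ℤ, pow2 (-(c * |p * k + x|)) ≤ C := by
  -- Shifting the index by the integer nearest to x/p leaves an offset of at most 1/2; replacing it
  -- by 1 costs the factor 2^{cp}.
  have hfin : pow2 (c * p) * ∑' k : ℤ, pow2 (-(c * p * |(k : ℝ)|)) ≠ ∞ :=
    ENNReal.mul_ne_top (pow2_ne_top _) (tsum_pow2_neg_abs_ne_top (mul_pos hc hp))
  refine ⟨(pow2 (c * p) * ∑' k : ℤ, pow2 (-(c * p * |(k : ℝ)|))).toNNReal, fun x => ?_⟩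
  rw [ENNReal.coe_toNNReal hfin, ← ENNReal.tsum_mul_left,
    ← (Equiv.subRight (round (x / p))).tsum_eq]
  refine ENNReal.tsum_le_tsum fun k => ?_
  rw [← pow2_add]
  refine pow2_mono ?_
  have h1 := abs_sub_round (x / p)
  have h2 : p * ((k : ℝ) - round (x / p)) + x = p * (k + (x / p - round (x / p))) := by
    field_simp; ring
  have h3 := abs_sub_abs_le_abs_sub (k : ℝ) (-(x / p - round (x / p)))
  rw [sub_neg_eq_add, abs_neg] at h3
  rw [Equiv.subRight_apply, Int.cast_sub, h2, abs_mul, abs_of_pos hp]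
  have : p * (|(k : ℝ)| - 1) ≤ p * |(k : ℝ) + (x / p - round (x / p))| := by
    gcongr; linarith
  nlinarith

/-- Three exponents that are jointly negative in all directions. -/
lemma exists_min_forms_le {κ a b : ℝ} (hκ : 0 < κ) (hb : 0 ≤ b) (hab : b < a) :
    ∃ c > 0, ∀ ξ η : ℝ,
      min (-(κ * (ξ + η))) (min (a * ξ - b * η) (a * η - b * ξ)) ≤ -(c * |ξ|) - c * |η| := by
  have hD : 0 < a - b := by linarith
  have ha : 0 < a + b := by linarith
  set S : ℝ := 2 + 2 * κ / (a - b) + (a - b) / κ with hS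
  have hS0 : 0 < S := by positivity
  -- With t minus the minimum, the forms have size at most St. The first gives |ξ + η| ≤ St/κ, the
  -- difference of the other two |ξ - η| ≤ 2St/(a + b); the sum of these controls |ξ| + |η|.
  refine ⟨1 / (S / κ + 2 * S / (a + b)), by positivity, fun ξ η => ?_⟩
  set L1 := -(κ * (ξ + η)) with h1
  set L2 := a * ξ - b * η with h2
  set L3 := a * η - b * ξ with h3
  set t := -(min L1 (min L2 L3)) with ht
  have e1 : -t ≤ L1 := by rw [ht, neg_neg]; exact min_le_left _ _
  have e2 : -t ≤ L2 := by rw [ht, neg_neg]; exact (min_le_right _ _).trans (min_le_left _ _)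
  have e3 : -t ≤ L3 := by rw [ht, neg_neg]; exact (min_le_right _ _).trans (min_le_right _ _)
  -- A combination with positive weights vanishes, so lower bounds -t for all three forms are also
  -- upper bounds, up to constants.
  have hz : (a - b) * L1 + κ * L2 + κ * L3 = 0 := by rw [h1, h2, h3]; ring
  have ht0 : 0 ≤ t := by nlinarith
  have u1 : |L1| ≤ S * t := by
    rw [abs_le]
    constructor
    · have : 1 * t ≤ S * t := by
        gcongr
        rw [hS]
        have : 0 < 2 * κ / (a - b) := by positivity
        have : 0 < (a - b) / κ := by positivity
        linarith
      linarith
    · have e : L1 ≤ 2 * κ / (a - b) * t := by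
        rw [div_mul_eq_mul_div, le_div_iff₀ hD]; nlinarith
      have : 2 * κ / (a - b) * t ≤ S * t := by
        gcongr
        rw [hS]
        have : 0 < (a - b) / κ := by positivity
        linarith
      linarith
  have u2 : ∀ L L', -t ≤ L → -t ≤ L' → (a - b) * L1 + κ * L + κ * L' = 0 → |L| ≤ S * t := by
    intro L L' hL hL' hz
    have hS' : 1 + (a - b) / κ ≤ S := by
      rw [hS]
      have : 0 < 2 * κ / (a - b) := by positivity
      linarith
    have hpos : 0 < (a - b) / κ := by positivity
    rw [abs_le]
    constructor
    · nlinarith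
    · have e : L ≤ (1 + (a - b) / κ) * t := by
        have : (1 + (a - b) / κ) * t = (κ * t + (a - b) * t) / κ := by field_simp
        rw [this, le_div_iff₀ hκ]; nlinarith
      nlinarith
  have u2' := u2 L2 L3 e2 e3 hz
  have u3' := u2 L3 L2 e3 e2 (by linarith)
  have v1 : |ξ + η| ≤ S * t / κ := by
    rw [le_div_iff₀ hκ]
    have : |L1| = |ξ + η| * κ := by rw [h1, abs_neg, abs_mul, abs_of_pos hκ, mul_comm]
    linarith
  have v2 : |ξ - η| ≤ 2 * (S * t) / (a + b) := by
    rw [le_div_iff₀ ha]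
    have : |L2 - L3| = |ξ - η| * (a + b) := by
      rw [h2, h3, show a * ξ - b * η - (a * η - b * ξ) = (ξ - η) * (a + b) by ring, abs_mul,
        abs_of_pos ha]
    have := abs_sub L2 L3
    linarith
  have v3 : |ξ| + |η| ≤ |ξ + η| + |ξ - η| := by
    rcases abs_cases ξ with ⟨p1, _⟩ | ⟨p1, _⟩ <;> rcases abs_cases η with ⟨p2, _⟩ | ⟨p2, _⟩ <;>
      rcases abs_cases (ξ + η) with ⟨p3, _⟩ | ⟨p3, _⟩ <;>
      rcases abs_cases (ξ - η) with ⟨p4, _⟩ | ⟨p4, _⟩ <;> linarith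
  have v4 : |ξ| + |η| ≤ (S / κ + 2 * S / (a + b)) * t := by
    calc _ ≤ S * t / κ + 2 * (S * t) / (a + b) := by linarith
      _ = _ := by ring
  have v5 : 1 / (S / κ + 2 * S / (a + b)) * (|ξ| + |η|) ≤ t := by
    rw [one_div, inv_mul_le_iff₀ (by positivity)]
    linarith
  linarith

/-- Summation of a trilinear family over dyadic scales. -/
lemma exists_tsum_three_le {κ a b p q : ℝ} (hκ : 0 < κ) (hb : 0 ≤ b) (hab : b < a) (hp : 0 < p)
    (hq : 0 < q) : ∃ C : ℝ≥0, ∀ (α β : ℤ → ℝ≥0∞) (X : ℤ → ℤ → ℤ → ℝ≥0∞),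
      (∀ j k l : ℤ, X j k l ≤ pow2 (-(κ * ((p * k + q * j) + (p * l + q * j)))) * (α k + β l)) →
      (∀ j k l : ℤ, X j k l ≤ pow2 (a * (p * k + q * j) - b * (p * l + q * j)) * (α k + β l)) →
      (∀ j k l : ℤ, X j k l ≤ pow2 (a * (p * l + q * j) - b * (p * k + q * j)) * (α k + β l)) →
      ∑' j, ∑' k, ∑' l, X j k l ≤ C * (∑' k, α k + ∑' l, β l) := by
  obtain ⟨c, hc, hmin⟩ := exists_min_forms_le hκ hb hab
  obtain ⟨C₁, h₁⟩ := exists_tsum_pow2_le hc hp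
  obtain ⟨C₂, h₂⟩ := exists_tsum_pow2_le hc hq
  refine ⟨C₂ * C₁, fun α β X b1 b2 b3 => ?_⟩
  -- The best of the three bounds decays geometrically in both pk + qj and pl + qj.
  have hX : ∀ j k l : ℤ, X j k l ≤ pow2 (-(c * |p * k + q * j|)) * pow2 (-(c * |p * l + q * j|)) *
      (α k + β l) := by
    intro j k l
    rw [← pow2_add]
    have hm := hmin (p * k + q * j) (p * l + q * j)
    rw [sub_eq_add_neg] at hm
    rcases min_le_iff.1 hm with h | h
    · exact (b1 j k l).trans (by gcongr; exact pow2_mono h)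
    · rcases min_le_iff.1 h with h | h
      · exact (b2 j k l).trans (by gcongr; exact pow2_mono h)
      · exact (b3 j k l).trans (by gcongr; exact pow2_mono h)
  -- Sum over l first, then over j, each a geometric series bounded uniformly in its offset; only
  -- the sum of u remains.
  have hs : ∀ (u : ℤ → ℝ≥0∞), ∑' j : ℤ, ∑' k : ℤ, ∑' l : ℤ, pow2 (-(c * |p * k + q * j|)) *
      pow2 (-(c * |p * l + q * j|)) * u k ≤ C₂ * C₁ * ∑' k, u k := by
    intro u
    rw [ENNReal.tsum_comm, ← ENNReal.tsum_mul_left]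
    refine ENNReal.tsum_le_tsum fun k => ?_
    calc _ ≤ ∑' j : ℤ, pow2 (-(c * |p * k + q * j|)) * C₁ * u k := by
          refine ENNReal.tsum_le_tsum fun j => ?_
          rw [ENNReal.tsum_mul_right, ENNReal.tsum_mul_left]
          gcongr
          exact h₁ _
      _ ≤ _ := by
          rw [ENNReal.tsum_mul_right, ENNReal.tsum_mul_right]
          gcongr
          refine le_trans (le_of_eq ?_) (h₂ (p * k))
          exact tsum_congr fun j => by rw [add_comm]
  calc _ ≤ ∑' j : ℤ, ∑' k : ℤ, ∑' l : ℤ, (pow2 (-(c * |p * k + q * j|)) *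
      pow2 (-(c * |p * l + q * j|)) * α k + pow2 (-(c * |p * l + q * j|)) *
      pow2 (-(c * |p * k + q * j|)) * β l) := by
        refine ENNReal.tsum_le_tsum fun j => ENNReal.tsum_le_tsum fun k =>
          ENNReal.tsum_le_tsum fun l => (hX j k l).trans (le_of_eq ?_)
        rw [mul_add, mul_comm (pow2 (-(c * |p * l + q * j|)))]
    _ = (∑' j : ℤ, ∑' k : ℤ, ∑' l : ℤ, pow2 (-(c * |p * k + q * j|)) *
          pow2 (-(c * |p * l + q * j|)) * α k) + ∑' j : ℤ, ∑' l : ℤ, ∑' k : ℤ,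
          pow2 (-(c * |p * l + q * j|)) * pow2 (-(c * |p * k + q * j|)) * β l := by
        rw [← ENNReal.tsum_add]
        refine tsum_congr fun j => ?_
        rw [ENNReal.tsum_comm (f := fun l k => pow2 (-(c * |p * (l : ℤ) + q * j|)) *
          pow2 (-(c * |p * (k : ℤ) + q * j|)) * β l), ← ENNReal.tsum_add]
        exact tsum_congr fun k => by rw [← ENNReal.tsum_add]
    _ ≤ _ := by
        rw [ENNReal.coe_mul, mul_add]
        exact add_le_add (hs α) (hs β)

/-! ### Dyadic levels of a number -/

/-- The indicator of `2^k < y`. -/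
def above (k : ℤ) (y : ℝ≥0∞) : ℝ≥0∞ := if pow2 k < y then 1 else 0

lemma measurable_above (k : ℤ) : Measurable (above k) :=
  Measurable.ite measurableSet_Ioi measurable_const measurable_const

/-- The single term with 2^m < y ≤ 2^{m+1} suffices. With `exists_tsum_above_le` this makes y^p
comparable to ∑ 2^{pk} 1_{2^k < y}, the discrete layer-cake formula. -/
lemma le_tsum_above (y : ℝ≥0∞) : y ≤ ∑' k : ℤ, pow2 (k + 1) * above k y := by
  rcases eq_or_ne y 0 with rfl | h0
  · simp
  rcases eq_or_ne y ∞ with rfl | ht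
  · have h1 : ∀ k : ℤ, above k ∞ = 1 := fun k => if_pos (pow2_lt_top _)
    simp only [h1, mul_one]
    have h2 : ∑' _ : ℕ, (1 : ℝ≥0∞) = ∞ := ENNReal.tsum_const_eq_top_of_ne_zero one_ne_zero
    rw [← h2]
    refine le_trans ?_ (ENNReal.tsum_comp_le_tsum_of_injective Nat.cast_injective
      fun k : ℤ => pow2 (k + 1))
    refine ENNReal.tsum_le_tsum fun n => ?_
    rw [← pow2_zero]
    exact pow2_mono (by positivity)
  · obtain ⟨m, hm, hm'⟩ := exists_pow2_lt_le h0 ht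
    refine le_trans ?_ (ENNReal.le_tsum m)
    rw [above, if_pos hm, mul_one]
    exact hm'

/-- A geometric series dominated by its last term, the one with 2^m < y ≤ 2^{m+1}. -/
lemma exists_tsum_above_le {p : ℝ} (hp : 0 < p) :
    ∃ C : ℝ≥0, ∀ y : ℝ≥0∞, ∑' k : ℤ, pow2 (p * k) * above k y ≤ C * y ^ p := by
  obtain ⟨C, hC⟩ := exists_tsum_pow2_le one_pos hp
  refine ⟨C + 1, fun y => ?_⟩
  rcases eq_or_ne y 0 with rfl | h0
  · simp [above]
  rcases eq_or_ne y ∞ with rfl | ht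
  · rw [ENNReal.top_rpow_of_pos hp, ENNReal.mul_top (by simp)]
    exact le_top
  obtain ⟨m, hm, hm'⟩ := exists_pow2_lt_le h0 ht
  have h1 : ∀ k : ℤ, pow2 (p * k) * above k y ≤
      pow2 (p * m) * pow2 (-(1 * |p * k + -(p * m)|)) := by
    intro k
    rw [above]
    split_ifs with h
    · have hk : (k : ℝ) < m + 1 := by
        by_contra! hc
        exact absurd (h.trans_le hm') (not_lt.2 (pow2_mono hc))
      have hk' : (k : ℝ) ≤ m := by exact_mod_cast Int.lt_add_one_iff.1 (by exact_mod_cast hk)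
      rw [mul_one, ← pow2_add]
      refine pow2_mono ?_
      rw [abs_of_nonpos (by nlinarith)]
      linarith
    · simp
  calc _ ≤ ∑' k : ℤ, pow2 (p * m) * pow2 (-(1 * |p * k + -(p * m)|)) := ENNReal.tsum_le_tsum h1
    _ ≤ pow2 (p * m) * C := by rw [ENNReal.tsum_mul_left]; gcongr; exact hC _
    _ ≤ _ := by
      rw [mul_comm, mul_comm p, ← pow2_rpow]
      gcongr
      exact_mod_cast le_self_add

end QuadSchrodinger

end

noncomputable section

namespace QuadSchrodinger

/-! ### The Hardy–Littlewood–Sobolev inequality for kernels of weak type -/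

lemma lintegral_sub_mul_fst {e u : ℝ → ℝ≥0∞} (he : Measurable e) (hu : AEMeasurable u) :
    ∫⁻ z : ℝ × ℝ, e (z.2 - z.1) * u z.1 = (∫⁻ τ, e τ) * ∫⁻ s, u s := by
  have hm : AEMeasurable (fun z : ℝ × ℝ => e (z.2 - z.1) * u z.1) (volume.prod volume) :=
    ((he.comp (measurable_snd.sub measurable_fst)).aemeasurable).mul
      (hu.comp_quasiMeasurePreserving Measure.quasiMeasurePreserving_fst)
  rw [Measure.volume_eq_prod, lintegral_prod _ hm, ← lintegral_const_mul'' _ hu]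
  refine lintegral_congr fun s => ?_
  have me : Measurable fun y => e (y - s) := he.comp (measurable_id.sub_const s)
  change ∫⁻ y, e (y - s) * u s = _
  rw [lintegral_mul_const _ me, lintegral_sub_right_eq_self (fun τ => e τ) s]

lemma lintegral_sub_mul_snd {e u : ℝ → ℝ≥0∞} (he : Measurable e) (hu : AEMeasurable u) :
    ∫⁻ z : ℝ × ℝ, e (z.2 - z.1) * u z.2 = (∫⁻ τ, e τ) * ∫⁻ s, u s := by
  have hm : AEMeasurable (fun z : ℝ × ℝ => e (z.2 - z.1) * u z.2) (volume.prod volume) :=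
    ((he.comp (measurable_snd.sub measurable_fst)).aemeasurable).mul
      (hu.comp_quasiMeasurePreserving Measure.quasiMeasurePreserving_snd)
  rw [Measure.volume_eq_prod, lintegral_prod_symm _ hm, ← lintegral_const_mul'' _ hu]
  refine lintegral_congr fun s => ?_
  have me : Measurable fun y => e (s - y) := he.comp (measurable_const.sub measurable_id)
  change ∫⁻ y, e (s - y) * u s = _
  rw [lintegral_mul_const _ me, lintegral_sub_left_eq_self (fun τ => e τ) s]

lemma lintegral_above_comp (k : ℤ) {u : ℝ → ℝ≥0∞} (hu : Measurable u) :
    ∫⁻ s, above k (u s) = volume {s | pow2 k < u s} := by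
  have h : MeasurableSet {s | pow2 k < u s} := measurableSet_lt measurable_const hu
  rw [← lintegral_indicator_one h]
  refine lintegral_congr fun s => ?_
  simp only [above, indicator, mem_ofPred_eq, Pi.one_apply]

lemma above_le_one (k : ℤ) (y : ℝ≥0∞) : above k y ≤ 1 := by
  rw [above]; split_ifs <;> simp

/-- `κ` is of weak type `ρ`, with constant `C`. -/
def WeakType (ρ : ℝ) (C : ℝ≥0) (κ : ℝ → ℝ≥0∞) : Prop :=
  Measurable κ ∧ ∀ x : ℝ, volume {τ | pow2 x < κ τ} ≤ C * pow2 (-(ρ * x))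

lemma WeakType.rpow {ρ β : ℝ} {C : ℝ≥0} {κ : ℝ → ℝ≥0∞} (h : WeakType ρ C κ) (hβ : 0 < β) :
    WeakType (ρ / β) C fun τ => κ τ ^ β := by
  refine ⟨h.1.pow_const β, fun x => ?_⟩
  have h1 : {τ | pow2 x < κ τ ^ β} = {τ | pow2 (x / β) < κ τ} := by
    ext τ
    simp only [mem_ofPred_eq]
    rw [← ENNReal.rpow_lt_rpow_iff hβ (x := pow2 (x / β)), pow2_rpow, div_mul_cancel₀ _ hβ.ne']
  rw [h1]
  refine (h.2 _).trans (le_of_eq ?_)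
  congr 2
  field_simp

lemma pow2_three : pow2 3 = 8 := by
  rw [pow2, show (3 : ℝ) = ((3 : ℕ) : ℝ) by norm_num, ENNReal.rpow_natCast]
  norm_num

/-- Decompose the kernel (at heights 2^{-m}) and both functions into dyadic levels. The trilinear
form of three indicators is at most the product of any two of the three measures, which gives
exactly the bounds required by `exists_tsum_three_le`. As the norms are normalised, α_kβ_l is at
most a constant times α_k + β_l, and sums of the weights suffice. -/
lemma hls_normalized {P ρ : ℝ} (hP1 : 1 < P) (hP2 : P < 2) (hρ : 0 < ρ) (h : 2 / P + 1 / ρ = 2)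
    (C₀ : ℝ≥0) : ∃ C : ℝ≥0, ∀ κ : ℝ → ℝ≥0∞, WeakType ρ C₀ κ → ∀ a b : ℝ → ℝ≥0∞,
      Measurable a → Measurable b → ∫⁻ s, a s ^ P ≤ 1 → ∫⁻ t, b t ^ P ≤ 1 →
      ∫⁻ z : ℝ × ℝ, κ (z.2 - z.1) * (a z.1 * b z.2) ≤ C := by
  have hP0 : 0 < P := by linarith
  have hκ : 0 < (P - 1) / P := div_pos (by linarith) hP0
  have hab : (P - 1) / P < 1 / P := by gcongr; linarith
  obtain ⟨C₁, h₁⟩ := exists_tsum_three_le hκ hκ.le hab hP0 hρ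
  obtain ⟨C₂, h₂⟩ := exists_tsum_above_le hP0
  refine ⟨C₁ * (8 * (C₂ + C₀) * C₂ + 8 * (C₂ + C₀) * C₂), fun κ hκw a b ha hb ha1 hb1 => ?_⟩
  -- 8 = 2³ comes from the upper ends 2^{k+1} of the three dyadic levels; C₂ bounds the weights, C₀
  -- the kernel.
  set D : ℝ≥0∞ := 8 * (C₂ + C₀) with hD
  set α : ℤ → ℝ≥0∞ := fun k => pow2 (P * k) * volume {s | pow2 k < a s} with hα
  set β : ℤ → ℝ≥0∞ := fun k => pow2 (P * k) * volume {s | pow2 k < b s} with hβ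
  have hsum : ∀ u : ℝ → ℝ≥0∞, Measurable u → ∫⁻ s, u s ^ P ≤ 1 →
      ∑' k : ℤ, pow2 (P * k) * volume {s | pow2 k < u s} ≤ C₂ := by
    intro u hu hu1
    have mu : ∀ k : ℤ, Measurable fun s => above k (u s) := fun k => (measurable_above k).comp hu
    calc _ = ∫⁻ s, ∑' k : ℤ, pow2 (P * k) * above k (u s) := by
          rw [lintegral_tsum fun k => ((mu k).const_mul _).aemeasurable]
          refine tsum_congr fun k => ?_
          rw [lintegral_const_mul _ (mu k), lintegral_above_comp k hu]
      _ ≤ ∫⁻ s, C₂ * u s ^ P := lintegral_mono fun s => h₂ _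
      _ ≤ _ := by
          rw [lintegral_const_mul _ (hu.pow_const P)]
          exact mul_le_of_le_one_right' hu1
  have hα1 := hsum a ha ha1
  have hβ1 := hsum b hb hb1
  set N : ℤ → ℤ → ℤ → ℝ≥0∞ := fun m k l => ∫⁻ z : ℝ × ℝ,
    above (-m) (κ (z.2 - z.1)) * (above k (a z.1) * above l (b z.2)) with hN
  have mE : ∀ m : ℤ, Measurable fun τ => above (-m) (κ τ) := fun m =>
    (measurable_above _).comp hκw.1
  have mA : ∀ k : ℤ, Measurable fun τ => above k (a τ) := fun k => (measurable_above _).comp ha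
  have mB : ∀ k : ℤ, Measurable fun τ => above k (b τ) := fun k => (measurable_above _).comp hb
  have hE : ∀ m : ℤ, ∫⁻ τ, above (-m) (κ τ) ≤ C₀ * pow2 (ρ * m) := fun m => by
    rw [lintegral_above_comp _ hκw.1]
    refine (hκw.2 _).trans (le_of_eq ?_)
    congr 2
    push_cast; ring
  have n1 : ∀ m k l, N m k l ≤ volume {s | pow2 k < a s} * volume {s | pow2 l < b s} := by
    intro m k l
    rw [← lintegral_above_comp k ha, ← lintegral_above_comp l hb,
      ← lintegral_prod_mul (mA k).aemeasurable (mB l).aemeasurable, ← Measure.volume_eq_prod]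
    exact lintegral_mono fun z => mul_le_of_le_one_left' (above_le_one _ _)
  have n2 : ∀ m k l, N m k l ≤ C₀ * pow2 (ρ * m) * volume {s | pow2 l < b s} := by
    intro m k l
    rw [← lintegral_above_comp l hb]
    refine le_trans (le_trans ?_ (lintegral_sub_mul_snd (mE m) (mB l).aemeasurable).le)
      (by gcongr; exact hE m)
    exact lintegral_mono fun z => by gcongr; exact mul_le_of_le_one_left' (above_le_one _ _)
  have n3 : ∀ m k l, N m k l ≤ C₀ * pow2 (ρ * m) * volume {s | pow2 k < a s} := by
    intro m k l
    rw [← lintegral_above_comp k ha]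
    refine le_trans (le_trans ?_ (lintegral_sub_mul_fst (mE m) (mA k).aemeasurable).le)
      (by gcongr; exact hE m)
    exact lintegral_mono fun z => by gcongr; exact mul_le_of_le_one_right' (above_le_one _ _)
  have hvol : ∀ (u : ℝ → ℝ≥0∞) (k : ℤ), volume {s | pow2 k < u s} =
      pow2 (-(P * k)) * (pow2 (P * k) * volume {s | pow2 k < u s}) := fun u k => by
    rw [← mul_assoc, ← pow2_add, neg_add_cancel, pow2_zero, one_mul]
  -- The scaling relation in the form that makes the exponents below functions of Pk + ρm and Pl +
  -- ρm alone.
  have hρP : ρ * (2 * (P - 1)) = P := by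
    field_simp at h
    linarith
  have key := h₁ (fun k => D * α k) (fun k => D * β k)
    (fun m k l => pow2 (-m + 1) * (pow2 (k + 1) * pow2 (l + 1)) * N m k l) ?_ ?_ ?_
  · refine le_trans ?_ (key.trans ?_)
    · calc _ ≤ ∫⁻ z : ℝ × ℝ, ∑' m : ℤ, ∑' k : ℤ, ∑' l : ℤ,
            pow2 (-m + 1) * (pow2 (k + 1) * pow2 (l + 1)) *
            (above (-m) (κ (z.2 - z.1)) * (above k (a z.1) * above l (b z.2))) := by
            refine lintegral_mono fun z => ?_
            have e1 : κ (z.2 - z.1) ≤ ∑' m : ℤ, pow2 (-m + 1) * above (-m) (κ (z.2 - z.1)) := by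
              refine (le_tsum_above _).trans (le_of_eq ?_)
              rw [← (Equiv.neg ℤ).tsum_eq]
              simp
            refine (mul_le_mul' e1 (mul_le_mul' (le_tsum_above (a z.1))
              (le_tsum_above (b z.2)))).trans (le_of_eq ?_)
            rw [← ENNReal.tsum_mul_right]
            refine tsum_congr fun m => ?_
            rw [← ENNReal.tsum_mul_right, ← ENNReal.tsum_mul_left]
            refine tsum_congr fun k => ?_
            rw [← ENNReal.tsum_mul_left, ← ENNReal.tsum_mul_left]
            exact tsum_congr fun l => by ring
        _ = _ := by
            have mm : ∀ m k l : ℤ, AEMeasurable (fun z : ℝ × ℝ =>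
                pow2 (-m + 1) * (pow2 (k + 1) * pow2 (l + 1)) *
                (above (-m) (κ (z.2 - z.1)) * (above k (a z.1) * above l (b z.2)))) := fun m k l =>
              ((((mE m).comp (measurable_snd.sub measurable_fst)).mul
                (((mA k).comp measurable_fst).mul ((mB l).comp measurable_snd))).const_mul _).aemeasurable
            rw [lintegral_tsum fun m => AEMeasurable.tsum fun k =>
              AEMeasurable.tsum fun l => mm m k l]
            refine tsum_congr fun m => ?_
            rw [lintegral_tsum fun k => AEMeasurable.tsum fun l => mm m k l]
            refine tsum_congr fun k => ?_
            rw [lintegral_tsum fun l => mm m k l]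
            refine tsum_congr fun l => ?_
            exact lintegral_const_mul' _ _ (ENNReal.mul_ne_top (pow2_ne_top _)
              (ENNReal.mul_ne_top (pow2_ne_top _) (pow2_ne_top _)))
    · rw [ENNReal.tsum_mul_left, ENNReal.tsum_mul_left]
      push_cast
      gcongr
  · intro m k l
    calc _ ≤ pow2 (-m + 1) * (pow2 (k + 1) * pow2 (l + 1)) *
          (pow2 (-(P * k)) * α k * (pow2 (-(P * l)) * β l)) := by
          gcongr
          refine (n1 m k l).trans (le_of_eq ?_)
          rw [hvol a k, hvol b l]
      _ = pow2 (-m + 1 + (k + 1) + (l + 1) + -(P * k) + -(P * l)) * (α k * β l) := by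
          simp only [pow2_add]; ring
      _ = pow2 (-((P - 1) / P * (P * k + ρ * m + (P * l + ρ * m)))) * (8 * (α k * β l)) := by
          have : -m + 1 + (k + 1) + (l + 1) + -(P * k) + -(P * l) =
              -((P - 1) / P * (P * k + ρ * m + (P * l + ρ * m))) + (3 : ℝ) := by
            field_simp
            linear_combination (m : ℝ) * hρP
          rw [this, pow2_add, mul_assoc, pow2_three]
      _ ≤ pow2 (-((P - 1) / P * (P * k + ρ * m + (P * l + ρ * m)))) *
          (8 * ((C₂ + C₀) * (α k + β l))) := by
          have : α k * β l ≤ (C₂ + C₀) * (α k + β l) :=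
            calc α k * β l ≤ α k * C₂ := by gcongr; exact (ENNReal.le_tsum l).trans hβ1
              _ = C₂ * α k := mul_comm _ _
              _ ≤ _ := mul_le_mul' le_self_add le_self_add
          gcongr
      _ = _ := by rw [hD]; ring
  · intro m k l
    calc _ ≤ pow2 (-m + 1) * (pow2 (k + 1) * pow2 (l + 1)) *
          (C₀ * pow2 (ρ * m) * (pow2 (-(P * l)) * β l)) := by
          gcongr
          refine (n2 m k l).trans (le_of_eq ?_)
          rw [hvol b l]
      _ = pow2 (-m + 1 + (k + 1) + (l + 1) + ρ * m + -(P * l)) * (C₀ * β l) := by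
          simp only [pow2_add]; ring
      _ = pow2 (1 / P * (P * k + ρ * m) - (P - 1) / P * (P * l + ρ * m)) * (8 * (C₀ * β l)) := by
          have : -m + 1 + (k + 1) + (l + 1) + ρ * m + -(P * l) =
              1 / P * (P * k + ρ * m) - (P - 1) / P * (P * l + ρ * m) + (3 : ℝ) := by
            field_simp
            linear_combination (m : ℝ) * hρP
          rw [this, pow2_add, mul_assoc, pow2_three]
      _ ≤ pow2 (1 / P * (P * k + ρ * m) - (P - 1) / P * (P * l + ρ * m)) *
          (8 * ((C₂ + C₀) * (α k + β l))) := by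
          gcongr
          · exact le_add_self
          · exact le_add_self
      _ = _ := by rw [hD]; ring
  · intro m k l
    calc _ ≤ pow2 (-m + 1) * (pow2 (k + 1) * pow2 (l + 1)) *
          (C₀ * pow2 (ρ * m) * (pow2 (-(P * k)) * α k)) := by
          gcongr
          refine (n3 m k l).trans (le_of_eq ?_)
          rw [hvol a k]
      _ = pow2 (-m + 1 + (k + 1) + (l + 1) + ρ * m + -(P * k)) * (C₀ * α k) := by
          simp only [pow2_add]; ring
      _ = pow2 (1 / P * (P * l + ρ * m) - (P - 1) / P * (P * k + ρ * m)) * (8 * (C₀ * α k)) := by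
          have : -m + 1 + (k + 1) + (l + 1) + ρ * m + -(P * k) =
              1 / P * (P * l + ρ * m) - (P - 1) / P * (P * k + ρ * m) + (3 : ℝ) := by
            field_simp
            linear_combination (m : ℝ) * hρP
          rw [this, pow2_add, mul_assoc, pow2_three]
      _ ≤ pow2 (1 / P * (P * l + ρ * m) - (P - 1) / P * (P * k + ρ * m)) *
          (8 * ((C₂ + C₀) * (α k + β l))) := by
          gcongr
          · exact le_add_self
          · exact le_self_add
      _ = _ := by rw [hD]; ring

/-- The Hardy–Littlewood–Sobolev inequality. -/
theorem exists_hls {P ρ : ℝ} (hP1 : 1 < P) (hP2 : P < 2) (hρ : 0 < ρ) (h : 2 / P + 1 / ρ = 2)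
    (C₀ : ℝ≥0) : ∃ C : ℝ≥0, ∀ κ : ℝ → ℝ≥0∞, WeakType ρ C₀ κ → ∀ a b : ℝ → ℝ≥0∞,
      Measurable a → Measurable b →
      ∫⁻ z : ℝ × ℝ, κ (z.2 - z.1) * (a z.1 * b z.2) ≤
        C * ((∫⁻ s, a s ^ P) ^ (1 / P) * (∫⁻ t, b t ^ P) ^ (1 / P)) := by
  obtain ⟨C, hC⟩ := hls_normalized hP1 hP2 hρ h C₀
  have hP0 : 0 < P := by linarith
  have hP0' : 0 < 1 / P := by positivity
  -- The constant must not vanish, so that an infinite norm makes the right side infinite.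
  refine ⟨C + 1, fun κ hκ a b ha hb => ?_⟩
  have hzero : ∀ u : ℝ → ℝ≥0∞, Measurable u → ∫⁻ s, u s ^ P = 0 → u =ᵐ[volume] 0 := by
    intro u hu h0
    filter_upwards [(lintegral_eq_zero_iff (hu.pow_const P)).1 h0] with s hs
    exact (ENNReal.rpow_eq_zero_iff_of_pos hP0).1 hs
  rcases eq_or_ne (∫⁻ s, a s ^ P) 0 with a0 | a0
  · have : (fun z : ℝ × ℝ => κ (z.2 - z.1) * (a z.1 * b z.2)) =ᵐ[volume] 0 := by
      filter_upwards [Measure.quasiMeasurePreserving_fst.ae (hzero a ha a0)] with z hz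
      simp [show a z.1 = 0 from hz]
    rw [lintegral_congr_ae this]; simp
  rcases eq_or_ne (∫⁻ s, b s ^ P) 0 with b0 | b0
  · have : (fun z : ℝ × ℝ => κ (z.2 - z.1) * (a z.1 * b z.2)) =ᵐ[volume] 0 := by
      filter_upwards [Measure.quasiMeasurePreserving_snd.ae (hzero b hb b0)] with z hz
      simp [show b z.2 = 0 from hz]
    rw [lintegral_congr_ae this]; simp
  have hn : ∀ {x : ℝ≥0∞}, x ≠ 0 → x ^ (1 / P) ≠ 0 := fun hx h0 =>
    hx ((ENNReal.rpow_eq_zero_iff_of_pos hP0').1 h0)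
  rcases eq_or_ne (∫⁻ s, a s ^ P) ∞ with at' | at'
  · rw [at', ENNReal.top_rpow_of_pos hP0', ENNReal.top_mul (hn b0), ENNReal.mul_top (by simp)]
    exact le_top
  rcases eq_or_ne (∫⁻ s, b s ^ P) ∞ with bt | bt
  · rw [bt, ENNReal.top_rpow_of_pos hP0', ENNReal.mul_top (hn a0), ENNReal.mul_top (by simp)]
    exact le_top
  set x := (∫⁻ s, a s ^ P) ^ (1 / P) with hx
  set y := (∫⁻ s, b s ^ P) ^ (1 / P) with hy
  have hx0 : x ≠ 0 := hn a0
  have hy0 : y ≠ 0 := hn b0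
  have hxt : x ≠ ∞ := ENNReal.rpow_ne_top_of_nonneg hP0'.le at'
  have hyt : y ≠ ∞ := ENNReal.rpow_ne_top_of_nonneg hP0'.le bt
  have hnorm : ∀ (u : ℝ → ℝ≥0∞) (w : ℝ≥0∞), Measurable u → ∫⁻ s, u s ^ P ≠ 0 →
      ∫⁻ s, u s ^ P ≠ ∞ → w = (∫⁻ s, u s ^ P) ^ (1 / P) → ∫⁻ s, (w⁻¹ * u s) ^ P ≤ 1 := by
    intro u w hu h0 ht hw
    simp_rw [ENNReal.mul_rpow_of_nonneg _ _ hP0.le]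
    rw [lintegral_const_mul _ (hu.pow_const P), ENNReal.inv_rpow, hw, ← ENNReal.rpow_mul,
      one_div_mul_cancel hP0.ne', ENNReal.rpow_one, ENNReal.inv_mul_cancel h0 ht]
  have key := hC κ hκ (fun s => x⁻¹ * a s) (fun s => y⁻¹ * b s) (ha.const_mul _) (hb.const_mul _)
    (hnorm a x ha a0 at' hx) (hnorm b y hb b0 bt hy)
  calc ∫⁻ z : ℝ × ℝ, κ (z.2 - z.1) * (a z.1 * b z.2)
      = ∫⁻ z : ℝ × ℝ, (x * y) * (κ (z.2 - z.1) * (x⁻¹ * a z.1 * (y⁻¹ * b z.2))) := by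
        refine lintegral_congr fun z => ?_
        have e1 := ENNReal.mul_inv_cancel hx0 hxt
        have e2 := ENNReal.mul_inv_cancel hy0 hyt
        calc _ = (x * x⁻¹) * (y * y⁻¹) * (κ (z.2 - z.1) * (a z.1 * b z.2)) := by
              rw [e1, e2, one_mul, one_mul]
          _ = _ := by ring
    _ = (x * y) * ∫⁻ z : ℝ × ℝ, κ (z.2 - z.1) * (x⁻¹ * a z.1 * (y⁻¹ * b z.2)) :=
        lintegral_const_mul' _ _ (ENNReal.mul_ne_top hxt hyt)
    _ ≤ (x * y) * C := by gcongr
    _ ≤ _ := by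
        rw [mul_comm]
        gcongr
        exact_mod_cast le_self_add

end QuadSchrodinger

end

noncomputable section

namespace QuadSchrodinger

variable {d : ℕ}

/-! ### Dyadic levels of a function in `L²` -/

/-- Both components of `z`, clamped to `[-R, R]`. -/
def clampC (R : ℝ) (z : ℂ) : ℂ := ⟨max (-R) (min R z.re), max (-R) (min R z.im)⟩

lemma lipschitzWith_clampC (R : ℝ) : LipschitzWith 1 (clampC R) := by
  have h : ∀ x y : ℝ, |max (-R) (min R x) - max (-R) (min R y)| ≤ |x - y| := fun x y =>
    (abs_max_sub_max_le_max _ _ _ _).trans (max_le (by simp) ((abs_min_sub_min_le_max _ _ _ _).trans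
      (max_le (by simp) le_rfl)))
  refine LipschitzWith.of_dist_le_mul fun z w => ?_
  rw [NNReal.coe_one, one_mul, Complex.dist_eq_re_im, Complex.dist_eq_re_im]
  exact Real.sqrt_le_sqrt (add_le_add (sq_le_sq.2 (h _ _)) (sq_le_sq.2 (h _ _)))

lemma clampC_zero {R : ℝ} (hR : 0 ≤ R) : clampC R 0 = 0 := by
  simp [clampC, hR, Complex.ext_iff]

lemma clampC_eq_self {R : ℝ} {z : ℂ} (h : ‖z‖ ≤ R) : clampC R z = z := by
  have h1 := abs_le.1 ((Complex.abs_re_le_norm z).trans h)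
  have h2 := abs_le.1 ((Complex.abs_im_le_norm z).trans h)
  simp [clampC, h1.1, h1.2, h2.1, h2.2]

lemma abs_clamp_sub_le {r R x : ℝ} (hr : 0 ≤ r) (hR : r ≤ R) :
    |max (-R) (min R x) - max (-r) (min r x)| ≤ |x| ∧
      |max (-R) (min R x) - max (-r) (min r x)| ≤ R - r := by
  rcases le_total 0 x with hx | hx
  · rw [max_eq_right (by have := le_min (hr.trans hR) hx; linarith),
      max_eq_right (by have := le_min hr hx; linarith), abs_of_nonneg hx]
    have h1 : min r x ≤ min R x := min_le_min_right x hR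
    rw [abs_of_nonneg (by linarith)]
    constructor
    · linarith [min_le_right R x, le_min hr hx]
    · rcases le_total r x with h | h
      · rw [min_eq_left h]; linarith [min_le_left R x]
      · rw [min_eq_right h, min_eq_right (h.trans hR)]; linarith
  · rw [min_eq_right (hx.trans (hr.trans hR)), min_eq_right (hx.trans hr), abs_of_nonpos hx]
    have h1 : max (-R) x ≤ max (-r) x := max_le_max_right x (by linarith)
    rw [abs_of_nonpos (by linarith)]
    constructor
    · linarith [le_max_right (-R) x, max_le (show -r ≤ 0 by linarith) hx]
    · rcases le_total (-r) x with h | h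
      · rw [max_eq_right h, max_eq_right (by linarith)]; linarith
      · rw [max_eq_left h]; linarith [le_max_left (-R) x]

lemma norm_clampC_sub_le {r R : ℝ} (hr : 0 ≤ r) (hR : r ≤ R) (z : ℂ) :
    ‖clampC R z - clampC r z‖ ≤ ‖z‖ := by
  rw [← sq_le_sq₀ (norm_nonneg _) (norm_nonneg _), Complex.sq_norm, Complex.sq_norm,
    Complex.normSq_apply, Complex.normSq_apply]
  have h1 := sq_le_sq.2 (abs_clamp_sub_le (x := z.re) hr hR).1
  have h2 := sq_le_sq.2 (abs_clamp_sub_le (x := z.im) hr hR).1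
  simp only [clampC, Complex.sub_re, Complex.sub_im]
  nlinarith

/-- Each component changes by at most 2^{k+1} - 2^k = 2^k, the two together by at most 2^{k+1};
nothing changes where |z| ≤ 2^k. -/
lemma enorm_clampC_sub_le (k : ℤ) (z : ℂ) :
    ‖clampC (2 ^ (k + 1)) z - clampC (2 ^ k) z‖ₑ ≤ pow2 (k + 1) * above k ‖z‖ₑ := by
  have hp : (0 : ℝ) < 2 ^ k := by positivity
  have hk : (2 : ℝ) ^ (k + 1) = 2 * 2 ^ k := by rw [zpow_add_one₀ two_ne_zero, mul_comm]
  have hk' : (2 : ℝ) ^ k ≤ 2 ^ (k + 1) := by linarith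
  have hpow : ∀ m : ℤ, pow2 m = ENNReal.ofReal (2 ^ m) := fun m => by
    rw [pow2_eq_ofReal, Real.rpow_intCast]
  rw [above]
  split_ifs with h
  · rw [mul_one, ← Int.cast_one (R := ℝ), ← Int.cast_add, hpow, ← ofReal_norm]
    refine ENNReal.ofReal_le_ofReal ?_
    have h1 := (abs_clamp_sub_le (x := z.re) hp.le hk').2
    have h2 := (abs_clamp_sub_le (x := z.im) hp.le hk').2
    refine (Complex.norm_le_abs_re_add_abs_im _).trans ?_
    simp only [clampC, Complex.sub_re, Complex.sub_im]
    linarith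
  · have hz : ‖z‖ ≤ 2 ^ k := by
      rw [not_lt, hpow, ← ofReal_norm] at h
      exact (ENNReal.ofReal_le_ofReal_iff hp.le).1 h
    rw [clampC_eq_self hz, clampC_eq_self (hz.trans (by linarith))]
    simp

/-- Truncation of both components at height `2 ^ k`. -/
def truncation (k : ℤ) (φ : L2 d) : L2 d :=
  (lipschitzWith_clampC (2 ^ k)).compLp (clampC_zero (by positivity)) φ

/-- The part of `φ` of height about `2 ^ k`. -/
def level (k : ℤ) (φ : L2 d) : L2 d := truncation (k + 1) φ - truncation k φ

/-- The measure of the set where `2 ^ k < |φ|`. -/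
def levelVolume (k : ℤ) (φ : L2 d) : ℝ≥0∞ := ∫⁻ x, above k ‖φ x‖ₑ

lemma continuous_truncation (k : ℤ) : Continuous (truncation k : L2 d → L2 d) :=
  LipschitzWith.continuous_compLp (lipschitzWith_clampC _) (clampC_zero (by positivity))

lemma continuous_level (k : ℤ) : Continuous (level k : L2 d → L2 d) :=
  (continuous_truncation _).sub (continuous_truncation _)

lemma coeFn_truncation (k : ℤ) (φ : L2 d) : truncation k φ =ᵐ[volume] fun x => clampC (2 ^ k) (φ x) :=
  LipschitzWith.coeFn_compLp _ _ φ

lemma coeFn_truncation_sub (k l : ℤ) (φ : L2 d) : (truncation k φ - truncation l φ : L2 d)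
    =ᵐ[volume] fun x => clampC (2 ^ k) (φ x) - clampC (2 ^ l) (φ x) := by
  filter_upwards [Lp.coeFn_sub (truncation k φ) (truncation l φ), coeFn_truncation k φ,
    coeFn_truncation l φ] with x h1 h2 h3
  rw [h1, Pi.sub_apply, h2, h3]

lemma enorm_level_apply_le (k : ℤ) (φ : L2 d) :
    ∀ᵐ x, ‖level k φ x‖ₑ ≤ pow2 (k + 1) * above k ‖φ x‖ₑ := by
  filter_upwards [coeFn_truncation_sub (k + 1) k φ] with x hx
  rw [level, hx]
  exact enorm_clampC_sub_le k _

lemma eLpNorm_one_level_le (k : ℤ) (φ : L2 d) :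
    eLpNorm (level k φ) 1 volume ≤ pow2 (k + 1) * levelVolume k φ := by
  rw [eLpNorm_one_eq_lintegral_enorm, levelVolume, ← lintegral_const_mul' _ _ (pow2_ne_top _)]
  exact lintegral_mono_ae (enorm_level_apply_le k φ)

lemma above_rpow (k : ℤ) (y : ℝ≥0∞) {p : ℝ} (hp : 0 < p) : above k y ^ p = above k y := by
  rw [above]; split_ifs <;> simp [hp]

lemma enorm_level_le (k : ℤ) (φ : L2 d) :
    ‖level k φ‖ₑ ≤ pow2 (k + 1) * levelVolume k φ ^ (1 / 2 : ℝ) := by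
  rw [Lp.enorm_def, eLpNorm_eq_lintegral_rpow_enorm_toReal two_ne_zero ENNReal.ofNat_ne_top,
    ENNReal.toReal_ofNat]
  calc (∫⁻ x, ‖level k φ x‖ₑ ^ (2 : ℝ)) ^ (1 / 2 : ℝ)
      ≤ (∫⁻ x, pow2 (k + 1) ^ (2 : ℝ) * above k ‖φ x‖ₑ) ^ (1 / 2 : ℝ) := by
        refine ENNReal.rpow_le_rpow (lintegral_mono_ae ?_) (by norm_num)
        filter_upwards [enorm_level_apply_le k φ] with x hx
        calc _ ≤ (pow2 (k + 1) * above k ‖φ x‖ₑ) ^ (2 : ℝ) := by gcongr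
          _ = _ := by rw [ENNReal.mul_rpow_of_nonneg _ _ zero_le_two, above_rpow _ _ two_pos]
    _ = _ := by
        rw [lintegral_const_mul' _ _ (by rw [pow2_rpow]; exact pow2_ne_top _),
          ENNReal.mul_rpow_of_nonneg _ _ (by norm_num), ← ENNReal.rpow_mul, levelVolume]
        norm_num

/-- The layer-cake formula in discrete form, integrated in x. This is how L^p norms enter the dyadic
sums. -/
lemma exists_tsum_levelVolume_le {p : ℝ≥0∞} (h0 : p ≠ 0) (ht : p ≠ ∞) : ∃ C : ℝ≥0, ∀ φ : L2 d,
    ∑' k : ℤ, pow2 (p.toReal * k) * levelVolume k φ ≤ C * eLpNorm φ p volume ^ p.toReal := by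
  have hp := ENNReal.toReal_pos h0 ht
  obtain ⟨C, hC⟩ := exists_tsum_above_le hp
  refine ⟨C, fun φ => ?_⟩
  have hm : AEMeasurable (fun x => ‖φ x‖ₑ) := (Lp.aestronglyMeasurable φ).enorm
  have hm' : ∀ k : ℤ, AEMeasurable (fun x => above k ‖φ x‖ₑ) := fun k =>
    (measurable_above k).comp_aemeasurable hm
  simp only [levelVolume]
  calc ∑' k : ℤ, pow2 (p.toReal * k) * ∫⁻ x, above k ‖φ x‖ₑ
      = ∫⁻ x, ∑' k : ℤ, pow2 (p.toReal * k) * above k ‖φ x‖ₑ := by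
        rw [lintegral_tsum fun k => (hm' k).const_mul _]
        exact tsum_congr fun k => (lintegral_const_mul' _ _ (pow2_ne_top _)).symm
    _ ≤ ∫⁻ x, C * ‖φ x‖ₑ ^ p.toReal := lintegral_mono fun x => hC _
    _ = _ := by
        rw [lintegral_const_mul' _ _ ENNReal.coe_ne_top, eLpNorm_eq_lintegral_rpow_enorm_toReal h0 ht,
          ← ENNReal.rpow_mul, one_div_mul_cancel hp.ne', ENNReal.rpow_one]

/-! ### Measurability of functionals on `L²` -/

attribute [local instance] borel

lemma exists_ae_tendsto_of_tendsto_L2 {u : ℕ → L2 d} {φ : L2 d} (h : Tendsto u atTop (𝓝 φ)) :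
    ∃ ns : ℕ → ℕ, StrictMono ns ∧
      ∀ᵐ x, Tendsto (fun n => u (ns n) x) atTop (𝓝 (φ x)) :=
  (tendstoInMeasure_of_tendsto_Lp h).exists_seq_tendsto_ae

/-- L² convergence gives almost everywhere convergence of a subsequence, and the L^r norm is lower
semicontinuous under it. Hence the L^r norm is a Borel function on L², and s ↦ ‖F(s)‖_r is
measurable. -/
lemma isClosed_eLpNorm_le (r c : ℝ≥0∞) : IsClosed {φ : L2 d | eLpNorm φ r volume ≤ c} := by
  refine isSeqClosed_iff_isClosed.1 fun u φ hu h => ?_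
  obtain ⟨ns, -, hns⟩ := exists_ae_tendsto_of_tendsto_L2 h
  exact Lp.eLpNorm_le_of_ae_tendsto (Eventually.of_forall fun n => hu (ns n))
    (fun n => Lp.aestronglyMeasurable _) hns

/-- The condition 2^k < |φ(x)| is strict, so it persists under small changes and Fatou's lemma
applies. -/
lemma isClosed_levelVolume_le (k : ℤ) (c : ℝ≥0∞) : IsClosed {φ : L2 d | levelVolume k φ ≤ c} := by
  refine isSeqClosed_iff_isClosed.1 fun u φ hu h => ?_
  obtain ⟨ns, -, hns⟩ := exists_ae_tendsto_of_tendsto_L2 h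
  refine le_trans (b := ∫⁻ x, liminf (fun n => above k ‖u (ns n) x‖ₑ) atTop) ?_ ?_
  · refine lintegral_mono_ae ?_
    filter_upwards [hns] with x hx
    rw [above]
    split_ifs with hk
    · refine le_liminf_of_le (by isBoundedDefault) ?_
      filter_upwards [(hx.enorm).eventually (lt_mem_nhds hk)] with n hn
      rw [above, if_pos hn]
    · exact zero_le
  · refine (lintegral_liminf_le' fun n => (measurable_above k).comp_aemeasurable
      (Lp.aestronglyMeasurable _).enorm).trans ?_
    refine liminf_le_of_le (by isBoundedDefault) fun b hb => ?_
    obtain ⟨n, hn⟩ := hb.exists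
    exact hn.trans (hu (ns n))

lemma measurable_eLpNorm_comp {F : ℝ → L2 d} (hF : StronglyMeasurable F) (r : ℝ≥0∞) :
    Measurable fun s => eLpNorm (F s) r volume := by
  have : BorelSpace (L2 d) := ⟨rfl⟩
  have h : Measurable fun φ : L2 d => eLpNorm φ r volume :=
    measurable_of_Iic fun c => (isClosed_eLpNorm_le r c).measurableSet
  exact h.comp hF.measurable

lemma aemeasurable_eLpNorm_comp {F : ℝ → L2 d} (hF : AEStronglyMeasurable F) (r : ℝ≥0∞) :
    AEMeasurable fun s => eLpNorm (F s) r volume :=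
  ⟨_, measurable_eLpNorm_comp hF.stronglyMeasurable_mk r,
    hF.ae_eq_mk.mono fun s hs => by beta_reduce; rw [hs]⟩

lemma measurable_levelVolume_comp {F : ℝ → L2 d} (hF : StronglyMeasurable F) (k : ℤ) :
    Measurable fun s => levelVolume k (F s) := by
  have : BorelSpace (L2 d) := ⟨rfl⟩
  have h : Measurable fun φ : L2 d => levelVolume k φ :=
    measurable_of_Iic fun c => (isClosed_levelVolume_le k c).measurableSet
  exact h.comp hF.measurable

/-! ### Reconstruction from the levels -/

/-- `{-N, …, N - 1}`. -/
def dyadicWindow (N : ℕ) : Finset ℤ :=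
  (Finset.range (2 * N)).map ⟨fun i : ℕ => (i : ℤ) - N, fun a b h => by simpa using h⟩

lemma sum_dyadicWindow_sub {M : Type*} [AddCommGroup M] (u : ℤ → M) (N : ℕ) :
    ∑ k ∈ dyadicWindow N, (u (k + 1) - u k) = u N - u (-N) := by
  rw [dyadicWindow, Finset.sum_map]
  have h := Finset.sum_range_sub (fun i : ℕ => u ((i : ℤ) - N)) (2 * N)
  refine Eq.trans (Finset.sum_congr rfl fun i _ => ?_) (h.trans ?_)
  · change u ((i : ℤ) - N + 1) - u ((i : ℤ) - N) = u (((i + 1 : ℕ) : ℤ) - N) - u ((i : ℤ) - N)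
    congr 2
    push_cast; ring
  · congr 2 <;> push_cast <;> ring

lemma sum_level (N : ℕ) (φ : L2 d) :
    ∑ k ∈ dyadicWindow N, level k φ = truncation N φ - truncation (-N) φ :=
  sum_dyadicWindow_sub (fun k => truncation k φ) N

lemma norm_truncation_sub_le {k l : ℤ} (h : k ≤ l) (φ : L2 d) :
    ∀ᵐ x, ‖(truncation l φ - truncation k φ : L2 d) x‖ ≤ ‖φ x‖ := by
  filter_upwards [coeFn_truncation_sub l k φ] with x hx
  rw [hx]
  exact norm_clampC_sub_le (by positivity) (zpow_le_zpow_right₀ one_le_two h) _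

/-- The sum telescopes to a difference of two clamps, dominated pointwise by |φ|; this supplies the
majorants for dominated convergence. -/
lemma norm_sum_level_le (N : ℕ) (φ : L2 d) : ‖∑ k ∈ dyadicWindow N, level k φ‖ ≤ ‖φ‖ := by
  rw [sum_level]
  exact Lp.norm_le_norm_of_ae_le (norm_truncation_sub_le (by omega) φ)

lemma tendsto_clampC_sub (z : ℂ) :
    Tendsto (fun N : ℕ => clampC (2 ^ (N : ℤ)) z - clampC (2 ^ (-(N : ℤ))) z) atTop (𝓝 z) := by
  have h1 : Tendsto (fun N : ℕ => clampC (2 ^ (N : ℤ)) z) atTop (𝓝 z) := by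
    refine tendsto_const_nhds.congr' ?_
    filter_upwards [(tendsto_pow_atTop_atTop_of_one_lt (one_lt_two (α := ℝ))).eventually_ge_atTop ‖z‖]
      with N hN
    rw [zpow_natCast, clampC_eq_self hN]
  have h2 : Tendsto (fun N : ℕ => clampC (2 ^ (-(N : ℤ))) z) atTop (𝓝 0) := by
    have h3 : Tendsto (fun N : ℕ => 2 * ((2 : ℝ)⁻¹) ^ N) atTop (𝓝 0) := by
      simpa using (tendsto_pow_atTop_nhds_zero_of_lt_one (r := (2 : ℝ)⁻¹) (by norm_num)
        (by norm_num)).const_mul 2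
    refine squeeze_zero_norm (fun N => ?_) h3
    have hp : (0 : ℝ) ≤ 2 ^ (-(N : ℤ)) := by positivity
    have h4 : ∀ x : ℝ, |max (-(2 : ℝ) ^ (-(N : ℤ))) (min (2 ^ (-(N : ℤ))) x)| ≤ 2 ^ (-(N : ℤ)) :=
      fun x => abs_le.2 ⟨le_max_left _ _, max_le (by linarith) (min_le_left _ _)⟩
    rw [inv_pow, ← zpow_natCast, ← zpow_neg]
    refine (Complex.norm_le_abs_re_add_abs_im _).trans ?_
    simp only [clampC]
    linarith [h4 z.re, h4 z.im]
  simpa using h1.sub h2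

lemma tendsto_sum_level (φ : L2 d) :
    Tendsto (fun N => ∑ k ∈ dyadicWindow N, level k φ) atTop (𝓝 φ) := by
  rw [Lp.tendsto_Lp_iff_tendsto_eLpNorm']
  simp only [sum_level]
  have h0 : ∀ N : ℕ, eLpNorm (⇑(truncation N φ - truncation (-N) φ : L2 d) - ⇑φ) 2 volume =
      (∫⁻ x, ‖clampC (2 ^ (N : ℤ)) (φ x) - clampC (2 ^ (-(N : ℤ))) (φ x) - φ x‖ₑ ^ (2 : ℝ)) ^
        (1 / 2 : ℝ) := fun N => by
    rw [eLpNorm_eq_lintegral_rpow_enorm_toReal two_ne_zero ENNReal.ofNat_ne_top,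
      ENNReal.toReal_ofNat]
    congr 1
    refine lintegral_congr_ae ?_
    filter_upwards [coeFn_truncation_sub N (-N) φ] with x hx
    rw [Pi.sub_apply, hx]
  simp only [h0]
  have hz : (0 : ℝ≥0∞) = (0 : ℝ≥0∞) ^ (1 / 2 : ℝ) := by simp
  rw [hz]
  refine ((ENNReal.continuous_rpow_const (y := 1 / 2)).tendsto 0).comp ?_
  have hφ : ∫⁻ x, ((2 : ℝ≥0∞) ^ (2 : ℝ)) * ‖φ x‖ₑ ^ (2 : ℝ) ≠ ∞ := by
    rw [lintegral_const_mul' _ _ (by norm_num)]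
    refine ENNReal.mul_ne_top (by norm_num) ?_
    have := (eLpNorm_lt_top_iff_lintegral_rpow_enorm_lt_top two_ne_zero ENNReal.ofNat_ne_top).1
      (Lp.memLp φ).2
    simpa using this.ne
  have := tendsto_lintegral_of_dominated_convergence' (μ := (volume : Measure (Space d)))
    (F := fun (N : ℕ) x => ‖clampC (2 ^ (N : ℤ)) (φ x) - clampC (2 ^ (-(N : ℤ))) (φ x) - φ x‖ₑ ^ (2 : ℝ))
    (f := fun _ => 0) _ ?_ ?_ hφ ?_
  · simpa using this
  · intro N
    have hc := fun R : ℝ => (lipschitzWith_clampC R).continuous.comp_aestronglyMeasurable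
      (Lp.aestronglyMeasurable φ)
    exact (((hc _).sub (hc _)).sub (Lp.aestronglyMeasurable φ)).enorm.pow_const _
  · intro N
    refine Eventually.of_forall fun x => ?_
    beta_reduce
    rw [← ENNReal.mul_rpow_of_nonneg _ _ zero_le_two]
    refine ENNReal.rpow_le_rpow ?_ zero_le_two
    rw [two_mul]
    refine (enorm_sub_le).trans (add_le_add ?_ le_rfl)
    rw [← ofReal_norm, ← ofReal_norm]
    exact ENNReal.ofReal_le_ofReal (norm_clampC_sub_le (by positivity)
      (zpow_le_zpow_right₀ one_le_two (by omega)) _)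
  · refine Eventually.of_forall fun x => ?_
    have h := ((tendsto_clampC_sub (φ x)).sub_const (φ x)).enorm
    rw [sub_self, enorm_zero] at h
    have h2 := ((ENNReal.continuous_rpow_const (y := 2)).tendsto 0).comp h
    simpa [Function.comp_def] using h2

end QuadSchrodinger

end

noncomputable section

namespace QuadSchrodinger

variable {d : ℕ}

/-! ### Duality in `L²` and in the mixed norms -/

/-- Division by J^{1/Q'}, legitimate only for finite J; for this reason the duality arguments below
work with truncations. -/
lemma rpow_le_of_le_mul_rpow {J M : ℝ≥0∞} {Q Q' : ℝ} (hQ : Q.HolderConjugate Q') (hJ : J ≠ ∞)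
    (h : J ≤ M * J ^ (1 / Q')) : J ^ (1 / Q) ≤ M := by
  rcases eq_or_ne J 0 with rfl | h0
  · rw [ENNReal.zero_rpow_of_pos (one_div_pos.2 hQ.pos)]
    exact zero_le
  · have h1 : J ^ (1 / Q) * J ^ (1 / Q') = J := by
      rw [← ENNReal.rpow_add _ _ h0 hJ, one_div, one_div, hQ.inv_add_inv_eq_one, ENNReal.rpow_one]
    have h2 : J ^ (1 / Q') ≠ 0 := by simp [h0, hJ]
    have h3 : J ^ (1 / Q') ≠ ∞ := ENNReal.rpow_ne_top_of_nonneg (by have := hQ.symm.pos; positivity) hJ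
    exact (ENNReal.mul_le_mul_iff_left h2 h3).1 (h1.le.trans h)

/-- The test functions of the converse Hölder inequality are w(|φ|)φ; boundedness of w keeps them in
L². -/
lemma exists_weight (φ : L2 d) {w : ℝ → ℝ} (hw : Measurable w) (h0 : ∀ x, 0 ≤ w x) {B : ℝ}
    (hB : ∀ x, w x ≤ B) : ∃ g : L2 d, (g =ᵐ[volume] fun x => (w ‖φ x‖ : ℂ) * φ x) ∧
      ‖inner ℂ g φ‖ₑ = ∫⁻ x, ENNReal.ofReal (w ‖φ x‖) * ‖φ x‖ₑ ^ 2 := by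
  have hm : AEStronglyMeasurable (fun x => (w ‖φ x‖ : ℂ) * φ x) := by
    have h1 : AEMeasurable (fun x => w ‖φ x‖) :=
      hw.comp_aemeasurable (Lp.aestronglyMeasurable φ).norm.aemeasurable
    exact (Complex.measurable_ofReal.comp_aemeasurable h1).aestronglyMeasurable.mul
      (Lp.aestronglyMeasurable φ)
  have hL : MemLp (fun x => (w ‖φ x‖ : ℂ) * φ x) 2 :=
    (Lp.memLp φ).of_le_mul hm (c := B) (Eventually.of_forall fun x => by
      rw [norm_mul, Complex.norm_real, Real.norm_of_nonneg (h0 _)]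
      exact mul_le_mul_of_nonneg_right (hB _) (norm_nonneg _))
  have hg := hL.coeFn_toLp
  refine ⟨hL.toLp, hg, ?_⟩
  have h1 : (fun x => inner ℂ (hL.toLp _ x) (φ x)) =ᵐ[volume]
      fun x => ((w ‖φ x‖ * ‖φ x‖ ^ 2 : ℝ) : ℂ) := by
    filter_upwards [hg] with x hx
    rw [hx, ← smul_eq_mul, inner_smul_left, Complex.conj_ofReal, inner_self_eq_norm_sq_to_K]
    push_cast; rfl
  have h2 : Integrable fun x => w ‖φ x‖ * ‖φ x‖ ^ 2 := by
    have := ((L2.integrable_inner (𝕜 := ℂ) (hL.toLp _) φ).congr h1).re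
    exact this
  rw [L2.inner_def, integral_congr_ae h1, integral_complex_ofReal, ← ofReal_norm,
    Complex.norm_real, Real.norm_of_nonneg (integral_nonneg fun x => mul_nonneg (h0 _) (sq_nonneg _)),
    ofReal_integral_eq_lintegral_ofReal h2
      (Eventually.of_forall fun x => mul_nonneg (h0 _) (sq_nonneg _))]
  refine lintegral_congr fun x => ?_
  rw [ENNReal.ofReal_mul (h0 _), ENNReal.ofReal_pow (norm_nonneg _), ofReal_norm]

lemma enorm_inner_le_mul_eLpNorm {φ : L2 d} {c r' : ℝ≥0∞} (hr' : r' ≠ 0)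
    (h : ∀ g : L2 d, eLpNorm g r' volume ≤ 1 → ‖inner ℂ g φ‖ₑ ≤ c) (g : L2 d)
    (hg : eLpNorm g r' volume ≠ ∞) : ‖inner ℂ g φ‖ₑ ≤ c * eLpNorm g r' volume := by
  rcases eq_or_ne (eLpNorm g r' volume) 0 with h0 | h0
  · have : g = 0 := by
      refine Lp.ext ?_
      filter_upwards [(eLpNorm_eq_zero_iff (Lp.aestronglyMeasurable g) hr').1 h0,
        Lp.coeFn_zero ℂ 2 (volume : Measure (Space d))] with x h1 h2
      rw [h1, h2]
    simp [this]
  · set a := (eLpNorm g r' volume).toReal with ha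
    have ha0 : 0 < a := ENNReal.toReal_pos h0 hg
    have haa : eLpNorm g r' volume = ‖(a : ℂ)‖ₑ := by
      rw [← ofReal_norm, Complex.norm_real, Real.norm_of_nonneg ha0.le, ENNReal.ofReal_toReal hg]
    have h1 := h (((a⁻¹ : ℝ) : ℂ) • g) (by
      rw [eLpNorm_congr_ae (Lp.coeFn_smul _ _), eLpNorm_const_smul, haa, ← enorm_mul]
      rw [← Complex.ofReal_mul, inv_mul_cancel₀ ha0.ne']
      simp)
    have h2 : g = (a : ℂ) • (((a⁻¹ : ℝ) : ℂ) • g) := by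
      rw [smul_smul, ← Complex.ofReal_mul, mul_inv_cancel₀ ha0.ne', Complex.ofReal_one, one_smul]
    rw [haa, mul_comm]
    calc ‖inner ℂ g φ‖ₑ = ‖(a : ℂ)‖ₑ * ‖inner ℂ (((a⁻¹ : ℝ) : ℂ) • g) φ‖ₑ := by
          nth_rw 1 [h2]
          rw [inner_smul_left, enorm_mul, Complex.conj_ofReal]
      _ ≤ _ := by gcongr

/-- Converse Hölder inequality. -/
lemma eLpNorm_le_of_forall_inner_le {r r' : ℝ≥0∞} (hr : 2 ≤ r) [hrr : r.HolderConjugate r']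
    {φ : L2 d} {c : ℝ≥0∞} (h : ∀ g : L2 d, eLpNorm g r' volume ≤ 1 → ‖inner ℂ g φ‖ₑ ≤ c) :
    eLpNorm φ r volume ≤ c := by
  have hr0' : r' ≠ 0 := ENNReal.HolderConjugate.ne_zero r' r
  have h' := enorm_inner_le_mul_eLpNorm hr0' h
  have hφm : AEMeasurable (fun x => ‖φ x‖ₑ) := (Lp.aestronglyMeasurable φ).enorm
  rcases eq_or_ne r ∞ with rfl | hrt
  · have hr1 : r' = 1 := (ENNReal.HolderConjugate.eq_top_iff_eq_one ∞ r').1 rfl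
    subst hr1
    by_contra! hc
    obtain ⟨b, hcb, hb⟩ := exists_between hc
    have hb0 : b ≠ 0 := (zero_le.trans_lt hcb).ne'
    have hbt : b ≠ ∞ := hb.ne_top
    set A : ℝ≥0∞ := volume {x | b < ‖φ x‖ₑ} with hA
    have hA0 : A ≠ 0 := fun h0 => by
      refine hb.not_ge ?_
      rw [eLpNorm_exponent_top]
      refine essSup_le_of_ae_le _ ?_
      have : ∀ᵐ x, ¬ b < ‖φ x‖ₑ := by rw [ae_iff]; simpa using h0
      filter_upwards [this] with x hx using not_lt.1 hx
    have hms : NullMeasurableSet {x | b < ‖φ x‖ₑ} := nullMeasurableSet_lt aemeasurable_const hφm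
    set w : ℝ → ℝ := fun x => if b.toReal < x then x⁻¹ else 0 with hw
    have hb' : 0 < b.toReal := ENNReal.toReal_pos hb0 hbt
    have hiff : ∀ x, b.toReal < ‖φ x‖ ↔ b < ‖φ x‖ₑ := fun x => by
      rw [← ofReal_norm, ENNReal.lt_ofReal_iff_toReal_lt hbt]
    have hwm : Measurable w := Measurable.ite measurableSet_Ioi measurable_inv measurable_const
    obtain ⟨g, hg1, hg2⟩ := exists_weight φ hwm (fun x => by
      rw [hw]; beta_reduce; split_ifs with h
      · exact inv_nonneg.2 (hb'.le.trans h.le)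
      · exact le_rfl) (B := b.toReal⁻¹) (fun x => by
      rw [hw]; beta_reduce; split_ifs with h
      · exact inv_anti₀ hb' h.le
      · exact inv_nonneg.2 hb'.le)
    have hgn : eLpNorm g 1 volume = A := by
      rw [eLpNorm_one_eq_lintegral_enorm, hA, ← lintegral_indicator_one₀ hms]
      refine lintegral_congr_ae ?_
      filter_upwards [hg1] with x hx
      rw [hx, enorm_mul, ← ofReal_norm, Complex.norm_real]
      simp only [hw]
      by_cases hx2 : b < ‖φ x‖ₑ
      · have h3 := (hiff x).2 hx2
        have h4 : 0 < ‖φ x‖ := hb'.trans h3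
        rw [if_pos h3, indicator_of_mem (by exact hx2), norm_inv, norm_norm, ← ofReal_norm,
          ← ENNReal.ofReal_mul (by positivity), inv_mul_cancel₀ h4.ne']
        simp
      · rw [if_neg fun h => hx2 ((hiff x).1 h), indicator_of_notMem (by exact hx2)]
        simp
    have hgi : b * A ≤ ‖inner ℂ g φ‖ₑ := by
      rw [hg2, hA, ← lintegral_indicator_one₀ hms, ← lintegral_const_mul' _ _ hbt]
      refine lintegral_mono fun x => ?_
      by_cases hx2 : b < ‖φ x‖ₑ
      · have h3 := (hiff x).2 hx2
        have h4 : 0 < ‖φ x‖ := hb'.trans h3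
        simp only [hw]
        rw [if_pos h3, indicator_of_mem (by exact hx2), Pi.one_apply, mul_one, sq, ← mul_assoc,
          ← ofReal_norm, ← ENNReal.ofReal_mul (by positivity), inv_mul_cancel₀ h4.ne',
          ENNReal.ofReal_one, one_mul, ofReal_norm]
        exact hx2.le
      · rw [indicator_of_notMem (by exact hx2), mul_zero]
        exact zero_le
    -- The pairing of two L² functions is finite and bounds bA, so the superlevel set has finite
    -- measure.
    have hAt : A ≠ ∞ := fun hAt => by
      rw [hAt, ENNReal.mul_top hb0, top_le_iff] at hgi
      exact enorm_ne_top hgi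
    have := hgi.trans (h' g (by rwa [hgn]))
    rw [hgn] at this
    exact hcb.not_ge ((ENNReal.mul_le_mul_iff_left hA0 hAt).1 this)
  · have hrt' : r' ≠ ∞ := fun h1 => by
      have := (ENNReal.HolderConjugate.eq_top_iff_eq_one r' r).1 h1
      rw [this] at hr
      exact absurd hr (by norm_num)
    have hR := ENNReal.HolderConjugate.toReal_of_ne_top hrt hrt'
    have h2R : 2 ≤ r.toReal := by
      rw [← ENNReal.toReal_ofNat 2]; exact ENNReal.toReal_mono hrt hr
    set R := r.toReal
    set R' := r'.toReal
    have hr0 : r ≠ 0 := ENNReal.HolderConjugate.ne_zero r r'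
    have hlt : ∀ (n : ℕ) (y : ℝ≥0∞), y ≤ n → y ≠ ∞ := fun n y h =>
      ne_top_of_le_ne_top (ENNReal.natCast_ne_top n) h
    set I : ℕ → ℝ≥0∞ := fun n => ∫⁻ x, if ‖φ x‖ₑ ≤ n then ‖φ x‖ₑ ^ R else 0 with hI
    have hIn : ∀ n, I n ^ (1 / R) ≤ c := fun n => by
      -- The extremal weight |φ|^{r-2}, cut off where |φ| > n. Since r ≥ 2 it is bounded by n^{r-2}.
      set w : ℝ → ℝ := fun x => if |x| ≤ n then |x| ^ (R - 2) else 0 with hw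
      have hwm : Measurable w := Measurable.ite (measurableSet_le (by fun_prop) measurable_const)
        (by fun_prop) measurable_const
      obtain ⟨g, hg1, hg2⟩ := exists_weight φ hwm (fun x => by
        rw [hw]; beta_reduce; split_ifs
        · positivity
        · exact le_rfl) (B := (n : ℝ) ^ (R - 2)) (fun x => by
        rw [hw]; beta_reduce; split_ifs with h
        · exact Real.rpow_le_rpow (abs_nonneg _) h (by linarith)
        · positivity)
      have hiff : ∀ x, |‖φ x‖| ≤ n ↔ ‖φ x‖ₑ ≤ n := fun x => by
        rw [abs_norm, ← ofReal_norm, ENNReal.ofReal_le_natCast]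
      have hwx : ∀ x, ENNReal.ofReal (w ‖φ x‖) = if ‖φ x‖ₑ ≤ n then ‖φ x‖ₑ ^ (R - 2) else 0 :=
        fun x => by
        simp only [hw, hiff]
        split_ifs
        · rw [abs_norm, ← ENNReal.ofReal_rpow_of_nonneg (norm_nonneg _) (by linarith), ofReal_norm]
        · exact ENNReal.ofReal_zero
      have hw0 : ∀ x, 0 ≤ w x := fun x => by
        rw [hw]; beta_reduce; split_ifs
        · positivity
        · exact le_rfl
      have hgi : ‖inner ℂ g φ‖ₑ = I n := by
        rw [hg2, hI]
        refine lintegral_congr fun x => ?_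
        rw [hwx]
        split_ifs
        · rw [← ENNReal.rpow_ofNat, ← ENNReal.rpow_add_of_nonneg _ _ (by linarith) zero_le_two]
          congr 1; ring
        · exact zero_mul _
      have hgn : eLpNorm g r' volume = I n ^ (1 / R') := by
        rw [eLpNorm_eq_lintegral_rpow_enorm_toReal hr0' hrt']
        congr 1
        refine lintegral_congr_ae ?_
        filter_upwards [hg1] with x hx
        rw [hx, enorm_mul, ← ofReal_norm, Complex.norm_real, Real.norm_of_nonneg (hw0 _), hwx]
        split_ifs
        · nth_rw 2 [← ENNReal.rpow_one ‖φ x‖ₑ]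
          rw [← ENNReal.rpow_add_of_nonneg _ _ (by linarith) zero_le_one, ← ENNReal.rpow_mul]
          congr 1
          have := hR.sub_one_mul_conj
          change (R - 2 + 1) * R' = R
          linarith
        · rw [zero_mul, ENNReal.zero_rpow_of_pos hR.symm.pos]
      have hIt : I n ≠ ∞ := by rw [← hgi]; exact enorm_ne_top
      refine rpow_le_of_le_mul_rpow hR hIt ?_
      rw [← hgi, hgi, ← hgn, ← hgi]
      refine h' g ?_
      rw [hgn]
      exact ENNReal.rpow_ne_top_of_nonneg (by have := hR.symm.pos; positivity) hIt
    have hlim : Tendsto I atTop (𝓝 (∫⁻ x, ‖φ x‖ₑ ^ R)) := by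
      refine lintegral_tendsto_of_tendsto_of_monotone (fun n => ?_) ?_ ?_
      · exact (Measurable.ite measurableSet_Iic (by fun_prop) measurable_const :
          Measurable fun y : ℝ≥0∞ => if y ≤ n then y ^ R else 0).comp_aemeasurable hφm
      · refine Eventually.of_forall fun x n m hnm => ?_
        beta_reduce
        split_ifs with h1 h2
        · exact le_rfl
        · exact absurd (h1.trans (by exact_mod_cast hnm)) h2
        · exact zero_le
        · exact le_rfl
      · refine Eventually.of_forall fun x => tendsto_const_nhds.congr' ?_
        obtain ⟨m, hm⟩ := ENNReal.exists_nat_gt (enorm_ne_top (x := φ x))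
        filter_upwards [eventually_ge_atTop m] with n hn
        rw [if_pos (hm.le.trans (by exact_mod_cast hn))]
    rw [eLpNorm_eq_lintegral_rpow_enorm_toReal hr0 hrt]
    exact le_of_tendsto' (((ENNReal.continuous_rpow_const (y := 1 / R)).tendsto _).comp hlim) hIn

/-- A countable family that computes all `Lʳ` norms on `L²`. -/
lemma exists_norming_sequence {r r' : ℝ≥0∞} (hr : 2 ≤ r) [r.HolderConjugate r'] :
    ∃ g : ℕ → L2 d, (∀ n, eLpNorm (g n) r' volume ≤ 1) ∧
      ∀ φ : L2 d, eLpNorm φ r volume ≤ ⨆ n, ‖inner ℂ (g n) φ‖ₑ := by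
  let S : Set (L2 d) := {g | eLpNorm g r' volume ≤ 1}
  have h0 : (0 : L2 d) ∈ S := by
    change eLpNorm (0 : L2 d) r' volume ≤ 1
    rw [eLpNorm_congr_ae (Lp.coeFn_zero ℂ 2 _), eLpNorm_zero]
    exact zero_le
  have : Nonempty S := ⟨⟨0, h0⟩⟩
  have : Fact ((2 : ℝ≥0∞) ≠ ∞) := ⟨ENNReal.ofNat_ne_top⟩
  -- L² is separable, and the pairing with φ is continuous in the L² topology; density in the L^{r'}
  -- norm is not needed.
  obtain ⟨u, hu⟩ := TopologicalSpace.exists_dense_seq S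
  refine ⟨fun n => u n, fun n => (u n).2, fun φ => ?_⟩
  refine eLpNorm_le_of_forall_inner_le (r' := r') hr fun g hg => ?_
  have hc : Continuous fun g : S => ‖inner ℂ (g : L2 d) φ‖ₑ := by fun_prop
  exact hu.induction_on (p := fun g : S => ‖inner ℂ (g : L2 d) φ‖ₑ ≤ ⨆ n, ‖inner ℂ (u n : L2 d) φ‖ₑ)
    ⟨g, hg⟩ (isClosed_le hc continuous_const)
    fun n => le_iSup (fun n => ‖inner ℂ (u n : L2 d) φ‖ₑ) n

end QuadSchrodinger

end

noncomputable section

namespace QuadSchrodinger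

variable {d : ℕ}

/-! ### Duality and Hölder's inequality in the mixed norms -/

lemma mixedNorm_eq_lintegral {q : ℝ≥0∞} (h0 : q ≠ 0) (ht : q ≠ ∞) (r : ℝ≥0∞) (F : ℝ → Space d → ℂ) :
    mixedNorm q r F = (∫⁻ t, eLpNorm (F t) r volume ^ q.toReal) ^ (1 / q.toReal) := by
  rw [mixedNorm, eLpNorm_eq_lintegral_rpow_enorm_toReal h0 ht]
  rfl

lemma mixedNorm_congr (q r : ℝ≥0∞) {F G : ℝ → L2 d} (h : F =ᵐ[volume] G) :
    mixedNorm q r (fun t => (F t : Space d → ℂ)) = mixedNorm q r (fun t => (G t : Space d → ℂ)) :=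
  eLpNorm_congr_ae (h.mono fun t ht => by beta_reduce; rw [ht])

/-- Compare one new function at a time on the measurable set where it does better. The selector
takes finitely many values, hence is bounded and measurable. -/
lemma exists_measurable_selector {Φ : ℝ → L2 d} (hΦ : StronglyMeasurable Φ) (g : ℕ → L2 d) (N : ℕ) :
    ∃ γ : ℝ → L2 d, StronglyMeasurable γ ∧ (∀ t, ∃ n, γ t = g n) ∧ (∃ B, ∀ t, ‖γ t‖ ≤ B) ∧
      ∀ t, ∀ n ≤ N, ‖inner ℂ (g n) (Φ t)‖ₑ ≤ ‖inner ℂ (γ t) (Φ t)‖ₑ := by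
  induction N with
  | zero =>
    refine ⟨fun _ => g 0, stronglyMeasurable_const, fun _ => ⟨0, rfl⟩, ⟨‖g 0‖, fun _ => le_rfl⟩,
      fun t n hn => ?_⟩
    rw [Nat.le_zero.1 hn]
  | succ N ih =>
    obtain ⟨γ, h1, h2, ⟨B, hB⟩, h3⟩ := ih
    classical
    have hs : MeasurableSet {t | ‖inner ℂ (γ t) (Φ t)‖ₑ < ‖inner ℂ (g (N + 1)) (Φ t)‖ₑ} :=
      measurableSet_lt (h1.inner hΦ).enorm (stronglyMeasurable_const.inner hΦ).enorm
    refine ⟨fun t => if ‖inner ℂ (γ t) (Φ t)‖ₑ < ‖inner ℂ (g (N + 1)) (Φ t)‖ₑ then g (N + 1) else γ t,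
      StronglyMeasurable.ite hs stronglyMeasurable_const h1, fun t => ?_,
      ⟨max ‖g (N + 1)‖ B, fun t => ?_⟩, fun t n hn => ?_⟩
    · beta_reduce
      split_ifs
      exacts [⟨_, rfl⟩, h2 t]
    · beta_reduce
      split_ifs
      exacts [le_max_left _ _, (hB t).trans (le_max_right _ _)]
    · beta_reduce
      rcases Nat.le_succ_iff.1 hn with hn | rfl
      · split_ifs with h
        exacts [(h3 t n hn).trans h.le, h3 t n hn]
      · split_ifs with h
        exacts [le_rfl, not_lt.1 h]

/-- A bounded function with values in `L²` belongs to `L^q_t L^r_x` if it acts as a functional on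
the integrable functions with the dual mixed norm. -/
lemma mixedNorm_le_of_forall_integral_inner_le {q q' r r' : ℝ≥0∞} (hq : 2 ≤ q) (hqt : q ≠ ∞)
    [hqq : q.HolderConjugate q'] (hr : 2 ≤ r) [hrr : r.HolderConjugate r'] {Φ : ℝ → L2 d}
    (hΦ : StronglyMeasurable Φ) {B : ℝ} (hB : ∀ t, ‖Φ t‖ ≤ B) {M : ℝ≥0∞}
    (h : ∀ G : ℝ → L2 d, StronglyMeasurable G → Integrable G →
      ‖∫ t, inner ℂ (G t) (Φ t)‖ₑ ≤ M * mixedNorm q' r' (fun t => (G t : Space d → ℂ))) :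
    mixedNorm q r (fun t => (Φ t : Space d → ℂ)) ≤ M := by
  have hq0 : q ≠ 0 := ENNReal.HolderConjugate.ne_zero q q'
  have hq0' : q' ≠ 0 := ENNReal.HolderConjugate.ne_zero q' q
  have hqt' : q' ≠ ∞ := fun h1 => by
    rw [(ENNReal.HolderConjugate.eq_top_iff_eq_one q' q).1 h1] at hq
    exact absurd hq (by norm_num)
  have hQ := ENNReal.HolderConjugate.toReal_of_ne_top hqt hqt'
  have h2Q : 2 ≤ q.toReal := by
    rw [← ENNReal.toReal_ofNat 2]; exact ENNReal.toReal_mono hqt hq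
  rw [mixedNorm_eq_lintegral hq0 hqt]
  set Q := q.toReal with hQdef
  set Q' := q'.toReal with hQdef'
  obtain ⟨g, hg1, hg2⟩ := exists_norming_sequence (d := d) (r' := r') hr
  set S : ℕ → Set ℝ := fun N => Icc (-(N : ℝ)) N with hS
  have hSm : ∀ N, MeasurableSet (S N) := fun N => measurableSet_Icc
  set k : ℕ → ℝ → ℝ≥0∞ := fun n t => ‖inner ℂ (g n) (Φ t)‖ₑ ^ Q with hk
  have hkm : ∀ n, Measurable (k n) := fun n =>
    ((stronglyMeasurable_const.inner hΦ).enorm).pow_const _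
  -- Restriction to finitely many norming functions and to [-N, N] makes all quantities finite;
  -- monotone convergence removes it at the end.
  have bound : ∀ N : ℕ, ∫⁻ t, (S N).indicator (fun t => ⨆ n ≤ N, k n t) t ≤ M ^ Q := fun N => by
    obtain ⟨γ, γm, γg, ⟨B', hB'⟩, hγ⟩ := exists_measurable_selector hΦ g N
    set z : ℝ → ℂ := fun t => inner ℂ (γ t) (Φ t) with hz
    have hzm : StronglyMeasurable z := γm.inner hΦ
    have hzB : ∀ t, ‖z t‖ ≤ B' * B := fun t => (norm_inner_le_norm _ _).trans
      (mul_le_mul (hB' t) (hB t) (norm_nonneg _) ((norm_nonneg _).trans (hB' t)))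
    set J := ∫⁻ t in S N, ‖z t‖ₑ ^ Q with hJ
    have hzQ : ∀ t, ‖z t‖ₑ ^ Q = ENNReal.ofReal (‖z t‖ ^ Q) := fun t => by
      rw [← ENNReal.ofReal_rpow_of_nonneg (norm_nonneg _) hQ.nonneg, ofReal_norm]
    have hint : IntegrableOn (fun t => ‖z t‖ ^ Q) (S N) := by
      refine Measure.integrableOn_of_bounded (M := (B' * B) ^ Q) ?_ ?_ ?_
      · rw [hS]; simp
      · exact (hzm.norm.measurable.pow_const _).aestronglyMeasurable
      · refine Eventually.of_forall fun t => ?_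
        rw [Real.norm_of_nonneg (by positivity)]
        exact Real.rpow_le_rpow (norm_nonneg _) (hzB t) hQ.nonneg
    have hJint : ENNReal.ofReal (∫ t in S N, ‖z t‖ ^ Q) = J := by
      rw [ofReal_integral_eq_lintegral_ofReal hint (Eventually.of_forall fun t => by positivity), hJ]
      simp only [hzQ]
    have hJt : J ≠ ∞ := by rw [← hJint]; exact ENNReal.ofReal_ne_top
    -- |z|^{Q-2}z is the extremal multiplier for Hölder's inequality in t; tested with it, the
    -- pairing is the integral of |z|^Q.
    set c : ℝ → ℂ := fun t => ((‖z t‖ ^ (Q - 2) : ℝ) : ℂ) * z t with hc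
    have hcm : StronglyMeasurable c :=
      (Complex.measurable_ofReal.comp (hzm.norm.measurable.pow_const _)).stronglyMeasurable.mul hzm
    have hcn : ∀ t, ‖c t‖ = ‖z t‖ ^ (Q - 1) := fun t => by
      rw [hc]
      beta_reduce
      rw [norm_mul, Complex.norm_real, Real.norm_of_nonneg (by positivity)]
      nth_rw 2 [← Real.rpow_one ‖z t‖]
      rw [← Real.rpow_add_of_nonneg (norm_nonneg _) (by linarith) zero_le_one]
      congr 1; ring
    have hcz : ∀ t, (starRingEnd ℂ) (c t) * z t = ((‖z t‖ ^ Q : ℝ) : ℂ) := fun t => by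
      rw [hc]
      beta_reduce
      rw [map_mul, Complex.conj_ofReal, mul_assoc, Complex.conj_mul', ← Complex.ofReal_pow,
        ← Complex.ofReal_mul, ← Real.rpow_natCast, ← Real.rpow_add_of_nonneg (norm_nonneg _)
          (by linarith) (by norm_num)]
      congr 2; push_cast; ring
    have hG : Integrable ((S N).indicator fun t => c t • γ t) := by
      rw [integrable_indicator_iff (hSm N)]
      refine Measure.integrableOn_of_bounded (M := (B' * B) ^ (Q - 1) * B') ?_ ?_ ?_
      · rw [hS]; simp
      · exact (hcm.smul γm).aestronglyMeasurable
      · refine Eventually.of_forall fun t => ?_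
        rw [norm_smul, hcn]
        exact mul_le_mul (Real.rpow_le_rpow (norm_nonneg _) (hzB t) (by linarith)) (hB' t)
          (norm_nonneg _) (Real.rpow_nonneg ((norm_nonneg _).trans (hzB t)) _)
    have h1 := h ((S N).indicator fun t => c t • γ t) ((hcm.smul γm).indicator (hSm N)) hG
    have h2 : ∫ t, inner ℂ ((S N).indicator (fun t => c t • γ t) t) (Φ t) =
        ((∫ t in S N, ‖z t‖ ^ Q : ℝ) : ℂ) := by
      rw [← integral_complex_ofReal, ← integral_indicator (hSm N)]
      refine integral_congr_ae (Eventually.of_forall fun t => ?_)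
      by_cases ht : t ∈ S N
      · simp only [indicator_of_mem ht]
        rw [inner_smul_left]
        exact hcz t
      · simp [indicator_of_notMem ht]
    have h3 : mixedNorm q' r' (fun t => (((S N).indicator (fun t => c t • γ t) t : L2 d) :
        Space d → ℂ)) ≤ J ^ (1 / Q') := by
      rw [mixedNorm_eq_lintegral hq0' hqt', hJ, ← lintegral_indicator (hSm N)]
      refine ENNReal.rpow_le_rpow (lintegral_mono fun t => ?_) (by have := hQ.symm.pos; positivity)
      by_cases ht : t ∈ S N
      · simp only [indicator_of_mem ht]
        rw [eLpNorm_congr_ae (Lp.coeFn_smul _ _), eLpNorm_const_smul]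
        obtain ⟨n, hn⟩ := γg t
        calc (‖c t‖ₑ * eLpNorm (γ t) r' volume) ^ Q' ≤ (‖c t‖ₑ * 1) ^ Q' := by
              rw [hn]
              exact ENNReal.rpow_le_rpow (mul_le_mul' le_rfl (hg1 n)) hQ.symm.nonneg
          _ = ‖z t‖ₑ ^ Q := by
              rw [mul_one, ← ofReal_norm, hcn, ← ENNReal.ofReal_rpow_of_nonneg (norm_nonneg _)
                (by linarith), ofReal_norm, ← ENNReal.rpow_mul, hQ.sub_one_mul_conj]
      · simp only [indicator_of_notMem ht]
        rw [eLpNorm_congr_ae (Lp.coeFn_zero ℂ 2 _), eLpNorm_zero, ENNReal.zero_rpow_of_pos hQ.symm.pos]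
    have h4 : J ≤ M * J ^ (1 / Q') := by
      rw [h2, ← ofReal_norm, Complex.norm_real, Real.norm_of_nonneg
        (integral_nonneg fun t => by positivity), hJint] at h1
      exact h1.trans (mul_le_mul' le_rfl h3)
    have h5 := rpow_le_of_le_mul_rpow hQ hJt h4
    have h6 : J ≤ M ^ Q := by
      rwa [one_div, ENNReal.rpow_inv_le_iff hQ.pos] at h5
    refine le_trans ?_ h6
    rw [hJ, ← lintegral_indicator (hSm N)]
    refine lintegral_mono fun t => indicator_le_indicator ?_
    refine iSup₂_le fun n hn => ENNReal.rpow_le_rpow (hγ t n hn) hQ.nonneg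
  have hle : ∀ t, eLpNorm (Φ t) r volume ^ Q ≤ ⨆ N, (S N).indicator (fun t => ⨆ n ≤ N, k n t) t :=
    fun t => by
    rw [← ENNReal.le_rpow_inv_iff hQ.pos]
    refine (hg2 (Φ t)).trans (iSup_le fun n => ?_)
    rw [ENNReal.le_rpow_inv_iff hQ.pos]
    obtain ⟨m, hm⟩ := exists_nat_ge |t|
    have hmem : t ∈ S (max n m) := by
      have := abs_le.1 (hm.trans (show (m : ℝ) ≤ ((max n m : ℕ) : ℝ) by exact_mod_cast le_max_right n m))
      exact ⟨this.1, this.2⟩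
    refine le_trans ?_ (le_iSup _ (max n m))
    rw [indicator_of_mem hmem]
    exact le_iSup₂ (f := fun n _ => k n t) n (le_max_left n m)
  rw [one_div, ENNReal.rpow_inv_le_iff hQ.pos]
  calc ∫⁻ t, eLpNorm (Φ t) r volume ^ Q
      ≤ ∫⁻ t, ⨆ N, (S N).indicator (fun t => ⨆ n ≤ N, k n t) t := lintegral_mono hle
    _ = ⨆ N, ∫⁻ t, (S N).indicator (fun t => ⨆ n ≤ N, k n t) t := by
        refine lintegral_iSup (fun N => ?_) fun N N' hN t => ?_
        · exact (Measurable.iSup fun n => Measurable.iSup fun _ => hkm n).indicator (hSm N)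
        · have hN' : (N : ℝ) ≤ N' := by exact_mod_cast hN
          refine (indicator_le_indicator_of_subset (Icc_subset_Icc (by linarith) hN')
            (fun _ => zero_le) t).trans (indicator_le_indicator ?_)
          exact iSup₂_le fun n hn => le_iSup₂ (f := fun n _ => k n t) n (hn.trans hN)
    _ ≤ M ^ Q := iSup_le bound

/-- Hölder's inequality in the mixed norms. -/
lemma lintegral_enorm_inner_le {q q' r r' : ℝ≥0∞} (hqt : q ≠ ∞) (hqt' : q' ≠ ∞)
    [hqq : q.HolderConjugate q'] [hrr : r.HolderConjugate r'] {F Φ : ℝ → L2 d}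
    (hF : AEStronglyMeasurable F) (hΦ : AEStronglyMeasurable Φ) :
    ∫⁻ t, ‖inner ℂ (F t) (Φ t)‖ₑ ≤
      mixedNorm q' r' (fun t => (F t : Space d → ℂ)) * mixedNorm q r (fun t => (Φ t : Space d → ℂ)) := by
  have hQ := ENNReal.HolderConjugate.toReal_of_ne_top hqt hqt'
  rw [mixedNorm_eq_lintegral (ENNReal.HolderConjugate.ne_zero q' q) hqt',
    mixedNorm_eq_lintegral (ENNReal.HolderConjugate.ne_zero q q') hqt]
  refine le_trans (lintegral_mono fun t => ?_) (ENNReal.lintegral_mul_le_Lp_mul_Lq volume hQ.symm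
    (aemeasurable_eLpNorm_comp hF r') (aemeasurable_eLpNorm_comp hΦ r))
  rw [L2.inner_def, Pi.mul_apply]
  refine (enorm_integral_le_lintegral_enorm _).trans ?_
  rw [← eLpNorm_one_eq_lintegral_enorm]
  have : r'.HolderTriple r 1 := hrr.symm
  refine (eLpNorm_le_eLpNorm_mul_eLpNorm_of_nnnorm (p := r') (q := r) (Lp.aestronglyMeasurable (F t))
    (Lp.aestronglyMeasurable (Φ t)) (fun a b => inner ℂ a b) 1
    (Eventually.of_forall fun x => ?_)).trans (by simp)
  rw [one_mul]
  exact nnnorm_inner_le_nnnorm _ _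

end QuadSchrodinger

end

noncomputable section

namespace QuadSchrodinger

variable {d : ℕ}

/-! ### From one bilinear estimate to all Strichartz estimates -/

open ContinuousLinearMap (adjoint)

lemma enorm_inner_le_mul (φ ψ : L2 d) : ‖inner ℂ φ ψ‖ₑ ≤ ‖φ‖ₑ * ‖ψ‖ₑ := by
  rw [← ofReal_norm, ← ofReal_norm, ← ofReal_norm, ← ENNReal.ofReal_mul (norm_nonneg _)]
  exact ENNReal.ofReal_le_ofReal (norm_inner_le_norm _ _)

/-- Strongly continuous families of unitary operators. -/
structure UnitaryFamily (V : ℝ → (L2 d →L[ℂ] L2 d)) : Prop where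
  norm_eq : ∀ t φ, ‖V t φ‖ = ‖φ‖
  norm_adjoint : ∀ t φ, ‖adjoint (V t) φ‖ = ‖φ‖
  continuous : ∀ φ, Continuous fun t => V t φ
  continuous_adjoint : ∀ φ, Continuous fun t => adjoint (V t) φ

/-- Strong continuity and equicontinuity give joint continuity, hence measurability of s ↦ T(s)F(s)
for strongly measurable F. -/
lemma continuous_uncurry_of_isometry {T : ℝ → (L2 d →L[ℂ] L2 d)} (h1 : ∀ t φ, ‖T t φ‖ = ‖φ‖)
    (h2 : ∀ φ, Continuous fun t => T t φ) : Continuous fun p : ℝ × L2 d => T p.1 p.2 := by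
  refine continuous_iff_continuousAt.2 fun p => ?_
  rw [ContinuousAt, tendsto_iff_norm_sub_tendsto_zero]
  have h3 : Tendsto (fun x : ℝ × L2 d => ‖x.2 - p.2‖ + ‖T x.1 p.2 - T p.1 p.2‖) (𝓝 p) (𝓝 0) := by
    have h4 : Continuous fun x : ℝ × L2 d => ‖x.2 - p.2‖ + ‖T x.1 p.2 - T p.1 p.2‖ :=
      (continuous_snd.sub continuous_const).norm.add
        ((((h2 p.2).comp continuous_fst).sub continuous_const).norm)
    simpa using h4.tendsto p
  refine squeeze_zero (fun _ => norm_nonneg _) (fun x => ?_) h3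
  calc ‖T x.1 x.2 - T p.1 p.2‖ = ‖T x.1 (x.2 - p.2) + (T x.1 p.2 - T p.1 p.2)‖ := by
        rw [map_sub]; congr 1; abel
    _ ≤ _ := (norm_add_le _ _).trans (by rw [h1])

lemma stronglyMeasurable_apply_of_isometry {T : ℝ → (L2 d →L[ℂ] L2 d)}
    (h1 : ∀ t φ, ‖T t φ‖ = ‖φ‖) (h2 : ∀ φ, Continuous fun t => T t φ) {F : ℝ → L2 d}
    (hF : StronglyMeasurable F) : StronglyMeasurable fun s => T s (F s) := by
  have h3 : StronglyMeasurable fun s => (s, F s) := stronglyMeasurable_id.prodMk hF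
  exact (continuous_uncurry_of_isometry h1 h2).comp_stronglyMeasurable h3

/-- `∫_{t - s ∈ W} V(t) V(s)* F(s) ds`. -/
def duhamel (V : ℝ → (L2 d →L[ℂ] L2 d)) (W : Set ℝ) (F : ℝ → L2 d) (t : ℝ) : L2 d :=
  V t (∫ s in {s | t - s ∈ W}, adjoint (V s) (F s))

/-- `∬_{t - s ∈ W} ⟨V(t)* G(t), V(s)* F(s)⟩ ds dt`. -/
def pairing (V : ℝ → (L2 d →L[ℂ] L2 d)) (W : Set ℝ) (F G : ℝ → L2 d) : ℂ :=
  ∫ z : ℝ × ℝ, {z : ℝ × ℝ | z.2 - z.1 ∈ W}.indicator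
    (fun z => inner ℂ (adjoint (V z.2) (G z.2)) (adjoint (V z.1) (F z.1))) z

/-- `L^q_t L^r_x` lies between `L^∞_t L²_x` and `L^{q₀}_t L^{r₀}_x`. -/
def Between (d : ℕ) (q₀ r₀ q r : ℝ≥0∞) : Prop :=
  (q = ∞ ∧ r = 2) ∨ (2 ≤ q ∧ q ≠ ∞ ∧ 2 ≤ r ∧ ∃ l : ℝ, 0 < l ∧ l ≤ 1 ∧ l * q.toReal = q₀.toReal ∧
    ∀ φ : L2 d, eLpNorm φ r volume ≤ ‖φ‖ₑ ^ (1 - l) * eLpNorm φ r₀ volume ^ l)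

lemma mixedNorm_mono {q r : ℝ≥0∞} {F G : ℝ → L2 d}
    (h : ∀ t, eLpNorm (F t) r volume ≤ eLpNorm (G t) r volume) :
    mixedNorm q r (fun t => (F t : Space d → ℂ)) ≤ mixedNorm q r (fun t => (G t : Space d → ℂ)) :=
  eLpNorm_mono_enorm h

/-- Interpolate in x at each fixed time, take out the supremum of the L² norm, and integrate; the
relation lq = q₀ turns the other factor into the base norm. -/
lemma Between.mixedNorm_le {q₀ r₀ q r : ℝ≥0∞} (h : Between d q₀ r₀ q r) (hq₀ : 2 ≤ q₀)
    (hqt : q₀ ≠ ∞) {Φ : ℝ → L2 d} {D : ℝ≥0∞} (h1 : ∀ t, ‖Φ t‖ₑ ≤ D)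
    (h2 : mixedNorm q₀ r₀ (fun t => (Φ t : Space d → ℂ)) ≤ D) :
    mixedNorm q r (fun t => (Φ t : Space d → ℂ)) ≤ D := by
  rcases h with ⟨rfl, rfl⟩ | ⟨hq, hqt', -, l, hl0, hl1, hlq, hl⟩
  · rw [mixedNorm, eLpNorm_exponent_top]
    refine essSup_le_of_ae_le _ (Eventually.of_forall fun t => ?_)
    exact (Lp.enorm_def (Φ t)).symm.le.trans (h1 t)
  · have h0 : ∀ {x : ℝ≥0∞}, 2 ≤ x → x ≠ 0 := fun h h0 => by simp [h0] at h
    rw [mixedNorm_eq_lintegral (h0 hq₀) hqt] at h2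
    rw [mixedNorm_eq_lintegral (h0 hq) hqt']
    have hQ : 0 < q.toReal := ENNReal.toReal_pos (h0 hq) hqt'
    have hQ0 : 0 < q₀.toReal := ENNReal.toReal_pos (h0 hq₀) hqt
    rcases eq_or_ne D ∞ with rfl | hD
    · exact le_top
    have hl1' : 0 ≤ 1 - l := by linarith
    calc (∫⁻ t, eLpNorm (Φ t) r volume ^ q.toReal) ^ (1 / q.toReal)
        ≤ (∫⁻ t, (D ^ (1 - l)) ^ q.toReal * eLpNorm (Φ t) r₀ volume ^ q₀.toReal) ^
            (1 / q.toReal) := by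
          refine ENNReal.rpow_le_rpow (lintegral_mono fun t => ?_) (by positivity)
          refine (ENNReal.rpow_le_rpow (hl (Φ t)) hQ.le).trans ?_
          rw [ENNReal.mul_rpow_of_nonneg _ _ hQ.le, ← ENNReal.rpow_mul (eLpNorm _ _ _), hlq]
          gcongr
          exact h1 t
      _ = D ^ (1 - l) * ((∫⁻ t, eLpNorm (Φ t) r₀ volume ^ q₀.toReal) ^ (1 / q₀.toReal)) ^ l := by
          rw [lintegral_const_mul' _ _ (ENNReal.rpow_ne_top_of_nonneg hQ.le
            (ENNReal.rpow_ne_top_of_nonneg hl1' hD)), ENNReal.mul_rpow_of_nonneg _ _ (by positivity),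
            ← ENNReal.rpow_mul, ← ENNReal.rpow_mul, mul_one_div_cancel hQ.ne', mul_one]
          have hexp : 1 / q.toReal = 1 / q₀.toReal * l := by rw [← hlq]; field_simp
          rw [hexp, ENNReal.rpow_mul]
      _ ≤ D ^ (1 - l) * D ^ l := by gcongr
      _ = D := by
          rw [← ENNReal.rpow_add_of_nonneg _ _ hl1' hl0.le, sub_add_cancel, ENNReal.rpow_one]

lemma enorm_integral_inner_le_of_between {q₀ r₀ q r : ℝ≥0∞} (h : Between d q₀ r₀ q r)
    {F Φ : ℝ → L2 d} (hF : AEStronglyMeasurable F) (hΦ : AEStronglyMeasurable Φ) {D : ℝ≥0∞}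
    (h1 : ∀ t, ‖Φ t‖ₑ ≤ D) (h2 : mixedNorm q r (fun t => (Φ t : Space d → ℂ)) ≤ D) :
    ‖∫ t, inner ℂ (F t) (Φ t)‖ₑ ≤ D * mixedNorm (ENNReal.conjExponent q) (ENNReal.conjExponent r)
      (fun t => (F t : Space d → ℂ)) := by
  refine (enorm_integral_le_lintegral_enorm _).trans ?_
  rcases h with ⟨rfl, rfl⟩ | ⟨hq, hqt, hr, -⟩
  · have e1 : ENNReal.conjExponent ∞ = 1 := by simp [ENNReal.conjExponent]
    have i2 := ENNReal.HolderConjugate.conjExponent (p := 2) one_le_two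
    have e2 : ENNReal.conjExponent 2 = 2 := ENNReal.HolderConjugate.unique 2 _ 2
    rw [e1, e2, mixedNorm, eLpNorm_one_eq_lintegral_enorm, mul_comm]
    rcases eq_or_ne D ∞ with rfl | hD
    -- For D = ∞ the product ∞ · 0 is 0, so the case of vanishing F has to be treated separately.
    · rw [ENNReal.mul_top']
      split_ifs with h0
      · simp only [enorm_eq_self] at h0
        rw [lintegral_eq_zero_iff' (aemeasurable_eLpNorm_comp hF 2)] at h0
        refine (lintegral_eq_zero_iff' (hF.inner hΦ).enorm).2 ?_ |>.le
        filter_upwards [h0] with t ht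
        have : ‖F t‖ₑ = 0 := (Lp.enorm_def (F t)).trans ht
        rw [enorm_eq_zero.1 this, inner_zero_left]
        simp
      · exact le_top
    · rw [← lintegral_mul_const' _ _ hD]
      refine lintegral_mono fun t => ?_
      refine le_trans ?_ (mul_le_mul' (Lp.enorm_def (F t)).le (h1 t))
      exact enorm_inner_le_mul _ _
  · have h1q : 1 ≤ q := one_le_two.trans hq
    have h1r : 1 ≤ r := one_le_two.trans hr
    have i1 := ENNReal.HolderConjugate.conjExponent h1q
    have i2 := ENNReal.HolderConjugate.conjExponent h1r
    have hqt' : ENNReal.conjExponent q ≠ ∞ := fun h1 => by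
      rw [(ENNReal.HolderConjugate.eq_top_iff_eq_one (ENNReal.conjExponent q) q).1 h1] at hq
      exact absurd hq (by norm_num)
    refine (lintegral_enorm_inner_le (q := q) (r := r) (r' := ENNReal.conjExponent r) hqt hqt' hF hΦ).trans ?_
    rw [mul_comm]
    gcongr

namespace UnitaryFamily

variable {V : ℝ → (L2 d →L[ℂ] L2 d)}

lemma stronglyMeasurable_adjoint (hV : UnitaryFamily V) {F : ℝ → L2 d} (hF : StronglyMeasurable F) :
    StronglyMeasurable fun s => adjoint (V s) (F s) :=
  stronglyMeasurable_apply_of_isometry (T := fun s => adjoint (V s)) hV.norm_adjoint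
    hV.continuous_adjoint hF

lemma integrable_adjoint (hV : UnitaryFamily V) {F : ℝ → L2 d} (hF : StronglyMeasurable F)
    (hi : Integrable F) : Integrable fun s => adjoint (V s) (F s) :=
  hi.mono (hV.stronglyMeasurable_adjoint hF).aestronglyMeasurable
    (Eventually.of_forall fun s => (hV.norm_adjoint s (F s)).le)

lemma measurableSet_window {W : Set ℝ} (hW : MeasurableSet W) :
    MeasurableSet {z : ℝ × ℝ | z.2 - z.1 ∈ W} :=
  (measurable_snd.sub measurable_fst) hW

lemma measurableSet_window_right {W : Set ℝ} (hW : MeasurableSet W) (t : ℝ) :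
    MeasurableSet {s | t - s ∈ W} :=
  (measurable_const.sub measurable_id) hW

lemma stronglyMeasurable_duhamel (hV : UnitaryFamily V) {W : Set ℝ} (hW : MeasurableSet W)
    {F : ℝ → L2 d} (hF : StronglyMeasurable F) : StronglyMeasurable (duhamel V W F) := by
  refine stronglyMeasurable_apply_of_isometry hV.norm_eq hV.continuous ?_
  have h1 : StronglyMeasurable fun z : ℝ × ℝ => {z : ℝ × ℝ | z.1 - z.2 ∈ W}.indicator
      (fun z => adjoint (V z.2) (F z.2)) z :=
    ((hV.stronglyMeasurable_adjoint hF).comp_measurable measurable_snd).indicator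
      ((measurable_fst.sub measurable_snd) hW)
  have h2 := h1.integral_prod_right' (ν := (volume : Measure ℝ))
  convert h2 using 2 with t
  rw [← integral_indicator (measurableSet_window_right hW t)]
  rfl

lemma enorm_duhamel_le (hV : UnitaryFamily V) (W : Set ℝ) (F : ℝ → L2 d) (t : ℝ) :
    ‖duhamel V W F t‖ₑ ≤ ∫⁻ s, ‖F s‖ₑ := by
  rw [duhamel, ← ofReal_norm, hV.norm_eq, ofReal_norm]
  refine (enorm_integral_le_lintegral_enorm _).trans ((setLIntegral_le_lintegral _ _).trans ?_)
  refine lintegral_mono fun s => ?_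
  rw [← ofReal_norm, hV.norm_adjoint, ofReal_norm]

lemma norm_duhamel_le (hV : UnitaryFamily V) (W : Set ℝ) {F : ℝ → L2 d} (hF : Integrable F) (t : ℝ) :
    ‖duhamel V W F t‖ ≤ (∫⁻ s, ‖F s‖ₑ).toReal := by
  rw [← toReal_enorm]
  exact ENNReal.toReal_mono hF.2.ne (hV.enorm_duhamel_le W F t)

lemma integrable_pairing (hV : UnitaryFamily V) {W : Set ℝ} (hW : MeasurableSet W) {F G : ℝ → L2 d}
    (hF : StronglyMeasurable F) (hFi : Integrable F) (hG : StronglyMeasurable G)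
    (hGi : Integrable G) : Integrable fun z : ℝ × ℝ => {z : ℝ × ℝ | z.2 - z.1 ∈ W}.indicator
      (fun z => inner ℂ (adjoint (V z.2) (G z.2)) (adjoint (V z.1) (F z.1))) z := by
  have h1 := hFi.norm.mul_prod hGi.norm
  refine Integrable.indicator ?_ (measurableSet_window hW)
  refine h1.mono ?_ (Eventually.of_forall fun z => ?_)
  · exact (((hV.stronglyMeasurable_adjoint hG).comp_measurable measurable_snd).inner
      ((hV.stronglyMeasurable_adjoint hF).comp_measurable measurable_fst)).aestronglyMeasurable
  · refine (norm_inner_le_norm _ _).trans ?_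
    rw [hV.norm_adjoint, hV.norm_adjoint, mul_comm]
    simp

lemma integral_inner_duhamel (hV : UnitaryFamily V) {W : Set ℝ} (hW : MeasurableSet W)
    {F G : ℝ → L2 d} (hF : StronglyMeasurable F) (hFi : Integrable F) (hG : StronglyMeasurable G)
    (hGi : Integrable G) : ∫ t, inner ℂ (G t) (duhamel V W F t) = pairing V W F G := by
  rw [pairing, Measure.volume_eq_prod, integral_prod_symm _ (hV.integrable_pairing hW hF hFi hG hGi)]
  refine integral_congr_ae (Eventually.of_forall fun t => ?_)
  beta_reduce
  rw [duhamel, ← ContinuousLinearMap.adjoint_inner_left,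
    ← integral_inner ((hV.integrable_adjoint hF hFi).integrableOn),
    ← integral_indicator (measurableSet_window_right hW t)]
  rfl

/-- Conjugation exchanges the two functions and reflects the window: the adjoint of the retarded
operator is the advanced one, again within the class of windows. -/
lemma conj_pairing {W : Set ℝ} (F G : ℝ → L2 d) :
    (starRingEnd ℂ) (pairing V W F G) = pairing V (-W) G F := by
  rw [pairing, pairing, ← integral_conj, Measure.volume_eq_prod, ← integral_prod_swap]
  refine integral_congr_ae (Eventually.of_forall fun z => ?_)
  by_cases h : z.1 - z.2 ∈ W
  · have h' : z.2 - z.1 ∈ -W := by rwa [Set.mem_neg, neg_sub]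
    beta_reduce
    rw [indicator_of_mem (by exact h), indicator_of_mem (by exact h'), inner_conj_symm]
    rfl
  · have h' : z.2 - z.1 ∉ -W := by rwa [Set.mem_neg, neg_sub]
    beta_reduce
    rw [indicator_of_notMem (by exact h), indicator_of_notMem (by exact h'), map_zero]

end UnitaryFamily

end QuadSchrodinger

end

noncomputable section

namespace QuadSchrodinger

variable {d : ℕ}

open ContinuousLinearMap (adjoint)

/-! ### Homogeneous, dual and windowed estimates from the bilinear bound -/

/-- The norm dual to `L^q_t L^r_x`. -/
def dualNorm (q r : ℝ≥0∞) (F : ℝ → L2 d) : ℝ≥0∞ :=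
  mixedNorm (ENNReal.conjExponent q) (ENNReal.conjExponent r) (fun t => (F t : Space d → ℂ))

/-- The bilinear estimate at one pair of exponents. -/
def BaseEstimate (V : ℝ → (L2 d →L[ℂ] L2 d)) (q r : ℝ≥0∞) (C : ℝ≥0) : Prop :=
  ∀ W : Set ℝ, MeasurableSet W → ∀ F G : ℝ → L2 d, StronglyMeasurable F → Integrable F →
    StronglyMeasurable G → Integrable G →
      ‖pairing V W F G‖ₑ ≤ C * (dualNorm q r F * dualNorm q r G)

namespace UnitaryFamily

variable {V : ℝ → (L2 d →L[ℂ] L2 d)}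

lemma enorm_integral_inner_apply (hV : UnitaryFamily V) {G : ℝ → L2 d} (hG : StronglyMeasurable G)
    (hGi : Integrable G) (φ : L2 d) :
    ‖∫ t, inner ℂ (G t) (V t φ)‖ₑ = ‖inner ℂ φ (∫ t, adjoint (V t) (G t))‖ₑ := by
  rw [← integral_inner (hV.integrable_adjoint hG hGi), ← RCLike.enorm_conj, ← integral_conj]
  congr 1
  refine integral_congr_ae (Eventually.of_forall fun t => ?_)
  beta_reduce
  rw [inner_conj_symm, ContinuousLinearMap.adjoint_inner_right]

lemma duhamel_univ (F : ℝ → L2 d) (t : ℝ) :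
    duhamel V univ F t = V t (∫ s, adjoint (V s) (F s)) := by
  simp [duhamel]

variable {q₀ r₀ q r q₁ r₁ : ℝ≥0∞} {C : ℝ≥0}

/-- The TT* argument: with G = F and the full window the form is the squared norm of the integral.
As C ≥ 1, its square root may be replaced by C. -/
lemma enorm_integral_le_base (hV : UnitaryFamily V) (hC : 1 ≤ C) (hb : BaseEstimate V q₀ r₀ C)
    {F : ℝ → L2 d} (hF : StronglyMeasurable F) (hFi : Integrable F) :
    ‖∫ s, adjoint (V s) (F s)‖ₑ ≤ C * dualNorm q₀ r₀ F := by
  set x := ∫ s, adjoint (V s) (F s) with hx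
  have h1 := hb univ MeasurableSet.univ F F hF hFi hF hFi
  rw [← hV.integral_inner_duhamel MeasurableSet.univ hF hFi hF hFi] at h1
  simp only [duhamel_univ] at h1
  rw [hV.enorm_integral_inner_apply hF hFi, ← hx, inner_self_eq_norm_sq_to_K, enorm_pow] at h1
  have h2 : ‖((‖x‖ : ℝ) : ℂ)‖ₑ = ‖x‖ₑ := by rw [← ofReal_norm, Complex.norm_real, norm_norm, ofReal_norm]
  have h3 : ‖x‖ₑ ^ 2 ≤ C * (dualNorm q₀ r₀ F * dualNorm q₀ r₀ F) := by
    rw [← h2]; exact h1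
  refine (ENNReal.pow_le_pow_left_iff two_ne_zero).1 (h3.trans ?_)
  rw [mul_pow, ← sq]
  gcongr
  rw [sq]
  exact le_mul_of_one_le_left zero_le (by exact_mod_cast hC)

lemma mixedNorm_apply_le_base (hV : UnitaryFamily V) (hq₀ : 2 ≤ q₀) (hqt : q₀ ≠ ∞) (hr₀ : 2 ≤ r₀)
    (hC : 1 ≤ C) (hb : BaseEstimate V q₀ r₀ C) (φ : L2 d) :
    mixedNorm q₀ r₀ (fun t => (V t φ : Space d → ℂ)) ≤ C * ‖φ‖ₑ := by
  have i1 := ENNReal.HolderConjugate.conjExponent (one_le_two.trans hq₀)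
  have i2 := ENNReal.HolderConjugate.conjExponent (one_le_two.trans hr₀)
  refine mixedNorm_le_of_forall_integral_inner_le (q' := ENNReal.conjExponent q₀)
    (r' := ENNReal.conjExponent r₀) hq₀ hqt hr₀ (hV.continuous φ).stronglyMeasurable
    (fun t => (hV.norm_eq t φ).le) fun G hG hGi => ?_
  rw [hV.enorm_integral_inner_apply hG hGi]
  refine (enorm_inner_le_mul _ _).trans ?_
  rw [mul_comm, mul_right_comm]
  gcongr
  exact hV.enorm_integral_le_base hC hb hG hGi

lemma mixedNorm_apply_le (hV : UnitaryFamily V) (hq₀ : 2 ≤ q₀) (hqt : q₀ ≠ ∞) (hr₀ : 2 ≤ r₀)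
    (hC : 1 ≤ C) (hb : BaseEstimate V q₀ r₀ C) (h : Between d q₀ r₀ q r) (φ : L2 d) :
    mixedNorm q r (fun t => (V t φ : Space d → ℂ)) ≤ C * ‖φ‖ₑ := by
  refine h.mixedNorm_le hq₀ hqt (Φ := fun t => V t φ) (fun t => ?_)
    (hV.mixedNorm_apply_le_base hq₀ hqt hr₀ hC hb φ)
  rw [← ofReal_norm, hV.norm_eq, ofReal_norm]
  exact le_mul_of_one_le_left zero_le (by exact_mod_cast hC)

/-- Test the homogeneous estimate with the integral x itself as data: ‖x‖² is at most C‖x‖ times the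
dual norm of F. -/
lemma enorm_integral_le (hV : UnitaryFamily V) (hq₀ : 2 ≤ q₀) (hqt : q₀ ≠ ∞) (hr₀ : 2 ≤ r₀)
    (hC : 1 ≤ C) (hb : BaseEstimate V q₀ r₀ C) (h : Between d q₀ r₀ q r) {F : ℝ → L2 d}
    (hF : StronglyMeasurable F) (hFi : Integrable F) :
    ‖∫ s, adjoint (V s) (F s)‖ₑ ≤ C * dualNorm q r F := by
  set x := ∫ s, adjoint (V s) (F s) with hx
  have h1 := enorm_integral_inner_le_of_between h hF.aestronglyMeasurable
    (hV.continuous x).stronglyMeasurable.aestronglyMeasurable (D := C * ‖x‖ₑ) (fun t => by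
      rw [← ofReal_norm, hV.norm_eq, ofReal_norm]
      exact le_mul_of_one_le_left zero_le (by exact_mod_cast hC))
    (hV.mixedNorm_apply_le hq₀ hqt hr₀ hC hb h x)
  rw [hV.enorm_integral_inner_apply hF hFi, ← hx, inner_self_eq_norm_sq_to_K, enorm_pow] at h1
  have h2 : ‖((‖x‖ : ℝ) : ℂ)‖ₑ = ‖x‖ₑ := by rw [← ofReal_norm, Complex.norm_real, norm_norm, ofReal_norm]
  have h3 : ‖x‖ₑ * ‖x‖ₑ ≤ C * dualNorm q r F * ‖x‖ₑ := by
    rw [← sq]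
    nth_rw 1 [← h2]
    rw [mul_right_comm]
    exact h1
  rcases eq_or_ne x 0 with h0 | h0
  · rw [h0]; simp
  · exact (ENNReal.mul_le_mul_iff_left (by simpa using h0) enorm_ne_top).1 h3

/-- At fixed t the Duhamel integral is, up to the isometry V(t), the dual operator applied to F cut
off to the window. -/
lemma enorm_duhamel_le_dualNorm (hV : UnitaryFamily V) (hq₀ : 2 ≤ q₀) (hqt : q₀ ≠ ∞) (hr₀ : 2 ≤ r₀)
    (hC : 1 ≤ C) (hb : BaseEstimate V q₀ r₀ C) (h : Between d q₀ r₀ q r) {W : Set ℝ}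
    (hW : MeasurableSet W) {F : ℝ → L2 d} (hF : StronglyMeasurable F) (hFi : Integrable F) (t : ℝ) :
    ‖duhamel V W F t‖ₑ ≤ C * dualNorm q r F := by
  have hS := measurableSet_window_right hW t
  have h1 := hV.enorm_integral_le hq₀ hqt hr₀ hC hb h (hF.indicator hS) (hFi.indicator hS)
  rw [duhamel, ← ofReal_norm, hV.norm_eq, ofReal_norm, ← integral_indicator hS]
  have h2 : (fun s => adjoint (V s) ({s | t - s ∈ W}.indicator F s)) =
      {s | t - s ∈ W}.indicator fun s => adjoint (V s) (F s) := by
    ext1 s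
    by_cases hs : s ∈ {s | t - s ∈ W}
    · rw [indicator_of_mem hs, indicator_of_mem hs]
    · rw [indicator_of_notMem hs, indicator_of_notMem hs, map_zero]
  rw [h2] at h1
  refine h1.trans (mul_le_mul' le_rfl (mixedNorm_mono fun s => ?_))
  by_cases hs : s ∈ {s | t - s ∈ W}
  · rw [indicator_of_mem hs]
  · rw [indicator_of_notMem hs, eLpNorm_congr_ae (Lp.coeFn_zero ℂ 2 _), eLpNorm_zero]
    exact zero_le

lemma mixedNorm_duhamel_le_of_pairing (hV : UnitaryFamily V) (hq₀ : 2 ≤ q₀) (hqt : q₀ ≠ ∞)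
    (hr₀ : 2 ≤ r₀) {W : Set ℝ} (hW : MeasurableSet W) {F : ℝ → L2 d} (hF : StronglyMeasurable F)
    (hFi : Integrable F) {D : ℝ≥0∞} (h : ∀ G : ℝ → L2 d, StronglyMeasurable G → Integrable G →
      ‖pairing V W F G‖ₑ ≤ D * dualNorm q₀ r₀ G) :
    mixedNorm q₀ r₀ (fun t => (duhamel V W F t : Space d → ℂ)) ≤ D := by
  have i1 := ENNReal.HolderConjugate.conjExponent (one_le_two.trans hq₀)
  have i2 := ENNReal.HolderConjugate.conjExponent (one_le_two.trans hr₀)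
  refine mixedNorm_le_of_forall_integral_inner_le (q' := ENNReal.conjExponent q₀)
    (r' := ENNReal.conjExponent r₀) hq₀ hqt hr₀ (hV.stronglyMeasurable_duhamel hW hF)
    (hV.norm_duhamel_le W hFi) fun G hG hGi => ?_
  rw [hV.integral_inner_duhamel hW hF hFi hG hGi]
  exact h G hG hGi

lemma mixedNorm_duhamel_le_base (hV : UnitaryFamily V) (hq₀ : 2 ≤ q₀) (hqt : q₀ ≠ ∞) (hr₀ : 2 ≤ r₀)
    (hC : 1 ≤ C) (hb : BaseEstimate V q₀ r₀ C) (h0 : Between d q₀ r₀ q₀ r₀)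
    (h : Between d q₀ r₀ q r) {W : Set ℝ}
    (hW : MeasurableSet W) {F : ℝ → L2 d} (hF : StronglyMeasurable F) (hFi : Integrable F) :
    mixedNorm q r (fun t => (duhamel V W F t : Space d → ℂ)) ≤ C * dualNorm q₀ r₀ F := by
  refine h.mixedNorm_le hq₀ hqt
    (hV.enorm_duhamel_le_dualNorm hq₀ hqt hr₀ hC hb h0 hW hF hFi) ?_
  refine hV.mixedNorm_duhamel_le_of_pairing hq₀ hqt hr₀ hW hF hFi fun G hG hGi => ?_
  rw [mul_assoc]
  exact hb W hW F G hF hFi hG hGi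

/-- The inhomogeneous estimate for arbitrary pairs of exponents. -/
lemma mixedNorm_duhamel_le (hV : UnitaryFamily V) (hq₀ : 2 ≤ q₀) (hqt : q₀ ≠ ∞) (hr₀ : 2 ≤ r₀)
    (hC : 1 ≤ C) (hb : BaseEstimate V q₀ r₀ C) (h0 : Between d q₀ r₀ q₀ r₀)
    (h : Between d q₀ r₀ q r) (h₁ : Between d q₀ r₀ q₁ r₁) {W : Set ℝ}
    (hW : MeasurableSet W) {F : ℝ → L2 d} (hF : StronglyMeasurable F) (hFi : Integrable F) :
    mixedNorm q r (fun t => (duhamel V W F t : Space d → ℂ)) ≤ C * dualNorm q₁ r₁ F := by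
  refine h.mixedNorm_le hq₀ hqt
    (hV.enorm_duhamel_le_dualNorm hq₀ hqt hr₀ hC hb h₁ hW hF hFi) ?_
  refine hV.mixedNorm_duhamel_le_of_pairing hq₀ hqt hr₀ hW hF hFi fun G hG hGi => ?_
  -- Exchanging the roles puts G into the base pair, for which the estimate into (q₁, r₁) is known;
  -- F is then paired by Hölder's inequality.
  rw [← RCLike.enorm_conj, conj_pairing, ← hV.integral_inner_duhamel hW.neg hG hGi hF hFi,
    mul_right_comm]
  exact enorm_integral_inner_le_of_between h₁ hF.aestronglyMeasurable
    (hV.stronglyMeasurable_duhamel hW.neg hG).aestronglyMeasurable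
    (hV.enorm_duhamel_le_dualNorm hq₀ hqt hr₀ hC hb h0 hW.neg hG hGi)
    (hV.mixedNorm_duhamel_le_base hq₀ hqt hr₀ hC hb h0 h₁ hW.neg hG hGi)

end UnitaryFamily

lemma dualNorm_congr (q r : ℝ≥0∞) {F G : ℝ → L2 d} (h : F =ᵐ[volume] G) :
    dualNorm q r F = dualNorm q r G := mixedNorm_congr _ _ h

/-- The Strichartz estimates follow from the bilinear estimate at one pair of exponents. -/
theorem strichartzEstimates_of_baseEstimate {U : ℝ → ℝ → (L2 d →L[ℂ] L2 d)}
    (hV : UnitaryFamily fun t => U t 0) {q₀ r₀ q r q₁ r₁ : ℝ≥0∞} (hq₀ : 2 ≤ q₀) (hqt : q₀ ≠ ∞)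
    (hr₀ : 2 ≤ r₀) {C : ℝ≥0} (hC : 1 ≤ C) (hb : BaseEstimate (fun t => U t 0) q₀ r₀ C)
    (h0 : Between d q₀ r₀ q₀ r₀) (h : Between d q₀ r₀ q r) (h₁ : Between d q₀ r₀ q₁ r₁) :
    StrichartzEstimates U q r q₁ r₁ C := by
  refine ⟨hV.mixedNorm_apply_le hq₀ hqt hr₀ hC hb h, fun F hF => ?_, fun F hF => ?_⟩
  · have hm := hF.1.ae_eq_mk
    have h2 := hV.enorm_integral_le hq₀ hqt hr₀ hC hb h hF.1.stronglyMeasurable_mk (hF.congr hm)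
    rw [← dualNorm_congr _ _ hm] at h2
    rw [integral_congr_ae (g := fun s => adjoint (U s 0) (hF.1.mk F s))
      (hm.mono fun s hs => by beta_reduce; rw [hs])]
    exact h2
  · have hm := hF.1.ae_eq_mk
    -- The window t - s > 0 is the retarded integral. F is replaced by a strongly measurable
    -- representative.
    have h2 := hV.mixedNorm_duhamel_le hq₀ hqt hr₀ hC hb h0 h h₁ (W := Ioi 0) measurableSet_Ioi
      hF.1.stronglyMeasurable_mk (hF.congr hm)
    rw [← dualNorm_congr _ _ hm] at h2
    have h3 : ∀ t, ∫ s in Iio t, U t 0 (adjoint (U s 0) (F s)) =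
        duhamel (fun t => U t 0) (Ioi 0) (hF.1.mk F) t := fun t => by
      have hs : {s | t - s ∈ Ioi (0 : ℝ)} = Iio t := by ext s; simp
      have hi := (hV.integrable_adjoint hF.1.stronglyMeasurable_mk (hF.congr hm)).integrableOn
        (s := Iio t)
      rw [duhamel, hs, ← ContinuousLinearMap.integral_comp_comm _ hi]
      exact integral_congr_ae ((ae_restrict_of_ae hm).mono fun s hs => by beta_reduce; rw [hs])
    simp only [h3]
    exact h2

end QuadSchrodinger

end

noncomputable section

namespace QuadSchrodinger

variable {d : ℕ}

/-! ### Interpolation between the dispersive bound and unitarity -/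

lemma exists_eq_pow2 {y : ℝ≥0∞} (h0 : y ≠ 0) (ht : y ≠ ∞) : ∃ x : ℝ, y = pow2 x := by
  refine ⟨Real.logb 2 y.toReal, ?_⟩
  rw [pow2_eq_ofReal, Real.rpow_logb two_pos (by norm_num) (ENNReal.toReal_pos h0 ht),
    ENNReal.ofReal_toReal ht]

lemma eq_zero_of_eLpNorm_eq_zero {p : ℝ≥0∞} (hp : p ≠ 0) {φ : L2 d}
    (h : eLpNorm φ p volume = 0) : φ = 0 := by
  refine Lp.ext ?_
  filter_upwards [(eLpNorm_eq_zero_iff (Lp.aestronglyMeasurable φ) hp).1 h,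
    Lp.coeFn_zero ℂ 2 (volume : Measure (Space d))] with x h1 h2
  rw [h1, h2]

lemma eLpNorm_smul_L2 (p : ℝ≥0∞) (c : ℂ) (φ : L2 d) :
    eLpNorm (c • φ : L2 d) p volume = ‖c‖ₑ * eLpNorm φ p volume := by
  rw [eLpNorm_congr_ae (Lp.coeFn_smul _ _), eLpNorm_const_smul]

lemma exists_normalized {p : ℝ≥0∞} {φ : L2 d} (h0 : eLpNorm φ p volume ≠ 0)
    (ht : eLpNorm φ p volume ≠ ∞) : ∃ (c : ℂ) (φ' : L2 d), φ = c • φ' ∧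
      ‖c‖ₑ = eLpNorm φ p volume ∧ eLpNorm φ' p volume = 1 := by
  set a := (eLpNorm φ p volume).toReal with ha
  have ha0 : 0 < a := ENNReal.toReal_pos h0 ht
  have haa : eLpNorm φ p volume = ‖(a : ℂ)‖ₑ := by
    rw [← ofReal_norm, Complex.norm_real, Real.norm_of_nonneg ha0.le, ENNReal.ofReal_toReal ht]
  have hac : (a : ℂ) ≠ 0 := by exact_mod_cast ha0.ne'
  refine ⟨a, (a : ℂ)⁻¹ • φ, by rw [smul_smul, mul_inv_cancel₀ hac, one_smul], haa.symm, ?_⟩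
  rw [eLpNorm_smul_L2, haa, ← enorm_mul, inv_mul_cancel₀ hac, enorm_one]

lemma enorm_inner_le_tsum_level (A B : L2 d →L[ℂ] L2 d) (φ ψ : L2 d) :
    ‖inner ℂ (B ψ) (A φ)‖ₑ ≤ ∑' k : ℤ, ∑' l : ℤ, ‖inner ℂ (B (level l ψ)) (A (level k φ))‖ₑ := by
  have h1 : Tendsto (fun N => ‖inner ℂ (B (∑ l ∈ dyadicWindow N, level l ψ))
      (A (∑ k ∈ dyadicWindow N, level k φ))‖ₑ) atTop (𝓝 ‖inner ℂ (B ψ) (A φ)‖ₑ) :=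
    ((((B.continuous.tendsto ψ).comp (tendsto_sum_level ψ)).inner
      ((A.continuous.tendsto φ).comp (tendsto_sum_level φ)))).enorm
  refine le_of_tendsto' h1 fun N => ?_
  rw [map_sum, map_sum, inner_sum]
  simp only [sum_inner]
  refine (enorm_sum_le _ _).trans ?_
  refine le_trans (Finset.sum_le_sum fun k _ => enorm_sum_le _ _) ?_
  refine le_trans (Finset.sum_le_sum fun k _ => ENNReal.sum_le_tsum _) (ENNReal.sum_le_tsum _)

/-- For levels k and l the L¹ bound has the size 2^{x - (k+l)(P-1)} and the L² bound 2^{(k+l)(1 -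
P/2)}. Both depend only on k + l, they cross at the value 2^{xθ}, and their minimum decays
geometrically away from the crossing. This sums to a strong bound with the Riesz–Thorin exponent,
without complex interpolation. -/
lemma exists_bilinear_interpolation_normalized {p : ℝ≥0∞} (hp1 : 1 < p.toReal)
    (hp2 : p.toReal < 2) : ∃ C : ℝ≥0, ∀ (A B : L2 d →L[ℂ] L2 d) (x : ℝ),
      (∀ φ, ‖A φ‖ = ‖φ‖) → (∀ φ, ‖B φ‖ = ‖φ‖) →
      (∀ φ ψ, ‖inner ℂ (B ψ) (A φ)‖ₑ ≤ pow2 x * (eLpNorm φ 1 volume * eLpNorm ψ 1 volume)) →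
      ∀ φ ψ : L2 d, eLpNorm φ p volume = 1 → eLpNorm ψ p volume = 1 →
        ‖inner ℂ (B ψ) (A φ)‖ₑ ≤ C * pow2 (x * (2 / p.toReal - 1)) := by
  have hp0 : p ≠ 0 := fun h => by norm_num [h] at hp1
  have hpt : p ≠ ∞ := fun h => by norm_num [h] at hp1
  obtain ⟨C₁, hC₁⟩ := exists_tsum_levelVolume_le (d := d) hp0 hpt
  set P := p.toReal with hP
  have hP0 : 0 < P := by linarith
  set θ := 2 / P - 1 with hθ
  have hθ0 : 0 < θ := by rw [hθ, sub_pos, lt_div_iff₀ hP0]; linarith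
  have hθ1 : θ < 1 := by
    have : 2 / P < 2 := by rw [div_lt_iff₀ hP0]; linarith
    linarith
  set c := min θ (1 - θ) with hc
  have hc0 : 0 < c := lt_min hθ0 (by linarith)
  obtain ⟨C₂, hC₂⟩ := exists_tsum_pow2_le hc0 (show 0 < P / 2 by positivity)
  refine ⟨4 * (C₁ + 1) * C₂ * (C₁ + C₁), fun A B x hA hB hK φ ψ hφ hψ => ?_⟩
  set a : ℤ → ℝ≥0∞ := fun k => pow2 (P * k) * levelVolume k φ with ha
  set b : ℤ → ℝ≥0∞ := fun k => pow2 (P * k) * levelVolume k ψ with hb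
  have ha1 : ∑' k, a k ≤ C₁ := by simpa [hφ] using hC₁ φ
  have hb1 : ∑' k, b k ≤ C₁ := by simpa [hψ] using hC₁ ψ
  have hva : ∀ k, levelVolume k φ = pow2 (-(P * k)) * a k := fun k => by
    rw [ha, ← mul_assoc, ← pow2_add, neg_add_cancel, pow2_zero, one_mul]
  have hvb : ∀ k, levelVolume k ψ = pow2 (-(P * k)) * b k := fun k => by
    rw [hb, ← mul_assoc, ← pow2_add, neg_add_cancel, pow2_zero, one_mul]
  clear_value a b
  have four : pow2 2 = 4 := by rw [pow2]; norm_num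
  have bound : ∀ k l : ℤ, ‖inner ℂ (B (level l ψ)) (A (level k φ))‖ₑ ≤
      4 * (C₁ + 1) * pow2 (x * θ) * pow2 (-(c * |P / 2 * ((k + l : ℤ) : ℝ) + -x|)) * (a k + b l) := by
    intro k l
    have h1 : ‖inner ℂ (B (level l ψ)) (A (level k φ))‖ₑ ≤
        4 * (C₁ + 1) * (a k + b l) * pow2 (x - (k + l) * (P - 1)) := by
      calc _ ≤ pow2 x * ((pow2 (k + 1) * levelVolume k φ) * (pow2 (l + 1) * levelVolume l ψ)) := by
            refine (hK _ _).trans ?_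
            gcongr <;> exact eLpNorm_one_level_le _ _
        _ = 4 * (a k * b l) * pow2 (x - (k + l) * (P - 1)) := by
            rw [hva, hvb, ← four]
            have : pow2 2 * pow2 (x - (k + l) * (P - 1)) =
                pow2 x * pow2 (k + 1) * pow2 (-(P * k)) * pow2 (l + 1) * pow2 (-(P * l)) := by
              simp only [← pow2_add]
              congr 1; ring
            calc _ = pow2 x * pow2 (k + 1) * pow2 (-(P * k)) * pow2 (l + 1) * pow2 (-(P * l)) *
                  (a k * b l) := by ring
              _ = _ := by rw [← this]; ring
        _ ≤ 4 * ((C₁ + 1) * (a k + b l)) * pow2 (x - (k + l) * (P - 1)) := by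
            have : a k * b l ≤ (C₁ + 1) * (a k + b l) :=
              calc a k * b l ≤ a k * C₁ := by gcongr; exact (ENNReal.le_tsum l).trans hb1
                _ = C₁ * a k := mul_comm _ _
                _ ≤ _ := mul_le_mul' le_self_add le_self_add
            gcongr
        _ = _ := by ring
    have h2 : ‖inner ℂ (B (level l ψ)) (A (level k φ))‖ₑ ≤
        4 * (C₁ + 1) * (a k + b l) * pow2 ((k + l) * (1 - P / 2)) := by
      calc _ ≤ (pow2 (l + 1) * levelVolume l ψ ^ (1 / 2 : ℝ)) *
            (pow2 (k + 1) * levelVolume k φ ^ (1 / 2 : ℝ)) := by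
            refine (enorm_inner_le_mul _ _).trans ?_
            rw [← ofReal_norm (B _), hB, ofReal_norm, ← ofReal_norm (A _), hA, ofReal_norm]
            gcongr <;> exact enorm_level_le _ _
        _ = 4 * (b l ^ (1 / 2 : ℝ) * a k ^ (1 / 2 : ℝ)) * pow2 ((k + l) * (1 - P / 2)) := by
            rw [hva, hvb, ENNReal.mul_rpow_of_nonneg _ _ (by norm_num),
              ENNReal.mul_rpow_of_nonneg _ _ (by norm_num), pow2_rpow, pow2_rpow, ← four]
            have : pow2 2 * pow2 ((k + l) * (1 - P / 2)) = pow2 (l + 1) * pow2 (-(P * l) * (1 / 2)) *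
                pow2 (k + 1) * pow2 (-(P * k) * (1 / 2)) := by
              simp only [← pow2_add]
              congr 1; ring
            calc _ = pow2 (l + 1) * pow2 (-(P * l) * (1 / 2)) *
                  pow2 (k + 1) * pow2 (-(P * k) * (1 / 2)) *
                  (b l ^ (1 / 2 : ℝ) * a k ^ (1 / 2 : ℝ)) := by ring
              _ = _ := by rw [← this]; ring
        _ ≤ 4 * (1 * (a k + b l)) * pow2 ((k + l) * (1 - P / 2)) := by
            refine mul_le_mul' (mul_le_mul' le_rfl ?_) le_rfl
            calc b l ^ (1 / 2 : ℝ) * a k ^ (1 / 2 : ℝ)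
                ≤ (a k + b l) ^ (1 / 2 : ℝ) * (a k + b l) ^ (1 / 2 : ℝ) := by
                  gcongr
                  · exact le_add_self
                  · exact le_self_add
              _ = 1 * (a k + b l) := by
                  rw [← ENNReal.rpow_add_of_nonneg _ _ (by norm_num) (by norm_num)]
                  norm_num
        _ ≤ 4 * ((C₁ + 1) * (a k + b l)) * pow2 ((k + l) * (1 - P / 2)) := by
            gcongr
            exact le_add_self
        _ = _ := by ring
    -- The variable u measures the distance from the crossing; there the exponents are xθ - (1 - θ)u
    -- and xθ + θu.
    have h3 : min (x - (k + l) * (P - 1)) ((k + l) * (1 - P / 2)) ≤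
        x * θ - c * |P / 2 * ((k + l : ℤ) : ℝ) + -x| := by
      set u := P / 2 * ((k + l : ℤ) : ℝ) + -x with hu
      have hn : ((k : ℝ) + l) = (u + x) * (2 / P) := by rw [hu]; push_cast; field_simp; ring
      have e2 : ((k : ℝ) + l) * (1 - P / 2) = x * θ + θ * u := by
        rw [hn, hθ]; field_simp; ring
      have e1 : x - ((k : ℝ) + l) * (P - 1) = x * θ - (1 - θ) * u := by
        rw [hn, hθ]; field_simp; ring
      rw [e1, e2]
      rcases le_total 0 u with h | h
      · refine (min_le_left _ _).trans ?_
        rw [abs_of_nonneg h]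
        linarith [mul_le_mul_of_nonneg_right (min_le_right θ (1 - θ)) h]
      · refine (min_le_right _ _).trans ?_
        rw [abs_of_nonpos h]
        nlinarith [mul_le_mul_of_nonneg_right (min_le_left θ (1 - θ)) (neg_nonneg.2 h)]
    have h4 : ‖inner ℂ (B (level l ψ)) (A (level k φ))‖ₑ ≤ 4 * (C₁ + 1) * (a k + b l) *
        pow2 (x * θ - c * |P / 2 * ((k + l : ℤ) : ℝ) + -x|) := by
      rcases min_le_iff.1 h3 with h | h
      · exact h1.trans (mul_le_mul' le_rfl (pow2_mono h))
      · exact h2.trans (mul_le_mul' le_rfl (pow2_mono h))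
    refine h4.trans (le_of_eq ?_)
    rw [sub_eq_add_neg, pow2_add]
    ring
  -- Summing along n = k + l separates the geometric factor in n from the weights, whose sums do not
  -- depend on n.
  have hshift : ∀ (k : ℤ) (f : ℤ → ℝ≥0∞), ∑' l, f l = ∑' n, f (n - k) := fun k f =>
    ((Equiv.subRight k).tsum_eq f).symm
  set D : ℝ≥0∞ := 4 * (C₁ + 1) * pow2 (x * θ) with hD
  set w : ℤ → ℝ≥0∞ := fun n => pow2 (-(c * |P / 2 * (n : ℝ) + -x|)) with hw
  calc ‖inner ℂ (B ψ) (A φ)‖ₑ ≤ ∑' k : ℤ, ∑' l : ℤ, D * w (k + l) * (a k + b l) :=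
        (enorm_inner_le_tsum_level A B φ ψ).trans
          (ENNReal.tsum_le_tsum fun k => ENNReal.tsum_le_tsum fun l => bound k l)
    _ = ∑' n : ℤ, ∑' k : ℤ, D * w n * (a k + b (n - k)) := by
        rw [ENNReal.tsum_comm (f := fun n k => D * w n * (a k + b (n - k)))]
        refine tsum_congr fun k => ?_
        rw [hshift k fun l => D * w (k + l) * (a k + b l)]
        refine tsum_congr fun n => ?_
        rw [add_sub_cancel]
    _ = ∑' n : ℤ, D * w n * (∑' k, a k + ∑' k, b k) := by
        refine tsum_congr fun n => ?_
        rw [ENNReal.tsum_mul_left, ENNReal.tsum_add, ← (Equiv.subLeft n).tsum_eq b]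
        rfl
    _ ≤ ∑' n : ℤ, D * w n * (C₁ + C₁) := by gcongr
    _ ≤ D * C₂ * (C₁ + C₁) := by
        rw [ENNReal.tsum_mul_right, ENNReal.tsum_mul_left]
        gcongr
        exact hC₂ (-x)
    _ = _ := by
        rw [hD]
        push_cast
        ring

/-- `L¹` and `L²` bounds of a bilinear form imply an `L^p` bound. -/
lemma exists_bilinear_interpolation {p : ℝ≥0∞} (hp1 : 1 < p.toReal)
    (hp2 : p.toReal < 2) : ∃ C : ℝ≥0, ∀ (A B : L2 d →L[ℂ] L2 d) (K : ℝ≥0∞), K ≠ 0 →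
      (∀ φ, ‖A φ‖ = ‖φ‖) → (∀ φ, ‖B φ‖ = ‖φ‖) →
      (∀ φ ψ, ‖inner ℂ (B ψ) (A φ)‖ₑ ≤ K * (eLpNorm φ 1 volume * eLpNorm ψ 1 volume)) →
      ∀ φ ψ : L2 d, ‖inner ℂ (B ψ) (A φ)‖ₑ ≤
        (C * K ^ (2 / p.toReal - 1)) * (eLpNorm φ p volume * eLpNorm ψ p volume) := by
  obtain ⟨C, hC⟩ := exists_bilinear_interpolation_normalized (d := d) hp1 hp2
  have hp0 : p ≠ 0 := fun h => by norm_num [h] at hp1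
  have hθ : 0 < 2 / p.toReal - 1 := by rw [sub_pos, lt_div_iff₀ (by linarith)]; linarith
  refine ⟨C + 1, fun A B K hK hA hB h φ ψ => ?_⟩
  rcases eq_or_ne (eLpNorm φ p volume) 0 with h0 | h0
  · rw [eq_zero_of_eLpNorm_eq_zero hp0 h0]; simp
  rcases eq_or_ne (eLpNorm ψ p volume) 0 with h1 | h1
  · rw [eq_zero_of_eLpNorm_eq_zero hp0 h1]; simp
  have hKθ : K ^ (2 / p.toReal - 1) ≠ 0 := by simp [hK, hθ.not_gt]
  have hC1 : ((C + 1 : ℝ≥0) : ℝ≥0∞) ≠ 0 := by simp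
  rcases eq_or_ne K ∞ with rfl | hKt
  · rw [ENNReal.top_rpow_of_pos hθ, ENNReal.mul_top hC1, ENNReal.top_mul (mul_ne_zero h0 h1)]
    exact le_top
  rcases eq_or_ne (eLpNorm φ p volume) ∞ with h2 | h2
  · rw [h2, ENNReal.top_mul h1, ENNReal.mul_top (mul_ne_zero hC1 hKθ)]
    exact le_top
  rcases eq_or_ne (eLpNorm ψ p volume) ∞ with h3 | h3
  · rw [h3, ENNReal.mul_top h0, ENNReal.mul_top (mul_ne_zero hC1 hKθ)]
    exact le_top
  obtain ⟨x, rfl⟩ := exists_eq_pow2 hK hKt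
  obtain ⟨c, φ', hφ, hc, hφ'⟩ := exists_normalized h0 h2
  obtain ⟨c', ψ', hψ, hc', hψ'⟩ := exists_normalized h1 h3
  rw [← hc, ← hc', hφ, hψ, map_smul, map_smul, inner_smul_left, inner_smul_right, enorm_mul,
    enorm_mul, RCLike.enorm_conj, pow2_rpow]
  calc ‖c'‖ₑ * (‖c‖ₑ * ‖inner ℂ (B ψ') (A φ')‖ₑ)
      ≤ ‖c'‖ₑ * (‖c‖ₑ * (C * pow2 (x * (2 / p.toReal - 1)))) := by
        gcongr
        exact hC A B x hA hB h φ' ψ' hφ' hψ'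
    _ = C * pow2 (x * (2 / p.toReal - 1)) * (‖c‖ₑ * ‖c'‖ₑ) := by ring
    _ ≤ _ := by
        gcongr
        exact_mod_cast le_self_add

/-! ### The bilinear estimate from the Hardy–Littlewood–Sobolev inequality -/

open ContinuousLinearMap (adjoint)

lemma enorm_pairing_le_lintegral {V : ℝ → (L2 d →L[ℂ] L2 d)} (W : Set ℝ) (F G : ℝ → L2 d) :
    ‖pairing V W F G‖ₑ ≤
      ∫⁻ z : ℝ × ℝ, ‖inner ℂ (adjoint (V z.2) (G z.2)) (adjoint (V z.1) (F z.1))‖ₑ :=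
  (enorm_integral_le_lintegral_enorm _).trans
    (lintegral_mono fun _ => enorm_indicator_le_enorm_self _ _)

lemma dualNorm_eq {q r : ℝ≥0∞} (hq : 2 ≤ q) (F : ℝ → L2 d) :
    dualNorm q r F = (∫⁻ s, eLpNorm (F s) (ENNReal.conjExponent r) volume ^
      (ENNReal.conjExponent q).toReal) ^ (1 / (ENNReal.conjExponent q).toReal) := by
  have i1 := ENNReal.HolderConjugate.conjExponent (one_le_two.trans hq)
  refine mixedNorm_eq_lintegral (ENNReal.HolderConjugate.ne_zero _ q) (fun h1 => ?_) _ _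
  rw [(ENNReal.HolderConjugate.eq_top_iff_eq_one (ENNReal.conjExponent q) q).1 h1] at hq
  exact absurd hq (by norm_num)

/-- Apply the Hardy–Littlewood–Sobolev inequality to the spatial norms of F(s) and G(t). The window
disappears because only absolute values enter. -/
lemma exists_baseEstimate_of_weakType {q r : ℝ≥0∞} {ρ : ℝ} (hq : 2 ≤ q)
    (h1 : 1 < (ENNReal.conjExponent q).toReal) (h2 : (ENNReal.conjExponent q).toReal < 2)
    (hρ : 0 < ρ) (h : 2 / (ENNReal.conjExponent q).toReal + 1 / ρ = 2) (C₀ : ℝ≥0) :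
    ∃ C : ℝ≥0, ∀ (V : ℝ → (L2 d →L[ℂ] L2 d)) (κ : ℝ → ℝ≥0∞), WeakType ρ C₀ κ →
      (∀ s t φ ψ, ‖inner ℂ (adjoint (V t) ψ) (adjoint (V s) φ)‖ₑ ≤ κ (t - s) *
        (eLpNorm φ (ENNReal.conjExponent r) volume * eLpNorm ψ (ENNReal.conjExponent r) volume)) →
      BaseEstimate V q r C := by
  obtain ⟨C, hC⟩ := exists_hls h1 h2 hρ h C₀
  refine ⟨C, fun V κ hκ hV W hW F G hF hFi hG hGi => (enorm_pairing_le_lintegral W F G).trans ?_⟩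
  rw [dualNorm_eq hq, dualNorm_eq hq]
  exact (lintegral_mono fun _ => hV _ _ _ _).trans
    (hC κ hκ _ _ (measurable_eLpNorm_comp hF _) (measurable_eLpNorm_comp hG _))

end QuadSchrodinger

end

noncomputable section

namespace QuadSchrodinger

variable {d : ℕ}

/-! ### The endpoint: windowed bilinear bounds for the levels -/

open ContinuousLinearMap (adjoint)

/-- Layer cake: levels above 1 are empty, and level 2^i contributes 2^{i(1 - 1/ν)}, summable over i
< 0 because ν > 1. With ν = d/2 this is where d > 2 is needed. -/
lemma exists_lintegral_min_le {ν : ℝ} (hν : 1 < ν) (C₀ : ℝ≥0) :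
    ∃ C : ℝ≥0, ∀ κ : ℝ → ℝ≥0∞, WeakType (1 / ν) C₀ κ → ∀ x : ℝ,
      ∫⁻ τ, min (pow2 x * κ τ) 1 ≤ C * pow2 (x / ν) := by
  have hc : 0 < 1 - 1 / ν := by rw [sub_pos, div_lt_one (by linarith)]; exact hν
  have hfin : 2 * C₀ * ∑' i : ℤ, pow2 (-((1 - 1 / ν) * |(i : ℝ)|)) ≠ ∞ :=
    ENNReal.mul_ne_top (by finiteness) (tsum_pow2_neg_abs_ne_top hc)
  refine ⟨(2 * C₀ * ∑' i : ℤ, pow2 (-((1 - 1 / ν) * |(i : ℝ)|))).toNNReal, fun κ hκ x => ?_⟩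
  rw [ENNReal.coe_toNNReal hfin]
  have hm : Measurable fun τ => min (pow2 x * κ τ) 1 := (hκ.1.const_mul _).min measurable_const
  calc ∫⁻ τ, min (pow2 x * κ τ) 1
      ≤ ∫⁻ τ, ∑' i : ℤ, pow2 (i + 1) * above i (min (pow2 x * κ τ) 1) :=
        lintegral_mono fun τ => le_tsum_above _
    _ = ∑' i : ℤ, pow2 (i + 1) * volume {τ | pow2 i < min (pow2 x * κ τ) 1} := by
        have hma : ∀ i : ℤ, Measurable fun τ => above i (min (pow2 x * κ τ) 1) := fun i =>
          (measurable_above i).comp hm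
        rw [lintegral_tsum fun i => ((hma i).const_mul _).aemeasurable]
        refine tsum_congr fun i => ?_
        rw [lintegral_const_mul _ (hma i), lintegral_above_comp i hm]
    _ ≤ ∑' i : ℤ, 2 * C₀ * pow2 (-((1 - 1 / ν) * |(i : ℝ)|)) * pow2 (x / ν) := by
        refine ENNReal.tsum_le_tsum fun i => ?_
        rcases lt_or_ge i 0 with hi | hi
        · have h1 : volume {τ | pow2 i < min (pow2 x * κ τ) 1} ≤ C₀ * pow2 (-(1 / ν * (i - x))) := by
            refine (measure_mono fun τ hτ => ?_).trans (hκ.2 (i - x))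
            have h2 : pow2 i < pow2 x * κ τ := (lt_min_iff.1 hτ).1
            have h3 : pow2 (i : ℝ) = pow2 x * pow2 (i - x) := by rw [← pow2_add]; congr 1; ring
            rw [h3] at h2
            exact (ENNReal.mul_lt_mul_iff_right (pow2_ne_zero x) (pow2_ne_top x)).1 h2
          calc pow2 (i + 1) * volume {τ | pow2 i < min (pow2 x * κ τ) 1}
              ≤ pow2 (i + 1) * (C₀ * pow2 (-(1 / ν * (i - x)))) := by gcongr
            _ = 2 * C₀ * pow2 (-((1 - 1 / ν) * |(i : ℝ)|)) * pow2 (x / ν) := by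
                rw [← pow2_one]
                have : pow2 (i + 1) * pow2 (-(1 / ν * (i - x))) =
                    pow2 1 * pow2 (-((1 - 1 / ν) * |(i : ℝ)|)) * pow2 (x / ν) := by
                  simp only [← pow2_add]
                  rw [abs_of_neg (by exact_mod_cast hi)]
                  congr 1; ring
                calc _ = C₀ * (pow2 (i + 1) * pow2 (-(1 / ν * (i - x)))) := by ring
                  _ = _ := by rw [this]; ring
        · have h1 : {τ | pow2 i < min (pow2 x * κ τ) 1} = ∅ := by
            refine eq_empty_of_forall_notMem fun τ hτ => ?_
            have h2 : pow2 i < 1 := (lt_min_iff.1 hτ).2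
            rw [← pow2_zero] at h2
            exact h2.not_ge (pow2_mono (by exact_mod_cast hi))
          rw [h1, measure_empty, mul_zero]
          exact zero_le
    _ = _ := by rw [ENNReal.tsum_mul_right, ENNReal.tsum_mul_left]

/-- A decomposition `F = ∑ F_k` of a function with values in `L²` into levels, where `a(s)` is the
`L^p` norm of `F(s)` and `α_k(s)` are the relative weights of the levels. -/
structure LevelDecomposition (p : ℝ) (C : ℝ≥0) (F : ℝ → L2 d) (a : ℝ → ℝ≥0∞)
    (α : ℤ → ℝ → ℝ≥0∞) (Fk : ℤ → ℝ → L2 d) : Prop where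
  stronglyMeasurable : ∀ k, StronglyMeasurable (Fk k)
  measurable : Measurable a
  measurable_weight : ∀ k, Measurable (α k)
  norm_one_le : ∀ k s, eLpNorm (Fk k s) 1 volume ≤ pow2 (1 + k - p * k) * (a s * α k s)
  enorm_le : ∀ k s, ‖Fk k s‖ₑ ≤ pow2 (1 + k - p * k / 2) * (a s * α k s ^ (1 / 2 : ℝ))
  tsum_le : ∀ s, ∑' k, α k s ≤ C
  norm_le : ∀ k s, ‖Fk k s‖ ≤ ‖F s‖
  norm_sum_le : ∀ N s, ‖∑ k ∈ dyadicWindow N, Fk k s‖ ≤ ‖F s‖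
  tendsto : ∀ᵐ s, Tendsto (fun N => ∑ k ∈ dyadicWindow N, Fk k s) atTop (𝓝 (F s))

lemma norm_level_le (k : ℤ) (φ : L2 d) : ‖level k φ‖ ≤ ‖φ‖ :=
  Lp.norm_le_norm_of_ae_le (norm_truncation_sub_le (by omega) φ)

/-- Normalise F(s) in L^p at each time and decompose the quotient. The heights are then relative to
a(s), and the weights 2^{pk}|{2^k < |f(s)|}| have a sum bounded uniformly in s. -/
lemma exists_levelDecomposition {p : ℝ≥0∞} (h0 : p ≠ 0) (ht : p ≠ ∞) : ∃ C : ℝ≥0, 1 ≤ C ∧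
    ∀ F : ℝ → L2 d, StronglyMeasurable F → (∀ᵐ s, eLpNorm (F s) p volume ≠ ∞) →
      ∃ α Fk, LevelDecomposition p.toReal C F (fun s => eLpNorm (F s) p volume) α Fk := by
  obtain ⟨C, hC⟩ := exists_tsum_levelVolume_le (d := d) h0 ht
  refine ⟨C + 1, le_add_self, fun F hF hfin => ?_⟩
  set a : ℝ → ℝ≥0∞ := fun s => eLpNorm (F s) p volume with ha
  have ham : Measurable a := measurable_eLpNorm_comp hF p
  -- Where a(s) is 0 or ∞ the real inverse is 0 and f(s) = 0. In the first case F(s) = 0 as well;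
  -- the second occurs only on a null set.
  set f : ℝ → L2 d := fun s => (((a s).toReal⁻¹ : ℝ) : ℂ) • F s with hf
  have hfm : StronglyMeasurable f :=
    (Complex.measurable_ofReal.comp ham.ennreal_toReal.inv).stronglyMeasurable.smul hF
  have hc : StronglyMeasurable fun s => ((a s).toReal : ℂ) :=
    (Complex.measurable_ofReal.comp ham.ennreal_toReal).stronglyMeasurable
  have hce : ∀ s, ‖((a s).toReal : ℂ)‖ₑ ≤ a s := fun s => by
    rw [← ofReal_norm, Complex.norm_real, Real.norm_of_nonneg ENNReal.toReal_nonneg]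
    exact ENNReal.ofReal_toReal_le
  have hfa : ∀ s, a s ≠ ∞ → ((a s).toReal : ℂ) • f s = F s := fun s hs => by
    rcases eq_or_ne (a s) 0 with hz | hz
    · rw [eq_zero_of_eLpNorm_eq_zero h0 hz, hz]; simp
    · have : ((a s).toReal : ℂ) ≠ 0 := by exact_mod_cast (ENNReal.toReal_pos hz hs).ne'
      rw [hf, smul_smul, Complex.ofReal_inv, mul_inv_cancel₀ this, one_smul]
  have hfn : ∀ s, ‖((a s).toReal : ℂ)‖ * ‖f s‖ ≤ ‖F s‖ := fun s => by
    rcases eq_or_ne (a s) ∞ with hz | hz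
    · rw [hz]; simp
    · rw [← norm_smul, hfa s hz]
  have hf1 : ∀ s, eLpNorm (f s) p volume ≤ 1 := fun s => by
    rw [hf, eLpNorm_smul_L2]
    change _ * a s ≤ 1
    rcases eq_or_ne (a s) ∞ with hz | hz
    · rw [hz]; simp
    rcases eq_or_ne (a s) 0 with hz' | hz'
    · rw [hz']; simp
    · rw [← ofReal_norm, Complex.norm_real, Real.norm_of_nonneg (by positivity),
        ENNReal.ofReal_inv_of_pos (ENNReal.toReal_pos hz' hz), ENNReal.ofReal_toReal hz,
        ENNReal.inv_mul_cancel hz' hz]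
  have hP := ENNReal.toReal_pos h0 ht
  have hv : ∀ (k : ℤ) s, levelVolume k (f s) =
      pow2 (-(p.toReal * k)) * (pow2 (p.toReal * k) * levelVolume k (f s)) := fun k s => by
    rw [← mul_assoc, ← pow2_add, neg_add_cancel, pow2_zero, one_mul]
  refine ⟨fun k s => pow2 (p.toReal * k) * levelVolume k (f s),
    fun k s => ((a s).toReal : ℂ) • level k (f s), ?_⟩
  refine ⟨fun k => hc.smul ((continuous_level k).comp_stronglyMeasurable hfm), ham,
    fun k => (measurable_levelVolume_comp hfm k).const_mul _, fun k s => ?_, fun k s => ?_,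
    fun s => ?_, fun k s => ?_, fun N s => ?_, ?_⟩
  · rw [eLpNorm_smul_L2]
    calc _ ≤ a s * (pow2 (k + 1) * (pow2 (-(p.toReal * k)) *
          (pow2 (p.toReal * k) * levelVolume k (f s)))) := by
          rw [← hv]
          exact mul_le_mul' (hce s) (eLpNorm_one_level_le _ _)
      _ = _ := by
          have : pow2 (1 + k - p.toReal * k) = pow2 (k + 1) * pow2 (-(p.toReal * k)) := by
            rw [← pow2_add]; congr 1; ring
          rw [this]; ring
  · rw [enorm_smul]
    calc _ ≤ a s * (pow2 (k + 1) * (pow2 (-(p.toReal * k)) *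
          (pow2 (p.toReal * k) * levelVolume k (f s))) ^ (1 / 2 : ℝ)) := by
          rw [← hv]
          exact mul_le_mul' (hce s) (enorm_level_le _ _)
      _ = _ := by
          rw [ENNReal.mul_rpow_of_nonneg (pow2 (-(p.toReal * k))) _ (by norm_num), pow2_rpow]
          have : pow2 (1 + k - p.toReal * k / 2) =
              pow2 (k + 1) * pow2 (-(p.toReal * k) * (1 / 2)) := by
            rw [← pow2_add]; congr 1; ring
          rw [this]; ring
  · refine (hC (f s)).trans ?_
    calc (C : ℝ≥0∞) * eLpNorm (f s) p volume ^ p.toReal ≤ C * 1 ^ p.toReal := by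
          gcongr; exact hf1 s
      _ ≤ _ := by rw [ENNReal.one_rpow, mul_one]; exact_mod_cast le_self_add
  · rw [norm_smul]
    exact (mul_le_mul_of_nonneg_left (norm_level_le k _) (norm_nonneg _)).trans (hfn s)
  · rw [← Finset.smul_sum, norm_smul]
    exact (mul_le_mul_of_nonneg_left (norm_sum_level_le N _) (norm_nonneg _)).trans (hfn s)
  · filter_upwards [hfin] with s hs
    simp only [← Finset.smul_sum]
    have := (tendsto_sum_level (f s)).const_smul ((a s).toReal : ℂ)
    rwa [hfa s hs] at this

lemma mul_le_sq_add_sq (x y : ℝ≥0∞) : x * y ≤ x ^ 2 + y ^ 2 := by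
  rcases le_total x y with h | h
  · exact (mul_le_mul' h le_rfl).trans ((sq y).symm.le.trans le_add_self)
  · exact (mul_le_mul' le_rfl h).trans ((sq x).symm.le.trans le_self_add)

lemma LevelDecomposition.sq_mul_sq_le {p : ℝ} {C : ℝ≥0} {F : ℝ → L2 d} {a : ℝ → ℝ≥0∞}
    {α : ℤ → ℝ → ℝ≥0∞} {Fk : ℤ → ℝ → L2 d} (h : LevelDecomposition p C F a α Fk) (k : ℤ) (s : ℝ) :
    (a s * α k s) ^ 2 ≤ C * (a s ^ 2 * α k s) := by
  have h1 : α k s ≤ C := (ENNReal.le_tsum k).trans (h.tsum_le s)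
  calc (a s * α k s) ^ 2 = α k s * (a s ^ 2 * α k s) := by ring
    _ ≤ _ := by gcongr

/-- The square of the norm of an integral as a double integral. -/
lemma enorm_integral_sq_le {μ : Measure ℝ} {H : ℝ → L2 d} (hH : Integrable H μ) :
    ‖∫ s, H s ∂μ‖ₑ ^ 2 ≤ ∫⁻ s, ∫⁻ s', ‖inner ℂ (H s) (H s')‖ₑ ∂μ ∂μ := by
  set x := ∫ s, H s ∂μ with hx
  have h1 : ‖x‖ₑ ^ 2 = ‖inner ℂ x x‖ₑ := by
    rw [inner_self_eq_norm_sq_to_K, enorm_pow]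
    congr 1
    change _ = ‖((‖x‖ : ℝ) : ℂ)‖ₑ
    rw [← ofReal_norm ((‖x‖ : ℝ) : ℂ), Complex.norm_real, norm_norm, ofReal_norm]
  rw [h1]
  nth_rw 2 [hx]
  rw [← integral_inner hH]
  refine (enorm_integral_le_lintegral_enorm _).trans (lintegral_mono fun s => ?_)
  rw [← RCLike.enorm_conj, inner_conj_symm, hx, ← integral_inner hH]
  exact enorm_integral_le_lintegral_enorm _

/-- The kernel bound for a family of unitary operators. -/
def DispersiveBound (V : ℝ → (L2 d →L[ℂ] L2 d)) (K : ℝ → ℝ≥0∞) : Prop :=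
  ∀ s t φ ψ, ‖inner ℂ (adjoint (V t) ψ) (adjoint (V s) φ)‖ₑ ≤
    K (t - s) * (eLpNorm φ 1 volume * eLpNorm ψ 1 volume)

/-- An endpoint L²_t bound for a single level. The squared norm is a double integral with kernel of
size 2^{2+2k-pk} min(2^{-pk}K(s - s'), 1), combining dispersion and unitarity, and Schur's test
applies because this kernel is integrable. -/
lemma exists_enorm_window_le {p : ℝ} (hd : 2 < d) (hp : p * (1 + 2 / d) = 2) (C₀ C₁ : ℝ≥0)
    (hC₁ : 1 ≤ C₁) : ∃ C : ℝ≥0, ∀ (V : ℝ → (L2 d →L[ℂ] L2 d)) (K : ℝ → ℝ≥0∞),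
      UnitaryFamily V → WeakType (2 / d) C₀ K → DispersiveBound V K →
      ∀ (F : ℝ → L2 d) (a : ℝ → ℝ≥0∞) (α : ℤ → ℝ → ℝ≥0∞) (Fk : ℤ → ℝ → L2 d),
      Integrable F → LevelDecomposition p C₁ F a α Fk → ∀ (k : ℤ) (S : Set ℝ),
        MeasurableSet S →
        ‖∫ s in S, adjoint (V s) (Fk k s)‖ₑ ^ 2 ≤ C * ∫⁻ s in S, a s ^ 2 * α k s := by
  have hd0 : (0 : ℝ) < d := by exact_mod_cast (by omega : 0 < d)
  have hν : 1 < (d : ℝ) / 2 := by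
    rw [lt_div_iff₀ two_pos, one_mul]; exact_mod_cast hd
  obtain ⟨C, hC⟩ := exists_lintegral_min_le hν C₀
  refine ⟨4 * (C₁ * (2 * C)), fun V K hV hK hVK F a α Fk hFi hF k S hS => ?_⟩
  set e : ℝ → L2 d := fun s => adjoint (V s) (Fk k s) with he
  have hFki : Integrable (Fk k) := hFi.mono (hF.stronglyMeasurable k).aestronglyMeasurable
    (Eventually.of_forall fun s => hF.norm_le k s)
  have hei : Integrable e := hV.integrable_adjoint (hF.stronglyMeasurable k) hFki
  set m : ℝ → ℝ≥0∞ := fun τ => min (pow2 (-(p * k)) * K τ) 1 with hm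
  have hmm : Measurable m := (hK.1.const_mul _).min measurable_const
  set u : ℝ → ℝ≥0∞ := fun s => a s ^ 2 * α k s with hu
  have hum : Measurable u := (hF.measurable.pow_const 2).mul (hF.measurable_weight k)
  have hC1 : ∀ s, α k s ≤ C₁ := fun s => (ENNReal.le_tsum k).trans (hF.tsum_le s)
  have h2α : ∀ s, (a s * α k s ^ (1 / 2 : ℝ)) ^ 2 = u s := fun s => by
    rw [mul_pow, ← ENNReal.rpow_ofNat (α k s ^ (1 / 2 : ℝ)), ← ENNReal.rpow_mul]
    norm_num [hu]
  set D : ℝ≥0∞ := pow2 (2 + 2 * k - p * k) with hD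
  have key : ∀ s s', ‖inner ℂ (e s) (e s')‖ₑ ≤ D * C₁ * (m (s - s') * (u s + u s')) := by
    intro s s'
    have hy : (a s * α k s ^ (1 / 2 : ℝ)) * (a s' * α k s' ^ (1 / 2 : ℝ)) ≤ u s + u s' := by
      rw [← h2α, ← h2α]; exact mul_le_sq_add_sq _ _
    set y := (a s * α k s ^ (1 / 2 : ℝ)) * (a s' * α k s' ^ (1 / 2 : ℝ)) with hydef
    have b1 : ‖inner ℂ (e s) (e s')‖ₑ ≤ D * C₁ * ((pow2 (-(p * k)) * K (s - s')) * y) := by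
      have hsq : ∀ s, α k s = α k s ^ (1 / 2 : ℝ) * α k s ^ (1 / 2 : ℝ) := fun s => by
        rw [← ENNReal.rpow_add_of_nonneg _ _ (by norm_num) (by norm_num)]; norm_num
      have hcc : α k s ^ (1 / 2 : ℝ) * α k s' ^ (1 / 2 : ℝ) ≤ C₁ := by
        calc _ ≤ (C₁ : ℝ≥0∞) ^ (1 / 2 : ℝ) * (C₁ : ℝ≥0∞) ^ (1 / 2 : ℝ) := by
              gcongr <;> exact hC1 _
          _ = C₁ := by
              rw [← ENNReal.rpow_add_of_nonneg _ _ (by norm_num) (by norm_num)]; norm_num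
      calc ‖inner ℂ (e s) (e s')‖ₑ ≤ K (s - s') *
            ((pow2 (1 + k - p * k) * (a s' * α k s')) * (pow2 (1 + k - p * k) * (a s * α k s))) := by
            refine (hVK s' s _ _).trans ?_
            gcongr <;> exact hF.norm_one_le _ _
        _ = D * (α k s ^ (1 / 2 : ℝ) * α k s' ^ (1 / 2 : ℝ)) *
              ((pow2 (-(p * k)) * K (s - s')) * y) := by
            have : D * pow2 (-(p * k)) = pow2 (1 + k - p * k) * pow2 (1 + k - p * k) := by
              rw [hD, ← pow2_add, ← pow2_add]; congr 1; ring
            rw [hydef]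
            nth_rw 1 [hsq s, hsq s']
            calc _ = pow2 (1 + k - p * k) * pow2 (1 + k - p * k) * (K (s - s') * (a s' * a s) *
                  (α k s ^ (1 / 2 : ℝ) * α k s ^ (1 / 2 : ℝ) *
                  (α k s' ^ (1 / 2 : ℝ) * α k s' ^ (1 / 2 : ℝ)))) := by ring
              _ = _ := by rw [← this]; ring
        _ ≤ _ := by gcongr
    have b2 : ‖inner ℂ (e s) (e s')‖ₑ ≤ D * C₁ * (1 * y) := by
      calc ‖inner ℂ (e s) (e s')‖ₑ ≤ (pow2 (1 + k - p * k / 2) * (a s * α k s ^ (1 / 2 : ℝ))) *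
            (pow2 (1 + k - p * k / 2) * (a s' * α k s' ^ (1 / 2 : ℝ))) := by
            refine (enorm_inner_le_mul _ _).trans ?_
            have hen : ∀ s, ‖e s‖ₑ = ‖Fk k s‖ₑ := fun s => by
              rw [← ofReal_norm, ← ofReal_norm, he, hV.norm_adjoint]
            rw [hen, hen]
            gcongr <;> exact hF.enorm_le _ _
        _ = D * 1 * (1 * y) := by
            have : D = pow2 (1 + k - p * k / 2) * pow2 (1 + k - p * k / 2) := by
              rw [hD, ← pow2_add]; congr 1; ring
            rw [this, hydef]; ring
        _ ≤ _ := by gcongr; exact_mod_cast hC₁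
    calc ‖inner ℂ (e s) (e s')‖ₑ ≤ D * C₁ * (m (s - s') * y) := by
          rcases min_choice (pow2 (-(p * k)) * K (s - s')) 1 with h | h <;>
            simp only [hm, h] <;> assumption
      _ ≤ _ := by gcongr
  -- The relation p(1 + 2/d) = 2 cancels the powers of 2^k: the estimate is the same for all levels.
  have hE : D * (C * pow2 (-(p * k) / (d / 2 : ℝ))) = 4 * C := by
    have : D * pow2 (-(p * k) / (d / 2 : ℝ)) = 4 := by
      rw [hD, ← pow2_add]
      have : 2 + 2 * (k : ℝ) - p * k + -(p * k) / (d / 2 : ℝ) = 2 := by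
        have h3 : -(p * k) / (d / 2 : ℝ) = -(p * (2 / d)) * k := by field_simp
        have h4 : p * (2 / d) = 2 - p := by linarith
        rw [h3, h4]; ring
      rw [this, pow2]; norm_num
    calc _ = C * (D * pow2 (-(p * k) / (d / 2 : ℝ))) := by ring
      _ = _ := by rw [this]; ring
  have hdiv : 1 / ((d : ℝ) / 2) = 2 / d := by field_simp
  have hmint : ∫⁻ τ, m τ ≤ C * pow2 (-(p * k) / (d / 2 : ℝ)) := hC K (hdiv ▸ hK) (-(p * k))
  have hi1 : ∫⁻ s in S, ∫⁻ s' in S, m (s - s') * u s ≤ (∫⁻ τ, m τ) * ∫⁻ s in S, u s := by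
    rw [← lintegral_const_mul _ hum]
    refine lintegral_mono fun s => ?_
    have hms : Measurable fun s' => m (s - s') := hmm.comp (measurable_const.sub measurable_id)
    calc _ ≤ ∫⁻ s', m (s - s') * u s := setLIntegral_le_lintegral _ _
      _ = _ := by
        rw [lintegral_mul_const _ hms, lintegral_sub_left_eq_self (fun τ => m τ) s]
  have hjm : Measurable fun z : ℝ × ℝ => m (z.1 - z.2) * u z.2 :=
    (hmm.comp (measurable_fst.sub measurable_snd)).mul (hum.comp measurable_snd)
  have hi2 : ∫⁻ s in S, ∫⁻ s' in S, m (s - s') * u s' ≤ (∫⁻ τ, m τ) * ∫⁻ s in S, u s := by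
    rw [lintegral_lintegral_swap hjm.aemeasurable, ← lintegral_const_mul _ hum]
    refine lintegral_mono fun s' => ?_
    have hms : Measurable fun s => m (s - s') := hmm.comp (measurable_id.sub_const s')
    calc _ ≤ ∫⁻ s, m (s - s') * u s' := setLIntegral_le_lintegral _ _
      _ = _ := by
        rw [lintegral_mul_const _ hms, lintegral_sub_right_eq_self (fun τ => m τ) s']
  have hDC : D * C₁ ≠ ∞ := ENNReal.mul_ne_top (pow2_ne_top _) ENNReal.coe_ne_top
  calc ‖∫ s in S, e s‖ₑ ^ 2
      ≤ ∫⁻ s in S, ∫⁻ s' in S, D * C₁ * (m (s - s') * u s + m (s - s') * u s') := by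
        refine (enorm_integral_sq_le hei.integrableOn).trans ?_
        refine lintegral_mono fun s => lintegral_mono fun s' => ?_
        rw [← mul_add]
        exact key s s'
    _ = D * C₁ * ((∫⁻ s in S, ∫⁻ s' in S, m (s - s') * u s) +
          ∫⁻ s in S, ∫⁻ s' in S, m (s - s') * u s') := by
        have hmz : Measurable fun z : ℝ × ℝ => m (z.1 - z.2) * u z.1 :=
          (hmm.comp (measurable_fst.sub measurable_snd)).mul (hum.comp measurable_fst)
        have h1 : Measurable fun s => ∫⁻ s' in S, m (s - s') * u s := hmz.lintegral_prod_right'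
        rw [← lintegral_add_left h1, ← lintegral_const_mul' _ _ hDC]
        refine lintegral_congr fun s => ?_
        have h2 : Measurable fun s' => m (s - s') * u s :=
          (hmm.comp (measurable_const.sub measurable_id)).mul_const _
        rw [← lintegral_add_left h2, ← lintegral_const_mul' _ _ hDC]
    _ ≤ D * C₁ * ((∫⁻ τ, m τ) * (∫⁻ s in S, u s) + (∫⁻ τ, m τ) * ∫⁻ s in S, u s) := by gcongr
    _ ≤ D * C₁ * (2 * (C * pow2 (-(p * k) / (d / 2 : ℝ))) * ∫⁻ s in S, u s) := by
        gcongr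
        rw [← add_mul, ← two_mul]
        gcongr
    _ = C₁ * 2 * (D * (C * pow2 (-(p * k) / (d / 2 : ℝ)))) * ∫⁻ s in S, u s := by ring
    _ = _ := by
        rw [hE]; push_cast; ring

end QuadSchrodinger

end

noncomputable section

namespace QuadSchrodinger

variable {d : ℕ}

open ContinuousLinearMap (adjoint)

/-! ### Pairings of two levels over one shell of the kernel, and their sum -/

lemma indicator_window_eq {E : Set ℝ} (z : ℝ × ℝ) {M : Type*} [Zero M] (f : ℝ × ℝ → M) [Decidable (z.2 - z.1 ∈ E)] :
    {z : ℝ × ℝ | z.2 - z.1 ∈ E}.indicator f z = if z.2 - z.1 ∈ E then f z else 0 := by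
  split_ifs with h
  · exact indicator_of_mem (by exact h) _
  · exact indicator_of_notMem (by exact h) _

namespace LevelDecomposition

variable {p : ℝ} {C₁ : ℝ≥0} {F G : ℝ → L2 d} {a b : ℝ → ℝ≥0∞} {α β : ℤ → ℝ → ℝ≥0∞}
  {Fk Gl : ℤ → ℝ → L2 d} {V : ℝ → (L2 d →L[ℂ] L2 d)} {K : ℝ → ℝ≥0∞}

lemma measurable_density (hF : LevelDecomposition p C₁ F a α Fk) (k : ℤ) :
    Measurable fun s => a s ^ 2 * α k s :=
  (hF.measurable.pow_const 2).mul (hF.measurable_weight k)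

lemma integrable (hF : LevelDecomposition p C₁ F a α Fk) (hFi : Integrable F) (k : ℤ) :
    Integrable (Fk k) :=
  hFi.mono (hF.stronglyMeasurable k).aestronglyMeasurable
    (Eventually.of_forall fun s => hF.norm_le k s)

/-- The bound of a windowed pairing of two levels by the dispersive estimate. -/
lemma enorm_pairing_le_of_dispersive (hF : LevelDecomposition p C₁ F a α Fk)
    (hG : LevelDecomposition p C₁ G b β Gl) (hVK : DispersiveBound V K) {E : Set ℝ}
    (hE : MeasurableSet E) {y : ℝ} (hK : ∀ τ ∈ E, K τ ≤ pow2 y) (k l : ℤ) :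
    ‖pairing V E (Fk k) (Gl l)‖ₑ ≤ pow2 (2 + y + (k + l) * (1 - p)) * C₁ *
      (volume E * (∫⁻ s, a s ^ 2 * α k s) + volume E * ∫⁻ t, b t ^ 2 * β l t) := by
  classical
  set D : ℝ≥0∞ := pow2 (2 + y + (k + l) * (1 - p)) with hD
  have hDC : D * C₁ ≠ ∞ := ENNReal.mul_ne_top (pow2_ne_top _) ENNReal.coe_ne_top
  have hu := hF.measurable_density k
  have hv := hG.measurable_density l
  have he : Measurable (E.indicator (1 : ℝ → ℝ≥0∞)) := measurable_one.indicator hE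
  have h1 := lintegral_sub_mul_fst he hu.aemeasurable
  have h2 := lintegral_sub_mul_snd he hv.aemeasurable
  rw [lintegral_indicator_one hE] at h1 h2
  have hm1 : Measurable fun z : ℝ × ℝ => E.indicator (1 : ℝ → ℝ≥0∞) (z.2 - z.1) *
      (a z.1 ^ 2 * α k z.1) :=
    (he.comp (measurable_snd.sub measurable_fst)).mul (hu.comp measurable_fst)
  rw [← h1, ← h2, ← lintegral_add_left hm1, ← lintegral_const_mul' _ _ hDC]
  refine (enorm_integral_le_lintegral_enorm _).trans (lintegral_mono fun z => ?_)
  beta_reduce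
  rw [indicator_window_eq, indicator_apply]
  split_ifs with hz
  · rw [Pi.one_apply, one_mul, one_mul]
    calc _ ≤ pow2 y * ((pow2 (1 + k - p * k) * (a z.1 * α k z.1)) *
          (pow2 (1 + l - p * l) * (b z.2 * β l z.2))) := by
          refine (hVK z.1 z.2 _ _).trans ?_
          gcongr
          exacts [hK _ hz, hF.norm_one_le _ _, hG.norm_one_le _ _]
      _ = D * ((a z.1 * α k z.1) * (b z.2 * β l z.2)) := by
          have : D = pow2 y * pow2 (1 + k - p * k) * pow2 (1 + l - p * l) := by
            rw [hD, ← pow2_add, ← pow2_add]; congr 1; ring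
          rw [this]; ring
      _ ≤ D * (C₁ * (a z.1 ^ 2 * α k z.1) + C₁ * (b z.2 ^ 2 * β l z.2)) := by
          gcongr
          exact (mul_le_sq_add_sq _ _).trans
            (add_le_add (hF.sq_mul_sq_le _ _) (hG.sq_mul_sq_le _ _))
      _ = _ := by ring
  · simp

/-- The bound of a windowed pairing of two levels by a square function estimate. -/
lemma enorm_pairing_le_of_window (hV : UnitaryFamily V) (hF : LevelDecomposition p C₁ F a α Fk)
    (hG : LevelDecomposition p C₁ G b β Gl) (hFi : Integrable F) (hGi : Integrable G) {C : ℝ≥0}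
    (k l : ℤ) (hw : ∀ S : Set ℝ, MeasurableSet S →
      ‖∫ s in S, adjoint (V s) (Fk k s)‖ₑ ^ 2 ≤ C * ∫⁻ s in S, a s ^ 2 * α k s) {E : Set ℝ}
    (hE : MeasurableSet E) (j : ℝ) :
    ‖pairing V E (Fk k) (Gl l)‖ₑ ≤ pow2 (1 + l - p * l / 2) *
      (pow2 (j / 2) * (∫⁻ t, b t ^ 2 * β l t) +
        pow2 (-(j / 2)) * (C * (volume E * ∫⁻ s, a s ^ 2 * α k s))) := by
  classical
  have hu := hF.measurable_density k
  have hv := hG.measurable_density l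
  have he : Measurable (E.indicator (1 : ℝ → ℝ≥0∞)) := measurable_one.indicator hE
  have h1 := lintegral_sub_mul_fst he hu.aemeasurable
  have hm1 : Measurable fun z : ℝ × ℝ => E.indicator (1 : ℝ → ℝ≥0∞) (z.2 - z.1) *
      (a z.1 ^ 2 * α k z.1) :=
    (he.comp (measurable_snd.sub measurable_fst)).mul (hu.comp measurable_fst)
  rw [lintegral_indicator_one hE, Measure.volume_eq_prod,
    lintegral_prod_symm _ hm1.aemeasurable] at h1
  rw [← h1, ← hV.integral_inner_duhamel hE (hF.stronglyMeasurable k) (hF.integrable hFi k)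
    (hG.stronglyMeasurable l) (hG.integrable hGi l), ← lintegral_const_mul' _ _ ENNReal.coe_ne_top,
    ← lintegral_const_mul' _ _ (pow2_ne_top _), ← lintegral_const_mul' _ _ (pow2_ne_top _),
    ← lintegral_add_left (hv.const_mul _), ← lintegral_const_mul' _ _ (pow2_ne_top _)]
  refine (enorm_integral_le_lintegral_enorm _).trans (lintegral_mono fun t => ?_)
  set Y := ‖∫ s in {s | t - s ∈ E}, adjoint (V s) (Fk k s)‖ₑ with hY
  have hd : ‖duhamel V E (Fk k) t‖ₑ = Y := by
    rw [duhamel, ← ofReal_norm, hV.norm_eq, ofReal_norm]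
  have hS := UnitaryFamily.measurableSet_window_right hE t
  have hY2 : Y ^ 2 ≤ C * ∫⁻ s, E.indicator (1 : ℝ → ℝ≥0∞) (t - s) * (a s ^ 2 * α k s) := by
    refine (hw _ hS).trans (le_of_eq ?_)
    rw [← lintegral_indicator hS]
    congr 1
    refine lintegral_congr fun s => ?_
    by_cases hs : t - s ∈ E
    · rw [indicator_of_mem (by exact hs), indicator_of_mem hs, Pi.one_apply, one_mul]
    · rw [indicator_of_notMem (by exact hs), indicator_of_notMem hs, zero_mul]
  have h2 : (b t * β l t ^ (1 / 2 : ℝ)) ^ 2 = b t ^ 2 * β l t := by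
    rw [mul_pow, ← ENNReal.rpow_ofNat (β l t ^ (1 / 2 : ℝ)), ← ENNReal.rpow_mul]
    norm_num
  calc ‖inner ℂ (Gl l t) (duhamel V E (Fk k) t)‖ₑ
      ≤ (pow2 (1 + l - p * l / 2) * (b t * β l t ^ (1 / 2 : ℝ))) * Y := by
        refine (enorm_inner_le_mul _ _).trans ?_
        rw [hd]
        gcongr
        exact hG.enorm_le l t
    -- The factors 2^{±j/4} balance the two squares when the window has measure about 2^j.
    _ = pow2 (1 + l - p * l / 2) * ((pow2 (j / 4) * (b t * β l t ^ (1 / 2 : ℝ))) *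
          (pow2 (-(j / 4)) * Y)) := by
        have : pow2 (j / 4) * pow2 (-(j / 4)) = 1 := by rw [← pow2_add, add_neg_cancel, pow2_zero]
        calc _ = pow2 (1 + l - p * l / 2) * ((b t * β l t ^ (1 / 2 : ℝ)) * Y) * 1 := by ring
          _ = _ := by rw [← this]; ring
    _ ≤ pow2 (1 + l - p * l / 2) * ((pow2 (j / 4) * (b t * β l t ^ (1 / 2 : ℝ))) ^ 2 +
          (pow2 (-(j / 4)) * Y) ^ 2) := by
        gcongr
        exact mul_le_sq_add_sq _ _
    _ = pow2 (1 + l - p * l / 2) * (pow2 (j / 2) * (b t ^ 2 * β l t) + pow2 (-(j / 2)) * Y ^ 2) := by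
        have e1 : pow2 (j / 4) ^ 2 = pow2 (j / 2) := by rw [sq, ← pow2_add]; congr 1; ring
        have e2 : pow2 (-(j / 4)) ^ 2 = pow2 (-(j / 2)) := by rw [sq, ← pow2_add]; congr 1; ring
        rw [mul_pow (pow2 (j / 4)), mul_pow (pow2 (-(j / 4))), e1, e2, h2]
    _ ≤ _ := by gcongr

end LevelDecomposition

/-- The times at which the kernel has size about `2 ^ (- d j / 2)`. -/
def kernelShell (d : ℕ) (K : ℝ → ℝ≥0∞) (j : ℤ) : Set ℝ :=
  {τ | pow2 (-(d / 2 * (j + 1))) < K τ ∧ K τ ≤ pow2 (-(d / 2 * j))}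

/-- Let ξ = pk + dj/2 and η = pl + dj/2. On shell j, of measure at most about 2^j, dispersion gives
the exponent -(1/2 - 1/d)(ξ + η), and the window estimate for one or the other function gives η/d
and ξ/d. The three are jointly negative off the origin, which is why no logarithm is lost at the
endpoint. -/
lemma exists_tsum_pairing_le {p : ℝ} (hd : 2 < d) (hp : p * (1 + 2 / d) = 2) (C₀ C₁ : ℝ≥0)
    (hC₁ : 1 ≤ C₁) : ∃ C : ℝ≥0, ∀ (V : ℝ → (L2 d →L[ℂ] L2 d)) (K : ℝ → ℝ≥0∞),
      UnitaryFamily V → WeakType (2 / d) C₀ K → DispersiveBound V K →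
      ∀ (F G : ℝ → L2 d) (a b : ℝ → ℝ≥0∞) (α β : ℤ → ℝ → ℝ≥0∞) (Fk Gl : ℤ → ℝ → L2 d),
      Integrable F → Integrable G → LevelDecomposition p C₁ F a α Fk →
      LevelDecomposition p C₁ G b β Gl → ∀ W : Set ℝ, MeasurableSet W →
        ∑' j : ℤ, ∑' k : ℤ, ∑' l : ℤ, ‖pairing V (kernelShell d K j ∩ W) (Fk k) (Gl l)‖ₑ ≤
          C * ((∫⁻ s, a s ^ 2) + ∫⁻ t, b t ^ 2) := by
  have hd0 : (0 : ℝ) < d := by exact_mod_cast (by omega : 0 < d)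
  have hd2 : (2 : ℝ) < d := by exact_mod_cast hd
  have hp' : p = 2 * d / (d + 2) := by field_simp at hp ⊢; linarith
  have hp0 : 0 < p := by rw [hp']; positivity
  have hd0' := hd0.ne'
  obtain ⟨C₂, h₂⟩ := exists_enorm_window_le hd hp C₀ C₁ hC₁
  have hκ : 0 < 1 / 2 - 1 / (d : ℝ) := by
    rw [sub_pos]; exact one_div_lt_one_div_of_lt two_pos hd2
  obtain ⟨C₃, h₃⟩ := exists_tsum_three_le hκ le_rfl (show (0 : ℝ) < 1 / d by positivity) hp0
    (show (0 : ℝ) < d / 2 by positivity)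
  set D : ℝ≥0 := 8 * C₁ * C₀ + 2 + 4 * C₂ * C₀ with hD
  refine ⟨C₃ * (D * C₁), fun V K hV hK hVK F G a b α β Fk Gl hFi hGi hF hG W hW => ?_⟩
  set A : ℤ → ℝ≥0∞ := fun k => ∫⁻ s, a s ^ 2 * α k s with hA
  set B : ℤ → ℝ≥0∞ := fun l => ∫⁻ t, b t ^ 2 * β l t with hB
  have hEm : ∀ j, MeasurableSet (kernelShell d K j) := fun j =>
    (measurableSet_lt measurable_const hK.1).inter (measurableSet_le hK.1 measurable_const)
  have hvol : ∀ j : ℤ, volume (kernelShell d K j) ≤ C₀ * pow2 (j + 1) := fun j => by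
    refine (measure_mono fun τ hτ => hτ.1).trans ((hK.2 _).trans (le_of_eq ?_))
    congr 2; field_simp
  have hEW : ∀ j, MeasurableSet (kernelShell d K j ∩ W) := fun j => (hEm j).inter hW
  have hvW : ∀ j : ℤ, volume (kernelShell d K j ∩ W) ≤ C₀ * pow2 (j + 1) := fun j =>
    (measure_mono inter_subset_left).trans (hvol j)
  have hDl : ∀ x : ℝ≥0∞, ∀ y : ℝ≥0, y ≤ D → (y : ℝ≥0∞) * x ≤ D * x := fun x y h => by
    gcongr
  -- This is p/2 = 1 - p/d, another form of the relation between p and d.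
  have hw : ∀ j l : ℤ, p * l / 2 = l - (p * l / d) := fun j l => by rw [hp']; field_simp; ring
  have core : ∀ (F G : ℝ → L2 d) (a b : ℝ → ℝ≥0∞) (α β : ℤ → ℝ → ℝ≥0∞) (Fk Gl : ℤ → ℝ → L2 d),
      Integrable F → Integrable G → LevelDecomposition p C₁ F a α Fk →
      LevelDecomposition p C₁ G b β Gl → ∀ (E : Set ℝ) (j k l : ℤ), MeasurableSet E →
      volume E ≤ C₀ * pow2 (j + 1) → ‖pairing V E (Fk k) (Gl l)‖ₑ ≤
        pow2 (1 / d * (p * l + d / 2 * j)) *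
          (D * (∫⁻ s, a s ^ 2 * α k s) + D * ∫⁻ t, b t ^ 2 * β l t) := by
    intro F G a b α β Fk Gl hFi hGi hF hG E j k l hE hvE
    refine (LevelDecomposition.enorm_pairing_le_of_window hV hF hG hFi hGi k l
      (fun S hS => h₂ V K hV hK hVK F a α Fk hFi hF k S hS) hE j).trans ?_
    have e1 : pow2 (1 + l - p * l / 2) * pow2 (j / 2) = 2 * pow2 (1 / d * (p * l + d / 2 * j)) := by
      rw [← pow2_one, ← pow2_add, ← pow2_add, hw j l]
      congr 1; field_simp; ring
    have e2 : pow2 (1 + l - p * l / 2) * pow2 (-(j / 2)) * pow2 (j + 1) =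
        4 * pow2 (1 / d * (p * l + d / 2 * j)) := by
      rw [show (4 : ℝ≥0∞) = pow2 2 by rw [pow2]; norm_num, ← pow2_add, ← pow2_add, ← pow2_add,
        hw j l]
      congr 1; field_simp; ring
    calc _ ≤ pow2 (1 + l - p * l / 2) * (pow2 (j / 2) * (∫⁻ t, b t ^ 2 * β l t) +
          pow2 (-(j / 2)) * (C₂ * ((C₀ * pow2 (j + 1)) * ∫⁻ s, a s ^ 2 * α k s))) := by gcongr
      _ = (pow2 (1 + l - p * l / 2) * pow2 (j / 2)) * (∫⁻ t, b t ^ 2 * β l t) +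
          (pow2 (1 + l - p * l / 2) * pow2 (-(j / 2)) * pow2 (j + 1)) *
            (C₂ * C₀ * ∫⁻ s, a s ^ 2 * α k s) := by ring
      _ = pow2 (1 / d * (p * l + d / 2 * j)) *
          (((4 * C₂ * C₀ : ℝ≥0) : ℝ≥0∞) * (∫⁻ s, a s ^ 2 * α k s) +
            ((2 : ℝ≥0) : ℝ≥0∞) * ∫⁻ t, b t ^ 2 * β l t) := by
          rw [e1, e2]; push_cast; ring
      _ ≤ _ := by
          refine mul_le_mul' le_rfl (add_le_add (hDl _ _ le_add_self) (hDl _ _ ?_))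
          rw [hD, add_assoc, add_left_comm]
          exact le_self_add
  have hsum : ∀ (a : ℝ → ℝ≥0∞) (α : ℤ → ℝ → ℝ≥0∞) (F : ℝ → L2 d) (Fk : ℤ → ℝ → L2 d),
      LevelDecomposition p C₁ F a α Fk → ∑' k, (D : ℝ≥0∞) * ∫⁻ s, a s ^ 2 * α k s ≤
        D * C₁ * ∫⁻ s, a s ^ 2 := by
    intro a α F Fk hF
    rw [ENNReal.tsum_mul_left, ← lintegral_tsum fun k => (hF.measurable_density k).aemeasurable,
      mul_assoc, ← lintegral_const_mul' (C₁ : ℝ≥0∞) (fun s => a s ^ 2) ENNReal.coe_ne_top]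
    refine mul_le_mul' le_rfl (lintegral_mono fun s => ?_)
    rw [ENNReal.tsum_mul_left, mul_comm]
    gcongr
    exact hF.tsum_le s
  refine (h₃ (fun k => D * A k) (fun l => D * B l) _ ?_ ?_ ?_).trans ?_
  · intro j k l
    refine (hF.enorm_pairing_le_of_dispersive hG hVK (hEW j) (fun τ hτ => hτ.1.2) k l).trans ?_
    have e1 : pow2 (2 + -(d / 2 * j) + (k + l) * (1 - p)) * pow2 (j + 1) =
        8 * pow2 (-((1 / 2 - 1 / d) * (p * k + d / 2 * j + (p * l + d / 2 * j)))) := by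
      rw [show (8 : ℝ≥0∞) = pow2 3 by rw [pow2]; norm_num, ← pow2_add, ← pow2_add]
      congr 1
      rw [hp']; field_simp; ring
    calc _ ≤ pow2 (2 + -(d / 2 * j) + (k + l) * (1 - p)) * C₁ *
          (C₀ * pow2 (j + 1) * A k + C₀ * pow2 (j + 1) * B l) := by
          gcongr <;> exact hvW j
      _ = (pow2 (2 + -(d / 2 * j) + (k + l) * (1 - p)) * pow2 (j + 1)) *
          (C₁ * C₀ * (A k + B l)) := by ring
      _ = pow2 (-((1 / 2 - 1 / d) * (p * k + d / 2 * j + (p * l + d / 2 * j)))) *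
          (((8 * C₁ * C₀ : ℝ≥0) : ℝ≥0∞) * A k + ((8 * C₁ * C₀ : ℝ≥0) : ℝ≥0∞) * B l) := by
          rw [e1]; push_cast; ring
      _ ≤ _ := by
          have : 8 * C₁ * C₀ ≤ D := by rw [hD, add_assoc]; exact le_self_add
          exact mul_le_mul' le_rfl (add_le_add (hDl _ _ this) (hDl _ _ this))
  · intro j k l
    -- The bound with the roles of F and G exchanged; the reflected window has the same measure.
    rw [zero_mul, sub_zero, ← RCLike.enorm_conj, UnitaryFamily.conj_pairing]
    refine (core G F b a β α Gl Fk hGi hFi hG hF _ j l k (hEW j).neg ?_).trans (le_of_eq ?_)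
    · rw [Measure.measure_neg]; exact hvW j
    · congr 1
      exact add_comm _ _
  · intro j k l
    rw [zero_mul, sub_zero]
    exact core F G a b α β Fk Gl hFi hGi hF hG _ j k l (hEW j) (hvW j)
  · calc _ ≤ (C₃ : ℝ≥0∞) * (D * C₁ * (∫⁻ s, a s ^ 2) + D * C₁ * ∫⁻ t, b t ^ 2) := by
          gcongr
          exacts [hsum a α F Fk hF, hsum b β G Gl hG]
      _ = _ := by push_cast; ring

end QuadSchrodinger

end

noncomputable section

namespace QuadSchrodinger

variable {d : ℕ}

/-! ### The endpoint bilinear estimate -/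

open ContinuousLinearMap (adjoint)

/-- The indicator of a shell is a difference of indicators of superlevel sets of K, so the sum
telescopes and is eventually constant. -/
lemma tendsto_sum_kernelShell (hd : 0 < d) {K : ℝ → ℝ≥0∞} {τ : ℝ} (h0 : K τ ≠ 0) (ht : K τ ≠ ∞)
    (W : Set ℝ) : Tendsto (fun N => ∑ j ∈ dyadicWindow N, (kernelShell d K j ∩ W).indicator
      (1 : ℝ → ℂ) τ) atTop (𝓝 (W.indicator 1 τ)) := by
  classical
  have hd0 : (0 : ℝ) < d := by exact_mod_cast hd
  set χ : ℤ → ℂ := fun j => if pow2 (-(d / 2 * j)) < K τ then W.indicator 1 τ else 0 with hχ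
  have h1 : ∀ j : ℤ, (kernelShell d K j ∩ W).indicator (1 : ℝ → ℂ) τ = χ (j + 1) - χ j := fun j => by
    have hmono : pow2 (-(d / 2 * ((j + 1 : ℤ) : ℝ))) ≤ pow2 (-(d / 2 * j)) :=
      pow2_mono (by push_cast; nlinarith)
    simp only [hχ, indicator_apply, kernelShell, mem_inter_iff, mem_ofPred_eq, Pi.one_apply,
      Int.cast_add, Int.cast_one] at hmono ⊢
    by_cases h2 : pow2 (-(d / 2 * j)) < K τ
    · simp [h2, hmono.trans_lt h2, not_le.2 h2]
    · simp [h2, not_lt.1 h2, ite_and]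
  simp only [h1, sum_dyadicWindow_sub]
  obtain ⟨x, hx⟩ := exists_eq_pow2 h0 ht
  obtain ⟨n, hn⟩ := exists_nat_gt (2 / d * |x|)
  rw [← sub_zero (W.indicator 1 τ)]
  refine tendsto_const_nhds.congr' ?_
  filter_upwards [eventually_ge_atTop n] with N hN
  have hNx : |x| < d / 2 * N := by
    have : 2 / d * |x| < N := hn.trans_le (by exact_mod_cast hN)
    rw [div_mul_eq_mul_div, div_lt_iff₀ hd0] at this
    linarith
  have e1 : pow2 (-(d / 2 * ((N : ℤ) : ℝ))) < K τ := by
    rw [hx, ← not_le, pow2_le_iff, not_le]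
    push_cast; linarith [neg_abs_le x]
  have e2 : ¬ pow2 (-(d / 2 * ((-(N : ℤ) : ℤ) : ℝ))) < K τ := by
    rw [hx, not_lt, pow2_le_iff]
    push_cast; linarith [le_abs_self x]
  simp only [hχ]
  rw [if_pos e1, if_neg e2]

lemma norm_sum_kernelShell_le (hd : 0 < d) (K : ℝ → ℝ≥0∞) (τ : ℝ) (W : Set ℝ) (N : ℕ) :
    ‖∑ j ∈ dyadicWindow N, (kernelShell d K j ∩ W).indicator (1 : ℝ → ℂ) τ‖ ≤ 1 := by
  classical
  have hd0 : (0 : ℝ) < d := by exact_mod_cast hd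
  set χ : ℤ → ℝ := fun j => if pow2 (-(d / 2 * j)) < K τ then W.indicator 1 τ else 0 with hχ
  have hmono : ∀ i j : ℤ, i ≤ j → pow2 (-(d / 2 * (j : ℝ))) ≤ pow2 (-(d / 2 * i)) :=
    fun i j hij => pow2_mono (by
      have : (i : ℝ) ≤ j := by exact_mod_cast hij
      nlinarith)
  have h1 : ∀ j : ℤ, (kernelShell d K j ∩ W).indicator (1 : ℝ → ℂ) τ = ((χ (j + 1) - χ j : ℝ) : ℂ) :=
    fun j => by
    have hmono := hmono j (j + 1) (by omega)
    simp only [hχ, indicator_apply, kernelShell, mem_inter_iff, mem_ofPred_eq, Pi.one_apply,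
      Int.cast_add, Int.cast_one] at hmono ⊢
    by_cases h2 : pow2 (-(d / 2 * j)) < K τ
    · simp [h2, hmono.trans_lt h2, not_le.2 h2]
    · by_cases h3 : pow2 (-(d / 2 * ((j : ℝ) + 1))) < K τ <;> by_cases h4 : τ ∈ W <;>
        simp [h2, h3, h4, not_lt.1 h2]
  simp only [h1]
  rw [← Complex.ofReal_sum, sum_dyadicWindow_sub, Complex.norm_real, Real.norm_eq_abs]
  have h01 : ∀ j, 0 ≤ χ j ∧ χ j ≤ 1 := fun j => by
    simp only [hχ, indicator_apply, Pi.one_apply]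
    split_ifs <;> norm_num
  exact abs_le.2 ⟨by linarith [(h01 N).1, (h01 (-N)).2], by linarith [(h01 N).2, (h01 (-N)).1]⟩

/-- Subtraction pulls null sets back to null sets, by Fubini's theorem applied to the indicator of a
measurable null superset. -/
lemma ae_comp_sub {p : ℝ → Prop} (h : ∀ᵐ τ, p τ) : ∀ᵐ z : ℝ × ℝ, p (z.2 - z.1) := by
  set S := toMeasurable volume {τ | ¬ p τ} with hS
  have hSm : MeasurableSet S := measurableSet_toMeasurable _ _
  have hS0 : volume S = 0 := by rw [hS, measure_toMeasurable]; exact h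
  have he : Measurable (S.indicator (1 : ℝ → ℝ≥0∞)) := measurable_one.indicator hSm
  have h1 := lintegral_sub_mul_fst (u := 1) he measurable_one.aemeasurable
  have hm : Measurable fun z : ℝ × ℝ =>
      S.indicator (1 : ℝ → ℝ≥0∞) (z.2 - z.1) * (1 : ℝ → ℝ≥0∞) z.1 :=
    (he.comp (measurable_snd.sub measurable_fst)).mul (measurable_one.comp measurable_fst)
  rw [lintegral_indicator_one hSm, hS0, zero_mul, lintegral_eq_zero_iff hm] at h1
  filter_upwards [h1] with z hz
  by_contra hc
  have : z.2 - z.1 ∈ S := subset_toMeasurable _ _ hc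
  simp [indicator_of_mem this] at hz

lemma WeakType.ae_ne_top {ρ : ℝ} (hρ : 0 < ρ) {C : ℝ≥0} {κ : ℝ → ℝ≥0∞} (h : WeakType ρ C κ) :
    ∀ᵐ τ, κ τ ≠ ∞ := by
  rw [ae_iff]
  simp only [not_not]
  have h1 : ∀ n : ℕ, volume {τ | κ τ = ∞} ≤ C * pow2 (-(ρ * n)) := fun n =>
    (measure_mono fun τ hτ => by
      rw [mem_ofPred_eq] at hτ ⊢; rw [hτ]; exact pow2_lt_top _).trans (h.2 n)
  have h2 : Tendsto (fun n : ℕ => (C : ℝ≥0∞) * pow2 (-(ρ * n))) atTop (𝓝 0) := by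
    have h3 : ∀ n : ℕ, pow2 (-(ρ * n)) = pow2 (-ρ) ^ n := fun n => by
      rw [← ENNReal.rpow_natCast, pow2_rpow]; congr 1; ring
    simp only [h3]
    have h4 : pow2 (-ρ) < 1 := by
      rw [← pow2_zero, ← not_le, pow2_le_iff]; linarith
    simpa using ENNReal.Tendsto.const_mul (ENNReal.tendsto_pow_atTop_nhds_zero_of_lt_one h4)
      (Or.inr ENNReal.coe_ne_top)
  exact le_antisymm (ge_of_tendsto' h2 h1) zero_le

/-- All three decompositions are cut to the same window of indices. The partial sums are dominated
by ‖F(s)‖‖G(t)‖, since the shell sums are bounded by 1 and the level sums by the norms, and they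
converge almost everywhere. -/
lemma enorm_pairing_le_tsum (hd : 0 < d) {p ρ : ℝ} {C₀ C₁ : ℝ≥0} (hρ : 0 < ρ)
    {V : ℝ → (L2 d →L[ℂ] L2 d)} {K : ℝ → ℝ≥0∞} (hV : UnitaryFamily V) (hK : WeakType ρ C₀ K)
    (hK0 : ∀ τ, K τ ≠ 0) {F G : ℝ → L2 d} {a b : ℝ → ℝ≥0∞} {α β : ℤ → ℝ → ℝ≥0∞}
    {Fk Gl : ℤ → ℝ → L2 d} (hFi : Integrable F) (hGi : Integrable G) (hF : LevelDecomposition p C₁ F a α Fk)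
    (hG : LevelDecomposition p C₁ G b β Gl) {W : Set ℝ} (hW : MeasurableSet W) :
    ‖pairing V W F G‖ₑ ≤
      ∑' j : ℤ, ∑' k : ℤ, ∑' l : ℤ, ‖pairing V (kernelShell d K j ∩ W) (Fk k) (Gl l)‖ₑ := by
  classical
  set B : (ℝ → L2 d) → (ℝ → L2 d) → ℝ × ℝ → ℂ := fun F G z =>
    inner ℂ (adjoint (V z.2) (G z.2)) (adjoint (V z.1) (F z.1)) with hB
  have hBn : ∀ F G z, ‖B F G z‖ ≤ ‖F z.1‖ * ‖G z.2‖ := fun F G z => by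
    refine (norm_inner_le_norm _ _).trans ?_
    rw [hV.norm_adjoint, hV.norm_adjoint, mul_comm]
  have hEm : ∀ j, MeasurableSet (kernelShell d K j ∩ W) := fun j =>
    ((measurableSet_lt measurable_const hK.1).inter (measurableSet_le hK.1 measurable_const)).inter hW
  have hind : ∀ (S : Set ℝ) (f : ℝ × ℝ → ℂ) (z : ℝ × ℝ), {z : ℝ × ℝ | z.2 - z.1 ∈ S}.indicator f z =
      S.indicator 1 (z.2 - z.1) * f z := fun S f z => by
    rw [indicator_window_eq, indicator_apply]
    split_ifs <;> simp
  set Φ : ℕ → ℝ × ℝ → ℂ := fun N z => ∑ j ∈ dyadicWindow N, ∑ k ∈ dyadicWindow N,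
    ∑ l ∈ dyadicWindow N, {z : ℝ × ℝ | z.2 - z.1 ∈ kernelShell d K j ∩ W}.indicator
      (B (Fk k) (Gl l)) z with hΦ
  have hint : ∀ j k l, Integrable fun z => {z : ℝ × ℝ | z.2 - z.1 ∈ kernelShell d K j ∩ W}.indicator
      (B (Fk k) (Gl l)) z := fun j k l =>
    hV.integrable_pairing (hEm j) (hF.stronglyMeasurable k) (hF.integrable hFi k)
      (hG.stronglyMeasurable l) (hG.integrable hGi l)
  have hΦeq : ∀ N z, Φ N z = (∑ j ∈ dyadicWindow N, (kernelShell d K j ∩ W).indicator 1 (z.2 - z.1)) *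
      B (fun s => ∑ k ∈ dyadicWindow N, Fk k s) (fun t => ∑ l ∈ dyadicWindow N, Gl l t) z := by
    intro N z
    simp only [hΦ, hind, hB]
    rw [map_sum, map_sum, inner_sum, Finset.sum_mul]
    refine Finset.sum_congr rfl fun j _ => ?_
    rw [Finset.mul_sum]
    refine Finset.sum_congr rfl fun k _ => ?_
    rw [sum_inner, Finset.mul_sum]
  have hΦi : ∀ N, Integrable (Φ N) := fun N => by
    rw [hΦ]
    exact integrable_finsetSum _ fun j _ => integrable_finsetSum _ fun k _ =>
      integrable_finsetSum _ fun l _ => hint j k l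
  have hΦint : ∀ N, ‖∫ z, Φ N z‖ₑ ≤
      ∑' j : ℤ, ∑' k : ℤ, ∑' l : ℤ, ‖pairing V (kernelShell d K j ∩ W) (Fk k) (Gl l)‖ₑ := by
    intro N
    have : ∫ z, Φ N z = ∑ j ∈ dyadicWindow N, ∑ k ∈ dyadicWindow N, ∑ l ∈ dyadicWindow N,
        pairing V (kernelShell d K j ∩ W) (Fk k) (Gl l) := by
      simp only [hΦ]
      rw [integral_finsetSum _ fun j _ => integrable_finsetSum _ fun k _ =>
        integrable_finsetSum _ fun l _ => hint j k l]
      refine Finset.sum_congr rfl fun j _ => ?_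
      rw [integral_finsetSum _ fun k _ => integrable_finsetSum _ fun l _ => hint j k l]
      refine Finset.sum_congr rfl fun k _ => ?_
      rw [integral_finsetSum _ fun l _ => hint j k l]
      rfl
    rw [this]
    refine (enorm_sum_le _ _).trans (le_trans (Finset.sum_le_sum fun j _ => ?_)
      (ENNReal.sum_le_tsum (dyadicWindow N)))
    refine (enorm_sum_le _ _).trans (le_trans (Finset.sum_le_sum fun k _ => ?_)
      (ENNReal.sum_le_tsum (dyadicWindow N)))
    exact (enorm_sum_le _ _).trans (ENNReal.sum_le_tsum _)
  clear_value Φ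
  have hBlim : ∀ z : ℝ × ℝ, Tendsto (fun N => ∑ k ∈ dyadicWindow N, Fk k z.1) atTop (𝓝 (F z.1)) →
      Tendsto (fun N => ∑ l ∈ dyadicWindow N, Gl l z.2) atTop (𝓝 (G z.2)) →
      Tendsto (fun N => B (fun s => ∑ k ∈ dyadicWindow N, Fk k s)
        (fun t => ∑ l ∈ dyadicWindow N, Gl l t) z) atTop (𝓝 (B F G z)) := fun z h1 h2 =>
    ((((adjoint (V z.2)).continuous.tendsto _).comp h2).inner
        (((adjoint (V z.1)).continuous.tendsto _).comp h1))
  have hpair : pairing V W F G = ∫ z, {z : ℝ × ℝ | z.2 - z.1 ∈ W}.indicator (B F G) z := rfl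
  rw [hpair]
  clear_value B
  have hlim : Tendsto (fun N => ∫ z, Φ N z) atTop 
      (𝓝 (∫ z, {z : ℝ × ℝ | z.2 - z.1 ∈ W}.indicator (B F G) z)) := by
    refine tendsto_integral_of_dominated_convergence (fun z => ‖F z.1‖ * ‖G z.2‖) (fun N => ?_)
      (hFi.norm.mul_prod hGi.norm) (fun N => Eventually.of_forall fun z => ?_) ?_
    · exact (hΦi N).aestronglyMeasurable
    · have h1 := norm_sum_kernelShell_le hd K (z.2 - z.1) W N
      have h2 := hBn (fun s => ∑ k ∈ dyadicWindow N, Fk k s) (fun t => ∑ l ∈ dyadicWindow N, Gl l t) z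
      beta_reduce at h2
      have h3 := h2.trans (mul_le_mul (hF.norm_sum_le N z.1) (hG.norm_sum_le N z.2) (norm_nonneg _)
        (norm_nonneg _))
      rw [hΦeq, norm_mul]
      exact (mul_le_mul h1 h3 (norm_nonneg _) zero_le_one).trans_eq (one_mul _)
    · have e1 := (Measure.quasiMeasurePreserving_fst (μ := (volume : Measure ℝ))
        (ν := (volume : Measure ℝ))).ae hF.tendsto
      have e2 := (Measure.quasiMeasurePreserving_snd (μ := (volume : Measure ℝ))
        (ν := (volume : Measure ℝ))).ae hG.tendsto
      have e3 := ae_comp_sub (hK.ae_ne_top hρ)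
      rw [Measure.volume_eq_prod] at e3 ⊢
      filter_upwards [e1, e2, e3] with z h1 h2 h3
      simp only [hΦeq]
      rw [hind]
      refine (tendsto_sum_kernelShell hd (hK0 _) h3 W).mul ?_
      exact hBlim z h1 h2
  exact le_of_tendsto' hlim.enorm hΦint

lemma UnitaryFamily.enorm_pairing_le {V : ℝ → (L2 d →L[ℂ] L2 d)} (hV : UnitaryFamily V) {W : Set ℝ}
    (hW : MeasurableSet W) {F G : ℝ → L2 d} (hF : StronglyMeasurable F) (hFi : Integrable F)
    (hG : StronglyMeasurable G) (hGi : Integrable G) :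
    ‖pairing V W F G‖ₑ ≤ (∫⁻ s, ‖F s‖ₑ) * ∫⁻ t, ‖G t‖ₑ := by
  rw [← hV.integral_inner_duhamel hW hF hFi hG hGi, ← lintegral_const_mul' _ _ hFi.2.ne]
  refine (enorm_integral_le_lintegral_enorm _).trans (lintegral_mono fun t => ?_)
  refine (enorm_inner_le_mul _ _).trans ?_
  rw [mul_comm]
  gcongr
  exact hV.enorm_duhamel_le W F t

lemma pairing_smul (V : ℝ → (L2 d →L[ℂ] L2 d)) (W : Set ℝ) (F G : ℝ → L2 d) (c c' : ℂ) :
    pairing V W (fun s => c • F s) (fun t => c' • G t) =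
      (starRingEnd ℂ) c' * c * pairing V W F G := by
  classical
  rw [pairing, pairing, ← integral_const_mul]
  refine integral_congr_ae (Eventually.of_forall fun z => ?_)
  beta_reduce
  rw [indicator_window_eq, indicator_window_eq]
  split_ifs
  · rw [map_smul, map_smul, inner_smul_left, inner_smul_right, mul_assoc]
  · rw [mul_zero]

/-- The endpoint bilinear estimate of Keel and Tao. -/
theorem exists_baseEstimate_endpoint (hd : 2 < d) {r : ℝ≥0∞}
    (hr : (ENNReal.conjExponent r).toReal * (1 + 2 / d) = 2) (C₀ : ℝ≥0) :
    ∃ C : ℝ≥0, ∀ (V : ℝ → (L2 d →L[ℂ] L2 d)) (K : ℝ → ℝ≥0∞), UnitaryFamily V →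
      WeakType (2 / d) C₀ K → (∀ τ, K τ ≠ 0) → DispersiveBound V K → BaseEstimate V 2 r C := by
  have hd0 : (0 : ℝ) < d := by exact_mod_cast (by omega : 0 < d)
  set p := ENNReal.conjExponent r with hp
  have hp0 : p ≠ 0 := fun h => by simp [h] at hr
  have hpt : p ≠ ∞ := fun h => by simp [h] at hr
  obtain ⟨C₁, hC₁, h₁⟩ := exists_levelDecomposition (d := d) hp0 hpt
  obtain ⟨C, hC⟩ := exists_tsum_pairing_le hd hr C₀ C₁ hC₁
  refine ⟨2 * C + 1, fun V K hV hK hK0 hVK W hW F G hF hFi hG hGi => ?_⟩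
  have i2 := ENNReal.HolderConjugate.conjExponent (p := 2) one_le_two
  have e2 : ENNReal.conjExponent 2 = 2 := ENNReal.HolderConjugate.unique 2 _ 2
  rw [dualNorm_eq le_rfl, dualNorm_eq le_rfl, e2, ENNReal.toReal_ofNat]
  set I : (ℝ → L2 d) → ℝ≥0∞ := fun F => ∫⁻ s, eLpNorm (F s) p volume ^ (2 : ℝ) with hI
  change _ ≤ _ * (I F ^ (1 / 2 : ℝ) * I G ^ (1 / 2 : ℝ))
  have hm : ∀ F : ℝ → L2 d, StronglyMeasurable F → Measurable fun s => eLpNorm (F s) p volume ^ (2 : ℝ) :=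
    fun F hF => (measurable_eLpNorm_comp hF p).pow_const _
  have hfin : ∀ F : ℝ → L2 d, StronglyMeasurable F → I F ≠ ∞ →
      ∀ᵐ s, eLpNorm (F s) p volume ≠ ∞ := fun F hF h => by
    filter_upwards [ae_lt_top (hm F hF) h] with s hs ht
    simp [ht] at hs
  have hnull : ∀ F : ℝ → L2 d, StronglyMeasurable F → I F = 0 → ∫⁻ s, ‖F s‖ₑ = 0 := fun F hF h => by
    rw [lintegral_eq_zero_iff hF.enorm]
    filter_upwards [(lintegral_eq_zero_iff (hm F hF)).1 h] with s hs
    have : eLpNorm (F s) p volume = 0 := by simpa using hs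
    rw [eq_zero_of_eLpNorm_eq_zero hp0 this]
    simp
  -- The dyadic sum controls the form only by the sum of the squared norms; bilinearity then turns
  -- sum into product.
  have additive : ∀ F G : ℝ → L2 d, StronglyMeasurable F → Integrable F → StronglyMeasurable G →
      Integrable G → I F ≠ ∞ → I G ≠ ∞ → ‖pairing V W F G‖ₑ ≤ C * (I F + I G) := by
    intro F G hF hFi hG hGi hIF hIG
    obtain ⟨α, Fk, hFk⟩ := h₁ F hF (hfin F hF hIF)
    obtain ⟨β, Gl, hGl⟩ := h₁ G hG (hfin G hG hIG)
    refine (enorm_pairing_le_tsum (by omega) (by positivity) hV hK hK0 hFi hGi hFk hGl hW).trans ?_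
    refine (hC V K hV hK hVK F G _ _ α β Fk Gl hFi hGi hFk hGl W hW).trans (le_of_eq ?_)
    simp only [hI, ENNReal.rpow_ofNat]
  rcases eq_or_ne (I F) 0 with hF0 | hF0
  · refine (hV.enorm_pairing_le hW hF hFi hG hGi).trans ?_
    rw [hnull F hF hF0, zero_mul]; exact zero_le
  rcases eq_or_ne (I G) 0 with hG0 | hG0
  · refine (hV.enorm_pairing_le hW hF hFi hG hGi).trans ?_
    rw [hnull G hG hG0, mul_zero]; exact zero_le
  have hC1 : ((2 * C + 1 : ℝ≥0) : ℝ≥0∞) ≠ 0 := by simp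
  have hne : ∀ {x : ℝ≥0∞}, x ≠ 0 → x ^ (1 / 2 : ℝ) ≠ 0 := fun {x} h => by simp [h]
  rcases eq_or_ne (I F) ∞ with hFt | hFt
  · rw [hFt, ENNReal.top_rpow_of_pos (by norm_num), ENNReal.top_mul (hne hG0), ENNReal.mul_top hC1]
    exact le_top
  rcases eq_or_ne (I G) ∞ with hGt | hGt
  · rw [hGt, ENNReal.top_rpow_of_pos (by norm_num), ENNReal.mul_top (hne hF0), ENNReal.mul_top hC1]
    exact le_top
  -- Both functions are normalised separately, so the additive bound becomes C(1 + 1).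
  have hscale : ∀ F : ℝ → L2 d, I F ≠ 0 → I F ≠ ∞ → ∃ c : ℂ, ‖c‖ₑ = I F ^ (1 / 2 : ℝ) ∧ c ≠ 0 ∧
      I (fun s => c⁻¹ • F s) = 1 := by
    intro F h0 ht
    have ht' : I F ^ (1 / 2 : ℝ) ≠ ∞ := ENNReal.rpow_ne_top_of_nonneg (by norm_num) ht
    have hpos := ENNReal.toReal_pos (hne h0) ht'
    refine ⟨((I F ^ (1 / 2 : ℝ)).toReal : ℂ), ?_, by exact_mod_cast hpos.ne', ?_⟩
    · rw [← ofReal_norm, Complex.norm_real, Real.norm_of_nonneg hpos.le, ENNReal.ofReal_toReal ht']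
    · simp only [hI, eLpNorm_smul_L2]
      rw [← Complex.ofReal_inv, ← ofReal_norm, Complex.norm_real, Real.norm_of_nonneg
        (inv_nonneg.2 hpos.le), ENNReal.ofReal_inv_of_pos hpos, ENNReal.ofReal_toReal ht']
      simp only [ENNReal.mul_rpow_of_nonneg _ _ (zero_le_two (α := ℝ))]
      rw [lintegral_const_mul' _ _ (ENNReal.rpow_ne_top_of_nonneg zero_le_two
        (ENNReal.inv_ne_top.2 (hne h0))), ENNReal.inv_rpow, ← ENNReal.rpow_mul,
        show (1 / 2 * 2 : ℝ) = 1 by norm_num, ENNReal.rpow_one]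
      change (I F)⁻¹ * I F = 1
      exact ENNReal.inv_mul_cancel h0 ht
  obtain ⟨c, hc, hc0, hcF⟩ := hscale F hF0 hFt
  obtain ⟨c', hc', hc0', hcG⟩ := hscale G hG0 hGt
  have h3 := additive (fun s => c⁻¹ • F s) (fun t => c'⁻¹ • G t) (hF.const_smul c⁻¹) (hFi.smul c⁻¹)
    (hG.const_smul c'⁻¹) (hGi.smul c'⁻¹) (by rw [hcF]; simp) (by rw [hcG]; simp)
  have h4 : pairing V W F G = (starRingEnd ℂ) c' * c *
      pairing V W (fun s => c⁻¹ • F s) (fun t => c'⁻¹ • G t) := by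
    rw [← pairing_smul]
    simp only [smul_smul, mul_inv_cancel₀ hc0, mul_inv_cancel₀ hc0', one_smul]
  rw [h4, enorm_mul, enorm_mul, RCLike.enorm_conj, ← hc, ← hc']
  calc _ ≤ ‖c'‖ₑ * ‖c‖ₑ * (C * (1 + 1)) := by
        gcongr
        rw [hcF, hcG] at h3
        exact h3
    _ = ((2 * C : ℝ≥0) : ℝ≥0∞) * (‖c‖ₑ * ‖c'‖ₑ) := by push_cast; ring
    _ ≤ _ := by
        gcongr
        exact le_self_add

end QuadSchrodinger

end

noncomputable section

namespace QuadSchrodinger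

variable {d : ℕ}

open ContinuousLinearMap (adjoint)

/-! ### Admissible exponents -/

/-- Logarithmic convexity of the norms: Hölder's inequality for |φ| = |φ|^{1-l}|φ|^l with exponents
2/(1 - l) and r₀/l. -/
lemma eLpNorm_le_rpow_mul_rpow {r r₀ : ℝ≥0∞} {l : ℝ} (hl0 : 0 < l) (hl1 : l < 1)
    (h : ENNReal.ofReal (1 - l) * 2⁻¹ + ENNReal.ofReal l * r₀⁻¹ = r⁻¹) (φ : L2 d) :
    eLpNorm φ r volume ≤ ‖φ‖ₑ ^ (1 - l) * eLpNorm φ r₀ volume ^ l := by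
  have hl1' : 0 < 1 - l := sub_pos.2 hl1
  have a0 : ENNReal.ofReal (1 - l) ≠ 0 := by simpa using hl1
  have b0 : ENNReal.ofReal l ≠ 0 := by simpa using hl0
  have hT : ENNReal.HolderTriple (2 / ENNReal.ofReal (1 - l)) (r₀ / ENNReal.ofReal l) r := ⟨by
    rw [ENNReal.inv_div (Or.inl ENNReal.ofReal_ne_top) (Or.inl a0),
      ENNReal.inv_div (Or.inl ENNReal.ofReal_ne_top) (Or.inl b0), div_eq_mul_inv, div_eq_mul_inv, h]⟩
  have hm : AEStronglyMeasurable (φ : Space d → ℂ) volume := Lp.aestronglyMeasurable φ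
  have h1 := eLpNorm_smul_le_mul_eLpNorm (r := r) (hm.norm.aemeasurable.pow_const l).aestronglyMeasurable
    (hm.norm.aemeasurable.pow_const (1 - l)).aestronglyMeasurable (hpqr := hT)
  have h2 : ((fun x => ‖φ x‖ ^ (1 - l)) • fun x => ‖φ x‖ ^ l) = fun x => ‖φ x‖ := by
    funext x
    simp only [Pi.smul_apply', smul_eq_mul]
    rw [← Real.rpow_add_of_nonneg (norm_nonneg _) hl1'.le hl0.le, sub_add_cancel, Real.rpow_one]
  rw [h2, eLpNorm_norm, eLpNorm_norm_rpow _ hl1', eLpNorm_norm_rpow _ hl0,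
    ENNReal.div_mul_cancel a0 ENNReal.ofReal_ne_top,
    ENNReal.div_mul_cancel b0 ENNReal.ofReal_ne_top] at h1
  rwa [Lp.enorm_def]

namespace SharpAdmissible

variable {q r q₀ r₀ : ℝ≥0∞}

lemma inv_ne_top (h : SharpAdmissible (d / 2) q r) : q⁻¹ ≠ ∞ ∧ r⁻¹ ≠ ∞ := by
  constructor <;> rw [ENNReal.inv_ne_top] <;> intro h0
  · have := h.1; simp [h0] at this
  · have := h.2.1; simp [h0] at this

lemma toReal_eq (h : SharpAdmissible (d / 2) q r) :
    q⁻¹.toReal + d / 2 * r⁻¹.toReal = d / 4 := by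
  have h1 := congrArg ENNReal.toReal h.2.2.2
  have hd : (d : ℝ≥0∞) / 2 ≠ ∞ := ENNReal.div_ne_top (ENNReal.natCast_ne_top d) (by norm_num)
  rw [one_div, div_eq_mul_inv (_ / 2 : ℝ≥0∞) r, ENNReal.toReal_add h.inv_ne_top.1
    (ENNReal.mul_ne_top hd h.inv_ne_top.2), ENNReal.toReal_mul, ENNReal.toReal_div,
    ENNReal.toReal_div, ENNReal.toReal_div, ENNReal.toReal_natCast, ENNReal.toReal_ofNat] at h1
  rw [h1]; ring

/-- The relation between 1/q and 1/r is affine, so an admissible pair with q ≥ q₀ lies on the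
segment from (∞, 2) to (q₀, r₀), at the parameter l = q₀/q. -/
lemma between (hd : 0 < d) (h : SharpAdmissible (d / 2) q r) (h0 : SharpAdmissible (d / 2) q₀ r₀)
    (ht : q₀ ≠ ∞) (hle : q₀ ≤ q) : Between d q₀ r₀ q r := by
  have hd0 : (0 : ℝ) < d := by exact_mod_cast hd
  have e := h.toReal_eq
  have e0 := h0.toReal_eq
  have hr : r⁻¹ ≠ ∞ := h.inv_ne_top.2
  have hr₀ : r₀⁻¹ ≠ ∞ := h0.inv_ne_top.2
  rcases eq_or_ne q ∞ with hq | hq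
  · refine Or.inl ⟨hq, ?_⟩
    rw [hq, ENNReal.inv_top, ENNReal.toReal_zero, zero_add] at e
    have e1 : r⁻¹.toReal = 2⁻¹ := by
      have : d / 2 * r⁻¹.toReal = d / 2 * 2⁻¹ := by rw [e]; ring
      exact mul_left_cancel₀ (by positivity) this
    rw [ENNReal.toReal_inv, inv_inj] at e1
    rw [← ENNReal.ofReal_toReal (a := r) fun hr => by simp [hr] at e1, e1]
    simp
  · refine Or.inr ⟨h.1, hq, h.2.1, ?_⟩
    have hq0 : 0 < q.toReal := ENNReal.toReal_pos (fun h1 => by simpa [h1] using h.1) hq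
    have hq₀ : 0 < q₀.toReal := ENNReal.toReal_pos (fun h1 => by simpa [h1] using h0.1) ht
    rcases eq_or_lt_of_le hle with rfl | hlt
    · have e1 : r₀ = r := by
        have : d / 2 * r₀⁻¹.toReal = d / 2 * r⁻¹.toReal := by linarith
        exact inv_injective ((ENNReal.toReal_eq_toReal_iff' hr₀ hr).1
          (mul_left_cancel₀ (by positivity) this))
      exact ⟨1, one_pos, le_rfl, one_mul _, fun φ => by simp [e1]⟩
    · have hlt' : q₀.toReal < q.toReal := (ENNReal.toReal_lt_toReal ht hq).2 hlt
      have hl : q₀.toReal / q.toReal < 1 := (div_lt_one hq0).2 hlt'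
      have hl0 : 0 < q₀.toReal / q.toReal := div_pos hq₀ hq0
      refine ⟨_, hl0, hl.le, div_mul_cancel₀ _ hq0.ne',
        eLpNorm_le_rpow_mul_rpow hl0 hl ?_⟩
      have h2 : ENNReal.ofReal (1 - q₀.toReal / q.toReal) * 2⁻¹ ≠ ∞ := by finiteness
      have h3 : ENNReal.ofReal (q₀.toReal / q.toReal) * r₀⁻¹ ≠ ∞ :=
        ENNReal.mul_ne_top ENNReal.ofReal_ne_top hr₀
      rw [← ENNReal.toReal_eq_toReal_iff' (by finiteness) hr, ENNReal.toReal_add h2 h3,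
        ENNReal.toReal_mul, ENNReal.toReal_mul, ENNReal.toReal_ofReal (sub_nonneg.2 hl.le),
        ENNReal.toReal_ofReal hl0.le, ENNReal.toReal_inv 2, ENNReal.toReal_ofNat]
      rw [ENNReal.toReal_inv] at e e0
      refine mul_left_cancel₀ (b := _) (half_pos hd0).ne' ?_
      have e2 : d / 2 * r⁻¹.toReal = d / 4 - q.toReal⁻¹ := by linarith
      have e3 : d / 2 * r₀⁻¹.toReal = d / 4 - q₀.toReal⁻¹ := by linarith
      rw [e2, mul_add, mul_left_comm _ _ r₀⁻¹.toReal, e3]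
      field_simp
      ring

end SharpAdmissible

lemma toReal_conjExponent {q : ℝ≥0∞} (hq : 1 ≤ q) :
    (ENNReal.conjExponent q).toReal⁻¹ = 1 - q⁻¹.toReal := by
  have i := ENNReal.HolderConjugate.conjExponent hq
  have h := congrArg ENNReal.toReal (ENNReal.HolderConjugate.inv_add_inv_eq_one q (ENNReal.conjExponent q))
  have h1 : q⁻¹ ≠ ∞ := ENNReal.inv_ne_top.2 fun h => by simp [h] at hq
  have h2 : (ENNReal.conjExponent q)⁻¹ ≠ ∞ := ENNReal.inv_ne_top.2 (by simp [ENNReal.conjExponent])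
  rw [ENNReal.toReal_add h1 h2, ENNReal.toReal_inv (ENNReal.conjExponent q), ENNReal.toReal_one] at h
  linarith

end QuadSchrodinger

end

noncomputable section

namespace QuadSchrodinger

variable {d : ℕ}

open ContinuousLinearMap (adjoint)

/-! ### The evolution as a family of unitary operators with a dispersive bound -/

namespace IsEvolutionOperator

variable {P : Coefficients d} {U : ℝ → ℝ → (L2 d →L[ℂ] L2 d)}

lemma comp_apply (hU : IsEvolutionOperator P U) (t r s : ℝ) (φ : L2 d) :
    U t r (U r s φ) = U t s φ := by
  rw [← ContinuousLinearMap.comp_apply, hU.comp]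

lemma inner_apply (hU : IsEvolutionOperator P U) (t s : ℝ) (φ ψ : L2 d) :
    inner ℂ (U t s φ) (U t s ψ) = inner ℂ φ ψ :=
  LinearIsometry.inner_map_map
    (⟨(U t s : L2 d →ₗ[ℂ] L2 d), hU.norm_eq t s⟩ : L2 d →ₗᵢ[ℂ] L2 d) φ ψ

lemma adjoint_eq (hU : IsEvolutionOperator P U) (t s : ℝ) : adjoint (U t s) = U s t := by
  symm
  rw [ContinuousLinearMap.eq_adjoint_iff]
  intro φ ψ
  rw [← hU.inner_apply t s (U s t φ) ψ, hU.comp_apply, hU.diag, ContinuousLinearMap.id_apply]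

lemma unitaryFamily (hU : IsEvolutionOperator P U) : UnitaryFamily fun t => U t 0 where
  norm_eq t φ := hU.norm_eq t 0 φ
  norm_adjoint t φ := by rw [hU.adjoint_eq]; exact hU.norm_eq 0 t φ
  continuous φ := (hU.strongly_continuous φ).comp (continuous_id.prodMk continuous_const)
  continuous_adjoint φ := by
    simp only [hU.adjoint_eq]
    exact (hU.strongly_continuous φ).comp (continuous_const.prodMk continuous_id)

end IsEvolutionOperator

/-- The norm of the propagator from `L¹` to `L^∞` for the elapsed time `τ`. -/
def dispersion (δ : Fin d → SignType) (ω : Fin d → ℝ) (τ : ℝ) : ℝ≥0∞ :=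
  ∏ j, ENNReal.ofReal (2 * Real.pi * |mu (δ j) (ω j) τ|) ^ (-(1 / 2) : ℝ)

section

variable {δ : Fin d → SignType} {ω : Fin d → ℝ}

lemma dispersion_ne_zero (τ : ℝ) : dispersion δ ω τ ≠ 0 :=
  Finset.prod_ne_zero_iff.2 fun j _ => by simp [ENNReal.rpow_eq_zero_iff]

lemma dispersion_eq_top {j : Fin d} {τ : ℝ} (h : mu (δ j) (ω j) τ = 0) :
    dispersion δ ω τ = ∞ := by
  rw [dispersion, ← Finset.mul_prod_erase _ _ (Finset.mem_univ j), h, abs_zero, mul_zero,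
    ENNReal.ofReal_zero, ENNReal.zero_rpow_of_neg (by norm_num), ENNReal.top_mul]
  exact Finset.prod_ne_zero_iff.2 fun j _ => by simp [ENNReal.rpow_eq_zero_iff]

lemma dispersion_eq_ofReal {τ : ℝ} (h : ∀ j, mu (δ j) (ω j) τ ≠ 0) :
    dispersion δ ω τ =
      ENNReal.ofReal (∏ j, (2 * Real.pi * |mu (δ j) (ω j) τ|) ^ (-(1 / 2) : ℝ)) := by
  rw [ENNReal.ofReal_prod_of_nonneg fun j _ => by positivity]
  refine Finset.prod_congr rfl fun j _ => ?_
  have := abs_pos.2 (h j)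
  rw [ENNReal.ofReal_rpow_of_pos (by positivity)]

lemma measurable_dispersion (hω : ∀ j, 0 < ω j) : Measurable (dispersion δ ω) := by
  unfold dispersion
  refine Finset.measurable_fun_prod _ fun j _ => Measurable.pow_const ?_ _
  exact (measurable_const.mul (continuous_mu (δ j) (hω j)).abs.measurable).ennreal_ofReal

lemma enorm_inner_le_eLpNorm_one_mul_top (ψ φ : L2 d) :
    ‖inner ℂ ψ φ‖ₑ ≤ eLpNorm ψ 1 volume * eLpNorm φ ∞ volume := by
  rw [L2.inner_def, eLpNorm_one_eq_lintegral_enorm,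
    ← lintegral_mul_const'' _ (Lp.aestronglyMeasurable ψ).enorm]
  refine (enorm_integral_le_lintegral_enorm _).trans (lintegral_mono_ae ?_)
  filter_upwards [enorm_ae_le_eLpNormEssSup (φ : Space d → ℂ) volume] with x hx
  have h1 : ‖inner ℂ (ψ x) (φ x)‖ₑ = ‖ψ x‖ₑ * ‖φ x‖ₑ := by
    rw [RCLike.inner_apply, enorm_mul, RCLike.enorm_conj, mul_comm]
  rw [h1, eLpNorm_exponent_top]
  gcongr

/-- The composition law reduces the form to ⟨ψ, U(t, s)φ⟩. At zeros of some μ_j the factor 0^{-1/2}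
is ∞ and the bound is trivial, unless one of the functions is zero. -/
lemma ConstantSigma.dispersiveBound {P : Coefficients d} {U : ℝ → ℝ → (L2 d →L[ℂ] L2 d)}
    (h : ConstantSigma P δ ω) (hU : IsEvolutionOperator P U) :
    DispersiveBound (fun t => U t 0) (dispersion δ ω) := by
  intro s t φ ψ
  have e1 : inner ℂ (adjoint (U t 0) ψ) (adjoint (U s 0) φ) = inner ℂ ψ (U t s φ) := by
    rw [hU.adjoint_eq s, ContinuousLinearMap.adjoint_inner_left, hU.comp_apply]
  rw [e1]
  by_cases hts : ∀ j, mu (δ j) (ω j) (t - s) ≠ 0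
  · rw [dispersion_eq_ofReal hts]
    refine (enorm_inner_le_eLpNorm_one_mul_top _ _).trans
      ((mul_le_mul_right (h.eLpNorm_top_le hU t s hts φ) _).trans_eq ?_)
    ring
  · push Not at hts
    obtain ⟨j, hj⟩ := hts
    rcases eq_or_ne (eLpNorm φ 1 volume * eLpNorm ψ 1 volume) 0 with h0 | h0
    · rcases mul_eq_zero.1 h0 with h1 | h1
      · rw [eq_zero_of_eLpNorm_eq_zero one_ne_zero h1]; simp
      · rw [eq_zero_of_eLpNorm_eq_zero one_ne_zero h1]; simp
    · rw [dispersion_eq_top hj, ENNReal.top_mul h0]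
      exact le_top

/-! ### The weak type of the dispersion -/

lemma volume_abs_lt (y : ℝ) : volume {τ : ℝ | |τ| < y} = 2 * ENNReal.ofReal y := by
  have : {τ : ℝ | |τ| < y} = Metric.ball 0 y := by ext τ; simp
  rw [this, Real.volume_ball, ENNReal.ofReal_mul zero_le_two, ENNReal.ofReal_ofNat]

/-- sinh|x| = 2 sinh(|x|/2) cosh(|x|/2): the first factor dominates |x|/2, and the exponential
growth of the second is available to be given away. -/
lemma abs_le_two_mul_abs_sinh_mul_exp (x : ℝ) : |x| ≤ 2 * (|Real.sinh x| * Real.exp (-(|x| / 2))) := by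
  rw [Real.abs_sinh]
  set y := |x| / 2 with hy
  have hy0 : 0 ≤ y := by positivity
  have e1 : Real.sinh |x| = 2 * Real.sinh y * Real.cosh y := by
    rw [← Real.sinh_two_mul, hy]; congr 1; ring
  have h1 : y ≤ Real.sinh y := Real.self_le_sinh_iff.2 hy0
  have h2 : Real.exp y ≤ 2 * Real.cosh y := by
    rw [Real.cosh_eq]; linarith [Real.exp_pos (-y)]
  have h3 : Real.exp y * Real.exp (-y) = 1 := by rw [← Real.exp_add]; simp
  have h4 := mul_le_mul_of_nonneg_right h2 (Real.exp_pos (-y)).le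
  rw [h3] at h4
  have h5 : Real.sinh y * 1 ≤ Real.sinh y * (2 * Real.cosh y * Real.exp (-y)) :=
    mul_le_mul_of_nonneg_left h4 (hy0.trans h1)
  rw [e1]
  linarith [show |x| = 2 * y by rw [hy]; ring]

lemma volume_mu_neg_lt {ω : ℝ} (hω : 0 < ω) {c : ℝ} (hc : -(ω / 2) ≤ c) (y : ℝ) :
    volume {τ | |mu SignType.neg ω τ| * Real.exp (c * |τ|) < y} ≤ 4 * ENNReal.ofReal y := by
  refine (measure_mono (t := {τ : ℝ | |τ| < 2 * y}) fun τ hτ => ?_).trans_eq ?_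
  · rw [mem_ofPred_eq] at hτ ⊢
    refine lt_of_le_of_lt ?_ (mul_lt_mul_of_pos_left hτ two_pos)
    have h1 := abs_le_two_mul_abs_sinh_mul_exp (ω * τ)
    have h2 : Real.exp (-(|ω * τ| / 2)) ≤ Real.exp (c * |τ|) := by
      refine Real.exp_le_exp.2 ?_
      rw [abs_mul, abs_of_pos hω]
      nlinarith [abs_nonneg τ]
    have h3 : |mu SignType.neg ω τ| = |Real.sinh (ω * τ)| / ω := by
      change |Real.sinh (ω * τ) / ω| = _
      rw [abs_div, abs_of_pos hω]
    rw [h3]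
    have h4 : |τ| = |ω * τ| / ω := by rw [abs_mul, abs_of_pos hω]; field_simp
    rw [h4]
    calc _ ≤ 2 * (|Real.sinh (ω * τ)| * Real.exp (-(|ω * τ| / 2))) / ω := by gcongr
      _ ≤ 2 * (|Real.sinh (ω * τ)| * Real.exp (c * |τ|)) / ω := by gcongr
      _ = _ := by rw [← h4]; ring
  · rw [volume_abs_lt, ENNReal.ofReal_mul zero_le_two, ENNReal.ofReal_ofNat, ← mul_assoc]
    norm_num

/-- The sublevel set is a union of neighbourhoods of the zeros kπ/ω. The weight e^{c|τ|} shrinks the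
k-th one geometrically in |k|; for c = 0 every zero would contribute the same length. -/
lemma exists_volume_mu_pos_lt {ω c : ℝ} (hω : 0 < ω) (hc : 0 < c) :
    ∃ C : ℝ≥0, ∀ y : ℝ, volume {τ | |mu SignType.pos ω τ| * Real.exp (c * |τ|) < y} ≤
      C * ENNReal.ofReal y := by
  have hπ := Real.pi_pos
  set a : ℝ := c * Real.pi / ω / Real.log 2 with ha
  have hl2 : 0 < Real.log 2 := Real.log_pos one_lt_two
  have ha0 : 0 < a := by positivity
  set A : ℝ := Real.pi * Real.exp (c * (Real.pi / (2 * ω))) with hA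
  have hfin : ENNReal.ofReal A * ∑' k : ℤ, pow2 (-(a * |(k : ℝ)|)) ≠ ∞ :=
    ENNReal.mul_ne_top ENNReal.ofReal_ne_top (tsum_pow2_neg_abs_ne_top ha0)
  refine ⟨(ENNReal.ofReal A * ∑' k : ℤ, pow2 (-(a * |(k : ℝ)|))).toNNReal, fun y => ?_⟩
  rw [ENNReal.coe_toNNReal hfin]
  have hsub : {τ | |mu SignType.pos ω τ| * Real.exp (c * |τ|) < y} ⊆ ⋃ k : ℤ,
      Metric.ball (k * Real.pi / ω) (A / 2 * y * 2 ^ (-(a * |(k : ℝ)|))) := by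
    intro τ hτ
    rw [mem_ofPred_eq] at hτ
    refine mem_iUnion.2 ⟨round (ω * τ / Real.pi), ?_⟩
    set k := round (ω * τ / Real.pi) with hk
    set x := ω * τ - k * Real.pi with hx
    have hx1 : |x| ≤ Real.pi / 2 := by
      have h1 := abs_sub_round (ω * τ / Real.pi)
      have h2 : x = (ω * τ / Real.pi - k) * Real.pi := by rw [hx]; field_simp
      rw [h2, abs_mul, abs_of_pos hπ]
      nlinarith
    have hs : |Real.sin (ω * τ)| = |Real.sin x| := by
      rw [hx, Real.sin_sub_int_mul_pi, abs_mul]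
      rcases Int.even_or_odd k with h | h <;> simp [h.neg_one_zpow]
    have h1 : |mu SignType.pos ω τ| = |Real.sin x| / ω := by
      change |Real.sin (ω * τ) / ω| = _
      rw [abs_div, abs_of_pos hω, hs]
    have h2 := Real.mul_abs_le_abs_sin hx1
    have h3 : |(k : ℝ)| * Real.pi / ω - Real.pi / (2 * ω) ≤ |τ| := by
      have h4 : |k * Real.pi| - |x| ≤ |ω * τ| := by
        have := abs_sub_abs_le_abs_sub ((k : ℝ) * Real.pi) (-x)
        rw [abs_neg, sub_neg_eq_add, hx, add_sub_cancel] at this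
        exact this
      rw [abs_mul, abs_mul, abs_of_pos hω, abs_of_pos hπ] at h4
      rw [sub_le_iff_le_add, div_le_iff₀ hω, add_mul]
      have : Real.pi / (2 * ω) * ω = Real.pi / 2 := by field_simp
      rw [this]
      linarith
    have h5 : (2 : ℝ) ^ (-(a * |(k : ℝ)|)) = Real.exp (-(c * (|(k : ℝ)| * Real.pi / ω))) := by
      rw [Real.rpow_def_of_pos two_pos, ha]
      congr 1
      field_simp
    have h7 : Real.exp (-(c * |τ|)) ≤ Real.exp (c * (Real.pi / (2 * ω))) * 2 ^ (-(a * |(k : ℝ)|)) := by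
      rw [h5, ← Real.exp_add]
      refine Real.exp_le_exp.2 ?_
      have := mul_le_mul_of_nonneg_left h3 hc.le
      linarith
    have hy0 : 0 < y := lt_of_le_of_lt (by positivity) hτ
    rw [Metric.mem_ball, Real.dist_eq]
    have h8 : |τ - k * Real.pi / ω| = |x| / ω := by
      rw [← abs_of_pos hω, ← abs_div, abs_of_pos hω, hx]
      congr 1; field_simp
    have h9 : 2 / Real.pi * |x| / ω < y * Real.exp (-(c * |τ|)) := by
      rw [Real.exp_neg, ← div_eq_mul_inv, lt_div_iff₀ (Real.exp_pos _)]
      refine lt_of_le_of_lt ?_ hτ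
      rw [h1]
      gcongr
    rw [h8]
    calc |x| / ω = Real.pi / 2 * (2 / Real.pi * |x| / ω) := by field_simp
      _ < Real.pi / 2 * (y * Real.exp (-(c * |τ|))) := by gcongr
      _ ≤ Real.pi / 2 * (y * (Real.exp (c * (Real.pi / (2 * ω))) * 2 ^ (-(a * |(k : ℝ)|)))) := by
          gcongr
      _ = _ := by rw [hA]; ring
  refine (measure_mono hsub).trans ((measure_iUnion_le _).trans (le_of_eq ?_))
  rw [← ENNReal.tsum_mul_left, ← ENNReal.tsum_mul_right]
  refine tsum_congr fun k => ?_
  rw [Real.volume_ball, pow2_eq_ofReal, ← ENNReal.ofReal_mul (by positivity),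
    ← ENNReal.ofReal_mul (by positivity)]
  congr 1; ring

lemma exists_volume_mu_lt (δ : SignType) {ω c : ℝ} (hω : 0 < ω) (hc : 0 < c) :
    ∃ C : ℝ≥0, ∀ y : ℝ, volume {τ | |mu δ ω τ| * Real.exp (c * |τ|) < y} ≤
      C * ENNReal.ofReal y := by
  rcases δ with _ | _ | _
  · refine ⟨2, fun y => (measure_mono (t := {τ : ℝ | |τ| < y}) fun τ hτ => ?_).trans_eq ?_⟩
    · rw [mem_ofPred_eq] at hτ ⊢
      refine lt_of_le_of_lt ?_ hτ
      exact le_mul_of_one_le_right (abs_nonneg τ) (Real.one_le_exp (by positivity))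
    · rw [volume_abs_lt]; rfl
  · exact ⟨4, fun y => volume_mu_neg_lt hω (by linarith) y⟩
  · exact exists_volume_mu_pos_lt hω hc

/-- The exponentials may be redistributed among the factors because their exponents add up to zero.
-/
lemma dispersion_le_of_forall_le {τ y : ℝ} (hy : 0 < y) (e : Fin d → ℝ) (he : ∑ j, e j = 0)
    (h : ∀ j, y ≤ |mu (δ j) (ω j) τ| * Real.exp (e j * |τ|)) :
    dispersion δ ω τ ≤ ENNReal.ofReal (y ^ (-(d / 2) : ℝ)) := by
  have hπ : 1 ≤ 2 * Real.pi := by linarith [Real.pi_gt_three]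
  have h1 : ∀ j, 0 < |mu (δ j) (ω j) τ| := fun j =>
    pos_of_mul_pos_left (hy.trans_le (h j)) (Real.exp_pos _).le
  rw [dispersion_eq_ofReal fun j => abs_pos.1 (h1 j)]
  refine ENNReal.ofReal_le_ofReal ?_
  have h2 : ∏ j, (|mu (δ j) (ω j) τ| * Real.exp (e j * |τ|)) ^ (-(1 / 2) : ℝ) =
      ∏ j, |mu (δ j) (ω j) τ| ^ (-(1 / 2) : ℝ) := by
    simp_rw [Real.mul_rpow (abs_nonneg _) (Real.exp_pos _).le]
    rw [Finset.prod_mul_distrib]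
    simp_rw [← Real.exp_mul]
    rw [← Real.exp_sum, ← Finset.sum_mul, ← Finset.sum_mul, he]
    simp
  calc _ ≤ ∏ j, |mu (δ j) (ω j) τ| ^ (-(1 / 2) : ℝ) := by
        refine Finset.prod_le_prod (fun j _ => by positivity) fun j _ => ?_
        refine Real.rpow_le_rpow_of_nonpos (h1 j) ?_ (by norm_num)
        exact le_mul_of_one_le_left (h1 j).le hπ
    _ ≤ ∏ _j : Fin d, y ^ (-(1 / 2) : ℝ) := by
        rw [← h2]
        refine Finset.prod_le_prod (fun j _ => by positivity) fun j _ => ?_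
        exact Real.rpow_le_rpow_of_nonpos hy (h j) (by norm_num)
    _ = _ := by
        rw [Finset.prod_const, Finset.card_univ, Fintype.card_fin, ← Real.rpow_natCast,
          ← Real.rpow_mul hy.le]
        congr 1; ring

/-- The repulsive coordinate i gives up e^{-ω_i|τ|/2}, and each of the d coordinates receives
e^{c|τ|} with c = ω_i/(2d). If K(τ) > 2^x, some weighted |μ_j(τ)| is below y = 2^{-2x/d}, and each
of these d sublevel sets has measure at most a constant times y. -/
theorem exists_weakType_dispersion (hω : ∀ j, 0 < ω j) {i : Fin d} (hi : δ i = -1) :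
    ∃ C : ℝ≥0, WeakType (2 / d) C (dispersion δ ω) := by
  classical
  have hd0 : (0 : ℝ) < d := by exact_mod_cast i.pos
  set c : ℝ := ω i / 2 / d with hc
  have hωi := hω i
  have hc0 : 0 < c := by positivity
  set e : Fin d → ℝ := fun j => c - if j = i then ω i / 2 else 0 with he
  have hsum : ∑ j, e j = 0 := by
    simp only [he, Finset.sum_sub_distrib, Finset.sum_const, Finset.card_univ, Fintype.card_fin,
      Finset.sum_ite_eq', Finset.mem_univ, if_true, nsmul_eq_mul, hc]
    field_simp
    ring
  have h1 : ∀ j, ∃ C : ℝ≥0, ∀ y : ℝ, volume {τ | |mu (δ j) (ω j) τ| * Real.exp (e j * |τ|) < y} ≤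
      C * ENNReal.ofReal y := fun j => by
    by_cases hj : j = i
    · subst hj
      rw [hi]
      refine ⟨4, fun y => volume_mu_neg_lt (hω j) ?_ y⟩
      simp only [he, if_true]; linarith
    · simp only [he, if_neg hj, sub_zero]
      exact exists_volume_mu_lt (δ j) (hω j) hc0
  choose C hC using h1
  refine ⟨∑ j, C j, measurable_dispersion hω, fun x => ?_⟩
  set y : ℝ := 2 ^ (-(2 / d * x)) with hy
  have hy0 : 0 < y := by positivity
  have hsub : {τ | pow2 x < dispersion δ ω τ} ⊆
      ⋃ j, {τ | |mu (δ j) (ω j) τ| * Real.exp (e j * |τ|) < y} := by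
    intro τ hτ
    by_contra hn
    simp only [mem_iUnion, mem_ofPred_eq, not_exists, not_lt] at hn hτ
    refine hτ.not_ge ((dispersion_le_of_forall_le hy0 e hsum hn).trans_eq ?_)
    rw [pow2_eq_ofReal, hy, ← Real.rpow_mul two_pos.le]
    congr 2
    field_simp
  refine (measure_mono hsub).trans ((measure_iUnion_le _).trans ?_)
  rw [tsum_fintype, pow2_eq_ofReal, ENNReal.ofNNReal_finsetSum, Finset.sum_mul]
  exact Finset.sum_le_sum fun j _ => hC j y

end

end QuadSchrodinger

end

noncomputable section

namespace QuadSchrodinger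

variable {d : ℕ}

open ContinuousLinearMap (adjoint)

/-! ### The bilinear estimate at every admissible pair with finite `q` -/

lemma WeakType.exists_const_mul {ρ : ℝ} (C₀ c : ℝ≥0) :
    ∃ C : ℝ≥0, ∀ κ : ℝ → ℝ≥0∞, WeakType ρ C₀ κ → WeakType ρ C fun τ => c * κ τ := by
  obtain ⟨n, hn⟩ : ∃ n : ℝ, (c : ℝ≥0∞) ≤ pow2 n := by
    rcases eq_or_ne (c : ℝ≥0∞) 0 with h | h
    · exact ⟨0, by rw [h]; exact zero_le⟩
    · obtain ⟨x, hx⟩ := exists_eq_pow2 h ENNReal.coe_ne_top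
      exact ⟨x, hx.le⟩
  refine ⟨C₀ * (pow2 (ρ * n)).toNNReal, fun κ h => ⟨h.1.const_mul _, fun x => ?_⟩⟩
  refine (measure_mono fun τ hτ => ?_).trans ((h.2 (x - n)).trans_eq ?_)
  · rw [mem_ofPred_eq] at hτ ⊢
    have h1 : pow2 n * pow2 (x - n) < pow2 n * κ τ := by
      rw [← pow2_add, add_sub_cancel]
      exact hτ.trans_le (mul_le_mul_left hn _)
    exact (ENNReal.mul_lt_mul_iff_right (pow2_ne_zero n) (pow2_ne_top n)).1 h1
  · rw [ENNReal.coe_mul, ENNReal.coe_toNNReal (pow2_ne_top _), mul_assoc, ← pow2_add]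
    congr 2; ring

/-- For q > 2, interpolation gives the kernel K^θ with θ = 1 - 2/r, of weak type ρ = 2/(dθ).
Admissibility is 1/ρ = 2/q, the Hardy–Littlewood–Sobolev relation. For r = ∞ the dispersive bound is
used directly. For q = 2, finiteness of 1/r excludes d = 1, and the forbidden pair excludes d = 2.
-/
lemma SharpAdmissible.exists_baseEstimate (hd : 0 < d) {q r : ℝ≥0∞}
    (h : SharpAdmissible (d / 2) q r) (hq : q ≠ ∞) (C₀ : ℝ≥0) :
    ∃ C : ℝ≥0, ∀ (V : ℝ → (L2 d →L[ℂ] L2 d)) (K : ℝ → ℝ≥0∞), UnitaryFamily V →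
      WeakType (2 / d) C₀ K → (∀ τ, K τ ≠ 0) → DispersiveBound V K → BaseEstimate V q r C := by
  have hd0 : (0 : ℝ) < d := by exact_mod_cast hd
  have e := h.toReal_eq
  have eq' := toReal_conjExponent (one_le_two.trans h.1)
  have er' := toReal_conjExponent (one_le_two.trans h.2.1)
  have hr0 : 0 ≤ r⁻¹.toReal := ENNReal.toReal_nonneg
  rcases eq_or_lt_of_le h.1 with h2 | h2
  · subst h2
    rw [ENNReal.toReal_inv, ENNReal.toReal_ofNat] at e
    have hd2 : 2 ≤ d := by
      by_contra hc
      have : d = 1 := by omega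
      subst this
      rw [ENNReal.toReal_inv] at hr0
      norm_num at e
      linarith
    have hd3 : 2 < d := lt_of_le_of_ne hd2 fun h2 => by
      subst h2
      norm_num at e
      refine h.2.2.1 ?_
      rcases (ENNReal.toReal_eq_zero_iff _).1 (ENNReal.toReal_inv r ▸ inv_eq_zero.2 e) with h3 | h3
      · rw [ENNReal.inv_eq_zero] at h3
        rw [h3, Nat.cast_ofNat, ENNReal.div_self (by norm_num) (by norm_num)]
      · exact absurd h3 h.inv_ne_top.2
    refine exists_baseEstimate_endpoint hd3 ?_ C₀
    have h3 : (ENNReal.conjExponent r).toReal⁻¹ = (1 + 2 / d) / 2 := by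
      rw [er']
      have : d / 2 * (1 - r⁻¹.toReal) = d / 2 * ((1 + 2 / d) / 2) := by
        rw [mul_sub, sub_eq_iff_eq_add]
        have : d / 2 * r⁻¹.toReal = d / 4 - 2⁻¹ := by linarith
        rw [this]
        field_simp
        ring
      exact mul_left_cancel₀ (by positivity) this
    rw [← inv_inv (ENNReal.conjExponent r).toReal, h3]
    field_simp
  · have hq2 : q⁻¹.toReal < 1 / 2 := by
      have := (ENNReal.toReal_lt_toReal h.inv_ne_top.1 (by simp)).2 (ENNReal.inv_lt_inv.2 h2)
      simpa using this
    have hq0 : 0 < q⁻¹.toReal :=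
      ENNReal.toReal_pos (ENNReal.inv_ne_zero.2 hq) h.inv_ne_top.1
    have hq'0 : 0 < (ENNReal.conjExponent q).toReal := inv_pos.1 (by rw [eq']; linarith)
    have hq'1 : 1 < (ENNReal.conjExponent q).toReal := by
      rw [← inv_lt_one₀ hq'0, eq']; linarith
    have hq'2 : (ENNReal.conjExponent q).toReal < 2 := by
      rw [← inv_lt_inv₀ two_pos hq'0, eq']; linarith
    set θ : ℝ := 1 - 2 * r⁻¹.toReal with hθ
    have hqθ : q⁻¹.toReal = d / 4 * θ := by rw [hθ]; linarith
    have hθ0 : 0 < θ := pos_of_mul_pos_right (hqθ ▸ hq0) (by positivity)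
    have hρ : 0 < 2 / d / θ := by positivity
    have hsum : 2 / (ENNReal.conjExponent q).toReal + 1 / (2 / d / θ) = 2 := by
      rw [div_eq_mul_inv 2 (ENNReal.conjExponent q).toReal, eq', hqθ]
      field_simp
      ring
    rcases eq_or_ne r ∞ with hr | hr
    · obtain ⟨C, hC⟩ := exists_baseEstimate_of_weakType (d := d) (r := r) h.1 hq'1 hq'2 hρ hsum C₀
      refine ⟨C, fun V K hV hK hK0 hVK => hC V K ?_ fun s t φ ψ => ?_⟩
      · have : θ = 1 := by rw [hθ, hr]; simp
        rwa [this, div_one]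
      · have : ENNReal.conjExponent r = 1 := by rw [hr]; simp [ENNReal.conjExponent]
        rw [this]
        exact hVK s t φ ψ
    · have hr1 : 0 < r⁻¹.toReal := ENNReal.toReal_pos (ENNReal.inv_ne_zero.2 hr) h.inv_ne_top.2
      have hr'0 : 0 < (ENNReal.conjExponent r).toReal := inv_pos.1 (by rw [er']; linarith)
      have hr'1 : 1 < (ENNReal.conjExponent r).toReal := by
        rw [← inv_lt_one₀ hr'0, er']; linarith
      have hr'2 : (ENNReal.conjExponent r).toReal < 2 := by
        rw [← inv_lt_inv₀ two_pos hr'0, er']; linarith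
      have hθ' : 2 / (ENNReal.conjExponent r).toReal - 1 = θ := by
        rw [div_eq_mul_inv, er', hθ]; ring
      obtain ⟨C₁, h₁⟩ := exists_bilinear_interpolation (d := d) hr'1 hr'2
      obtain ⟨C₂, h₂⟩ := WeakType.exists_const_mul (ρ := 2 / d / θ) C₀ C₁
      obtain ⟨C, hC⟩ := exists_baseEstimate_of_weakType (d := d) (r := r) h.1 hq'1 hq'2 hρ hsum C₂
      refine ⟨C, fun V K hV hK hK0 hVK => hC V _ (h₂ _ (hK.rpow hθ0)) fun s t φ ψ => ?_⟩
      rw [← hθ']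
      exact h₁ _ _ _ (hK0 (t - s)) (hV.norm_adjoint s) (hV.norm_adjoint t)
        (fun φ ψ => hVK s t φ ψ) φ ψ

/-- A pair with finite q that exists in every dimension (r = ∞ if d = 1); it is the base when both
given exponents in time are infinite. -/
lemma sharpAdmissible_four (hd : 0 < d) :
    SharpAdmissible (d / 2) 4 (ENNReal.ofReal ((d - 1) / (2 * d)))⁻¹ := by
  have hd1 : (1 : ℝ) ≤ d := by exact_mod_cast hd
  have hd0 : (0 : ℝ) < d := by linarith
  have hx : 0 ≤ ((d : ℝ) - 1) / (2 * d) := div_nonneg (by linarith) (by linarith)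
  refine ⟨by norm_num, ?_, fun h => ?_, ?_⟩
  · rw [ENNReal.le_inv_iff_le_inv, ← ENNReal.ofReal_ofNat, ← ENNReal.ofReal_inv_of_pos two_pos]
    refine ENNReal.ofReal_le_ofReal ?_
    rw [div_le_iff₀ (by linarith)]
    linarith
  · have := congrArg ENNReal.toReal (congrArg Prod.fst h)
    norm_num at this
  · have h1 : (d : ℝ≥0∞) / 2 ≠ ∞ := ENNReal.div_ne_top (ENNReal.natCast_ne_top d) (by norm_num)
    have h2 : (d : ℝ≥0∞) / 2 * ENNReal.ofReal ((d - 1) / (2 * d)) ≠ ∞ :=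
      ENNReal.mul_ne_top h1 ENNReal.ofReal_ne_top
    have h3 : (4 : ℝ≥0∞)⁻¹ ≠ ∞ := by norm_num
    rw [one_div, div_eq_mul_inv (_ / 2 : ℝ≥0∞) (_)⁻¹, inv_inv,
      ← ENNReal.toReal_eq_toReal_iff' (ENNReal.add_ne_top.2 ⟨h3, h2⟩)
        (ENNReal.div_ne_top h1 (by norm_num)), ENNReal.toReal_add h3 h2, ENNReal.toReal_mul,
      ENNReal.toReal_ofReal hx, ENNReal.toReal_inv]
    simp only [ENNReal.toReal_div, ENNReal.toReal_natCast, ENNReal.toReal_ofNat]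
    field_simp
    ring

/-- Interpolation with the energy bound only raises q, so the base pair must have the smaller
exponent in time; it must also be finite. -/
lemma SharpAdmissible.exists_le (hd : 0 < d) {q r q₁ r₁ : ℝ≥0∞} (h : SharpAdmissible (d / 2) q r)
    (h₁ : SharpAdmissible (d / 2) q₁ r₁) :
    ∃ q₀ r₀, SharpAdmissible (d / 2) q₀ r₀ ∧ q₀ ≠ ∞ ∧ q₀ ≤ q ∧ q₀ ≤ q₁ := by
  rcases eq_or_ne q ∞ with hq | hq
  · rcases eq_or_ne q₁ ∞ with hq₁ | hq₁
    · exact ⟨_, _, sharpAdmissible_four hd, by norm_num, by simp [hq], by simp [hq₁]⟩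
    · exact ⟨q₁, r₁, h₁, hq₁, by simp [hq], le_rfl⟩
  · rcases le_total q q₁ with hle | hle
    · exact ⟨q, r, h, hq, le_rfl, hle⟩
    · exact ⟨q₁, r₁, h₁, ne_top_of_le_ne_top hq hle, hle, le_rfl⟩

/-- The global Strichartz estimates when one of the coordinates is repulsive. -/
theorem exists_strichartzEstimates {δ : Fin d → SignType} {ω : Fin d → ℝ} (hω : ∀ j, 0 < ω j)
    {i : Fin d} (hi : δ i = -1) {q r q₁ r₁ : ℝ≥0∞} (h : SharpAdmissible (d / 2) q r)
    (h₁ : SharpAdmissible (d / 2) q₁ r₁) :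
    ∃ C : ℝ≥0, ∀ (P : Coefficients d) (U : ℝ → ℝ → (L2 d →L[ℂ] L2 d)), ConstantSigma P δ ω →
      IsEvolutionOperator P U → StrichartzEstimates U q r q₁ r₁ C := by
  have hd : 0 < d := i.pos
  obtain ⟨q₀, r₀, h₀, ht, hle, hle₁⟩ := h.exists_le hd h₁
  obtain ⟨C₀, hC₀⟩ := exists_weakType_dispersion hω hi
  obtain ⟨C, hC⟩ := h₀.exists_baseEstimate hd ht C₀
  -- The constant is fixed before P and U. Adding 1 provides the bound C ≥ 1 used in the TT*
  -- argument.
  refine ⟨C + 1, fun P U hP hU => ?_⟩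
  refine strichartzEstimates_of_baseEstimate hU.unitaryFamily h₀.1 ht h₀.2.1 le_add_self ?_
    (h₀.between hd h₀ ht le_rfl) (h.between hd h₀ ht hle) (h₁.between hd h₀ ht hle₁)
  intro W hW F G hF hFi hG hGi
  refine (hC _ _ hU.unitaryFamily hC₀ dispersion_ne_zero (hP.dispersiveBound hU) W hW F G hF hFi
    hG hGi).trans ?_
  gcongr
  exact le_self_add

end QuadSchrodinger

end

theorem theorem2 (d : ℕ) (hd : 0 < d) (δ : Fin d → SignType) (ω : Fin d → ℝ)
    (hω : ∀ j, 0 < ω j) :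
    (∀ P : QuadSchrodinger.Coefficients d, P.Regular →
      (∀ j t, P.sigma j t = (δ j : ℝ) * ω j ^ 2 / 4) →
        -- the characteristic functions
        (∀ j (m : ℝ → ℝ), QuadSchrodinger.IsCharacteristicFunction (P.sigma j) m ↔
          m = QuadSchrodinger.mu (δ j) (ω j)) ∧
        -- the evolution operator exists and is unique
        (∃! U : ℝ → ℝ → (QuadSchrodinger.L2 d →L[ℂ] QuadSchrodinger.L2 d),
          QuadSchrodinger.IsEvolutionOperator P U) ∧
        ∀ U : ℝ → ℝ → (QuadSchrodinger.L2 d →L[ℂ] QuadSchrodinger.L2 d),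
          QuadSchrodinger.IsEvolutionOperator P U →
            -- the explicit formula, while the derivatives of the `μ_j` have no zero
            (∀ t : ℝ, (∀ j, QuadSchrodinger.mu (δ j) (ω j) t ≠ 0 ∧
                ∀ τ ∈ Set.uIcc 0 t, deriv (QuadSchrodinger.mu (δ j) (ω j)) τ ≠ 0) →
              ∀ φ : QuadSchrodinger.L2 d, Integrable φ volume →
                (U t 0 φ : QuadSchrodinger.Space d → ℂ) =ᵐ[volume]
                  QuadSchrodinger.oscillatoryOperator
                    (fun j => QuadSchrodinger.amplitude (QuadSchrodinger.mu (δ j) (ω j) t))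
                    (fun j => QuadSchrodinger.phase P j (QuadSchrodinger.mu (δ j) (ω j)) t) φ) ∧
            -- the explicit formula, at all times with `μ_j(t) ≠ 0`
            (∀ t : ℝ, (∀ j, QuadSchrodinger.mu (δ j) (ω j) t ≠ 0) →
              ∀ φ : QuadSchrodinger.L2 d, Integrable φ volume →
                (U t 0 φ : QuadSchrodinger.Space d → ℂ) =ᵐ[volume]
                  QuadSchrodinger.oscillatoryOperator
                    (fun j => QuadSchrodinger.amplitudeExt (δ j) (ω j) t)
                    (fun j => QuadSchrodinger.phaseExt P j (QuadSchrodinger.mu (δ j) (ω j)) t)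
                    φ) ∧
            -- the dispersive bound
            (∀ t s : ℝ, (∀ j, QuadSchrodinger.mu (δ j) (ω j) (t - s) ≠ 0) →
              ∀ φ : QuadSchrodinger.L2 d,
                eLpNorm (U t s φ) ∞ volume ≤
                  ENNReal.ofReal (∏ j, (2 * Real.pi *
                    |QuadSchrodinger.mu (δ j) (ω j) (t - s)|) ^ (-(1 / 2) : ℝ)) *
                    eLpNorm φ 1 volume)) ∧
    -- global in time Strichartz estimates
    ((∃ j, δ j = -1) → ∀ q r q₁ r₁ : ℝ≥0∞,
      QuadSchrodinger.SharpAdmissible ((d : ℝ≥0∞) / 2) q r →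
      QuadSchrodinger.SharpAdmissible ((d : ℝ≥0∞) / 2) q₁ r₁ →
        ∃ C : ℝ≥0, ∀ P : QuadSchrodinger.Coefficients d, P.Regular →
          (∀ j t, P.sigma j t = (δ j : ℝ) * ω j ^ 2 / 4) →
            ∀ U : ℝ → ℝ → (QuadSchrodinger.L2 d →L[ℂ] QuadSchrodinger.L2 d),
              QuadSchrodinger.IsEvolutionOperator P U →
                QuadSchrodinger.StrichartzEstimates U q r q₁ r₁ C) := by
  refine ⟨fun P hP hσ => ?_, ?_⟩
  · have h : QuadSchrodinger.ConstantSigma P δ ω := ⟨hP, hω, hσ⟩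
    refine ⟨fun j m => QuadSchrodinger.isCharacteristicFunction_iff (δ j) (hω j) (hσ j) m,
      ⟨_, h.isEvolutionOperator, fun U hU => h.eq_evolution hU⟩, fun U hU =>
      ⟨fun t ht φ hφ => h.ae_eq_oscillatoryOperator hU ht φ hφ,
        fun t ht φ hφ => h.ae_eq_oscillatoryOperator_ext hU ht φ hφ,
        fun t s hts φ => h.eLpNorm_top_le hU t s hts φ⟩⟩
  · rintro ⟨i, hi⟩ q r q₁ r₁ h h₁
    obtain ⟨C, hC⟩ := QuadSchrodinger.exists_strichartzEstimates hω hi h h₁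
    exact ⟨C, fun P hP hσ U hU => hC P U ⟨hP, hω, hσ⟩ hU⟩
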